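/- Let $\mathbb{M}^{10,1}=\mathbb{R}^{11}$ have the orthonormal frame $e_0,e_1,\dots,e_9,e_\natural$ with $\langle e_0,e_0\rangle=-1$ and the others of norm $+1$, and let $\mathrm{C}\ell_{1,10}$ be its Clifford algebra, with $v^2=\langle v,v\rangle$. Let $\mathrm{Spin}_{10,1}\subset\mathrm{C}\ell_{1,10}$ be the double cover of the identity component of the Lorentz group, acting on vectors by $v\mapsto gvg^{-1}$, and let $\mathfrak{so}_{10,1}\subset\mathrm{C}\ell_{1,10}$ be its Lie algebra, spanned by the $\Sigma_{MN}=\Sigma(e_M,e_N)$, where $\Sigma(a,b)=-\tfrac14[a,b]$. Put $e_+=e_0+e_9$, $\Sigma_{+M}=\Sigma(e_+,e_M)$, and $v^*=\langle v,-\rangle$ for the one-form metrically dual to $v$. Let $L_1,\dots,L_7$ be left multiplication by imaginary octonion units on $\mathbb{O}\cong\mathbb{R}^8$. They generate an irreducible representation of $\mathrm{C}\ell_7$, whose restriction to $\mathrm{Spin}_7$, respectively $\mathfrak{so}_7$, is the spin representation on $\mathbb{R}^8$. Let $$\Gamma'_i=\begin{pmatrix}0&L_i\\L_i&0\end{pmatrix}\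 (1\le i\le 7),\qquad \Gamma'_8=\begin{pmatrix}0&-1\\1&0\end{pmatrix},\qquad \Gamma'_9=\Gamma'_1\cdots\Gamma'_8,$$ $\Sigma'_{ij}=\tfrac14[\Gamma'_i,\Gamma'_j]$, and let $\Delta=\mathbb{R}^{16}\oplus\mathbb{R}^{16}$ be the $\mathrm{C}\ell_{1,10}$-module in which $e_0,e_i$ $(1\le i\le 8)$, $e_9,e_\natural$ act by $$\begin{pmatrix}0&-\Gamma'_9\\\Gamma'_9&0\end{pmatrix},\quad\begin{pmatrix}0&-\Gamma'_i\\\Gamma'_i&0\end{pmatrix},\quad\begin{pmatrix}0&1\\1&0\end{pmatrix},\quad\begin{pmatrix}1&0\\0&-1\end{pmatrix}.$$ Let $\psi_-\in\mathbb{R}^{16}$ be nonzero with $\Gamma'_9\psi_-=-\psi_-$, let $\varepsilon=(\psi_-,0)\in\Delta$, let $\mathfrak{g}=\{X\in\mathfrak{so}_{10,1}: X\varepsilon=0\}$, and let $\mathcal{G}\subset\mathrm{Spin}_{10,1}$ be the subgroup generated by $\exp(\mathfrak{g})$. Then the following hold. 1. $\mathfrak{g}$ consists of the elements $\tfrac12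 a^{ij}\Sigma_{ij}+b^i\Sigma_{+i}+c\,\Sigma_{+\natural}$ ($1\le i,j\le 8$) with $b\in\mathbb{R}^8$ and $c\in\mathbb{R}$ arbitrary and $a$ antisymmetric with $\tfrac12a^{ij}\Sigma'_{ij}\psi_-=0$. As a Lie algebra $\mathfrak{g}\cong(\mathfrak{so}_7\ltimes\mathbb{R}^8)\times\mathbb{R}$, where $\mathbb{R}^8$ is abelian and $\mathfrak{so}_7$ acts on it by the spin representation. It has dimension $30$ and is not reductive. 2. $\mathcal{G}$ is a closed simply connected subgroup of $\mathrm{Spin}_{10,1}$ with Lie algebra $\mathfrak{g}$ (so it is $30$-dimensional and non-reductive), and it is the full isotropy group of $\varepsilon$ in $\mathrm{Spin}_{10,1}$. There is an isomorphism of topological groups $\mathbb{R}\times(\mathbb{R}^8\rtimes\mathrm{Spin}_7)\cong\mathcal{G}$, with $\mathrm{Spin}_7$ acting on $\mathbb{R}^8$ by the spin representation, which takes $(c,b)\in\mathbb{R}\times\mathbb{R}^8=\mathbb{R}^9$ to $\exp\big((Ab)^i\Sigma_{+i}+c\,\Sigma_{+\natural}\big)$ for some linear automorphism $A$ of $\mathbb{R}^8$.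 Every nonzero element of $\mathbb{R}^9$ acts on $\mathbb{M}^{10,1}$ as a null rotation about $e_+$: a Lorentz transformation which fixes $e_+$, acts trivially on $e_+^\perp/\mathbb{R}e_+$, and has $\mathbb{R}e_+$ as its only invariant null direction. The factor $\mathrm{Spin}_7$ fixes $e_0,e_9,e_\natural$. 3. $\mathcal{G}$ acts on $\mathbb{M}^{10,1}$ reducibly but indecomposably. 4. The spinors in $\Delta$ fixed by $\mathcal{G}$ are exactly the multiples of $\varepsilon$. 5. Let $$\Omega=-\frac{1}{4!\,|\psi_-|^2}\sum_{i,j,k,l=1}^8\langle\psi_-,\Gamma'_i\Gamma'_j\Gamma'_k\Gamma'_l\psi_-\rangle\, e_i^*\wedge e_j^*\wedge e_k^*\wedge e_l^*.$$ This is a Cayley form on the span of $e_1,\dots,e_8$, that is, in some orthonormal coframe $f_1,\dots,f_8$ it is $$f_{1234}+f_{1256}+f_{1278}+f_{1357}-f_{1368}-f_{1458}-f_{1467}-f_{2358}-f_{2367}-f_{2457}+f_{2468}+f_{3456}+f_{3478}+f_{5678}.$$ Put $\mathrm{vol}_8=e_1^*\wedge\dots\wedge e_8^*$. The $\mathcal{G}$-invariant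 forms on $\mathbb{M}^{10,1}$ in degrees $0,1,2,5,6,9,10,11$ are exactly the multiples of the nonzero forms $$1,\quad e_+^*,\quad e_+^*\wedge e_\natural^*,\quad e_+^*\wedge\Omega,\quad e_+^*\wedge e_\natural^*\wedge\Omega,\quad e_+^*\wedge\mathrm{vol}_8,\quad e_+^*\wedge e_\natural^*\wedge\mathrm{vol}_8,\quad e_0^*\wedge e_1^*\wedge\dots\wedge e_9^*\wedge e_\natural^*$$ respectively, and in every other degree only $0$ is invariant. -/

import Mathlib

open scoped Matrix

attribute [local instance] LieRing.ofAssociativeRing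

noncomputable section

namespace ExoticSpinor

/-! ### Real Clifford algebras as topological algebras -/

section Topology

variable {V : Type*} [AddCommGroup V] [Module ℝ V]

theorem exteriorAlgebra_finite [Module.Finite ℝ V] : Module.Finite ℝ (ExteriorAlgebra ℝ V) := by
  have htop : (⨆ n : ℕ, ⋀[ℝ]^n V) = ⊤ :=
    (DirectSum.Decomposition.isInternal (fun n : ℕ => ⋀[ℝ]^n V)).submodule_iSup_eq_top
  have hbot : ∀ n : ℕ, Module.finrank ℝ V < n → ⋀[ℝ]^n V = ⊥ := by
    intro n hn
    rw [← Submodule.finrank_eq_zero (R := ℝ), exteriorPower.finrank_eq]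
    exact Nat.choose_eq_zero_of_lt hn
  have hle : (⨆ n : ℕ, ⋀[ℝ]^n V)
      ≤ ⨆ n : Fin (Module.finrank ℝ V + 1), ⋀[ℝ]^(n : ℕ) V := by
    refine iSup_le fun n => ?_
    by_cases hn : Module.finrank ℝ V < n
    · rw [hbot n hn]; exact bot_le
    · exact le_iSup (fun k : Fin (Module.finrank ℝ V + 1) => ⋀[ℝ]^(k : ℕ) V)
        ⟨n, by omega⟩
  rw [htop, top_le_iff] at hle
  refine ⟨?_⟩
  rw [← hle]
  exact Submodule.fg_iSup _ fun n => Module.Finite.iff_fg.mp inferInstance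

instance cliffordFinite [Module.Finite ℝ V] (Q : QuadraticForm ℝ V) :
    Module.Finite ℝ (CliffordAlgebra Q) :=
  haveI := exteriorAlgebra_finite (V := V)
  Module.Finite.equiv (CliffordAlgebra.equivExterior Q).symm

/-- The canonical topology of a real Clifford algebra, as a real vector space
(for a finite-dimensional algebra: the unique Hausdorff vector space topology). -/
instance cliffordTopology (Q : QuadraticForm ℝ V) : TopologicalSpace (CliffordAlgebra Q) :=
  moduleTopology ℝ (CliffordAlgebra Q)

instance cliffordIsModuleTopology (Q : QuadraticForm ℝ V) :
    IsModuleTopology ℝ (CliffordAlgebra Q) := ⟨rfl⟩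

instance cliffordTopologicalRing [Module.Finite ℝ V] (Q : QuadraticForm ℝ V) :
    IsTopologicalRing (CliffordAlgebra Q) :=
  IsModuleTopology.isTopologicalRing ℝ (CliffordAlgebra Q)

/-- A semidirect product of topological groups carries the product topology. -/
instance semidirectTopology {N G : Type*} [Group N] [Group G] [TopologicalSpace N]
    [TopologicalSpace G] (φ : G →* MulAut N) : TopologicalSpace (N ⋊[φ] G) :=
  TopologicalSpace.induced SemidirectProduct.equivProd inferInstance

end Topology

/-! ### The Lie algebra and the vector representation of a spin group -/

section SpinLie

variable {V : Type*} [AddCommGroup V] [Module ℝ V] (Q : QuadraticForm ℝ V)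

theorem lie_lie_ι (a b c : V) :
    ∃ d : V, ⁅⁅CliffordAlgebra.ι Q a, CliffordAlgebra.ι Q b⁆, CliffordAlgebra.ι Q c⁆
      = CliffordAlgebra.ι Q d := by
  refine ⟨(2 * QuadraticMap.polar Q b c) • a - (2 * QuadraticMap.polar Q a c) • b, ?_⟩
  have h (x y : V) := CliffordAlgebra.ι_mul_ι_add_swap (Q := Q) x y
  have hbc := h b c
  have hac := h a c
  set A := CliffordAlgebra.ι Q a
  set B := CliffordAlgebra.ι Q b
  set C := CliffordAlgebra.ι Q c
  set p := QuadraticMap.polar Q b c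
  set q := QuadraticMap.polar Q a c
  have e1 : B * C = algebraMap ℝ _ p - C * B := by rw [← hbc]; abel
  have e2 : A * C = algebraMap ℝ _ q - C * A := by rw [← hac]; abel
  have e3 : A * B * C = p • A - q • B + C * A * B := by
    rw [mul_assoc, e1, mul_sub, ← mul_assoc, e2, sub_mul, ← Algebra.commutes p A,
      Algebra.smul_def, Algebra.smul_def]
    abel
  have e4 : B * A * C = q • B - p • A + C * B * A := by
    rw [mul_assoc, e2, mul_sub, ← mul_assoc, e1, sub_mul, ← Algebra.commutes q B,
      Algebra.smul_def, Algebra.smul_def]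
    abel
  rw [map_sub, map_smul, map_smul]
  simp only [LieRing.of_associative_ring_bracket, sub_mul, mul_sub, e3, e4, two_mul, add_smul,
    ← mul_assoc]
  abel

/-- The Lie algebra of the spin group of `Q` inside the Clifford algebra: the span of the
commutators of vectors. -/
def spinLie : LieSubalgebra ℝ (CliffordAlgebra Q) where
  __ := Submodule.span ℝ
    {X | ∃ a b : V, X = ⁅CliffordAlgebra.ι Q a, CliffordAlgebra.ι Q b⁆}
  lie_mem' := by
    intro X Y hX hY
    simp only [AddSubsemigroup.mem_carrier, AddSubmonoid.mem_toSubsemigroup,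
      Submodule.mem_toAddSubmonoid] at hX hY ⊢
    induction hX, hY using Submodule.span_induction₂ with
    | mem_mem X Y hX hY =>
      obtain ⟨a, b, rfl⟩ := hX
      obtain ⟨c, d, rfl⟩ := hY
      obtain ⟨u, hu⟩ := lie_lie_ι Q a b c
      obtain ⟨v, hv⟩ := lie_lie_ι Q a b d
      rw [leibniz_lie, hu, hv]
      exact Submodule.add_mem _ (Submodule.subset_span ⟨u, d, rfl⟩)
        (Submodule.subset_span ⟨c, v, rfl⟩)
    | zero_left => simp
    | zero_right => simp
    | add_left X Y Z _ _ _ h1 h2 => rw [add_lie]; exact Submodule.add_mem _ h1 h2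
    | add_right X Y Z _ _ _ h1 h2 => rw [lie_add]; exact Submodule.add_mem _ h1 h2
    | smul_left r X Y _ _ h => rw [smul_lie]; exact Submodule.smul_mem _ r h
    | smul_right r X Y _ _ h => rw [lie_smul]; exact Submodule.smul_mem _ r h

variable {Q}

/-- The linear projection of the Clifford algebra onto vectors, a left inverse of `ι`. -/
def vecPart : CliffordAlgebra Q →ₗ[ℝ] V :=
  ExteriorAlgebra.ιInv ∘ₗ (CliffordAlgebra.equivExterior Q).toLinearMap

theorem vecPart_ι (v : V) : vecPart (CliffordAlgebra.ι Q v) = v := by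
  have h : CliffordAlgebra.equivExterior Q (CliffordAlgebra.ι Q v) = ExteriorAlgebra.ι ℝ v :=
    CliffordAlgebra.changeForm_ι CliffordAlgebra.changeForm.associated_neg_proof v
  simp only [vecPart, LinearMap.comp_apply, LinearEquiv.coe_coe, h]
  exact ExteriorAlgebra.ι_leftInverse v

/-- The vector representation of the spin group, `v ↦ g v g⁻¹`. -/
def vecAct (g : spinGroup Q) : V →ₗ[ℝ] V :=
  vecPart ∘ₗ LinearMap.mulLeftRight ℝ ((g : CliffordAlgebra Q), ((g⁻¹ : spinGroup Q) : _)) ∘ₗ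
    CliffordAlgebra.ι Q

theorem ι_vecAct (g : spinGroup Q) (v : V) :
    CliffordAlgebra.ι Q (vecAct g v)
      = (g : CliffordAlgebra Q) * CliffordAlgebra.ι Q v * ((g⁻¹ : spinGroup Q) : _) := by
  have h := spinGroup.conjAct_smul_ι_mem_range_ι (x := spinGroup.toUnits g) g.2 v
  obtain ⟨w, hw⟩ := h
  have hw' : CliffordAlgebra.ι Q w
      = (g : CliffordAlgebra Q) * CliffordAlgebra.ι Q v * ((g⁻¹ : spinGroup Q) : _) := hw
  have : vecAct g v = w := by
    simp only [vecAct, LinearMap.comp_apply, LinearMap.mulLeftRight_apply]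
    rw [← hw', vecPart_ι]
  rw [this, hw']

end SpinLie

/-! ### Octonions, the Clifford algebra `Cl₇` and the spin representation of `Spin₇` -/

/-- Structure constants of the imaginary octonion units `o₀, …, o₆`:
`oᵢ oⱼ = - δᵢⱼ + ∑ₖ octEps i j k oₖ`, where `oᵢ oᵢ₊₁ = oᵢ₊₃` (indices modulo 7). -/
def octEps (i j k : Fin 7) : ℤ :=
  if (j - i, k - i) ∈ ({(1, 3), (2, 6), (4, 5)} : Finset (Fin 7 × Fin 7)) then 1
  else if (k - i, j - i) ∈ ({(1, 3), (2, 6), (4, 5)} : Finset (Fin 7 × Fin 7)) then -1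
  else 0

/-- The integral matrix of left multiplication by `oᵢ` in the basis `1, o₀, …, o₆`
(rows index the output). -/
def octLZ (i : Fin 7) : Matrix (Fin 8) (Fin 8) ℤ :=
  Matrix.of fun r c =>
    Fin.cases (motive := fun _ => ℤ)
      (Fin.cases (motive := fun _ => ℤ) 0 (fun j => if i = j then -1 else 0) c)
      (fun k => Fin.cases (motive := fun _ => ℤ) (if k = i then 1 else 0)
        (fun j => octEps i j k) c) r

/-- Left multiplication by `oᵢ` on the octonions. -/
def octL (i : Fin 7) : Matrix (Fin 8) (Fin 8) ℝ := (octLZ i).map (Int.castRingHom ℝ)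

/-- Left multiplication by the imaginary octonion `∑ xᵢ oᵢ`. -/
def octLin : (Fin 7 → ℝ) →ₗ[ℝ] Matrix (Fin 8) (Fin 8) ℝ := Fintype.linearCombination ℝ octL

theorem octLZ_anticomm : ∀ i j : Fin 7,
    octLZ i * octLZ j + octLZ j * octLZ i = (if i = j then -2 else 0 : ℤ) • 1 := by
  decide +kernel

theorem octL_anticomm (i j : Fin 7) :
    octL i * octL j + octL j * octL i = (if i = j then -2 else 0 : ℝ) • 1 := by
  have h := congrArg (Int.castRingHom ℝ).mapMatrix (octLZ_anticomm i j)
  rw [map_add, map_mul, map_mul, map_zsmul, map_one] at h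
  refine h.trans ?_
  rw [← Int.cast_smul_eq_zsmul ℝ]
  split_ifs <;> simp

theorem octLin_apply (x : Fin 7 → ℝ) : octLin x = ∑ i, x i • octL i := rfl

theorem octLin_mul_self (x : Fin 7 → ℝ) :
    octLin x * octLin x = (-∑ i, x i ^ 2) • (1 : Matrix (Fin 8) (Fin 8) ℝ) := by
  have h2 : octLin x * octLin x + octLin x * octLin x
      = ∑ i, ∑ j, (x i * x j) • (octL i * octL j + octL j * octL i) := by
    simp only [smul_add, Finset.sum_add_distrib]
    congr 1
    · simp only [octLin_apply, Finset.sum_mul_sum, smul_mul_smul_comm]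
    · rw [Finset.sum_comm]
      simp only [octLin_apply, Finset.sum_mul_sum, smul_mul_smul_comm, mul_comm]
  have h3 : octLin x * octLin x + octLin x * octLin x
      = (2 : ℝ) • ((-∑ i, x i ^ 2) • (1 : Matrix (Fin 8) (Fin 8) ℝ)) := by
    rw [h2]
    simp only [octL_anticomm, smul_smul, ← Finset.sum_smul, mul_ite, mul_zero,
      Finset.sum_ite_eq, Finset.mem_univ, if_true, ← Finset.sum_mul]
    congr 1
    simp only [pow_two]; ring
  rw [← two_smul ℝ] at h3
  exact smul_right_injective _ (two_ne_zero' ℝ) h3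

/-- The negative definite form on `ℝ⁷`, so that unit vectors square to `-1` in `Cl₇`. -/
def Q7 : QuadraticForm ℝ (Fin 7 → ℝ) := QuadraticMap.weightedSumSquares ℝ fun _ => (-1 : ℝ)

/-- The irreducible representation of `Cl₇` on the octonions by left multiplication. -/
def rho7 : CliffordAlgebra Q7 →ₐ[ℝ] Matrix (Fin 8) (Fin 8) ℝ :=
  CliffordAlgebra.lift Q7 ⟨octLin, fun x => by
    rw [octLin_mul_self, Algebra.algebraMap_eq_smul_one]
    congr 1
    simp [Q7, QuadraticMap.weightedSumSquares_apply, pow_two]⟩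

/-- `Spin₇`. -/
abbrev Spin7 : Type := spinGroup Q7

/-- The spin representation of `Spin₇` on `ℝ⁸`, as an action by automorphisms of the
(multiplicatively written) vector group `ℝ⁸`. -/
def spinAction : Spin7 →* MulAut (Multiplicative (Fin 8 → ℝ)) where
  toFun g :=
    { toFun := fun x => Multiplicative.ofAdd (rho7 g *ᵥ x.toAdd)
      invFun := fun x => Multiplicative.ofAdd (rho7 (g⁻¹ : Spin7) *ᵥ x.toAdd)
      left_inv := fun x => by
        simp [Matrix.mulVec_mulVec, ← map_mul, ← Submonoid.coe_mul]
      right_inv := fun x => by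
        simp [Matrix.mulVec_mulVec, ← map_mul, ← Submonoid.coe_mul]
      map_mul' := fun x y => by simp [Matrix.mulVec_add] }
  map_one' := by ext x; simp
  map_mul' g h := by ext x; simp [Matrix.mulVec_mulVec]

/-- The spin representation of `so₇`, `A ↦ -¼ ∑ Aᵢⱼ LᵢLⱼ`; the sign is the one for which
`[spinMat A, L x] = L (A x)`. -/
def spinMat : Matrix (Fin 7) (Fin 7) ℝ →ₗ[ℝ] Matrix (Fin 8) (Fin 8) ℝ where
  toFun A := -(1 / 4 : ℝ) • ∑ i, ∑ j, A i j • (octL i * octL j)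
  map_add' A B := by
    simp only [Matrix.add_apply, add_smul, Finset.sum_add_distrib, smul_add]
  map_smul' c A := by
    simp only [Matrix.smul_apply, smul_assoc, ← Finset.smul_sum, RingHom.id_apply]
    rw [smul_comm]

theorem spinMat_apply (A : Matrix (Fin 7) (Fin 7) ℝ) :
    spinMat A = -(1 / 4 : ℝ) • ∑ i, ∑ j, A i j • (octL i * octL j) := rfl

theorem lie_spinMat_octL (A : Matrix (Fin 7) (Fin 7) ℝ) (hA : Aᵀ = -A) (k : Fin 7) :
    ⁅spinMat A, octL k⁆ = ∑ i, A i k • octL i := by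
  have key (i j : Fin 7) : ⁅octL i * octL j, octL k⁆
      = (if j = k then -2 else 0 : ℝ) • octL i - (if i = k then -2 else 0 : ℝ) • octL j := by
    have h1 : octL j * octL k = (if j = k then -2 else 0 : ℝ) • 1 - octL k * octL j :=
      eq_sub_of_add_eq (octL_anticomm j k)
    have h2 : octL i * octL k = (if i = k then -2 else 0 : ℝ) • 1 - octL k * octL i :=
      eq_sub_of_add_eq (octL_anticomm i k)
    rw [LieRing.of_associative_ring_bracket, mul_assoc, h1, mul_sub, ← mul_assoc (octL i), h2,
      sub_mul, mul_smul_comm, smul_mul_assoc, mul_one, one_mul, mul_assoc]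
    abel
  have hA' (i j : Fin 7) : A i j = - A j i := by
    have := congrFun (congrFun hA j) i
    simpa using this
  rw [spinMat_apply, smul_lie, sum_lie]
  simp only [sum_lie, smul_lie, key, smul_sub, Finset.sum_sub_distrib, smul_ite, smul_zero,
    ite_smul, zero_smul, Finset.sum_ite_eq', Finset.mem_univ, if_true]
  rw [Finset.sum_comm (f := fun i j => if i = k then A i j • (-2 : ℝ) • octL j else 0)]
  simp only [Finset.sum_ite_eq', Finset.mem_univ, if_true]
  rw [← smul_sub, ← Finset.sum_sub_distrib, Finset.smul_sum]
  refine Finset.sum_congr rfl fun i _ => ?_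
  rw [hA' k i, smul_smul, smul_smul, ← sub_smul, smul_smul]
  congr 1
  ring

theorem spinMat_lie (A B : Matrix (Fin 7) (Fin 7) ℝ) (hA : Aᵀ = -A) :
    spinMat ⁅A, B⁆ = ⁅spinMat A, spinMat B⁆ := by
  have hA' (i j : Fin 7) : A i j = - A j i := by
    have := congrFun (congrFun hA j) i
    simpa using this
  have key (i j : Fin 7) : ⁅spinMat A, octL i * octL j⁆
      = ∑ k, A k i • (octL k * octL j) + ∑ k, A k j • (octL i * octL k) := by
    have : ⁅spinMat A, octL i * octL j⁆
        = ⁅spinMat A, octL i⁆ * octL j + octL i * ⁅spinMat A, octL j⁆ := by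
      simp only [LieRing.of_associative_ring_bracket]; noncomm_ring
    rw [this, lie_spinMat_octL A hA, lie_spinMat_octL A hA, Finset.sum_mul, Finset.mul_sum]
    simp only [smul_mul_assoc, mul_smul_comm]
  rw [spinMat_apply B, lie_smul, lie_sum]
  simp only [lie_sum, lie_smul, key, smul_add, Finset.sum_add_distrib, Finset.smul_sum,
    smul_smul]
  have e1 : ∑ i, ∑ j, ∑ k, (-(1 / 4) * (B i j * A k i)) • (octL k * octL j)
      = ∑ i, ∑ j, (-(1 / 4) * (A * B) i j) • (octL i * octL j) := by
    have c1 (i : Fin 7) := Finset.sum_comm (s := Finset.univ) (t := Finset.univ)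
      (f := fun j k : Fin 7 => (-(1 / 4) * (B i j * A k i)) • (octL k * octL j))
    simp only [c1]
    rw [Finset.sum_comm]
    refine Finset.sum_congr rfl fun k _ => ?_
    rw [Finset.sum_comm]
    refine Finset.sum_congr rfl fun j _ => ?_
    rw [← Finset.sum_smul, Matrix.mul_apply, Finset.mul_sum]
    congr 1
    exact Finset.sum_congr rfl fun i _ => by ring
  have e2 : ∑ i, ∑ j, ∑ k, (-(1 / 4) * (B i j * A k j)) • (octL i * octL k)
      = ∑ i, ∑ j, (-(1 / 4) * -(B * A) i j) • (octL i * octL j) := by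
    refine Finset.sum_congr rfl fun i _ => ?_
    rw [Finset.sum_comm]
    refine Finset.sum_congr rfl fun j _ => ?_
    rw [← Finset.sum_smul, Matrix.mul_apply, ← Finset.sum_neg_distrib, Finset.mul_sum]
    congr 1
    refine Finset.sum_congr rfl fun k _ => ?_
    rw [hA' j k]; ring
  rw [e1, e2, ← Finset.sum_add_distrib, spinMat_apply, Finset.smul_sum]
  refine Finset.sum_congr rfl fun i _ => ?_
  rw [← Finset.sum_add_distrib, Finset.smul_sum]
  refine Finset.sum_congr rfl fun j _ => ?_
  rw [← add_smul, smul_smul, LieRing.of_associative_ring_bracket, Matrix.sub_apply]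
  congr 1
  ring

/-- `so₇` acting on the abelian Lie algebra `ℝ⁸` (the commutator bracket of the commutative
ring `ℝ⁸` vanishes) through the spin representation. -/
def spinDer : LieAlgebra.Orthogonal.so (Fin 7) ℝ →ₗ⁅ℝ⁆ LieDerivation ℝ (Fin 8 → ℝ) (Fin 8 → ℝ) where
  toFun A :=
    { toLinearMap := (spinMat A.1).mulVecLin
      leibniz' := fun a b => by
        simp [LieRing.of_associative_ring_bracket, mul_comm] }
  map_add' A B := by ext; simp
  map_smul' c A := by ext; simp
  map_lie' := by
    intro A B
    have hA : (A.1)ᵀ = -A.1 := (LieAlgebra.Orthogonal.mem_so _ _ A.1).mp A.2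
    have h : spinMat (⁅A, B⁆ : LieAlgebra.Orthogonal.so (Fin 7) ℝ).1
        = ⁅spinMat A.1, spinMat B.1⁆ := spinMat_lie A.1 B.1 hA
    refine LieDerivation.ext fun v => ?_
    change spinMat (⁅A, B⁆ : LieAlgebra.Orthogonal.so (Fin 7) ℝ).1 *ᵥ v
      = spinMat A.1 *ᵥ (spinMat B.1 *ᵥ v) - spinMat B.1 *ᵥ (spinMat A.1 *ᵥ v)
    rw [h, LieRing.of_associative_ring_bracket, Matrix.sub_mulVec, Matrix.mulVec_mulVec,
      Matrix.mulVec_mulVec]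

/-! ### The real realisation of `Cl₈` on `ℝ¹⁶ = ℝ⁸ ⊕ ℝ⁸` -/

/-- Index set of the 16 components of a spinor of `Cl₈`. -/
abbrev S8 : Type := Fin 8 ⊕ Fin 8

/-- The generators `Γ'₁, …, Γ'₈` of `Cl₈` (numbered from `0` to `7`), each squaring to `-1`. -/
def gammaP : Fin 8 → Matrix S8 S8 ℝ :=
  Fin.snoc (α := fun _ => Matrix S8 S8 ℝ)
    (fun i : Fin 7 => Matrix.fromBlocks 0 (octL i) (octL i) 0)
    (Matrix.fromBlocks 0 (-1) 1 0)

/-- The chirality operator `Γ'₉ = Γ'₁ Γ'₂ ⋯ Γ'₈`. -/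
def gammaP9 : Matrix S8 S8 ℝ := (List.ofFn gammaP).prod

/-- Clifford multiplication by the vector `x` of Euclidean `ℝ⁸`. -/
def gammaPLin : (Fin 8 → ℝ) →ₗ[ℝ] Matrix S8 S8 ℝ := Fintype.linearCombination ℝ gammaP

theorem octLZ_prod :
    octLZ 0 * octLZ 1 * (octLZ 2 * octLZ 3) = octLZ 6 * octLZ 5 * octLZ 4 := by
  decide +kernel

theorem octL_prod :
    octL 0 * octL 1 * (octL 2 * octL 3) = octL 6 * octL 5 * octL 4 := by
  have h := congrArg (Int.castRingHom ℝ).mapMatrix octLZ_prod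
  simp only [map_mul] at h
  exact h

theorem octL_sq (i : Fin 7) : octL i * octL i = -1 := by
  have h := octL_anticomm i i
  rw [if_pos rfl, ← two_smul ℝ, neg_smul, ← smul_neg] at h
  exact smul_right_injective _ (two_ne_zero' ℝ) h

theorem gammaP9_eq : gammaP9 = Matrix.fromBlocks (-1) 0 0 1 := by
  have h7 : octL 0 * (octL 1 * (octL 2 * (octL 3 * (octL 4 * (octL 5 * octL 6))))) = -1 := by
    have : octL 0 * (octL 1 * (octL 2 * (octL 3 * (octL 4 * (octL 5 * octL 6)))))
        = octL 0 * octL 1 * (octL 2 * octL 3) * (octL 4 * (octL 5 * octL 6)) := by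
      simp only [mul_assoc]
    rw [this, octL_prod]
    have : octL 6 * octL 5 * octL 4 * (octL 4 * (octL 5 * octL 6))
        = octL 6 * (octL 5 * (octL 4 * octL 4) * octL 5) * octL 6 := by
      simp only [mul_assoc]
    rw [this, octL_sq]
    simp only [mul_neg, mul_one, neg_mul, octL_sq, neg_neg]
  have hs (i : Fin 7) : gammaP i.castSucc = Matrix.fromBlocks 0 (octL i) (octL i) 0 := by
    simp [gammaP]
  have hl : gammaP (Fin.last 7) = Matrix.fromBlocks 0 (-1) 1 0 := Fin.snoc_last _ _
  have h : gammaP9 = gammaP (Fin.castSucc 0) * (gammaP (Fin.castSucc 1) *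
      (gammaP (Fin.castSucc 2) * (gammaP (Fin.castSucc 3) * (gammaP (Fin.castSucc 4) *
      (gammaP (Fin.castSucc 5) * (gammaP (Fin.castSucc 6) * gammaP (Fin.last 7))))))) := by
    simp [gammaP9, List.ofFn_succ]
  rw [h]
  simp only [hs, hl, Matrix.fromBlocks_multiply, mul_zero, zero_mul, add_zero, zero_add, mul_neg,
    mul_one, h7, neg_zero, neg_neg]

theorem gammaPLin_eq (x : Fin 8 → ℝ) :
    gammaPLin x = Matrix.fromBlocks 0 (octLin (Fin.init x) - x (Fin.last 7) • 1)
      (octLin (Fin.init x) + x (Fin.last 7) • 1) 0 := by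
  have h : gammaPLin x = ∑ i, x i • gammaP i := rfl
  rw [h, Fin.sum_univ_castSucc, octLin_apply]
  have hs (i : Fin 7) : gammaP i.castSucc = Matrix.fromBlocks 0 (octL i) (octL i) 0 := by
    simp [gammaP]
  have hl : gammaP (Fin.last 7) = Matrix.fromBlocks 0 (-1) 1 0 := Fin.snoc_last _ _
  simp only [hs, hl, Fin.init]
  ext (i | i) (j | j) <;> simp [Matrix.sum_apply, sub_eq_add_neg]

theorem gammaPLin_mul_self (x : Fin 8 → ℝ) :
    gammaPLin x * gammaPLin x = (-∑ i, x i ^ 2) • (1 : Matrix S8 S8 ℝ) := by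
  have h := octLin_mul_self (Fin.init x)
  have hx : ∑ i, x i ^ 2 = ∑ i : Fin 7, Fin.init x i ^ 2 + x (Fin.last 7) ^ 2 :=
    Fin.sum_univ_castSucc _
  have e1 : (octLin (Fin.init x) - x (Fin.last 7) • 1) * (octLin (Fin.init x) + x (Fin.last 7) • 1)
      = (-∑ i, x i ^ 2) • (1 : Matrix (Fin 8) (Fin 8) ℝ) := by
    rw [sub_mul, mul_add, mul_add, h, hx]
    simp only [mul_smul_comm, smul_mul_assoc, mul_one, one_mul]
    module
  have e2 : (octLin (Fin.init x) + x (Fin.last 7) • 1) * (octLin (Fin.init x) - x (Fin.last 7) • 1)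
      = (-∑ i, x i ^ 2) • (1 : Matrix (Fin 8) (Fin 8) ℝ) := by
    rw [add_mul, mul_sub, mul_sub, h, hx]
    simp only [mul_smul_comm, smul_mul_assoc, mul_one, one_mul]
    module
  rw [gammaPLin_eq, Matrix.fromBlocks_multiply]
  simp only [mul_zero, zero_mul, add_zero, zero_add, e1, e2]
  rw [← Matrix.fromBlocks_one, Matrix.fromBlocks_smul, smul_zero]

/-! ### Minkowski space `𝕄^{10,1}`, its Clifford algebra and the spinor module `Δ` -/

/-- Eleven-dimensional Minkowski space; the coordinates `0, 1, …, 9` and `10` (for `♮`). -/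
abbrev Mink : Type := Fin 11 → ℝ

/-- The diagonal of the Minkowski metric, `(-1, 1, …, 1)`. -/
def eta (M : Fin 11) : ℝ := if M = 0 then -1 else 1

/-- The Minkowski quadratic form `-x₀² + x₁² + ⋯ + x₉² + x_♮²`. -/
def Qmink : QuadraticForm ℝ Mink := QuadraticMap.weightedSumSquares ℝ eta

/-- The Clifford algebra `Cl_{1,10}`, in which `v² = Qmink v`. -/
abbrev Cl : Type := CliffordAlgebra Qmink

/-- `Spin_{10,1}` inside `Cl_{1,10}`: the double cover of the identity component
of the Lorentz group. -/
abbrev Spin101 : Type := spinGroup Qmink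

/-- The orthonormal frame `e₀, e₁, …, e₉, e_♮`. -/
def e (M : Fin 11) : Mink := Pi.single M 1

/-- The null vector `e₊ = e₀ + e₉`. -/
def ePlus : Mink := e 0 + e 9

/-- The label in `{1, …, 8}` of the `i`-th direction of `𝔼⁸ ⊂ 𝕄^{10,1}`. -/
def idx8 (i : Fin 8) : Fin 11 := ⟨i + 1, by omega⟩

/-- `Σ(a, b) = -½ · ½ [a, b]`, so that `Σ(e_M, e_N) = Σ_{MN} = -½ Γ_{MN}`. -/
def Sig (a b : Mink) : Cl :=
  -(1 / 4 : ℝ) • ⁅CliffordAlgebra.ι Qmink a, CliffordAlgebra.ι Qmink b⁆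

/-- The generators `Σ'ᵢⱼ` of `so₈ ⊂ Cl₈`: the diagonal blocks of `Σᵢⱼ` acting on spinors. -/
def SigP (i j : Fin 8) : Matrix S8 S8 ℝ := (1 / 4 : ℝ) • ⁅gammaP i, gammaP j⁆

/-- Index set of the 32 components of a spinor of `Cl_{1,10}`. -/
abbrev S11 : Type := S8 ⊕ S8

/-- The gamma matrices `Γ₀, Γ₁, …, Γ₉, Γ_♮`. -/
def gamma : Fin 11 → Matrix S11 S11 ℝ :=
  let g (i : Fin 8) : Matrix S11 S11 ℝ := Matrix.fromBlocks 0 (-gammaP i) (gammaP i) 0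
  ![Matrix.fromBlocks 0 (-gammaP9) gammaP9 0,
    g 0, g 1, g 2, g 3, g 4, g 5, g 6, g 7,
    Matrix.fromBlocks 0 1 1 0,
    Matrix.fromBlocks 1 0 0 (-1)]

/-- Clifford multiplication by the vector `x` on spinors. -/
def gammaLin : Mink →ₗ[ℝ] Matrix S11 S11 ℝ := Fintype.linearCombination ℝ gamma

theorem gammaLin_mul_self (x : Mink) :
    gammaLin x * gammaLin x = Qmink x • (1 : Matrix S11 S11 ℝ) := by
  set y : Fin 8 → ℝ := fun i => x (idx8 i) with hy
  set K : Matrix S8 S8 ℝ := x 0 • gammaP9 + gammaPLin y with hK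
  have h1 : gammaLin x = Matrix.fromBlocks (x 10 • 1) (x 9 • 1 - K) (x 9 • 1 + K) (-(x 10 • 1)) := by
    have h : gammaLin x = ∑ i, x i • gamma i := rfl
    have hp : gammaPLin y = ∑ i, y i • gammaP i := rfl
    rw [h, hK, hp]
    simp only [Fin.sum_univ_succ, gamma, hy, idx8]
    ext (i | i) (j | j) <;> simp <;> ring_nf
  have hK2 : K * K = (x 0 ^ 2 - ∑ i, y i ^ 2) • (1 : Matrix S8 S8 ℝ) := by
    have h9 : gammaP9 * gammaP9 = 1 := by
      rw [gammaP9_eq, Matrix.fromBlocks_multiply]; simp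
    have hc : gammaP9 * gammaPLin y + gammaPLin y * gammaP9 = 0 := by
      rw [gammaP9_eq, gammaPLin_eq, Matrix.fromBlocks_multiply, Matrix.fromBlocks_multiply,
        Matrix.fromBlocks_add]
      simp
    have : K * K = (x 0 ^ 2) • (gammaP9 * gammaP9)
        + x 0 • (gammaP9 * gammaPLin y + gammaPLin y * gammaP9) + gammaPLin y * gammaPLin y := by
      rw [hK]
      simp only [add_mul, mul_add, smul_mul_assoc, mul_smul_comm, smul_add, smul_smul, pow_two]
      abel
    rw [this, h9, hc, gammaPLin_mul_self]
    module
  have hQ : Qmink x = x 10 ^ 2 + x 9 ^ 2 - (x 0 ^ 2 - ∑ i, y i ^ 2) := by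
    have e0 : eta 0 = -1 := if_pos rfl
    have es (i : Fin 10) : eta i.succ = 1 := if_neg (Fin.succ_ne_zero i)
    rw [Qmink, QuadraticMap.weightedSumSquares_apply, Fin.sum_univ_succ]
    simp only [e0, es, hy, idx8]
    simp [Fin.sum_univ_succ]
    ring
  have hone : (1 : Matrix S11 S11 ℝ) = Matrix.fromBlocks 1 0 0 1 := Matrix.fromBlocks_one.symm
  rw [h1, Matrix.fromBlocks_multiply, hone, Matrix.fromBlocks_smul, hQ]
  simp only [sub_mul, mul_sub, add_mul, mul_add, smul_mul_assoc, mul_smul_comm, mul_one, one_mul,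
    hK2, mul_neg, neg_mul, smul_zero]
  congr 1 <;> module

/-- The spinor module `Δ = ℝ³²` of `Cl_{1,10}`. -/
def rho : Cl →ₐ[ℝ] Matrix S11 S11 ℝ :=
  CliffordAlgebra.lift Qmink ⟨gammaLin, fun x => by
    rw [gammaLin_mul_self, Algebra.algebraMap_eq_smul_one]⟩

/-- The spinor `ε = (ψ, 0)`. -/
def eps (ψ : S8 → ℝ) : S11 → ℝ := Sum.elim ψ 0

/-! ### Isotropy algebra and isotropy group of a spinor -/

/-- The isotropy subalgebra of the spinor `χ` in `so_{10,1}`. -/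
def isotropyAlgebra (χ : S11 → ℝ) : LieSubalgebra ℝ Cl where
  carrier := {X | X ∈ spinLie Qmink ∧ rho X *ᵥ χ = 0}
  zero_mem' := ⟨zero_mem _, by simp⟩
  add_mem' := fun {X Y} hX hY => ⟨add_mem hX.1 hY.1, by
    rw [map_add, Matrix.add_mulVec, hX.2, hY.2, add_zero]⟩
  smul_mem' := fun c X hX => ⟨(spinLie Qmink).smul_mem c hX.1, by
    rw [map_smul, Matrix.smul_mulVec, hX.2, smul_zero]⟩
  lie_mem' := fun {X Y} hX hY => ⟨(spinLie Qmink).lie_mem hX.1 hY.1, by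
    rw [LieRing.of_associative_ring_bracket, map_sub, map_mul, map_mul, Matrix.sub_mulVec,
      ← Matrix.mulVec_mulVec, ← Matrix.mulVec_mulVec, hX.2, hY.2]
    simp⟩

/-- The isotropy subgroup of the spinor `χ` in `Spin_{10,1}`. -/
def isotropyGroup (χ : S11 → ℝ) : Subgroup Spin101 where
  carrier := {g | rho g *ᵥ χ = χ}
  one_mem' := by simp
  mul_mem' := fun {g h} hg hh => by
    change rho g *ᵥ χ = χ at hg
    change rho h *ᵥ χ = χ at hh
    change rho ((g * h : Spin101) : Cl) *ᵥ χ = χ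
    rw [Submonoid.coe_mul, map_mul, ← Matrix.mulVec_mulVec, hh, hg]
  inv_mem' := fun {g} hg => by
    change rho g *ᵥ χ = χ at hg
    change rho ((g⁻¹ : Spin101) : Cl) *ᵥ χ = χ
    nth_rewrite 1 [← hg]
    rw [Matrix.mulVec_mulVec, ← map_mul, ← Submonoid.coe_mul, inv_mul_cancel]
    simp

/-- The connected subgroup of `Spin_{10,1}` obtained by exponentiating, inside `Cl_{1,10}`,
the isotropy subalgebra of `χ`. -/
def expGroup (χ : S11 → ℝ) : Subgroup Spin101 :=
  Subgroup.closure {g | ∃ X ∈ isotropyAlgebra χ, (g : Cl) = NormedSpace.exp X}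

/-- The infinitesimal null rotation `bⁱ Σ₊ᵢ + c Σ₊_♮`. -/
def nullGen (b : Fin 8 → ℝ) (c : ℝ) : Cl :=
  ∑ i, b i • Sig ePlus (e (idx8 i)) + c • Sig ePlus (e 10)

/-- `L` is a null rotation about the null vector `n`: a Lorentz transformation fixing `n`, acting
trivially on `n^⊥ / n`, for which the direction of `n` is the only invariant null direction. -/
structure IsNullRotation (n : Mink) (L : Mink →ₗ[ℝ] Mink) : Prop where
  lorentz : ∀ v, Qmink (L v) = Qmink v
  ne_zero : n ≠ 0
  null : Qmink n = 0
  fixes : L n = n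
  screen : ∀ v, QuadraticMap.polar Qmink n v = 0 → L v - v ∈ Submodule.span ℝ {n}
  unique : ∀ w, Qmink w = 0 → (∃ t : ℝ, L w = t • w) → w ∈ Submodule.span ℝ {n}

/-! ### Forms on Minkowski space -/

/-- The algebra `⋀ (𝕄^{10,1})^*` of forms on Minkowski space. -/
abbrev Forms : Type := ExteriorAlgebra ℝ (Module.Dual ℝ Mink)

/-- The one-form `v^* = ⟨v, -⟩` dual to the vector `v` through the Minkowski metric. -/
def dualForm (v : Mink) : Forms :=
  ExteriorAlgebra.ι ℝ (∑ M, (eta M * v M) • (LinearMap.proj M : Mink →ₗ[ℝ] ℝ))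

/-- The forms of degree `k` invariant under the subgroup `G` of `Spin_{10,1}`,
which acts by pull-back through the vector representation. -/
def invariantForms (G : Subgroup Spin101) (k : ℕ) : Submodule ℝ Forms where
  carrier := {ω | ω ∈ ⋀[ℝ]^k (Module.Dual ℝ Mink) ∧
    ∀ g ∈ G, ExteriorAlgebra.map (vecAct g).dualMap ω = ω}
  zero_mem' := ⟨zero_mem _, fun _ _ => map_zero _⟩
  add_mem' := fun {ω τ} h h' => ⟨add_mem h.1 h'.1, fun g hg => by
    rw [map_add, h.2 g hg, h'.2 g hg]⟩
  smul_mem' := fun c ω h => ⟨Submodule.smul_mem _ c h.1, fun g hg => by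
    rw [map_smul, h.2 g hg]⟩

/-- The four-form on `𝔼⁸` built from the spinor `ψ` of `Cl₈`:
`Ω = - (4! |ψ|²)⁻¹ ∑ ⟨ψ, Γ'ᵢ Γ'ⱼ Γ'ₖ Γ'ₗ ψ⟩ eᵢ^* ∧ eⱼ^* ∧ eₖ^* ∧ eₗ^*`. -/
def cayley (ψ : S8 → ℝ) : Forms :=
  -(24 * (ψ ⬝ᵥ ψ))⁻¹ • ∑ i, ∑ j, ∑ k, ∑ l,
    (ψ ⬝ᵥ ((gammaP i * gammaP j * gammaP k * gammaP l) *ᵥ ψ)) •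
      (dualForm (e (idx8 i)) * dualForm (e (idx8 j)) *
        dualForm (e (idx8 k)) * dualForm (e (idx8 l)))

/-- `Ω` is a Cayley form on `𝔼⁸`: in some orthonormal coframe `f₁, …, f₈` it is the standard one,
`f₁₂₃₄ + f₁₂₅₆ + f₁₂₇₈ + f₁₃₅₇ - f₁₃₆₈ - f₁₄₅₈ - f₁₄₆₇ - f₂₃₅₈ - f₂₃₆₇ - f₂₄₅₇ + f₂₄₆₈
+ f₃₄₅₆ + f₃₄₇₈ + f₅₆₇₈`; here the coframe is numbered from `0`. -/
def IsCayleyForm (Ω : Forms) : Prop :=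
  ∃ A ∈ Matrix.orthogonalGroup (Fin 8) ℝ,
    let f (i : Fin 8) : Forms := ∑ j, A i j • dualForm (e (idx8 j))
    let w (i j k l : Fin 8) : Forms := f i * f j * f k * f l
    Ω = w 0 1 2 3 + w 0 1 4 5 + w 0 1 6 7 + w 0 2 4 6 - w 0 2 5 7 - w 0 3 4 7 - w 0 3 5 6
      - w 1 2 4 7 - w 1 2 5 6 - w 1 3 4 6 + w 1 3 5 7 + w 2 3 4 5 + w 2 3 6 7 + w 4 5 6 7

/-- The volume form `e₁^* ∧ ⋯ ∧ e₈^*` of `𝔼⁸`. -/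
def vol8 : Forms := (List.ofFn fun i : Fin 8 => dualForm (e (idx8 i))).prod

/-- The volume form `e₀^* ∧ e₁^* ∧ ⋯ ∧ e_♮^*`. -/
def vol11 : Forms := (List.ofFn fun M : Fin 11 => dualForm (e M)).prod

/-- The table of invariant forms, by degree; `0` where there is none. -/
def tableForm (Ω : Forms) : ℕ → Forms
  | 0 => 1
  | 1 => dualForm ePlus
  | 2 => dualForm ePlus * dualForm (e 10)
  | 5 => dualForm ePlus * Ω
  | 6 => dualForm ePlus * dualForm (e 10) * Ω
  | 9 => dualForm ePlus * vol8
  | 10 => dualForm ePlus * dualForm (e 10) * vol8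
  | 11 => vol11
  | _ => 0

end ExoticSpinor

end

open ExoticSpinor

noncomputable section
namespace ExoticSpinor

section VanKampen

open unitInterval

variable {X : Type*} [TopologicalSpace X]

/-- A family of homotopy classes of paths from a base point which is compatible with all paths
inside the members of an open cover is compatible with all paths. -/
theorem trans_mk_eq_of_cover {ι : Type*} {c : ι → Set X} (hc : ∀ i, IsOpen (c i))
    (hcov : ∀ x, ∃ i, x ∈ c i) {x₀ : X} (κ : ∀ x, Path.Homotopic.Quotient x₀ x)
    (hκ : ∀ i (x y : X) (γ : Path x y), Set.range γ ⊆ c i →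
      (κ x).trans (Path.Homotopic.Quotient.mk γ) = κ y) {x y : X} (γ : Path x y) :
    (κ x).trans (Path.Homotopic.Quotient.mk γ) = κ y := by
  obtain ⟨t, ht0, hmono, ⟨n, hn⟩, ht⟩ :=
    exists_monotone_Icc_subset_open_cover_unitInterval
      (c := fun i => γ ⁻¹' c i) (fun i => (hc i).preimage γ.continuous)
      (fun s _ => Set.mem_iUnion.2 (hcov (γ s)))
  have key : ∀ k, (κ (γ (t 0))).trans (Path.Homotopic.Quotient.mk (γ.subpath (t 0) (t k))) = κ (γ (t k)) := by
    intro k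
    induction k with
    | zero => rw [Path.subpath_self, Path.Homotopic.Quotient.mk_refl, Path.Homotopic.Quotient.trans_refl]
    | succ k ih =>
      obtain ⟨i, hi⟩ := ht k
      have h1 := hκ i _ _ (γ.subpath (t k) (t (k + 1))) (by
        rw [Path.range_subpath_of_le _ _ _ (hmono (Nat.le_succ k))]
        exact Set.image_subset_iff.2 hi)
      rw [← h1, ← ih, Path.Homotopic.Quotient.trans_assoc, ← Path.Homotopic.Quotient.mk_trans]
      congr 1
      exact (Path.Homotopic.Quotient.eq.2 ⟨Path.Homotopy.subpathTransSubpath γ _ _ _⟩).symm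
  have h := key n
  rw [ht0, hn n le_rfl, Path.subpath_zero_one, Path.Homotopic.Quotient.mk_cast] at h
  have e0 : γ 0 = x := γ.source
  have e1 : γ 1 = y := γ.target
  have gen : ∀ (a b : X) (ha : a = x) (hb : b = y),
      (κ a).trans ((Path.Homotopic.Quotient.mk γ).cast ha hb) = κ b → (κ x).trans (Path.Homotopic.Quotient.mk γ) = κ y := by
    rintro _ _ rfl rfl h
    simpa using h
  exact gen _ _ e0 e1 h

/-- Two paths inside a simply connected subset are homotopic in the ambient space. -/
theorem mk_eq_of_range_subset {U : Set X} (hU : SimplyConnectedSpace U) {x y : X}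
    (p q : Path x y) (hp : Set.range p ⊆ U) (hq : Set.range q ⊆ U) :
    Path.Homotopic.Quotient.mk p = Path.Homotopic.Quotient.mk q := by
  have hx : x ∈ U := hp ⟨0, p.source⟩
  have hy : y ∈ U := hp ⟨1, p.target⟩
  let lift (r : Path x y) (hr : Set.range r ⊆ U) : Path (⟨x, hx⟩ : U) ⟨y, hy⟩ :=
    { toFun := fun t => ⟨r t, hr ⟨t, rfl⟩⟩
      continuous_toFun := r.continuous.subtype_mk _
      source' := Subtype.ext r.source
      target' := Subtype.ext r.target }
  have h := (SimplyConnectedSpace.paths_homotopic (lift p hp) (lift q hq)).map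
    ⟨Subtype.val, continuous_subtype_val⟩
  exact Path.Homotopic.Quotient.eq.2 h

/-- A space which is the union of two simply connected open subsets with path connected
intersection is simply connected. -/
theorem simplyConnectedSpace_of_union {U V : Set X} (hUo : IsOpen U) (hVo : IsOpen V)
    (hcov : ∀ x, x ∈ U ∨ x ∈ V) (hU : SimplyConnectedSpace U) (hV : SimplyConnectedSpace V)
    (hUV : IsPathConnected (U ∩ V)) : SimplyConnectedSpace X := by
  classical
  obtain ⟨x₀, ⟨hx₀U, hx₀V⟩, hx₀⟩ := hUV
  have hpU : IsPathConnected U := isPathConnected_iff_pathConnectedSpace.2 inferInstance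
  have hpV : IsPathConnected V := isPathConnected_iff_pathConnectedSpace.2 inferInstance
  have hex : ∀ x, ∃ p : Path x₀ x, (x ∈ U → Set.range p ⊆ U) ∧ (x ∈ V → Set.range p ⊆ V) := by
    intro x
    by_cases h : x ∈ U ∩ V
    · obtain ⟨p, hp⟩ := hx₀ h
      exact ⟨p, fun _ => Set.range_subset_iff.2 fun t => (hp t).1,
        fun _ => Set.range_subset_iff.2 fun t => (hp t).2⟩
    · rcases hcov x with hx | hx
      · obtain ⟨p, hp⟩ := hpU.joinedIn x₀ hx₀U x hx
        exact ⟨p, fun _ => Set.range_subset_iff.2 hp, fun h' => absurd ⟨hx, h'⟩ h⟩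
      · obtain ⟨p, hp⟩ := hpV.joinedIn x₀ hx₀V x hx
        exact ⟨p, fun h' => absurd ⟨h', hx⟩ h, fun _ => Set.range_subset_iff.2 hp⟩
  choose p hpU' hpV' using hex
  have main : ∀ {x y : X} (γ : Path x y),
      (Path.Homotopic.Quotient.mk (p x)).trans (Path.Homotopic.Quotient.mk γ) = Path.Homotopic.Quotient.mk (p y) := by
    intro x y γ
    refine trans_mk_eq_of_cover (c := fun b : Bool => if b then U else V) ?_ ?_
      (fun x => Path.Homotopic.Quotient.mk (p x)) ?_ γ
    · rintro (_ | _)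
      · simpa using hVo
      · simpa using hUo
    · intro x
      rcases hcov x with h | h
      · exact ⟨true, by simpa using h⟩
      · exact ⟨false, by simpa using h⟩
    · rintro (_ | _) x y γ hγ
      · have hγ' : Set.range γ ⊆ V := by simpa using hγ
        rw [← Path.Homotopic.Quotient.mk_trans]
        refine mk_eq_of_range_subset hV _ _ ?_ (hpV' y (hγ' ⟨1, γ.target⟩))
        rw [Path.trans_range]
        exact Set.union_subset (hpV' x (hγ' ⟨0, γ.source⟩)) hγ'
      · have hγ' : Set.range γ ⊆ U := by simpa using hγ
        rw [← Path.Homotopic.Quotient.mk_trans]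
        refine mk_eq_of_range_subset hU _ _ ?_ (hpU' y (hγ' ⟨1, γ.target⟩))
        rw [Path.trans_range]
        exact Set.union_subset (hpU' x (hγ' ⟨0, γ.source⟩)) hγ'
  rw [simply_connected_iff_paths_homotopic']
  refine ⟨⟨⟨x₀⟩, fun x y => ⟨(p x).symm.trans (p y)⟩⟩, fun {x y} p₁ p₂ => ?_⟩
  rw [← Path.Homotopic.Quotient.eq]
  have h : (Path.Homotopic.Quotient.mk (p x)).trans (Path.Homotopic.Quotient.mk p₁) = (Path.Homotopic.Quotient.mk (p x)).trans (Path.Homotopic.Quotient.mk p₂) :=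
    (main p₁).trans (main p₂).symm
  have h2 := congrArg (fun q => (Path.Homotopic.Quotient.mk (p x)).symm.trans q) h
  simpa only [← Path.Homotopic.Quotient.trans_assoc, Path.Homotopic.Quotient.symm_trans, Path.Homotopic.Quotient.refl_trans] using h2

/-- A space which deformation retracts (in the weak sense) to a simply connected space is
simply connected. -/
theorem simplyConnectedSpace_of_retract {Y : Type*} [TopologicalSpace Y]
    (hY : SimplyConnectedSpace Y) (i : C(Y, X)) (r : C(X, Y)) (hri : ∀ y, r (i y) = y)
    (F : ℝ × X → X) (hF : ContinuousOn F (Set.Icc 0 1 ×ˢ Set.univ))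
    (h0 : ∀ x, F (0, x) = x) (h1 : ∀ x, F (1, x) = i (r x)) :
    SimplyConnectedSpace X := by
  have e : ContinuousMap.HomotopyEquiv X Y :=
    { toFun := r
      invFun := i
      left_inv := ⟨ContinuousMap.Homotopy.symm
        { toFun := fun q => F ((q.1 : ℝ), q.2)
          continuous_toFun := by
            refine hF.comp_continuous (by fun_prop) fun q => ?_
            exact ⟨q.1.2, trivial⟩
          map_zero_left := fun x => h0 x
          map_one_left := fun x => h1 x }⟩
      right_inv := by
        have : r.comp i = ContinuousMap.id Y := by ext y; exact hri y
        rw [this] }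
  exact e.simplyConnectedSpace

end VanKampen

end ExoticSpinor
end

noncomputable section
namespace ExoticSpinor

section Contraction

open CliffordAlgebra

variable {V : Type*} [AddCommGroup V] [Module ℝ V] {Q : QuadraticForm ℝ V}

/-- The twisted commutator with a vector is a contraction. -/
theorem ι_mul_sub_involute_mul_ι (v : V) (x : CliffordAlgebra Q) :
    ι Q v * x - involute x * ι Q v = contractLeft (Q.polarBilin v) x := by
  induction x using CliffordAlgebra.left_induction with
  | algebraMap r => simp [Algebra.commutes]
  | add x y hx hy =>
    rw [map_add, map_add, ← hx, ← hy, mul_add, add_mul]; abel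
  | ι_mul x a hx =>
    rw [contractLeft_ι_mul, ← hx, map_mul, involute_ι]
    have h : ι Q v * ι Q a = algebraMap ℝ _ (QuadraticMap.polar Q v a) - ι Q a * ι Q v := by
      rw [← ι_mul_ι_add_swap]; abel
    rw [← mul_assoc, h, sub_mul, Algebra.smul_def, QuadraticMap.polarBilin_apply_apply]
    noncomm_ring

theorem mem_even_iff_involute_eq {x : CliffordAlgebra Q} :
    x ∈ even Q ↔ involute x = x := by
  refine ⟨fun h => involute_eq_of_mem_even h, fun h => ?_⟩
  have hx : x ∈ evenOdd Q 0 ⊔ evenOdd Q 1 := by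
    rw [(evenOdd_isCompl Q).sup_eq_top]; trivial
  obtain ⟨a, ha, b, hb, rfl⟩ := Submodule.mem_sup.1 hx
  rw [map_add, involute_eq_of_mem_even ha, involute_eq_of_mem_odd hb, add_right_inj,
    neg_eq_iff_add_eq_zero, ← two_smul ℝ, smul_eq_zero_iff_right (two_ne_zero' ℝ)] at h
  rw [h, add_zero]
  exact ha

theorem algebraMap_clifford_injective :
    Function.Injective (algebraMap ℝ (CliffordAlgebra Q)) :=
  FaithfulSMul.algebraMap_injective ℝ _

theorem involute_list_prod (l : List V) :
    involute (l.map (ι Q)).prod = (-1 : ℝ) ^ l.length • (l.map (ι Q)).prod :=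
  involute_prod_map_ι l

/-- Vectors with a common square root of unity factor conjugate by the spin group. -/
theorem ι_vecAct_mul (g : spinGroup Q) (v : V) :
    ι Q (vecAct g v) * (g : CliffordAlgebra Q) = g * ι Q v := by
  rw [ι_vecAct, mul_assoc, ← Submonoid.coe_mul, inv_mul_cancel, Submonoid.coe_one, mul_one]

theorem ι_inj : Function.Injective (ι Q) := fun a b h => by
  rw [← vecPart_ι (Q := Q) a, h, vecPart_ι]

theorem vecAct_eq_of_mul {g : spinGroup Q} {v w : V}
    (h : (g : CliffordAlgebra Q) * ι Q v = ι Q w * g) : vecAct g v = w := by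
  apply ι_inj (Q := Q)
  rw [ι_vecAct, h, mul_assoc, ← Submonoid.coe_mul, mul_inv_cancel, Submonoid.coe_one, mul_one]

theorem vecAct_one : vecAct (1 : spinGroup Q) = LinearMap.id :=
  LinearMap.ext fun v => vecAct_eq_of_mul (by simp)

theorem vecAct_mul (g h : spinGroup Q) : vecAct (g * h) = vecAct g ∘ₗ vecAct h :=
  LinearMap.ext fun v => vecAct_eq_of_mul (by
    rw [LinearMap.comp_apply, Submonoid.coe_mul, mul_assoc, ← ι_vecAct_mul, ← mul_assoc,
      ← ι_vecAct_mul, mul_assoc])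

theorem vecAct_mul_apply (g h : spinGroup Q) (v : V) :
    vecAct (g * h) v = vecAct g (vecAct h v) := by rw [vecAct_mul]; rfl

theorem vecAct_inv_vecAct (g : spinGroup Q) (v : V) : vecAct g⁻¹ (vecAct g v) = v := by
  rw [← vecAct_mul_apply, inv_mul_cancel, vecAct_one]; rfl

theorem vecAct_vecAct_inv (g : spinGroup Q) (v : V) : vecAct g (vecAct g⁻¹ v) = v := by
  rw [← vecAct_mul_apply, mul_inv_cancel, vecAct_one]; rfl

theorem quadraticForm_vecAct (g : spinGroup Q) (v : V) : Q (vecAct g v) = Q v := by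
  apply algebraMap_clifford_injective (Q := Q)
  rw [← ι_sq_scalar, ← ι_sq_scalar]
  have h : ι Q (vecAct g v) * ι Q (vecAct g v) * g = ι Q v * ι Q v * (g : CliffordAlgebra Q) := by
    rw [mul_assoc, ι_vecAct_mul, ← mul_assoc, ι_vecAct_mul, mul_assoc, ι_sq_scalar,
      Algebra.commutes]
  have h2 := congrArg (· * ((g⁻¹ : spinGroup Q) : CliffordAlgebra Q)) h
  simpa only [mul_assoc, ← Submonoid.coe_mul, mul_inv_cancel, Submonoid.coe_one, mul_one] using h2

theorem polar_vecAct (g : spinGroup Q) (v w : V) :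
    QuadraticMap.polar Q (vecAct g v) (vecAct g w) = QuadraticMap.polar Q v w := by
  simp only [QuadraticMap.polar, ← map_add, quadraticForm_vecAct]

theorem coe_inv_spinGroup (g : spinGroup Q) :
    ((g⁻¹ : spinGroup Q) : CliffordAlgebra Q) = star (g : CliffordAlgebra Q) := rfl

end Contraction

/-! ### Diagonal quadratic forms -/

section Diagonal

open CliffordAlgebra

variable {n : ℕ}

/-- The diagonal quadratic form with weights `w`. -/
abbrev diagForm (w : Fin n → ℝ) : QuadraticForm ℝ (Fin n → ℝ) :=
  QuadraticMap.weightedSumSquares ℝ w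

variable {w : Fin n → ℝ}

theorem diagForm_apply (x : Fin n → ℝ) : diagForm w x = ∑ i, w i * (x i * x i) := by
  simp [QuadraticMap.weightedSumSquares_apply]

theorem polar_diagForm (x y : Fin n → ℝ) :
    QuadraticMap.polar (diagForm w) x y = 2 * ∑ i, w i * (x i * y i) := by
  simp only [QuadraticMap.polar, diagForm_apply, Pi.add_apply, Finset.mul_sum,
    ← Finset.sum_sub_distrib]
  exact Finset.sum_congr rfl fun i _ => by ring

theorem polar_single (i : Fin n) (y : Fin n → ℝ) :
    QuadraticMap.polar (diagForm w) (Pi.single i 1) y = 2 * (w i * y i) := by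
  rw [polar_diagForm, Finset.sum_eq_single i]
  · simp
  · intro j _ hj; simp [hj]
  · simp

theorem diagForm_single (i : Fin n) : diagForm w (Pi.single i 1) = w i := by
  rw [diagForm_apply, Finset.sum_eq_single i]
  · simp
  · intro j _ hj; simp [hj]
  · simp

/-- The `i`-th basis vector as an element of the Clifford algebra. -/
def gen (w : Fin n → ℝ) (i : Fin n) : CliffordAlgebra (diagForm w) := ι _ (Pi.single i 1)

theorem gen_sq (i : Fin n) : gen w i * gen w i = algebraMap ℝ _ (w i) := by
  rw [gen, ι_sq_scalar, diagForm_single]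

theorem gen_anticomm {i j : Fin n} (h : i ≠ j) : gen w i * gen w j = -(gen w j * gen w i) := by
  rw [eq_neg_iff_add_eq_zero, gen, gen, ι_mul_ι_add_swap, polar_single]
  simp [h]

theorem ι_eq_sum_gen (x : Fin n → ℝ) : ι (diagForm w) x = ∑ i, x i • gen w i := by
  conv_lhs => rw [pi_eq_sum_univ' x]
  rw [map_sum]
  refine Finset.sum_congr rfl fun i _ => ?_
  rw [map_smul, gen]

/-- Contraction with the `i`-th coordinate. -/
abbrev dContr (w : Fin n → ℝ) (i : Fin n) :
    CliffordAlgebra (diagForm w) →ₗ[ℝ] CliffordAlgebra (diagForm w) :=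
  contractLeft (LinearMap.proj i : (Fin n → ℝ) →ₗ[ℝ] ℝ)

theorem gen_mul_sub (i : Fin n) (x : CliffordAlgebra (diagForm w)) :
    gen w i * x - involute x * gen w i = (2 * w i) • dContr w i x := by
  rw [gen, ι_mul_sub_involute_mul_ι]
  have : (diagForm w).polarBilin (Pi.single i 1)
      = (2 * w i) • (LinearMap.proj i : (Fin n → ℝ) →ₗ[ℝ] ℝ) := by
    refine LinearMap.ext fun y => ?_
    rw [QuadraticMap.polarBilin_apply_apply, polar_single]
    simp [mul_assoc]
  rw [this, map_smul, LinearMap.smul_apply]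

theorem dContr_gen_mul (i j : Fin n) (x : CliffordAlgebra (diagForm w)) :
    dContr w i (gen w j * x) = (if i = j then x else 0) - gen w j * dContr w i x := by
  rw [gen, contractLeft_ι_mul]
  congr 1
  by_cases h : i = j <;> simp [h]

/-- The subalgebra generated by the first `m` basis vectors. -/
def lowAlg (w : Fin n → ℝ) (m : ℕ) : Subalgebra ℝ (CliffordAlgebra (diagForm w)) :=
  Algebra.adjoin ℝ {x | ∃ j : Fin n, j.val < m ∧ x = gen w j}

theorem gen_mem_lowAlg {m : ℕ} {j : Fin n} (h : j.val < m) : gen w j ∈ lowAlg w m :=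
  Algebra.subset_adjoin ⟨j, h, rfl⟩

theorem adjoin_le_of_mul_left {A : Type*} [Ring A] [Algebra ℝ A] {s : Set A} (p : Submodule ℝ A)
    (h1 : (1 : A) ∈ p) (hs : ∀ a ∈ s, ∀ x ∈ p, a * x ∈ p) {x : A} (hx : x ∈ Algebra.adjoin ℝ s) :
    x ∈ p := by
  have h : Subalgebra.toSubmodule (Algebra.adjoin ℝ s) ≤ p := by
    rw [Algebra.adjoin_eq_span, Submodule.span_le]
    intro y hy
    induction hy using Submonoid.closure_induction_left with
    | one => exact h1
    | mul_left a ha b _ ih => exact hs a ha b ih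
  exact h hx

theorem dContr_of_mem_lowAlg {m : ℕ} {i : Fin n} (hi : m ≤ i.val)
    {x : CliffordAlgebra (diagForm w)} (hx : x ∈ lowAlg w m) : dContr w i x = 0 := by
  refine adjoin_le_of_mul_left (LinearMap.ker (dContr w i)) ?_ ?_ hx
  · simp
  · rintro _ ⟨j, hj, rfl⟩ y hy
    rw [LinearMap.mem_ker] at hy ⊢
    rw [dContr_gen_mul, hy, if_neg (by rintro rfl; omega)]
    simp

theorem exists_of_mem_lowAlg_succ {m : ℕ} (hm : m < n) {x : CliffordAlgebra (diagForm w)}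
    (hx : x ∈ lowAlg w (m + 1)) :
    ∃ a ∈ lowAlg w m, ∃ b ∈ lowAlg w m, x = a + gen w ⟨m, hm⟩ * b := by
  let A := Subalgebra.toSubmodule (lowAlg w m)
  let p : Submodule ℝ (CliffordAlgebra (diagForm w)) :=
    A ⊔ A.map (LinearMap.mulLeft ℝ (gen w ⟨m, hm⟩))
  have hp : ∀ y, y ∈ p ↔ ∃ a ∈ lowAlg w m, ∃ b ∈ lowAlg w m, y = a + gen w ⟨m, hm⟩ * b := by
    intro y
    simp only [p, Submodule.mem_sup, Submodule.mem_map]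
    constructor
    · rintro ⟨a, ha, _, ⟨b, hb, rfl⟩, rfl⟩
      exact ⟨a, ha, b, hb, rfl⟩
    · rintro ⟨a, ha, b, hb, rfl⟩
      exact ⟨a, ha, _, ⟨b, hb, rfl⟩, rfl⟩
  rw [← hp]
  refine adjoin_le_of_mul_left p ((hp 1).2 ⟨1, one_mem _, 0, zero_mem _, by simp⟩) ?_ hx
  rintro _ ⟨j, hj, rfl⟩ y hy
  obtain ⟨a, ha, b, hb, rfl⟩ := (hp y).1 hy
  rw [hp]
  rcases Nat.lt_succ_iff_lt_or_eq.1 hj with h | h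
  · refine ⟨gen w j * a, mul_mem (gen_mem_lowAlg h) ha, -(gen w j * b),
      neg_mem (mul_mem (gen_mem_lowAlg h) hb), ?_⟩
    rw [mul_add, ← mul_assoc, gen_anticomm (i := j) (j := ⟨m, hm⟩)
      (by rintro rfl; exact lt_irrefl _ h)]
    simp [mul_assoc]
  · obtain rfl : j = ⟨m, hm⟩ := Fin.ext h
    refine ⟨algebraMap ℝ _ (w ⟨m, hm⟩) * b, mul_mem (Subalgebra.algebraMap_mem _ _) hb, a, ha, ?_⟩
    rw [mul_add, ← mul_assoc, gen_sq, add_comm]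

theorem mem_lowAlg_top (x : CliffordAlgebra (diagForm w)) : x ∈ lowAlg w n := by
  induction x using CliffordAlgebra.induction with
  | algebraMap r => exact Subalgebra.algebraMap_mem _ _
  | ι v =>
    rw [ι_eq_sum_gen]
    exact sum_mem fun i _ => Subalgebra.smul_mem _ (gen_mem_lowAlg i.2) _
  | mul a b ha hb => exact mul_mem ha hb
  | add a b ha hb => exact add_mem ha hb

theorem mem_lowAlg_of_dContr {m : ℕ} (hm : m ≤ n) {x : CliffordAlgebra (diagForm w)}
    (hx : ∀ i : Fin n, m ≤ i.val → dContr w i x = 0) : x ∈ lowAlg w m := by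
  induction k : n - m generalizing m with
  | zero =>
    obtain rfl : m = n := by omega
    exact mem_lowAlg_top x
  | succ k ih =>
    have hmn : m < n := by omega
    obtain ⟨a, ha, b, hb, rfl⟩ := exists_of_mem_lowAlg_succ hmn
      (ih (m := m + 1) hmn (fun i hi => hx i (by omega)) (by omega))
    have h := hx ⟨m, hmn⟩ le_rfl
    rw [map_add, dContr_of_mem_lowAlg (i := ⟨m, hmn⟩) le_rfl ha, dContr_gen_mul, if_pos rfl,
      dContr_of_mem_lowAlg (i := ⟨m, hmn⟩) le_rfl hb] at h
    simp only [mul_zero, sub_zero, zero_add] at h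
    rw [h]
    simpa using ha

theorem exists_algebraMap_of_dContr {x : CliffordAlgebra (diagForm w)}
    (hx : ∀ i : Fin n, dContr w i x = 0) : ∃ r : ℝ, x = algebraMap ℝ _ r := by
  have h := mem_lowAlg_of_dContr (Nat.zero_le n) (fun i _ => hx i)
  have h0 : lowAlg w 0 = ⊥ := by
    have he : {x | ∃ j : Fin n, j.val < 0 ∧ x = gen w j} = ∅ := by ext x; simp
    rw [lowAlg, he, Algebra.adjoin_empty]
  rw [h0, Algebra.mem_bot] at h
  obtain ⟨r, hr⟩ := h
  exact ⟨r, hr.symm⟩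

/-- An element which commutes with all vectors in the twisted sense is a scalar. -/
theorem exists_algebraMap_of_twisted_commute (hw : ∀ i, w i ≠ 0)
    {x : CliffordAlgebra (diagForm w)}
    (hx : ∀ v, ι (diagForm w) v * x = involute x * ι (diagForm w) v) :
    ∃ r : ℝ, x = algebraMap ℝ _ r := by
  refine exists_algebraMap_of_dContr fun i => ?_
  have h := gen_mul_sub i x
  rw [gen, hx, sub_self, eq_comm, smul_eq_zero] at h
  exact h.resolve_left (mul_ne_zero two_ne_zero (hw i))

/-- A representation of the Clifford algebra of a nondegenerate form is faithful on the even
subalgebra. -/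
theorem eq_zero_of_map_eq_zero_of_even (hw : ∀ i, w i ≠ 0) {B : Type*} [Ring B] [Nontrivial B]
    [Algebra ℝ B] (f : CliffordAlgebra (diagForm w) →ₐ[ℝ] B) {x : CliffordAlgebra (diagForm w)}
    (hx : involute x = x) (hfx : f x = 0) : x = 0 := by
  by_contra hne
  have key : ∀ m ≤ n, ∃ y : CliffordAlgebra (diagForm w), y ≠ 0 ∧ f y = 0 ∧
      (∃ s : ℝ, involute y = s • y) ∧ ∀ i : Fin n, i.val < m → dContr w i y = 0 := by
    intro m hm
    induction m with
    | zero => exact ⟨x, hne, hfx, ⟨1, by rw [hx, one_smul]⟩, fun i hi => absurd hi (by omega)⟩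
    | succ m ih =>
      obtain ⟨y, hy, hfy, ⟨s, hs⟩, hd⟩ := ih (by omega)
      by_cases h : dContr w ⟨m, hm⟩ y = 0
      · refine ⟨y, hy, hfy, ⟨s, hs⟩, fun i hi => ?_⟩
        rcases Nat.lt_succ_iff_lt_or_eq.1 hi with h' | h'
        · exact hd i h'
        · obtain rfl : i = ⟨m, hm⟩ := Fin.ext h'
          exact h
      · have hc : (2 * w ⟨m, hm⟩) ≠ 0 := mul_ne_zero two_ne_zero (hw _)
        have hdy : dContr w ⟨m, hm⟩ y
            = (2 * w ⟨m, hm⟩)⁻¹ • (gen w ⟨m, hm⟩ * y - s • (y * gen w ⟨m, hm⟩)) := by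
          rw [← smul_mul_assoc, ← hs, gen_mul_sub, smul_smul, inv_mul_cancel₀ hc, one_smul]
        refine ⟨dContr w ⟨m, hm⟩ y, h, ?_, ⟨-s, ?_⟩, fun i hi => ?_⟩
        · rw [hdy]; simp [hfy]
        · rw [hdy]
          simp only [map_smul, map_sub, map_mul, hs]
          have : involute (gen w ⟨m, hm⟩) = -gen w ⟨m, hm⟩ := involute_ι _
          rw [this, smul_comm (-s)]
          congr 1
          simp only [neg_mul, mul_neg, smul_mul_assoc, mul_smul_comm, neg_smul, smul_sub, smul_neg]
        · rcases Nat.lt_succ_iff_lt_or_eq.1 hi with h' | h'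
          · rw [contractLeft_comm, hd i h', map_zero, neg_zero]
          · obtain rfl : i = ⟨m, hm⟩ := Fin.ext h'
            exact contractLeft_contractLeft _ _
  obtain ⟨y, hy, hfy, -, hd⟩ := key n le_rfl
  obtain ⟨r, rfl⟩ := exists_algebraMap_of_dContr fun i => hd i i.2
  rw [AlgHom.commutes] at hfy
  have hr : r = 0 := (map_eq_zero_iff _ (FaithfulSMul.algebraMap_injective ℝ B)).1 hfy
  exact hy (by rw [hr, map_zero])

theorem eq_of_map_eq_of_even (hw : ∀ i, w i ≠ 0) {B : Type*} [Ring B] [Nontrivial B]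
    [Algebra ℝ B] (f : CliffordAlgebra (diagForm w) →ₐ[ℝ] B) {x y : CliffordAlgebra (diagForm w)}
    (hx : involute x = x) (hy : involute y = y) (h : f x = f y) : x = y :=
  sub_eq_zero.1 (eq_zero_of_map_eq_zero_of_even hw f (by rw [map_sub, hx, hy])
    (by rw [map_sub, h, sub_self]))

end Diagonal

end ExoticSpinor
end

noncomputable section
namespace ExoticSpinor

/-! ### Isometries are induced by products of vectors -/

section CartanDieudonne

open CliffordAlgebra

section General

variable {V : Type*} [AddCommGroup V] [Module ℝ V] (Q : QuadraticForm ℝ V)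

/-- The reflection in the hyperplane orthogonal to `a`. -/
def hyperRefl (a : V) : V →ₗ[ℝ] V :=
  LinearMap.id - (Q a)⁻¹ • (Q.polarBilin a).smulRight a

variable {Q}

theorem hyperRefl_apply (a v : V) :
    hyperRefl Q a v = v - ((Q a)⁻¹ * QuadraticMap.polar Q a v) • a := by
  simp [hyperRefl, smul_smul]

theorem hyperRefl_of_polar_eq_zero {a v : V} (h : QuadraticMap.polar Q a v = 0) :
    hyperRefl Q a v = v := by
  rw [hyperRefl_apply, h]; simp

theorem hyperRefl_mul {a : V} (ha : Q a ≠ 0) (v : V) :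
    ι Q (hyperRefl Q a v) * ι Q a = -(ι Q a * ι Q v) := by
  have h : ι Q a * ι Q v = algebraMap ℝ _ (QuadraticMap.polar Q a v) - ι Q v * ι Q a := by
    rw [← ι_mul_ι_add_swap]; abel
  rw [h, hyperRefl_apply, map_sub, map_smul, sub_mul, smul_mul_assoc, ι_sq_scalar,
    Algebra.smul_def, ← map_mul (algebraMap ℝ _), mul_right_comm, inv_mul_cancel₀ ha, one_mul,
    neg_sub]

theorem quadraticForm_hyperRefl {a : V} (ha : Q a ≠ 0) (v : V) : Q (hyperRefl Q a v) = Q v := by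
  rw [hyperRefl_apply, sub_eq_add_neg, ← neg_smul, QuadraticMap.map_add Q, QuadraticMap.map_smul,
    QuadraticMap.polar_smul_right, QuadraticMap.polar_comm]
  simp only [smul_eq_mul]
  field_simp
  ring

theorem polar_self_real (a : V) : QuadraticMap.polar Q a a = 2 * Q a := by
  rw [QuadraticMap.polar_self]; simp

theorem hyperRefl_hyperRefl {a : V} (ha : Q a ≠ 0) (v : V) :
    hyperRefl Q a (hyperRefl Q a v) = v := by
  rw [hyperRefl_apply a (hyperRefl Q a v), hyperRefl_apply, QuadraticMap.polar_sub_right,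
    QuadraticMap.polar_smul_right, polar_self_real, sub_sub, ← add_smul, smul_eq_mul]
  convert sub_zero v using 2
  convert zero_smul ℝ a using 2
  field_simp
  ring

theorem hyperRefl_sub {u v : V} (h : Q u = Q v) (ha : Q (u - v) ≠ 0) :
    hyperRefl Q (u - v) u = v := by
  have e : QuadraticMap.polar Q (u - v) u = Q (u - v) := by
    have h1 := QuadraticMap.map_add Q (u - v) (v)
    rw [sub_add_cancel] at h1
    have h2 := QuadraticMap.polar_add_right (Q := Q) (u - v) (u - v) v
    rw [sub_add_cancel, polar_self_real] at h2
    linarith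
  rw [hyperRefl_apply, e, inv_mul_cancel₀ ha, one_smul, sub_sub_cancel]

theorem hyperRefl_smul {a : V} {c : ℝ} (hc : c ≠ 0) (v : V) :
    hyperRefl Q (c • a) v = hyperRefl Q a v := by
  rw [hyperRefl_apply, hyperRefl_apply, QuadraticMap.map_smul, QuadraticMap.polar_smul_left,
    smul_smul]
  congr 2
  simp only [smul_eq_mul]
  by_cases ha : Q a = 0
  · simp [ha]
  · field_simp

theorem exists_smul_unit {a : V} (ha : Q a ≠ 0) :
    ∃ c : ℝ, c ≠ 0 ∧ (Q (c • a) = 1 ∨ Q (c • a) = -1) := by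
  have hp : 0 < |Q a| := abs_pos.2 ha
  have hs : Real.sqrt |Q a| ≠ 0 := (Real.sqrt_pos.2 hp).ne'
  refine ⟨(Real.sqrt |Q a|)⁻¹, inv_ne_zero hs, ?_⟩
  rw [QuadraticMap.map_smul, ← mul_inv, Real.mul_self_sqrt hp.le, smul_eq_mul]
  rcases abs_choice (Q a) with h | h
  · left; rw [h, inv_mul_cancel₀ ha]
  · right; rw [h, inv_neg, neg_mul, inv_mul_cancel₀ ha]

variable (Q)

/-- The list `l` consists of vectors of norm `±1`, and their product in the Clifford algebra
induces the map `T` through the twisted adjoint action. -/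
def Implements (l : List V) (T : V →ₗ[ℝ] V) : Prop :=
  (∀ v ∈ l, Q v = 1 ∨ Q v = -1) ∧
    ∀ v, involute (l.map (ι Q)).prod * ι Q v = ι Q (T v) * (l.map (ι Q)).prod

variable {Q}

theorem Implements.cons {l : List V} {T : V →ₗ[ℝ] V} {a : V} (ha : Q a ≠ 0)
    (h : Implements Q l (hyperRefl Q a ∘ₗ T)) : ∃ l', Implements Q l' T := by
  obtain ⟨c, hc, hca⟩ := exists_smul_unit ha
  refine ⟨(c • a) :: l, ?_, fun v => ?_⟩
  · intro v hv
    rcases List.mem_cons.1 hv with rfl | hv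
    · exact hca
    · exact h.1 v hv
  · have hca0 : Q (c • a) ≠ 0 := by rcases hca with h | h <;> rw [h] <;> norm_num
    have e := hyperRefl_mul hca0 (hyperRefl Q a (T v))
    rw [hyperRefl_smul hc, hyperRefl_hyperRefl ha] at e
    rw [List.map_cons, List.prod_cons, map_mul, involute_ι, mul_assoc, h.2 v, neg_mul, ← mul_assoc,
      ← mul_assoc, e, LinearMap.comp_apply, neg_mul]

theorem isUnit_list_prod {l : List V} (hl : ∀ v ∈ l, Q v = 1 ∨ Q v = -1) :
    ∃ u ∈ lipschitzGroup Q, (u : CliffordAlgebra Q) = (l.map (ι Q)).prod := by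
  induction l with
  | nil => exact ⟨1, one_mem _, by simp⟩
  | cons a l ih =>
    obtain ⟨u, hu, hul⟩ := ih fun v hv => hl v (List.mem_cons_of_mem _ hv)
    have ha : Q a * Q a = 1 := by
      rcases hl a List.mem_cons_self with h | h <;> rw [h] <;> norm_num
    have hm : ι Q a * (Q a • ι Q a) = 1 := by
      rw [mul_smul_comm, ι_sq_scalar, Algebra.smul_def, ← map_mul, ha, map_one]
    have hm' : (Q a • ι Q a) * ι Q a = 1 := by
      rw [smul_mul_assoc, ι_sq_scalar, Algebra.smul_def, ← map_mul, ha, map_one]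
    refine ⟨⟨ι Q a, Q a • ι Q a, hm, hm'⟩ * u, mul_mem (Subgroup.subset_closure ⟨a, rfl⟩) hu, ?_⟩
    rw [Units.val_mul, hul]; simp

theorem star_list_prod_mul {l : List V} (hl : ∀ v ∈ l, Q v = 1 ∨ Q v = -1) :
    ∃ s : ℝ, (s = 1 ∨ s = -1) ∧
      star (l.map (ι Q)).prod * (l.map (ι Q)).prod = algebraMap ℝ _ s := by
  induction l with
  | nil => exact ⟨1, Or.inl rfl, by simp⟩
  | cons a l ih =>
    obtain ⟨s, hs, hsl⟩ := ih fun v hv => hl v (List.mem_cons_of_mem _ hv)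
    refine ⟨-(Q a) * s, ?_, ?_⟩
    · rcases hl a List.mem_cons_self with h | h <;> rcases hs with rfl | rfl <;> rw [h] <;> norm_num
    · rw [List.map_cons, List.prod_cons, star_mul, star_ι, mul_assoc, ← mul_assoc (-ι Q a), neg_mul,
        ι_sq_scalar, ← map_neg, ← mul_assoc, ← Algebra.commutes, mul_assoc, hsl, ← map_mul]

end General

variable {n : ℕ} {w : Fin n → ℝ}

theorem linearMap_eq_id_of_single {T : (Fin n → ℝ) →ₗ[ℝ] (Fin n → ℝ)}
    (h : ∀ i : Fin n, T (Pi.single i 1) = Pi.single i 1) : T = LinearMap.id := by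
  refine LinearMap.pi_ext' fun i => LinearMap.ext_ring ?_
  simpa using h i

theorem polar_comp_of_isometry {T : (Fin n → ℝ) →ₗ[ℝ] (Fin n → ℝ)}
    (hT : ∀ v, diagForm w (T v) = diagForm w v) (u v : Fin n → ℝ) :
    QuadraticMap.polar (diagForm w) (T u) (T v) = QuadraticMap.polar (diagForm w) u v := by
  simp only [QuadraticMap.polar, ← map_add, hT]

/-- Every isometry of a nondegenerate diagonal form is a product of reflections. -/
theorem exists_implements (hw : ∀ i, w i ≠ 0) (T : (Fin n → ℝ) →ₗ[ℝ] (Fin n → ℝ))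
    (hT : ∀ v, diagForm w (T v) = diagForm w v) : ∃ l, Implements (diagForm w) l T := by
  suffices H : ∀ m ≤ n, ∀ T : (Fin n → ℝ) →ₗ[ℝ] (Fin n → ℝ),
      (∀ v, diagForm w (T v) = diagForm w v) →
      (∀ i : Fin n, i.val < m → T (Pi.single i 1) = Pi.single i 1) →
      ∃ l, Implements (diagForm w) l T from
    H 0 (Nat.zero_le n) T hT fun i hi => absurd hi (Nat.not_lt_zero _)
  intro m hm
  induction k : n - m generalizing m with
  | zero =>
    intro T _ hfix
    obtain rfl : m = n := by omega
    refine ⟨[], by simp, fun v => ?_⟩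
    rw [linearMap_eq_id_of_single fun i => hfix i i.2]
    simp
  | succ k ih =>
    intro T hT hfix
    have hmn : m < n := by omega
    have ih' := ih (m + 1) hmn (by omega)
    set em : Fin n → ℝ := Pi.single ⟨m, hmn⟩ 1 with hem
    have hpol : ∀ i : Fin n, i.val < m →
        QuadraticMap.polar (diagForm w) em (Pi.single i 1) = 0 := by
      intro i hi
      rw [hem, polar_single, Pi.single_eq_of_ne (by rintro rfl; exact lt_irrefl _ hi)]
      simp
    have hpolT : ∀ i : Fin n, i.val < m →
        QuadraticMap.polar (diagForm w) (T em) (Pi.single i 1) = 0 := by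
      intro i hi
      rw [← hfix i hi, polar_comp_of_isometry hT, hpol i hi]
    have hQT : diagForm w (T em) = diagForm w em := hT em
    have hQe : diagForm w em ≠ 0 := by rw [hem, diagForm_single]; exact hw _
    have step : ∀ T' : (Fin n → ℝ) →ₗ[ℝ] (Fin n → ℝ), (∀ v, diagForm w (T' v) = diagForm w v) →
        (∀ i : Fin n, i.val < m → T' (Pi.single i 1) = Pi.single i 1) → T' em = em →
        ∃ l, Implements (diagForm w) l T' := by
      intro T' h1 h2 h3
      refine ih' T' h1 fun i hi => ?_
      rcases Nat.lt_succ_iff_lt_or_eq.1 hi with h' | h'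
      · exact h2 i h'
      · obtain rfl : i = ⟨m, hmn⟩ := Fin.ext h'
        exact h3
    by_cases ha : diagForm w (T em - em) = 0
    · have ha' : diagForm w (T em - -em) ≠ 0 := by
        have h1 := QuadraticMap.map_add (diagForm w) (T em) em
        have h2 := QuadraticMap.map_add (diagForm w) (T em) (-em)
        rw [QuadraticMap.map_neg, QuadraticMap.polar_neg_right, ← sub_eq_add_neg] at h2
        rw [sub_neg_eq_add]
        intro h0
        apply hQe
        linarith
      have e1 : hyperRefl (diagForm w) (T em - -em) (T em) = -em :=
        hyperRefl_sub (by rw [QuadraticMap.map_neg, hQT]) ha'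
      have e2 : hyperRefl (diagForm w) em (-em) = em := by
        rw [map_neg, hyperRefl_apply, polar_self_real, mul_comm 2, ← mul_assoc,
          inv_mul_cancel₀ hQe, one_mul, two_smul]
        abel
      obtain ⟨l, hl⟩ := step (hyperRefl (diagForm w) em ∘ₗ
          (hyperRefl (diagForm w) (T em - -em) ∘ₗ T))
        (fun v => by
          rw [LinearMap.comp_apply, LinearMap.comp_apply, quadraticForm_hyperRefl hQe,
            quadraticForm_hyperRefl ha', hT])
        (fun i hi => by
          rw [LinearMap.comp_apply, LinearMap.comp_apply, hfix i hi,
            hyperRefl_of_polar_eq_zero (a := T em - -em), hyperRefl_of_polar_eq_zero (hpol i hi)]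
          rw [sub_neg_eq_add, QuadraticMap.polar_add_left, hpol i hi, hpolT i hi, add_zero])
        (by rw [LinearMap.comp_apply, LinearMap.comp_apply, e1, e2])
      obtain ⟨l', hl'⟩ := hl.cons hQe
      exact hl'.cons ha'
    · obtain ⟨l, hl⟩ := step (hyperRefl (diagForm w) (T em - em) ∘ₗ T)
        (fun v => by rw [LinearMap.comp_apply, quadraticForm_hyperRefl ha, hT])
        (fun i hi => by
          rw [LinearMap.comp_apply, hfix i hi, hyperRefl_of_polar_eq_zero]
          rw [QuadraticMap.polar_sub_left, hpol i hi, hpolT i hi, sub_zero])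
        (by rw [LinearMap.comp_apply, hyperRefl_sub hQT ha])
      exact hl.cons ha

/-- An element whose twisted adjoint action is that of a product of vectors is a multiple
of this product. -/
theorem exists_smul_of_implements (hw : ∀ i, w i ≠ 0) {l : List (Fin n → ℝ)}
    {T : (Fin n → ℝ) →ₗ[ℝ] (Fin n → ℝ)} (hl : Implements (diagForm w) l T)
    {x : CliffordAlgebra (diagForm w)}
    (hx : ∀ v, involute x * ι (diagForm w) v = ι (diagForm w) (T v) * x) :
    ∃ c : ℝ, x = c • (l.map (ι (diagForm w))).prod := by
  obtain ⟨u, -, hu⟩ := isUnit_list_prod hl.1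
  have hl2 := hl.2
  rw [← hu] at hl2 ⊢
  have hi : involute (↑u⁻¹ : CliffordAlgebra (diagForm w)) * involute (u : CliffordAlgebra _) = 1 := by
    rw [← map_mul, Units.inv_mul, map_one]
  obtain ⟨c, hc⟩ := exists_algebraMap_of_twisted_commute hw (x := ↑u⁻¹ * x) fun v => by
    have h1 : involute (↑u⁻¹ : CliffordAlgebra (diagForm w)) * ι (diagForm w) (T v)
        = ι (diagForm w) v * ↑u⁻¹ := by
      have h2 := congrArg (fun z => involute (↑u⁻¹ : CliffordAlgebra (diagForm w)) * z * ↑u⁻¹) (hl2 v)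
      simp only [← mul_assoc, hi, one_mul] at h2
      rw [mul_assoc (involute (↑u⁻¹ : CliffordAlgebra (diagForm w)) * _) (u : CliffordAlgebra _),
        Units.mul_inv, mul_one] at h2
      exact h2.symm
    rw [map_mul, mul_assoc (involute _), hx, ← mul_assoc (involute _), h1, mul_assoc]
  refine ⟨c, ?_⟩
  rw [Algebra.smul_def, Algebra.commutes, ← hc, Units.mul_inv_cancel_left]

/-- A criterion for membership in the spin group of a nondegenerate form. -/
theorem mem_spinGroup_of [NeZero n] (hw : ∀ i, w i ≠ 0) {x : CliffordAlgebra (diagForm w)}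
    (hx : involute x = x) (h1 : star x * x = 1) (h2 : x * star x = 1)
    (hV : ∀ v, ∃ v', x * ι (diagForm w) v = ι (diagForm w) v' * x) :
    x ∈ spinGroup (diagForm w) := by
  choose t ht using hV
  have ht' : ∀ v, x * ι (diagForm w) v * star x = ι (diagForm w) (t v) := fun v => by
    rw [ht, mul_assoc, h2, mul_one]
  let T : (Fin n → ℝ) →ₗ[ℝ] (Fin n → ℝ) :=
    vecPart ∘ₗ LinearMap.mulLeftRight ℝ (x, star x) ∘ₗ ι (diagForm w)
  have hT : ∀ v, T v = t v := fun v => by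
    simp only [T, LinearMap.comp_apply, LinearMap.mulLeftRight_apply, ht', vecPart_ι]
  have hQ : ∀ v, diagForm w (T v) = diagForm w v := fun v => by
    apply algebraMap_clifford_injective (Q := diagForm w)
    rw [← ι_sq_scalar, ← ι_sq_scalar, hT, ← ht']
    have : x * ι (diagForm w) v * star x * (x * ι (diagForm w) v * star x)
        = x * (ι (diagForm w) v * (star x * x) * ι (diagForm w) v) * star x := by
      simp only [mul_assoc]
    rw [this, h1, mul_one, ι_sq_scalar, ← Algebra.commutes, mul_assoc, h2, mul_one]
  obtain ⟨l, hl⟩ := exists_implements hw T hQ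
  obtain ⟨c, hc⟩ := exists_smul_of_implements hw hl (x := x) fun v => by rw [hx, ht, hT]
  obtain ⟨u, hu, hul⟩ := isUnit_list_prod hl.1
  have hc0 : c ≠ 0 := by
    rintro rfl
    rw [zero_smul] at hc
    rw [hc, mul_zero] at h1
    exact zero_ne_one h1
  have hw0 := hw 0
  have hsc : ∃ s ∈ lipschitzGroup (diagForm w), (s : CliffordAlgebra (diagForm w)) = algebraMap ℝ _ c := by
    have hsq : ι (diagForm w) (Pi.single 0 1) * ι (diagForm w) (Pi.single 0 1)
        = algebraMap ℝ _ (w 0) := gen_sq 0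
    have hm (a b : ℝ) (hab : a * b = (w 0)⁻¹) :
        ι (diagForm w) (a • Pi.single 0 1) * ι (diagForm w) (b • Pi.single 0 1) = 1 := by
      rw [map_smul, map_smul, smul_mul_smul_comm, hsq, Algebra.smul_def, ← map_mul, hab,
        inv_mul_cancel₀ hw0, map_one]
    refine ⟨⟨_, _, hm 1 (w 0)⁻¹ (one_mul _), hm (w 0)⁻¹ 1 (mul_one _)⟩ *
      ⟨_, _, hm (c * (w 0)⁻¹) c⁻¹ (by field_simp), hm c⁻¹ (c * (w 0)⁻¹) (by field_simp)⟩,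
      mul_mem (Subgroup.subset_closure ⟨_, rfl⟩) (Subgroup.subset_closure ⟨_, rfl⟩), ?_⟩
    rw [Units.val_mul]
    simp only [map_smul, one_smul]
    rw [mul_smul_comm, hsq, Algebra.smul_def, ← map_mul, inv_mul_cancel_right₀ hw0]
  obtain ⟨s, hs, hsc⟩ := hsc
  refine ⟨⟨⟨s * u, mul_mem hs hu, ?_⟩, h1, h2⟩, mem_even_iff_involute_eq.2 hx⟩
  rw [Units.coeHom_apply, Units.val_mul, hul, hsc, hc, Algebra.smul_def]

/-- Elements of the spin group of a nondegenerate form are products of an even number of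
vectors of norm `±1`, up to sign. -/
theorem exists_list_of_mem_spinGroup (hw : ∀ i, w i ≠ 0) (g : spinGroup (diagForm w)) :
    ∃ l : List (Fin n → ℝ), (∀ v ∈ l, diagForm w v = 1 ∨ diagForm w v = -1) ∧ Even l.length ∧
      ((g : CliffordAlgebra (diagForm w)) = (l.map (ι (diagForm w))).prod ∨
        (g : CliffordAlgebra (diagForm w)) = -(l.map (ι (diagForm w))).prod) := by
  obtain ⟨l, hl⟩ := exists_implements hw (vecAct g) (quadraticForm_vecAct g)
  have hinv : involute (g : CliffordAlgebra (diagForm w)) = g := spinGroup.involute_eq g.2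
  obtain ⟨c, hc⟩ := exists_smul_of_implements hw hl (x := g) fun v => by
    rw [hinv, ι_vecAct_mul]
  have hgg : star (g : CliffordAlgebra (diagForm w)) * g = 1 := spinGroup.coe_star_mul_self g
  obtain ⟨s, hs, hsl⟩ := star_list_prod_mul hl.1
  have hcs : c * c * s = 1 := by
    apply algebraMap_clifford_injective (Q := diagForm w)
    rw [map_mul, map_one, ← hsl, ← hgg, hc, CliffordAlgebra.star_smul, smul_mul_smul_comm, Algebra.smul_def]
  have hc1 : c = 1 ∨ c = -1 := by
    rcases hs with rfl | rfl
    · exact mul_self_eq_one_iff.1 (by linarith)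
    · nlinarith [mul_self_nonneg c]
  refine ⟨l, hl.1, ?_, ?_⟩
  · by_contra hodd
    rw [Nat.not_even_iff_odd] at hodd
    rw [hc, map_smul, involute_list_prod, hodd.neg_one_pow, neg_smul, one_smul, smul_neg,
      ← hc, neg_eq_iff_add_eq_zero, ← two_smul ℝ, smul_eq_zero_iff_right (two_ne_zero' ℝ)] at hinv
    rw [hinv, mul_zero] at hgg
    exact zero_ne_one hgg
  · rcases hc1 with rfl | rfl
    · left; rw [hc, one_smul]
    · right; rw [hc, neg_smul, one_smul]

end CartanDieudonne

end ExoticSpinor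
end

noncomputable section
namespace ExoticSpinor

/-! ### The exponential map of a real Clifford algebra -/

section Exponential

open CliffordAlgebra

section Norm

attribute [local instance] Matrix.linftyOpNormedRing Matrix.linftyOpNormedAlgebra

variable {V : Type*} [AddCommGroup V] [Module ℝ V] [Module.Finite ℝ V] (Q : QuadraticForm ℝ V)

/-- The left regular representation by matrices. -/
def leftRegular : CliffordAlgebra Q →ₐ[ℝ] Matrix (Fin (Module.finrank ℝ (CliffordAlgebra Q)))
    (Fin (Module.finrank ℝ (CliffordAlgebra Q))) ℝ :=
  Algebra.leftMulMatrix (Module.finBasis ℝ (CliffordAlgebra Q))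

/-- A submultiplicative norm on the Clifford algebra, inducing some topology. -/
abbrev regularNormedRing : NormedRing (CliffordAlgebra Q) :=
  NormedRing.induced (CliffordAlgebra Q) _ (leftRegular Q)
    (Algebra.leftMulMatrix_injective (Module.finBasis ℝ (CliffordAlgebra Q)))

theorem isModuleTopology_of_normedSpace (E : Type*) [NormedAddCommGroup E] [NormedSpace ℝ E]
    [FiniteDimensional ℝ E] : IsModuleTopology ℝ E :=
  IsModuleTopology.iso ((Module.finBasis ℝ E).equivFun.toContinuousLinearEquiv).symm

theorem topology_eq_regular :
    cliffordTopology Q = (regularNormedRing Q).toMetricSpace.toPseudoMetricSpace.toUniformSpace.toTopologicalSpace := by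
  let := regularNormedRing Q
  let : NormedSpace ℝ (CliffordAlgebra Q) :=
    { norm_smul_le := fun r x => by
        change ‖leftRegular Q (r • x)‖ ≤ ‖r‖ * ‖leftRegular Q x‖
        rw [map_smul]
        exact norm_smul_le _ _ }
  have := isModuleTopology_of_normedSpace (CliffordAlgebra Q)
  exact this.eq_moduleTopology'.symm

/-- The Clifford algebra as a normed ring whose topology is the canonical one. -/
abbrev cliffordNormedRing : NormedRing (CliffordAlgebra Q) :=
  { regularNormedRing Q with
    toMetricSpace := (regularNormedRing Q).toMetricSpace.replaceTopology (topology_eq_regular Q) }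

/-- The Clifford algebra as a normed algebra. -/
abbrev cliffordNormedAlgebra : @NormedAlgebra ℝ (CliffordAlgebra Q) _
    (cliffordNormedRing Q).toSeminormedRing :=
  letI := cliffordNormedRing Q
  { norm_smul_le := fun r x => by
      change ‖leftRegular Q (r • x)‖ ≤ ‖r‖ * ‖leftRegular Q x‖
      rw [map_smul]
      exact norm_smul_le _ _ }

end Norm

section Series

variable {V : Type*} [AddCommGroup V] [Module ℝ V] [Module.Finite ℝ V] {Q : QuadraticForm ℝ V}

instance cliffordT2 : T2Space (CliffordAlgebra Q) :=
  letI := cliffordNormedRing Q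
  inferInstanceAs (T2Space (CliffordAlgebra Q))

theorem continuous_clifford_linear {E : Type*} [AddCommGroup E] [Module ℝ E] [TopologicalSpace E]
    [ContinuousAdd E] [ContinuousSMul ℝ E] (f : CliffordAlgebra Q →ₗ[ℝ] E) : Continuous f :=
  IsModuleTopology.continuous_of_linearMap f

instance cliffordContinuousStar : ContinuousStar (CliffordAlgebra Q) where
  continuous_star := by
    have h : (star : CliffordAlgebra Q → CliffordAlgebra Q)
        = (reverse ∘ₗ involute.toLinearMap : CliffordAlgebra Q →ₗ[ℝ] CliffordAlgebra Q) := by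
      ext x; rfl
    rw [h]
    exact continuous_clifford_linear _

theorem clifford_hasSum_exp (X : CliffordAlgebra Q) :
    HasSum (fun n : ℕ => ((n.factorial : ℝ)⁻¹) • X ^ n) (NormedSpace.exp X) := by
  let := cliffordNormedRing Q
  let := cliffordNormedAlgebra Q
  let : NormedAlgebra ℚ (CliffordAlgebra Q) := NormedAlgebra.restrictScalars ℚ ℝ _
  have : CompleteSpace (CliffordAlgebra Q) := FiniteDimensional.complete ℝ _
  exact NormedSpace.exp_series_hasSum_exp' (𝕂 := ℝ) X

theorem clifford_exp_add {X Y : CliffordAlgebra Q} (h : Commute X Y) :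
    NormedSpace.exp (X + Y) = NormedSpace.exp X * NormedSpace.exp Y := by
  let := cliffordNormedRing Q
  let := cliffordNormedAlgebra Q
  let : NormedAlgebra ℚ (CliffordAlgebra Q) := NormedAlgebra.restrictScalars ℚ ℝ _
  have : CompleteSpace (CliffordAlgebra Q) := FiniteDimensional.complete ℝ _
  exact NormedSpace.exp_add_of_commute h

theorem clifford_exp_mul_exp_neg (X : CliffordAlgebra Q) :
    NormedSpace.exp X * NormedSpace.exp (-X) = 1 := by
  rw [← clifford_exp_add (Commute.neg_right (Commute.refl X)), add_neg_cancel,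
    NormedSpace.exp_zero]

theorem clifford_exp_neg_mul_exp (X : CliffordAlgebra Q) :
    NormedSpace.exp (-X) * NormedSpace.exp X = 1 := by
  simpa using clifford_exp_mul_exp_neg (-X)

/-- A continuous linear image of the exponential series. -/
theorem clifford_map_hasSum_exp {E : Type*} [AddCommGroup E] [Module ℝ E] [TopologicalSpace E]
    [ContinuousAdd E] [ContinuousSMul ℝ E] (f : CliffordAlgebra Q →ₗ[ℝ] E) (X : CliffordAlgebra Q) :
    HasSum (fun n : ℕ => ((n.factorial : ℝ)⁻¹) • f (X ^ n)) (f (NormedSpace.exp X)) := by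
  have h := (clifford_hasSum_exp X).map f (continuous_clifford_linear f)
  simpa [Function.comp_def] using h

theorem clifford_map_exp {B : Type*} [Ring B] [Algebra ℝ B] [TopologicalSpace B]
    [IsTopologicalRing B] [ContinuousSMul ℝ B] [T2Space B] (f : CliffordAlgebra Q →ₐ[ℝ] B)
    (X : CliffordAlgebra Q) : f (NormedSpace.exp X) = NormedSpace.exp (f X) := by
  rw [NormedSpace.exp_eq_tsum ℝ (𝔸 := B)]
  have h := clifford_map_hasSum_exp f.toLinearMap X
  simp only [AlgHom.toLinearMap_apply, map_pow] at h
  exact h.tsum_eq.symm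

theorem clifford_exp_of_sq_eq_zero {X : CliffordAlgebra Q} (h : X * X = 0) :
    NormedSpace.exp X = 1 + X := by
  refine (clifford_hasSum_exp X).unique ?_
  have h0 : ∀ n ∉ Finset.range 2, ((n.factorial : ℝ)⁻¹) • X ^ n = 0 := by
    intro n hn
    rw [Finset.mem_range, not_lt] at hn
    obtain ⟨k, rfl⟩ := Nat.exists_eq_add_of_le hn
    rw [pow_add, pow_two, h, zero_mul, smul_zero]
  have := hasSum_sum_of_ne_finset_zero (L := SummationFilter.unconditional ℕ) h0
  simpa [Finset.sum_range_succ] using this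

theorem clifford_hasDerivAt_exp (f : CliffordAlgebra Q →ₗ[ℝ] ℝ) (X : CliffordAlgebra Q) (t : ℝ) :
    HasDerivAt (fun s : ℝ => f (NormedSpace.exp (s • X))) (f (NormedSpace.exp (t • X) * X)) t := by
  let := cliffordNormedRing Q
  let := cliffordNormedAlgebra Q
  let : NormedAlgebra ℚ (CliffordAlgebra Q) := NormedAlgebra.restrictScalars ℚ ℝ _
  have : CompleteSpace (CliffordAlgebra Q) := FiniteDimensional.complete ℝ _
  exact (LinearMap.toContinuousLinearMap f).hasFDerivAt.comp_hasDerivAt t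
    (hasDerivAt_exp_smul_const X t)

theorem clifford_hasDerivAt_conj (f : CliffordAlgebra Q →ₗ[ℝ] ℝ) (X Y : CliffordAlgebra Q) :
    HasDerivAt (fun s : ℝ => f (NormedSpace.exp (s • X) * Y * NormedSpace.exp (s • -X)))
      (f (X * Y - Y * X)) 0 := by
  let := cliffordNormedRing Q
  let := cliffordNormedAlgebra Q
  let : NormedAlgebra ℚ (CliffordAlgebra Q) := NormedAlgebra.restrictScalars ℚ ℝ _
  have : CompleteSpace (CliffordAlgebra Q) := FiniteDimensional.complete ℝ _
  have h := ((hasDerivAt_exp_smul_const X (0 : ℝ)).mul_const Y).mul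
    (hasDerivAt_exp_smul_const (-X) (0 : ℝ))
  have h2 := (LinearMap.toContinuousLinearMap f).hasFDerivAt.comp_hasDerivAt (0 : ℝ) h
  have e : X * Y - Y * X = NormedSpace.exp ((0 : ℝ) • X) * X * Y * NormedSpace.exp ((0 : ℝ) • -X)
      + NormedSpace.exp ((0 : ℝ) • X) * Y * (NormedSpace.exp ((0 : ℝ) • -X) * -X) := by
    simp only [zero_smul, NormedSpace.exp_zero]
    noncomm_ring
  rw [e]
  exact h2

/-- If the commutator with `X` preserves vectors, so does conjugation by `exp X`. -/
theorem exp_mul_ι_of_lie {X : CliffordAlgebra Q}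
    (hX : ∀ v, ∃ u, X * ι Q v - ι Q v * X = ι Q u) (v : V) :
    ∃ u, NormedSpace.exp X * ι Q v = ι Q u * NormedSpace.exp X := by
  let := cliffordNormedRing Q
  let := cliffordNormedAlgebra Q
  let : NormedAlgebra ℚ (CliffordAlgebra Q) := NormedAlgebra.restrictScalars ℚ ℝ _
  have : CompleteSpace (CliffordAlgebra Q) := FiniteDimensional.complete ℝ _
  let E := CliffordAlgebra Q →L[ℝ] CliffordAlgebra Q
  have : CompleteSpace E := inferInstance
  let lX : E := LinearMap.toContinuousLinearMap (LinearMap.mulLeft ℝ X)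
  let rX : E := LinearMap.toContinuousLinearMap (LinearMap.mulRight ℝ X)
  have hl : ∀ z, lX z = X * z := fun z => rfl
  have hr : ∀ z, rX z = z * X := fun z => rfl
  have hser : ∀ (A : E) (z : CliffordAlgebra Q),
      HasSum (fun n : ℕ => ((n.factorial : ℝ)⁻¹) • (A ^ n) z) (NormedSpace.exp A z) := by
    intro A z
    let : NormedAlgebra ℚ E := NormedAlgebra.restrictScalars ℚ ℝ _
    have h := (NormedSpace.exp_series_hasSum_exp' (𝕂 := ℝ) A)
    exact h.map (ContinuousLinearMap.apply ℝ _ z) (ContinuousLinearMap.apply ℝ _ z).continuous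
  have hlz : ∀ z, NormedSpace.exp lX z = NormedSpace.exp X * z := by
    intro z
    refine (hser lX z).unique ?_
    have hp : ∀ n, (lX ^ n) z = X ^ n * z := by
      intro n
      induction n with
      | zero => simp
      | succ n ih => rw [pow_succ', mul_apply_eq_comp, ih, hl, pow_succ', mul_assoc]
    simp only [hp, ← smul_mul_assoc]
    exact (clifford_hasSum_exp X).mul_right z
  have hrz : ∀ z, NormedSpace.exp rX z = z * NormedSpace.exp X := by
    intro z
    refine (hser rX z).unique ?_
    have hp : ∀ n, (rX ^ n) z = z * X ^ n := by
      intro n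
      induction n with
      | zero => simp
      | succ n ih => rw [pow_succ', mul_apply_eq_comp, ih, hr, pow_succ, mul_assoc]
    simp only [hp, ← mul_smul_comm]
    exact (clifford_hasSum_exp X).mul_left z
  have hcomm : Commute rX (lX - rX) := by
    have h : Commute rX lX := by
      ext z
      simp only [mul_apply_eq_comp, hl, hr, mul_assoc]
    exact h.sub_right (Commute.refl rX)
  have hadd : NormedSpace.exp lX = NormedSpace.exp rX * NormedSpace.exp (lX - rX) := by
    let : NormedAlgebra ℚ E := NormedAlgebra.restrictScalars ℚ ℝ _
    rw [← NormedSpace.exp_add_of_commute hcomm, add_sub_cancel]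
  have hmem : NormedSpace.exp (lX - rX) (ι Q v) ∈ LinearMap.range (ι Q) := by
    have hcl : IsClosed (LinearMap.range (ι Q) : Set (CliffordAlgebra Q)) :=
      Submodule.closed_of_finiteDimensional _
    rw [← (hser (lX - rX) (ι Q v)).tsum_eq]
    refine tsum_mem hcl fun n => Submodule.smul_mem _ _ ?_
    induction n with
    | zero => exact ⟨v, by simp⟩
    | succ n ih =>
      obtain ⟨a, ha⟩ := ih
      obtain ⟨u, hu⟩ := hX a
      exact ⟨u, by rw [pow_succ', mul_apply_eq_comp, ← ha, ← hu]; rfl⟩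
  obtain ⟨u, hu⟩ := hmem
  exact ⟨u, by rw [← hlz, hadd, mul_apply_eq_comp, ← hu, hrz]⟩

end Series

end Exponential

end ExoticSpinor
end

noncomputable section
namespace ExoticSpinor

/-! ### The Lie algebra of the spin group -/

section SpinLieGroup

open CliffordAlgebra

section General

variable {V : Type*} [AddCommGroup V] [Module ℝ V] {Q : QuadraticForm ℝ V}

theorem lie_mem_spinLie (a b : V) : ⁅ι Q a, ι Q b⁆ ∈ spinLie Q :=
  Submodule.subset_span ⟨a, b, rfl⟩

theorem spinLie_induction {p : CliffordAlgebra Q → Prop} (h0 : p 0)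
    (hadd : ∀ x y, p x → p y → p (x + y)) (hsmul : ∀ (c : ℝ) x, p x → p (c • x))
    (hlie : ∀ a b, p ⁅ι Q a, ι Q b⁆) {X : CliffordAlgebra Q} (hX : X ∈ spinLie Q) : p X := by
  have hX' : X ∈ Submodule.span ℝ {X | ∃ a b : V, X = ⁅ι Q a, ι Q b⁆} := hX
  induction hX' using Submodule.span_induction with
  | mem x hx => obtain ⟨a, b, rfl⟩ := hx; exact hlie a b
  | zero => exact h0
  | add x y hx hy h1 h2 => exact hadd x y (h1 hx) (h2 hy)
  | smul c x hx h => exact hsmul c x (h hx)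

theorem involute_of_mem_spinLie {X : CliffordAlgebra Q} (hX : X ∈ spinLie Q) : involute X = X := by
  refine spinLie_induction (p := fun X => involute X = X) (map_zero _) (fun x y hx hy => by rw [map_add, hx, hy])
    (fun c x hx => by rw [map_smul, hx]) (fun a b => ?_) hX
  simp [LieRing.of_associative_ring_bracket]

theorem star_of_mem_spinLie {X : CliffordAlgebra Q} (hX : X ∈ spinLie Q) : star X = -X := by
  refine spinLie_induction (p := fun X => star X = -X) (by simp) (fun x y hx hy => by rw [star_add, hx, hy]; abel)
    (fun c x hx => by rw [CliffordAlgebra.star_smul, hx, smul_neg]) (fun a b => ?_) hX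
  rw [LieRing.of_associative_ring_bracket, star_sub, star_mul, star_mul, star_ι, star_ι]
  noncomm_ring

theorem lie_ι_of_mem_spinLie {X : CliffordAlgebra Q} (hX : X ∈ spinLie Q) :
    ∀ v, ∃ u, X * ι Q v - ι Q v * X = ι Q u := by
  refine spinLie_induction (p := fun X => ∀ v, ∃ u, X * ι Q v - ι Q v * X = ι Q u)
    (fun v => ⟨0, by simp⟩) ?_ ?_ ?_ hX
  · intro x y hx hy v
    obtain ⟨a, ha⟩ := hx v
    obtain ⟨b, hb⟩ := hy v
    exact ⟨a + b, by rw [map_add, ← ha, ← hb]; noncomm_ring⟩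
  · intro c x hx v
    obtain ⟨a, ha⟩ := hx v
    exact ⟨c • a, by rw [map_smul, ← ha, smul_sub, smul_mul_assoc, mul_smul_comm]⟩
  · intro a b v
    exact lie_lie_ι Q a b v

theorem lie_lie_ι_eq (a b c : V) :
    ⁅⁅ι Q a, ι Q b⁆, ι Q c⁆
      = ι Q ((2 * QuadraticMap.polar Q b c) • a - (2 * QuadraticMap.polar Q a c) • b) := by
  have h (x y : V) : ι Q x * ι Q y = algebraMap ℝ _ (QuadraticMap.polar Q x y) - ι Q y * ι Q x := by
    rw [← ι_mul_ι_add_swap]; abel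
  have e3 : ι Q a * ι Q b * ι Q c = QuadraticMap.polar Q b c • ι Q a
      - QuadraticMap.polar Q a c • ι Q b + ι Q c * ι Q a * ι Q b := by
    rw [mul_assoc, h b c, mul_sub, ← mul_assoc, h a c, sub_mul, ← Algebra.commutes,
      Algebra.smul_def, Algebra.smul_def]
    abel
  have e4 : ι Q b * ι Q a * ι Q c = QuadraticMap.polar Q a c • ι Q b
      - QuadraticMap.polar Q b c • ι Q a + ι Q c * ι Q b * ι Q a := by
    rw [mul_assoc, h a c, mul_sub, ← mul_assoc, h b c, sub_mul, ← Algebra.commutes,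
      Algebra.smul_def, Algebra.smul_def]
    abel
  rw [map_sub, map_smul, map_smul]
  simp only [LieRing.of_associative_ring_bracket, sub_mul, mul_sub, e3, e4, two_mul, add_smul,
    ← mul_assoc]
  abel

theorem involute_exp [Module.Finite ℝ V] {X : CliffordAlgebra Q} (h : involute X = X) :
    involute (NormedSpace.exp X) = NormedSpace.exp X := by
  rw [clifford_map_exp, h]

theorem star_exp_of_star [Module.Finite ℝ V] {X : CliffordAlgebra Q} (h : star X = -X) :
    star (NormedSpace.exp X) = NormedSpace.exp (-X) := by
  rw [NormedSpace.star_exp, h]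

end General

variable {n : ℕ} {w : Fin n → ℝ}

/-- A skew element of the even subalgebra which preserves vectors is in the Lie algebra of the
spin group. -/
theorem mem_spinLie_of (hw : ∀ i, w i ≠ 0) {X : CliffordAlgebra (diagForm w)}
    (h1 : involute X = X) (h2 : star X = -X)
    (h3 : ∀ v, ∃ u, X * ι (diagForm w) v - ι (diagForm w) v * X = ι (diagForm w) u) :
    X ∈ spinLie (diagForm w) := by
  choose B hB using h3
  have hskew : ∀ u v, QuadraticMap.polar (diagForm w) (B u) v
      = -QuadraticMap.polar (diagForm w) u (B v) := by
    intro u v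
    apply algebraMap_clifford_injective (Q := diagForm w)
    rw [map_neg, eq_neg_iff_add_eq_zero, ← ι_mul_ι_add_swap, ← ι_mul_ι_add_swap, ← hB, ← hB]
    have h := ι_mul_ι_add_swap (Q := diagForm w) u v
    have hc := Algebra.commutes (QuadraticMap.polar (diagForm w) u v) X
    rw [← h] at hc
    have : (X * ι (diagForm w) u - ι (diagForm w) u * X) * ι (diagForm w) v
        + ι (diagForm w) v * (X * ι (diagForm w) u - ι (diagForm w) u * X)
        + (ι (diagForm w) u * (X * ι (diagForm w) v - ι (diagForm w) v * X)
        + (X * ι (diagForm w) v - ι (diagForm w) v * X) * ι (diagForm w) u)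
        = X * (ι (diagForm w) u * ι (diagForm w) v + ι (diagForm w) v * ι (diagForm w) u)
        - (ι (diagForm w) u * ι (diagForm w) v + ι (diagForm w) v * ι (diagForm w) u) * X := by
      noncomm_ring
    rw [this, hc, sub_self]
  let Y : CliffordAlgebra (diagForm w) :=
    ∑ i, (8 * w i)⁻¹ • ⁅ι (diagForm w) (B (Pi.single i 1)), ι (diagForm w) (Pi.single i 1)⁆
  have hY : Y ∈ spinLie (diagForm w) :=
    sum_mem fun i _ => (spinLie (diagForm w)).smul_mem _ (lie_mem_spinLie _ _)
  have hBsum : ∀ c, ι (diagForm w) (B c) = ∑ i, c i • ι (diagForm w) (B (Pi.single i 1)) := by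
    intro c
    simp only [← hB]
    rw [ι_eq_sum_gen]
    simp only [gen, Finset.mul_sum, Finset.sum_mul, smul_sub, Finset.sum_sub_distrib,
      mul_smul_comm, smul_mul_assoc]
  have hYB : ∀ c, Y * ι (diagForm w) c - ι (diagForm w) c * Y = ι (diagForm w) (B c) := by
    intro c
    have : Y * ι (diagForm w) c - ι (diagForm w) c * Y = ⁅Y, ι (diagForm w) c⁆ := rfl
    rw [this]
    simp only [Y, sum_lie, smul_lie, lie_lie_ι_eq]
    have e : ∀ i, (8 * w i)⁻¹ • ι (diagForm w)
        ((2 * QuadraticMap.polar (diagForm w) (Pi.single i 1) c) • B (Pi.single i 1)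
          - (2 * QuadraticMap.polar (diagForm w) (B (Pi.single i 1)) c) • Pi.single i 1)
        = (2⁻¹ : ℝ) • (c i • ι (diagForm w) (B (Pi.single i 1))) + (2⁻¹ : ℝ) • (B c i • gen w i) := by
      intro i
      rw [hskew, polar_single, polar_single, map_sub, map_smul, map_smul, smul_sub, smul_smul,
        smul_smul, smul_smul, smul_smul, gen, sub_eq_add_neg, ← neg_smul]
      have := hw i
      congr 2 <;> field_simp <;> ring
    simp only [e, Finset.sum_add_distrib, ← Finset.smul_sum]
    rw [← hBsum, ← ι_eq_sum_gen, ← add_smul]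
    norm_num
  obtain ⟨r, hr⟩ := exists_algebraMap_of_twisted_commute hw (x := X - Y) fun v => by
    have h := (hB v).trans (hYB v).symm
    rw [map_sub, h1, involute_of_mem_spinLie hY, mul_sub, sub_mul]
    have h' : X * ι (diagForm w) v - Y * ι (diagForm w) v
        = ι (diagForm w) v * X - ι (diagForm w) v * Y := by
      rw [sub_eq_sub_iff_sub_eq_sub] at h
      exact h
    exact h'.symm
  have hr0 : r = -r := by
    apply algebraMap_clifford_injective (Q := diagForm w)
    rw [map_neg, ← hr]
    have := congrArg star hr
    rw [star_sub, h2, star_of_mem_spinLie hY, star_algebraMap, ← hr] at this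
    rw [neg_sub, ← this, neg_sub_neg]
  have hr1 : r = 0 := by linarith
  rw [hr1, map_zero, sub_eq_zero] at hr
  rw [hr]
  exact hY

theorem eq_of_lie_ι_eq (hw : ∀ i, w i ≠ 0) {X Y : CliffordAlgebra (diagForm w)}
    (hX : X ∈ spinLie (diagForm w)) (hY : Y ∈ spinLie (diagForm w))
    (h : ∀ i, ⁅X, gen w i⁆ = ⁅Y, gen w i⁆) : X = Y := by
  have hD : X - Y ∈ spinLie (diagForm w) := sub_mem hX hY
  obtain ⟨r, hr⟩ := exists_algebraMap_of_dContr (w := w) (x := X - Y) fun i => by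
    have h1 := gen_mul_sub i (X - Y)
    have h2 : gen w i * (X - Y) - (X - Y) * gen w i = 0 := by
      have h3 := h i
      rw [LieRing.of_associative_ring_bracket, LieRing.of_associative_ring_bracket] at h3
      have : gen w i * (X - Y) - (X - Y) * gen w i
          = (Y * gen w i - gen w i * Y) - (X * gen w i - gen w i * X) := by noncomm_ring
      rw [this, h3, sub_self]
    rw [involute_of_mem_spinLie hD, h2, eq_comm, smul_eq_zero] at h1
    exact h1.resolve_left (mul_ne_zero two_ne_zero (hw i))
  have h3 := star_of_mem_spinLie hD
  rw [hr, star_algebraMap, ← map_neg] at h3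
  have h4 : r = 0 := by linarith [algebraMap_clifford_injective h3]
  rw [h4, map_zero, sub_eq_zero] at hr
  exact hr

theorem exp_mem_spinGroup [NeZero n] (hw : ∀ i, w i ≠ 0) {X : CliffordAlgebra (diagForm w)}
    (hX : X ∈ spinLie (diagForm w)) : NormedSpace.exp X ∈ spinGroup (diagForm w) := by
  have hs := star_exp_of_star (star_of_mem_spinLie hX)
  refine mem_spinGroup_of hw (involute_exp (involute_of_mem_spinLie hX)) ?_ ?_
    (exp_mul_ι_of_lie (lie_ι_of_mem_spinLie hX))
  · rw [hs, clifford_exp_neg_mul_exp]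
  · rw [hs, clifford_exp_mul_exp_neg]

theorem clifford_eq_of_functional {V : Type*} [AddCommGroup V] [Module ℝ V]
    {Q : QuadraticForm ℝ V} {x y : CliffordAlgebra Q}
    (h : ∀ f : CliffordAlgebra Q →ₗ[ℝ] ℝ, f x = f y) : x = y := by
  rw [← sub_eq_zero, ← Module.forall_dual_apply_eq_zero_iff ℝ]
  intro f
  rw [map_sub, h f, sub_self]

/-- The Lie algebra of the spin group consists of the generators of its one-parameter subgroups. -/
theorem mem_spinLie_of_exp (hw : ∀ i, w i ≠ 0) {X : CliffordAlgebra (diagForm w)}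
    (hX : ∀ t : ℝ, NormedSpace.exp (t • X) ∈ spinGroup (diagForm w)) :
    X ∈ spinLie (diagForm w) := by
  have hder : ∀ (F G : CliffordAlgebra (diagForm w) →ₗ[ℝ] ℝ) (Y : CliffordAlgebra (diagForm w)),
      (∀ t : ℝ, F (NormedSpace.exp (t • X)) = G (NormedSpace.exp (t • Y))) → F X = G Y := by
    intro F G Y h
    have d1 := clifford_hasDerivAt_exp F X 0
    have d2 := clifford_hasDerivAt_exp G Y 0
    simp only [h] at d1
    simpa using d1.unique d2
  have hstar : ∀ t : ℝ, star (NormedSpace.exp (t • X)) = NormedSpace.exp (t • -X) := by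
    intro t
    have h1 := spinGroup.star_mul_self_of_mem (hX t)
    have h2 := clifford_exp_mul_exp_neg (t • X)
    rw [← smul_neg] at h2
    calc star (NormedSpace.exp (t • X))
        = star (NormedSpace.exp (t • X)) * (NormedSpace.exp (t • X) * NormedSpace.exp (t • -X)) := by
          rw [h2, mul_one]
      _ = _ := by rw [← mul_assoc, h1, one_mul]
  refine mem_spinLie_of hw (clifford_eq_of_functional fun f => ?_)
    (clifford_eq_of_functional fun f => ?_) fun v => ?_
  · refine hder (f ∘ₗ involute.toLinearMap) f X fun t => ?_
    exact congrArg f (spinGroup.involute_eq (hX t))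
  · refine hder (f ∘ₗ (reverse ∘ₗ involute.toLinearMap)) f (-X) fun t => ?_
    exact congrArg f (hstar t)
  · refine ⟨vecPart (X * ι (diagForm w) v - ι (diagForm w) v * X),
      clifford_eq_of_functional fun f => ?_⟩
    have d1 := clifford_hasDerivAt_conj f X (ι (diagForm w) v)
    have d2 := clifford_hasDerivAt_conj (f ∘ₗ ι (diagForm w) ∘ₗ vecPart) X (ι (diagForm w) v)
    have e : ∀ t : ℝ, f (NormedSpace.exp (t • X) * ι (diagForm w) v * NormedSpace.exp (t • -X))
        = (f ∘ₗ ι (diagForm w) ∘ₗ vecPart)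
          (NormedSpace.exp (t • X) * ι (diagForm w) v * NormedSpace.exp (t • -X)) := by
      intro t
      rw [← hstar]
      have h := ι_vecAct (⟨_, hX t⟩ : spinGroup (diagForm w)) v
      rw [coe_inv_spinGroup] at h
      simp only at h
      rw [← h]
      simp [vecPart_ι]
    simp only [e] at d1
    exact d1.unique d2

end SpinLieGroup

end ExoticSpinor
end

noncomputable section
namespace ExoticSpinor

/-! ### Spheres -/

section Sphere

variable {E : Type*} [NormedAddCommGroup E] [InnerProductSpace ℝ E]

theorem simplyConnectedSpace_of_homeomorph {X Y : Type*} [TopologicalSpace X] [TopologicalSpace Y]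
    (h : X ≃ₜ Y) (hY : SimplyConnectedSpace Y) : SimplyConnectedSpace X :=
  h.toHomotopyEquiv.simplyConnectedSpace

theorem simplyConnectedSpace_sphere_compl {v : E} (hv : ‖v‖ = 1) :
    SimplyConnectedSpace ({⟨v, by simp [hv]⟩}ᶜ : Set (Metric.sphere (0 : E) 1)) := by
  have h1 := (stereographic hv).toHomeomorphSourceTarget
  have h2 := (Homeomorph.setCongr (stereographic_source hv)).symm.trans
    (h1.trans ((Homeomorph.setCongr (stereographic_target hv)).trans
      (Homeomorph.Set.univ _)))
  exact simplyConnectedSpace_of_homeomorph h2 (SimplyConnectedSpace.ofContractible _)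

theorem isPathConnected_sphere_compl_pair [FiniteDimensional ℝ E] (hE : 2 < Module.finrank ℝ E)
    {v : E} (hv : ‖v‖ = 1) :
    IsPathConnected ({⟨v, by simp [hv]⟩}ᶜ ∩ {⟨-v, by simp [hv]⟩}ᶜ :
      Set (Metric.sphere (0 : E) 1)) := by
  have hv0 : v ≠ 0 := by rintro rfl; simp at hv
  have hc : IsPathConnected ((Submodule.span ℝ {v} : Submodule ℝ E) : Set E)ᶜ := by
    refine isPathConnected_compl_of_one_lt_codim ?_
    rw [← Module.finrank_eq_rank]
    have h1 := Submodule.finrank_quotient_add_finrank (Submodule.span ℝ {v})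
    rw [finrank_span_singleton hv0] at h1
    exact_mod_cast (by omega : 1 < Module.finrank ℝ (E ⧸ Submodule.span ℝ {v}))
  have hne : ∀ x ∈ ((Submodule.span ℝ {v} : Submodule ℝ E) : Set E)ᶜ, x ≠ 0 := by
    rintro x hx rfl; exact hx (zero_mem _)
  let f : E → E := fun x => ‖x‖⁻¹ • x
  have hf : ContinuousOn f ((Submodule.span ℝ {v} : Submodule ℝ E) : Set E)ᶜ :=
    (continuousOn_id.norm.inv₀ fun x hx => norm_ne_zero_iff.2 (hne x hx)).smul continuousOn_id
  have himg := hc.image' hf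
  have heq : f '' ((Submodule.span ℝ {v} : Submodule ℝ E) : Set E)ᶜ
      = Subtype.val '' ({⟨v, by simp [hv]⟩}ᶜ ∩ {⟨-v, by simp [hv]⟩}ᶜ :
      Set (Metric.sphere (0 : E) 1)) := by
    ext y
    simp only [Set.mem_image]
    constructor
    · rintro ⟨x, hx, rfl⟩
      have hx0 : ‖x‖ ≠ 0 := norm_ne_zero_iff.2 (hne x hx)
      have hx' : ∀ c : ℝ, f x = c • v → False := fun c hcv => hx (by
        have : x = (‖x‖ * c) • v := by rw [mul_smul, ← hcv, smul_smul, mul_inv_cancel₀ hx0, one_smul]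
        rw [this]; exact Submodule.smul_mem _ _ (Submodule.mem_span_singleton_self v))
      refine ⟨⟨f x, by simp [f, norm_smul, hx0]⟩, ⟨fun h => ?_, fun h => ?_⟩, rfl⟩
      · exact hx' 1 (by rw [one_smul]; exact congrArg Subtype.val h)
      · exact hx' (-1) (by rw [neg_one_smul]; exact congrArg Subtype.val h)
    · rintro ⟨⟨x, hx⟩, ⟨h1, h2⟩, rfl⟩
      have hn : ‖x‖ = 1 := by simpa using hx
      refine ⟨x, fun hxs => ?_, by simp [f, hn]⟩
      obtain ⟨c, rfl⟩ := Submodule.mem_span_singleton.1 hxs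
      rw [norm_smul, hv, mul_one, Real.norm_eq_abs] at hn
      rcases (abs_eq zero_le_one).1 hn with rfl | rfl
      · exact h1 (by simp)
      · exact h2 (by simp)
  rw [heq] at himg
  exact (Topology.IsInducing.subtypeVal.isPathConnected_iff).2 himg

theorem simplyConnectedSpace_sphere [FiniteDimensional ℝ E] (hE : 2 < Module.finrank ℝ E) :
    SimplyConnectedSpace (Metric.sphere (0 : E) 1) := by
  haveI : Nontrivial E := Module.nontrivial_of_finrank_pos (R := ℝ) (by omega)
  obtain ⟨v, hv⟩ := exists_norm_eq E (zero_le_one (α := ℝ))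
  have hv' : ‖-v‖ = 1 := by rw [norm_neg, hv]
  refine simplyConnectedSpace_of_union (isOpen_compl_singleton (x := ⟨v, by simp [hv]⟩))
    (isOpen_compl_singleton (x := ⟨-v, by simp [hv]⟩)) (fun x => ?_)
    (simplyConnectedSpace_sphere_compl hv) (simplyConnectedSpace_sphere_compl hv')
    (isPathConnected_sphere_compl_pair hE hv)
  by_contra! h
  have h1 : x = ⟨v, by simp [hv]⟩ := by simpa using h.1
  have h2 : x = ⟨-v, by simp [hv]⟩ := by simpa using h.2
  have h3 : v = -v := congrArg Subtype.val (h1.symm.trans h2)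
  have h4 : v = 0 := by
    have h5 : (2 : ℝ) • v = 0 := by rw [two_smul]; nth_rewrite 2 [h3]; exact add_neg_cancel v
    exact (smul_eq_zero.1 h5).resolve_left two_ne_zero
  rw [h4] at hv; simp at hv

end Sphere

instance spinGroupTopologicalGroup {V : Type*} [AddCommGroup V] [Module ℝ V] [Module.Finite ℝ V]
    (Q : QuadraticForm ℝ V) : IsTopologicalGroup (spinGroup Q) where
  continuous_inv := by
    refine Continuous.subtype_mk ?_ _
    exact continuous_star.comp continuous_subtype_val

theorem continuous_vecAct {V : Type*} [AddCommGroup V] [Module ℝ V] [Module.Finite ℝ V]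
    [TopologicalSpace V] [IsTopologicalAddGroup V] [ContinuousSMul ℝ V]
    {Q : QuadraticForm ℝ V} (v : V) : Continuous fun g : spinGroup Q => vecAct g v := by
  have h : Continuous fun g : spinGroup Q =>
      (g : CliffordAlgebra Q) * CliffordAlgebra.ι Q v * ((g⁻¹ : spinGroup Q) : CliffordAlgebra Q) :=
    (continuous_subtype_val.mul continuous_const).mul (continuous_subtype_val.comp continuous_inv)
  exact (continuous_clifford_linear (vecPart (Q := Q))).comp h

/-! ### The fibrations `Spin(k) → Spin(k + 1) → Sᵏ` -/

section SpinTower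

open CliffordAlgebra

variable {n : ℕ}

/-- The weights of the negative definite form. -/
abbrev negW (n : ℕ) : Fin n → ℝ := fun _ => -1

theorem negW_ne (i : Fin n) : negW n i ≠ 0 := by simp [negW]

/-- The subgroup of the spin group of the negative definite form on `ℝⁿ` which commutes with all
but the first `k` generators. -/
def subSpin (n k : ℕ) : Subgroup (spinGroup (diagForm (negW n))) where
  carrier := {g | ∀ i : Fin n, k ≤ i.val → vecAct g (Pi.single i 1) = Pi.single i 1}
  one_mem' := fun i _ => by rw [vecAct_one]; rfl
  mul_mem' := fun {a b} ha hb i hi => by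
    change vecAct (a * b) _ = _
    rw [vecAct_mul_apply, hb i hi, ha i hi]
  inv_mem' := fun {a} ha i hi => by
    change vecAct a⁻¹ _ = _
    nth_rewrite 1 [← ha i hi]
    rw [vecAct_inv_vecAct]

theorem diagForm_negW (x : Fin n → ℝ) : diagForm (negW n) x = -∑ i, x i ^ 2 := by
  rw [diagForm_apply, ← Finset.sum_neg_distrib]
  exact Finset.sum_congr rfl fun i _ => by simp only [negW]; ring

theorem ι_mul_ι_mul_ι {V : Type*} [AddCommGroup V] [Module ℝ V] {Q : QuadraticForm ℝ V} {z u : V}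
    (hz : Q z ≠ 0) (hu : Q u ≠ 0) (v : V) :
    ι Q z * ι Q u * ι Q v = ι Q (hyperRefl Q z (hyperRefl Q u v)) * (ι Q z * ι Q u) := by
  have h1 : ι Q u * ι Q v = -(ι Q (hyperRefl Q u v) * ι Q u) := by
    rw [hyperRefl_mul hu, neg_neg]
  have h2 : ι Q z * ι Q (hyperRefl Q u v)
      = -(ι Q (hyperRefl Q z (hyperRefl Q u v)) * ι Q z) := by
    rw [hyperRefl_mul hz, neg_neg]
  rw [mul_assoc, h1, mul_neg, ← mul_assoc, h2, neg_mul, neg_neg, mul_assoc]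

/-- A normalized product of two vectors. -/
def rotor (z u : Fin n → ℝ) : CliffordAlgebra (diagForm (negW n)) :=
  (-(Real.sqrt (-diagForm (negW n) z))⁻¹) • (ι _ z * ι _ u)

theorem rotor_mem [NeZero n] {z u : Fin n → ℝ} (hz : diagForm (negW n) z ≠ 0)
    (hu : diagForm (negW n) u = -1) : rotor z u ∈ spinGroup (diagForm (negW n)) := by
  have hneg : 0 < -diagForm (negW n) z := by
    have h1 : diagForm (negW n) z ≤ 0 := by
      rw [diagForm_negW, neg_nonpos]; exact Finset.sum_nonneg fun i _ => sq_nonneg _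
    have := lt_of_le_of_ne h1 hz
    linarith
  rw [rotor]
  generalize hQ : diagForm (negW n) z = q at *
  have hs : Real.sqrt (-q) * Real.sqrt (-q) = -q := Real.mul_self_sqrt hneg.le
  have hs0 : Real.sqrt (-q) ≠ 0 := (Real.sqrt_pos.2 hneg).ne'
  have hsq : (-(Real.sqrt (-q))⁻¹) * (-(Real.sqrt (-q))⁻¹) * (q * -1) = 1 := by
    field_simp; rw [pow_two, hs]
  generalize -(Real.sqrt (-q))⁻¹ = c at *
  have hstar : star (c • (ι (diagForm (negW n)) z * ι (diagForm (negW n)) u))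
      = c • (ι (diagForm (negW n)) u * ι (diagForm (negW n)) z) := by
    rw [CliffordAlgebra.star_smul, star_mul, star_ι, star_ι, neg_mul_neg]
  have hu0 : diagForm (negW n) u ≠ 0 := by rw [hu]; norm_num
  refine mem_spinGroup_of negW_ne ?_ ?_ ?_ fun v =>
    ⟨hyperRefl (diagForm (negW n)) z (hyperRefl (diagForm (negW n)) u v), ?_⟩
  · rw [map_smul, map_mul, involute_ι, involute_ι, neg_mul_neg]
  · rw [hstar, smul_mul_smul_comm, mul_assoc, ← mul_assoc (ι _ z), ι_sq_scalar,
      Algebra.left_comm, ι_sq_scalar, hu, hQ, ← map_mul, Algebra.smul_def, ← map_mul, hsq, map_one]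
  · rw [hstar, smul_mul_smul_comm, mul_assoc, ← mul_assoc (ι _ u), ι_sq_scalar,
      Algebra.left_comm, ι_sq_scalar, hu, hQ, ← map_mul, Algebra.smul_def, ← map_mul,
      mul_comm (-1 : ℝ), hsq, map_one]
  · rw [smul_mul_assoc, mul_smul_comm, ι_mul_ι_mul_ι (by rw [hQ]; exact hz) hu0]

theorem vecAct_of_coe_eq {V : Type*} [AddCommGroup V] [Module ℝ V] {Q : QuadraticForm ℝ V}
    {z u : V} (hz : Q z ≠ 0) (hu : Q u ≠ 0) {c : ℝ} {g : spinGroup Q}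
    (hg : (g : CliffordAlgebra Q) = c • (ι Q z * ι Q u)) (v : V) :
    vecAct g v = hyperRefl Q z (hyperRefl Q u v) := by
  apply vecAct_eq_of_mul
  rw [hg, smul_mul_assoc, mul_smul_comm, ι_mul_ι_mul_ι hz hu]

section SubSpin

variable {k : ℕ} (hk : k < n)

/-- The vector `e_k + ∑_{i<k} yᵢ eᵢ`. -/
def liftVec (y : Fin k → ℝ) : Fin n → ℝ := fun i =>
  if h : i.val < k then y ⟨i.val, h⟩ else if i.val = k then 1 else 0

theorem liftVec_self (y : Fin k → ℝ) : liftVec y ⟨k, hk⟩ = 1 := by simp [liftVec]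

theorem liftVec_gt (y : Fin k → ℝ) {i : Fin n} (hi : k < i.val) : liftVec y i = 0 := by
  simp [liftVec, hi.ne', hi.not_gt]

theorem sum_liftVec_pos (hk : k < n) (y : Fin k → ℝ) : 0 < ∑ i : Fin n, (liftVec y i : ℝ) ^ 2 := by
  refine Finset.sum_pos' (fun i _ => sq_nonneg _) ⟨⟨k, hk⟩, Finset.mem_univ _, ?_⟩
  rw [liftVec_self hk]; norm_num

theorem diagForm_liftVec_ne (hk : k < n) (y : Fin k → ℝ) : diagForm (negW n) (liftVec y) ≠ 0 := by
  rw [diagForm_negW, neg_ne_zero]; exact (sum_liftVec_pos hk y).ne'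

theorem continuous_liftVec : Continuous (liftVec : (Fin k → ℝ) → (Fin n → ℝ)) := by
  refine continuous_pi fun i => ?_
  unfold liftVec
  split_ifs
  · exact continuous_apply _
  · exact continuous_const
  · exact continuous_const

variable [NeZero n]

/-- The element of the spin group which rotates `e_k` towards `liftVec y`, by twice their angle. -/
def liftRotor (y : Fin k → ℝ) : spinGroup (diagForm (negW n)) :=
  ⟨rotor (liftVec y) (Pi.single ⟨k, hk⟩ 1), rotor_mem (diagForm_liftVec_ne hk y)
    (by rw [diagForm_single])⟩

theorem vecAct_liftRotor (y : Fin k → ℝ) (v : Fin n → ℝ) :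
    vecAct (liftRotor hk y) v = hyperRefl (diagForm (negW n)) (liftVec y)
      (hyperRefl (diagForm (negW n)) (Pi.single ⟨k, hk⟩ 1) v) :=
  vecAct_of_coe_eq (diagForm_liftVec_ne hk y) (by rw [diagForm_single]; norm_num) rfl v

theorem liftRotor_mem (y : Fin k → ℝ) : liftRotor hk y ∈ subSpin n (k + 1) := by
  intro i hi
  have h1 : i ≠ ⟨k, hk⟩ := by rintro rfl; simp at hi
  have h2 : hyperRefl (diagForm (negW n)) (Pi.single ⟨k, hk⟩ 1) (Pi.single i 1) = Pi.single i 1 :=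
    hyperRefl_of_polar_eq_zero (by rw [polar_single]; simp [h1.symm])
  rw [vecAct_liftRotor, h2]
  refine hyperRefl_of_polar_eq_zero ?_
  rw [QuadraticMap.polar_comm, polar_single, liftVec_gt y (by omega)]; simp

theorem vecAct_liftRotor_self (y : Fin k → ℝ) :
    vecAct (liftRotor hk y) (Pi.single ⟨k, hk⟩ 1)
      = -Pi.single ⟨k, hk⟩ 1 + (2 * (∑ i : Fin n, (liftVec y i : ℝ) ^ 2)⁻¹) • (liftVec y : Fin n → ℝ) := by
  have h0 : hyperRefl (diagForm (negW n)) (Pi.single ⟨k, hk⟩ 1) (Pi.single ⟨k, hk⟩ 1)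
      = -Pi.single ⟨k, hk⟩ 1 := by
    rw [hyperRefl_apply, polar_single, diagForm_single]
    simp only [negW, Pi.single_eq_same]
    module
  rw [vecAct_liftRotor, h0, map_neg, hyperRefl_apply, QuadraticMap.polar_comm, polar_single,
    liftVec_self hk, diagForm_negW, inv_neg]
  simp only [negW]
  module

theorem continuous_liftRotor : Continuous (liftRotor hk) := by
  refine Continuous.subtype_mk ?_ _
  have h1 : Continuous fun y : Fin k → ℝ => diagForm (negW n) (liftVec y) := by
    simp only [diagForm_negW]
    exact (continuous_finset_sum _ fun i _ =>
      ((continuous_apply i).comp continuous_liftVec).pow 2).neg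
  have h2 : Continuous fun y : Fin k → ℝ => -(Real.sqrt (-diagForm (negW n) (liftVec y)))⁻¹ := by
    refine ((Real.continuous_sqrt.comp h1.neg).inv₀ fun y => ?_).neg
    change Real.sqrt (-diagForm (negW n) (liftVec y)) ≠ 0
    rw [Real.sqrt_ne_zero', diagForm_negW, neg_neg]
    exact sum_liftVec_pos hk y
  have h3 : Continuous fun y : Fin k → ℝ => ι (diagForm (negW n)) (liftVec y) := by
    simp only [ι_eq_sum_gen]
    refine continuous_finset_sum _ fun i _ => ?_
    have h4 : Continuous fun y : Fin k → ℝ => (liftVec y : Fin n → ℝ) i :=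
      (continuous_pi_iff.1 continuous_liftVec) i
    exact h4.smul (continuous_const (y := gen (negW n) i))
  have h5 : Continuous fun _ : Fin k → ℝ => ι (diagForm (negW n)) (Pi.single ⟨k, hk⟩ 1) :=
    continuous_const
  exact h2.smul (h3.mul h5)

theorem liftRotor_zero : liftRotor hk (0 : Fin k → ℝ) = 1 := by
  have h : (liftVec (0 : Fin k → ℝ) : Fin n → ℝ) = Pi.single ⟨k, hk⟩ 1 := by
    ext i
    rcases eq_or_ne i ⟨k, hk⟩ with rfl | hi
    · simp [liftVec]
    · have : i.val ≠ k := fun h => hi (Fin.ext h)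
      simp [liftVec, hi, this]
  apply Subtype.ext
  change rotor _ _ = 1
  rw [rotor, h, ι_sq_scalar, diagForm_single]
  simp [negW]

/-- The image of `e_k`, read off as a function on the subgroup. -/
theorem vecAct_gt {g : spinGroup (diagForm (negW n))} (hg : g ∈ subSpin n (k + 1)) {i : Fin n}
    (hi : k < i.val) : vecAct g (Pi.single ⟨k, hk⟩ 1) i = 0 := by
  have h := polar_vecAct g (Pi.single i 1) (Pi.single ⟨k, hk⟩ 1)
  have hik : i ≠ ⟨k, hk⟩ := by rintro rfl; simp at hi
  rw [hg i hi, polar_single, polar_single] at h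
  simpa [hik] using h

theorem sum_vecAct_sq (g : spinGroup (diagForm (negW n))) :
    ∑ i, vecAct g (Pi.single ⟨k, hk⟩ 1) i ^ 2 = 1 := by
  have h := quadraticForm_vecAct g (Pi.single ⟨k, hk⟩ 1)
  rw [diagForm_single, diagForm_negW] at h
  simpa using h

/-- Stereographic coordinates of the image of `e_k`. -/
def stereo (g : spinGroup (diagForm (negW n))) : Fin k → ℝ := fun i =>
  vecAct g (Pi.single ⟨k, hk⟩ 1) ⟨i, i.2.trans hk⟩ / (1 + vecAct g (Pi.single ⟨k, hk⟩ 1) ⟨k, hk⟩)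

theorem vecAct_liftRotor_stereo {g : spinGroup (diagForm (negW n))} (hg : g ∈ subSpin n (k + 1))
    (h : -1 < vecAct g (Pi.single ⟨k, hk⟩ 1) ⟨k, hk⟩) :
    vecAct (liftRotor hk (stereo hk g)) (Pi.single ⟨k, hk⟩ 1)
      = vecAct g (Pi.single ⟨k, hk⟩ 1) := by
  have hs := sum_vecAct_sq hk g
  have hgt := fun i => vecAct_gt hk hg (i := i)
  rw [vecAct_liftRotor_self]
  unfold stereo
  generalize vecAct g (Pi.single ⟨k, hk⟩ 1) = x at *
  have hx : 1 + x ⟨k, hk⟩ ≠ 0 := by linarith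
  have hl : (liftVec fun i : Fin k => x ⟨i, i.2.trans hk⟩ / (1 + x ⟨k, hk⟩) : Fin n → ℝ)
      = (1 + x ⟨k, hk⟩)⁻¹ • (Pi.single ⟨k, hk⟩ 1 + x) := by
    ext i
    rcases lt_trichotomy i.val k with hi | hi | hi
    · have : i ≠ ⟨k, hk⟩ := by rintro rfl; simp at hi
      simp [liftVec, hi, this, div_eq_inv_mul]
    · obtain rfl : i = ⟨k, hk⟩ := Fin.ext hi
      simp [liftVec, hx]
    · have : i ≠ ⟨k, hk⟩ := by rintro rfl; simp at hi
      rw [liftVec_gt _ hi]; simp [this, hgt i hi]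
  have hsum : ∑ i, ((Pi.single ⟨k, hk⟩ 1 + x : Fin n → ℝ) i) ^ 2 = 2 * (1 + x ⟨k, hk⟩) := by
    have : ∀ i, ((Pi.single ⟨k, hk⟩ 1 + x : Fin n → ℝ) i) ^ 2
        = (Pi.single ⟨k, hk⟩ 1 : Fin n → ℝ) i * (1 + 2 * x ⟨k, hk⟩) + x i ^ 2 := by
      intro i
      rcases eq_or_ne i ⟨k, hk⟩ with rfl | hi
      · simp; ring
      · simp [hi]
    simp only [this, Finset.sum_add_distrib, ← Finset.sum_mul, hs, Finset.sum_pi_single',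
      Finset.mem_univ, if_true]
    ring
  rw [hl]
  simp only [Pi.smul_apply, smul_eq_mul, mul_pow, ← Finset.mul_sum, hsum, smul_smul]
  have : 2 * ((1 + x ⟨k, hk⟩)⁻¹ ^ 2 * (2 * (1 + x ⟨k, hk⟩)))⁻¹ * (1 + x ⟨k, hk⟩)⁻¹ = 1 := by
    field_simp
  rw [this, one_smul]; abel

end SubSpin

end SpinTower

end ExoticSpinor
end

noncomputable section
namespace ExoticSpinor
open CliffordAlgebra

section SubSpin

variable {n k : ℕ} (hk : k < n) [NeZero n]

theorem subSpin_mono : subSpin n k ≤ subSpin n (k + 1) := fun _ hg i hi => hg i (by omega)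

theorem vecAct_liftRotor_mul {h : spinGroup (diagForm (negW n))} (hh : h ∈ subSpin n k)
    (y : Fin k → ℝ) :
    vecAct (liftRotor hk y * h) (Pi.single ⟨k, hk⟩ 1) ⟨k, hk⟩
      = -1 + 2 * (∑ i : Fin n, (liftVec y i : ℝ) ^ 2)⁻¹ := by
  rw [vecAct_mul_apply, hh ⟨k, hk⟩ le_rfl, vecAct_liftRotor_self]
  simp [liftVec_self hk]

theorem liftRotor_inv_mul_mem {g : spinGroup (diagForm (negW n))} (hg : g ∈ subSpin n (k + 1))
    (h : -1 < vecAct g (Pi.single ⟨k, hk⟩ 1) ⟨k, hk⟩) :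
    (liftRotor hk (stereo hk g))⁻¹ * g ∈ subSpin n k := by
  intro i hi
  rcases hi.eq_or_lt with rfl | hi
  · rw [vecAct_mul_apply]
    change vecAct _ (vecAct g (Pi.single ⟨i, hk⟩ 1)) = _
    rw [← vecAct_liftRotor_stereo hk hg h, vecAct_inv_vecAct]
  · exact mul_mem (inv_mem (liftRotor_mem hk _)) hg i hi

theorem continuous_vecAct_coord (i j : Fin n) :
    Continuous fun g : subSpin n (k + 1) => vecAct (g : spinGroup (diagForm (negW n)))
      (Pi.single i 1) j :=
  (continuous_apply j).comp ((continuous_vecAct _).comp continuous_subtype_val)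

/-- The part of `subSpin n (k + 1)` over the complement of the south pole. -/
def northPart : Set (subSpin n (k + 1)) :=
  {g | -1 < vecAct (g : spinGroup (diagForm (negW n))) (Pi.single ⟨k, hk⟩ 1) ⟨k, hk⟩}

/-- The part of `subSpin n (k + 1)` over the complement of the north pole. -/
def southPart : Set (subSpin n (k + 1)) :=
  {g | vecAct (g : spinGroup (diagForm (negW n))) (Pi.single ⟨k, hk⟩ 1) ⟨k, hk⟩ < 1}

theorem continuous_stereo : Continuous fun g : northPart hk =>
    stereo hk ((g : subSpin n (k + 1)) : spinGroup (diagForm (negW n))) := by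
  refine continuous_pi fun i => ?_
  refine Continuous.div ((continuous_vecAct_coord _ _).comp continuous_subtype_val)
    (continuous_const.add ((continuous_vecAct_coord _ _).comp continuous_subtype_val)) fun g => ?_
  have : -1 < vecAct ((g : subSpin n (k + 1)) : spinGroup (diagForm (negW n)))
    (Pi.single ⟨k, hk⟩ 1) ⟨k, hk⟩ := g.2
  exact (by linarith : (0 : ℝ) < _).ne'

theorem simplyConnectedSpace_northPart (h : SimplyConnectedSpace (subSpin n k)) :
    SimplyConnectedSpace (northPart hk) := by
  have hcoe : Continuous fun g : northPart hk =>
      ((g : subSpin n (k + 1)) : spinGroup (diagForm (negW n))) :=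
    continuous_subtype_val.comp continuous_subtype_val
  let r : C(northPart hk, subSpin n k) :=
    ⟨fun g => ⟨(liftRotor hk (stereo hk g.1.1))⁻¹ * g.1.1, liftRotor_inv_mul_mem hk g.1.2 g.2⟩,
      Continuous.subtype_mk
        (((continuous_liftRotor hk).comp (continuous_stereo hk)).inv.mul hcoe) _⟩
  let j : (Fin k → ℝ) × subSpin n k → northPart hk := fun p =>
    ⟨⟨liftRotor hk p.1 * p.2.1, mul_mem (liftRotor_mem hk _) (subSpin_mono p.2.2)⟩, by
      change -1 < vecAct (liftRotor hk p.1 * p.2.1) _ _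
      rw [vecAct_liftRotor_mul hk p.2.2]
      have := sum_liftVec_pos hk p.1
      have : 0 < (∑ i : Fin n, (liftVec p.1 i : ℝ) ^ 2)⁻¹ := inv_pos.2 this
      linarith⟩
  have hj : Continuous j := by
    refine Continuous.subtype_mk (Continuous.subtype_mk ?_ _) _
    exact ((continuous_liftRotor hk).comp continuous_fst).mul
      (continuous_subtype_val.comp continuous_snd)
  refine simplyConnectedSpace_of_retract h
    ⟨fun g => j (0, g), hj.comp (continuous_const.prodMk continuous_id)⟩ r (fun g => ?_)
    (fun p => j ((1 - p.1) • stereo hk p.2.1.1, r p.2)) ?_ (fun g => ?_) (fun g => ?_)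
  · apply Subtype.ext
    have h1 : stereo hk g.1 = 0 := by
      ext i
      have : (⟨i, i.2.trans hk⟩ : Fin n) ≠ ⟨k, hk⟩ := fun h => i.2.ne (congrArg Fin.val h)
      simp only [stereo]
      rw [g.2 ⟨k, hk⟩ le_rfl]
      simp [this]
    change (liftRotor hk (stereo hk (liftRotor hk 0 * g.1)))⁻¹ * (liftRotor hk 0 * g.1) = g.1
    rw [liftRotor_zero, one_mul, h1, liftRotor_zero, inv_one, one_mul]
  · refine (hj.comp (Continuous.prodMk ?_ (r.continuous.comp continuous_snd))).continuousOn
    exact (continuous_const.sub continuous_fst).smul ((continuous_stereo hk).comp continuous_snd)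
  · apply Subtype.ext; apply Subtype.ext
    change liftRotor hk (((1 : ℝ) - 0) • stereo hk g.1.1)
      * ((liftRotor hk (stereo hk g.1.1))⁻¹ * g.1.1) = g.1.1
    rw [sub_zero, one_smul, mul_inv_cancel_left]
  · simp

theorem isPathConnected_northPart_inter (hk2 : 2 ≤ k) (h : PathConnectedSpace (subSpin n k)) :
    IsPathConnected (northPart hk ∩ southPart hk) := by
  have h1 : IsPathConnected ({0}ᶜ : Set (Fin k → ℝ)) := by
    refine isPathConnected_compl_singleton_of_one_lt_rank ?_ 0
    rw [rank_fin_fun]; exact_mod_cast hk2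
  have h2 : IsPathConnected (({0}ᶜ : Set (Fin k → ℝ)) ×ˢ (Set.univ : Set (subSpin n k))) :=
    h1.prod (pathConnectedSpace_iff_univ.1 h)
  let j : (Fin k → ℝ) × subSpin n k → subSpin n (k + 1) := fun p =>
    ⟨liftRotor hk p.1 * p.2.1, mul_mem (liftRotor_mem hk _) (subSpin_mono p.2.2)⟩
  have hj : Continuous j := by
    refine Continuous.subtype_mk ?_ _
    exact ((continuous_liftRotor hk).comp continuous_fst).mul
      (continuous_subtype_val.comp continuous_snd)
  convert h2.image hj using 1
  ext g
  constructor
  · rintro ⟨hg1, hg2⟩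
    refine ⟨(stereo hk g.1, ⟨_, liftRotor_inv_mul_mem hk g.2 hg1⟩), ⟨fun h0 => ?_, trivial⟩, ?_⟩
    · have h0' : stereo hk g.1 = 0 := h0
      have h3 := vecAct_liftRotor_stereo hk g.2 hg1
      rw [h0', liftRotor_zero, vecAct_one] at h3
      have h4 : vecAct g.1 (Pi.single ⟨k, hk⟩ 1) ⟨k, hk⟩ < 1 := hg2
      rw [← h3] at h4
      simp at h4
    · exact Subtype.ext (mul_inv_cancel_left _ _)
  · rintro ⟨⟨y, g⟩, ⟨hy, -⟩, rfl⟩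
    have hy0 : y ≠ 0 := hy
    have hpos := sum_liftVec_pos hk y
    have hgt : 1 < ∑ i : Fin n, (liftVec y i : ℝ) ^ 2 := by
      obtain ⟨i, hi⟩ := Function.ne_iff.1 hy0
      have h3 : (⟨i, i.2.trans hk⟩ : Fin n) ≠ ⟨k, hk⟩ := fun h => i.2.ne (congrArg Fin.val h)
      have h4 := Finset.add_le_sum (f := fun i : Fin n => (liftVec y i : ℝ) ^ 2)
        (fun i _ => sq_nonneg _) (Finset.mem_univ (⟨i, i.2.trans hk⟩ : Fin n))
        (Finset.mem_univ ⟨k, hk⟩) h3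
      have h5 : (liftVec y (⟨i, i.2.trans hk⟩ : Fin n)) = y i := by simp [liftVec]
      simp only [liftVec_self hk, h5] at h4
      have := (sq_pos_iff (a := y i)).2 hi
      nlinarith
    have h6 := vecAct_liftRotor_mul hk g.2 y
    constructor
    · change -1 < vecAct (liftRotor hk y * g.1) _ _
      rw [h6]
      have := inv_pos.2 hpos
      linarith
    · change vecAct (liftRotor hk y * g.1) _ _ < 1
      rw [h6]
      have := inv_lt_one_of_one_lt₀ hgt
      linarith

theorem simplyConnectedSpace_southPart (hk1 : 1 ≤ k) (h : SimplyConnectedSpace (northPart hk)) :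
    SimplyConnectedSpace (southPart hk) := by
  have h0 : 0 < n := by omega
  have hne : (⟨0, h0⟩ : Fin n) ≠ ⟨k, hk⟩ := fun h => by simp at h; omega
  have hz : diagForm (negW n) (Pi.single ⟨0, h0⟩ 1) ≠ 0 := by rw [diagForm_single]; norm_num
  have hu : diagForm (negW n) (Pi.single ⟨k, hk⟩ 1) ≠ 0 := by rw [diagForm_single]; norm_num
  let w : spinGroup (diagForm (negW n)) := ⟨_, rotor_mem hz
    (u := Pi.single ⟨k, hk⟩ 1) (by rw [diagForm_single])⟩
  have hw (v) : vecAct w v = hyperRefl (diagForm (negW n)) (Pi.single ⟨0, h0⟩ 1)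
      (hyperRefl (diagForm (negW n)) (Pi.single ⟨k, hk⟩ 1) v) := vecAct_of_coe_eq hz hu rfl v
  have hsub : w ∈ subSpin n (k + 1) := by
    intro i hi
    have h1 : i ≠ ⟨k, hk⟩ := by rintro rfl; simp at hi
    have h2 : i ≠ ⟨0, h0⟩ := by rintro rfl; simp at hi
    have h3 : hyperRefl (diagForm (negW n)) (Pi.single ⟨k, hk⟩ 1) (Pi.single i 1)
        = Pi.single i 1 :=
      hyperRefl_of_polar_eq_zero (by rw [polar_single]; simp [h1.symm])
    rw [hw, h3]
    exact hyperRefl_of_polar_eq_zero (by rw [polar_single, Pi.single_eq_of_ne h2.symm]; ring)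
  have hwk (v : Fin n → ℝ) : vecAct w v ⟨k, hk⟩ = - v ⟨k, hk⟩ := by
    rw [hw, hyperRefl_apply, hyperRefl_apply, polar_single, polar_single, diagForm_single,
      diagForm_single]
    simp only [negW, Pi.sub_apply, Pi.smul_apply, smul_eq_mul, Pi.single_eq_same,
      Pi.single_eq_of_ne hne.symm, Pi.single_eq_of_ne hne]
    ring
  refine simplyConnectedSpace_of_homeomorph
    ((Homeomorph.mulLeft (⟨w, hsub⟩ : subSpin n (k + 1))).subtype fun g => ?_) h
  change vecAct g.1 _ _ < 1 ↔ -1 < vecAct (w * g.1) _ _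
  rw [vecAct_mul_apply, hwk]
  constructor <;> intro h <;> linarith

theorem simplyConnectedSpace_subSpin_succ (hk : k < n) (hk2 : 2 ≤ k) (h : SimplyConnectedSpace (subSpin n k)) :
    SimplyConnectedSpace (subSpin n (k + 1)) := by
  have hN := simplyConnectedSpace_northPart hk h
  refine simplyConnectedSpace_of_union (U := northPart hk) (V := southPart hk) ?_ ?_ (fun g => ?_) hN
    (simplyConnectedSpace_southPart hk (by omega) hN)
    (isPathConnected_northPart_inter hk hk2 inferInstance)
  · exact isOpen_lt continuous_const (continuous_vecAct_coord _ _)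
  · exact isOpen_lt (continuous_vecAct_coord _ _) continuous_const
  · by_contra! h
    have h1 : ¬ -1 < vecAct g.1 _ _ := h.1
    have h2 : ¬ vecAct g.1 _ _ < 1 := h.2
    linarith

end SubSpin

section Base

variable {n : ℕ} (hn : 3 ≤ n)

/-- The even elements of the Clifford algebra of the first three generators. -/
def quatMap : (Fin 4 → ℝ) →ₗ[ℝ] CliffordAlgebra (diagForm (negW n)) :=
  Fintype.linearCombination ℝ ![1, gen (negW n) ⟨1, by omega⟩ * gen (negW n) ⟨0, by omega⟩,
    gen (negW n) ⟨2, by omega⟩ * gen (negW n) ⟨0, by omega⟩,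
    gen (negW n) ⟨2, by omega⟩ * gen (negW n) ⟨1, by omega⟩]

theorem quatMap_apply (y : Fin 4 → ℝ) : quatMap hn y = y 0 • 1
    + y 1 • (gen (negW n) ⟨1, by omega⟩ * gen (negW n) ⟨0, by omega⟩)
    + y 2 • (gen (negW n) ⟨2, by omega⟩ * gen (negW n) ⟨0, by omega⟩)
    + y 3 • (gen (negW n) ⟨2, by omega⟩ * gen (negW n) ⟨1, by omega⟩) := by
  simp [quatMap, Fintype.linearCombination_apply, Fin.sum_univ_four]

theorem star_gen {w : Fin n → ℝ} (i : Fin n) : star (gen w i) = -gen w i := star_ι _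

theorem star_quatMap (y : Fin 4 → ℝ) : star (quatMap hn y) = y 0 • 1
    - y 1 • (gen (negW n) ⟨1, by omega⟩ * gen (negW n) ⟨0, by omega⟩)
    - y 2 • (gen (negW n) ⟨2, by omega⟩ * gen (negW n) ⟨0, by omega⟩)
    - y 3 • (gen (negW n) ⟨2, by omega⟩ * gen (negW n) ⟨1, by omega⟩) := by
  have h1 : (⟨0, by omega⟩ : Fin n) ≠ ⟨1, by omega⟩ := by simp
  have h2 : (⟨0, by omega⟩ : Fin n) ≠ ⟨2, by omega⟩ := by simp
  have h3 : (⟨1, by omega⟩ : Fin n) ≠ ⟨2, by omega⟩ := by simp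
  rw [quatMap_apply]
  simp only [star_add, CliffordAlgebra.star_smul, star_mul, star_gen, star_one, neg_mul_neg]
  rw [gen_anticomm h1, gen_anticomm h2, gen_anticomm h3]
  module

theorem gen_negW_sq (i : Fin n) : gen (negW n) i * gen (negW n) i = -1 := by
  rw [gen_sq]; simp [negW]

/-- Products of the generators of a three-dimensional Clifford algebra. -/
theorem quaternion_identities {A : Type*} [Ring A] [Algebra ℝ A] {e₀ e₁ e₂ : A} (h0 : e₀ * e₀ = -1)
    (h1 : e₁ * e₁ = -1) (h2 : e₂ * e₂ = -1) (h10 : e₁ * e₀ = -(e₀ * e₁)) (h20 : e₂ * e₀ = -(e₀ * e₂))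
    (h21 : e₂ * e₁ = -(e₁ * e₂)) (a b c d : ℝ) :
    let q := a • 1 + b • (e₁ * e₀) + c • (e₂ * e₀) + d • (e₂ * e₁)
    let p := a • 1 - b • (e₁ * e₀) - c • (e₂ * e₀) - d • (e₂ * e₁)
    q * p = (a ^ 2 + b ^ 2 + c ^ 2 + d ^ 2) • 1 ∧ p * q = (a ^ 2 + b ^ 2 + c ^ 2 + d ^ 2) • 1 ∧
    q * e₀ * p = (a * a - b * b - c * c + d * d) • e₀ + (-2 * a * b - 2 * c * d) • e₁
      + (-2 * a * c + 2 * b * d) • e₂ ∧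
    q * e₁ * p = (2 * a * b - 2 * c * d) • e₀ + (a * a - b * b + c * c - d * d) • e₁
      + (-2 * a * d - 2 * b * c) • e₂ ∧
    q * e₂ * p = (2 * a * c + 2 * b * d) • e₀ + (2 * a * d - 2 * b * c) • e₁
      + (a * a + b * b - c * c - d * d) • e₂ := by
  have k0 (x : A) : e₀ * (e₀ * x) = -x := by rw [← mul_assoc, h0, neg_one_mul]
  have k1 (x : A) : e₁ * (e₁ * x) = -x := by rw [← mul_assoc, h1, neg_one_mul]
  have k2 (x : A) : e₂ * (e₂ * x) = -x := by rw [← mul_assoc, h2, neg_one_mul]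
  have k10 (x : A) : e₁ * (e₀ * x) = -(e₀ * (e₁ * x)) := by
    rw [← mul_assoc, h10, neg_mul, mul_assoc]
  have k20 (x : A) : e₂ * (e₀ * x) = -(e₀ * (e₂ * x)) := by
    rw [← mul_assoc, h20, neg_mul, mul_assoc]
  have k21 (x : A) : e₂ * (e₁ * x) = -(e₁ * (e₂ * x)) := by
    rw [← mul_assoc, h21, neg_mul, mul_assoc]
  intro q p
  simp only [q, p]
  refine ⟨?_, ?_, ?_, ?_, ?_⟩ <;>
  · simp only [mul_add, add_mul, mul_sub, sub_mul, smul_mul_assoc, mul_smul_comm, mul_one, one_mul,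
      mul_assoc, h10, h20, h21, h0, h1, h2, k0, k1, k2, k10, k20, k21, mul_neg, neg_neg, smul_neg,
      neg_mul]
    module

theorem star_quatMap_mul (y : Fin 4 → ℝ) :
    star (quatMap hn y) * quatMap hn y = (y 0 ^ 2 + y 1 ^ 2 + y 2 ^ 2 + y 3 ^ 2) • 1 := by
  have := quaternion_identities (gen_negW_sq _) (gen_negW_sq _) (gen_negW_sq _)
    (gen_anticomm (w := negW n) (i := ⟨1, by omega⟩) (j := ⟨0, by omega⟩) (by simp))
    (gen_anticomm (i := ⟨2, by omega⟩) (by simp)) (gen_anticomm (by simp)) (y 0) (y 1) (y 2) (y 3)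
  rw [star_quatMap, quatMap_apply]
  exact this.2.1

theorem quatMap_mem [NeZero n] {y : Fin 4 → ℝ} (hy : y 0 ^ 2 + y 1 ^ 2 + y 2 ^ 2 + y 3 ^ 2 = 1) :
    ∃ g ∈ subSpin n 3, (g : CliffordAlgebra (diagForm (negW n))) = quatMap hn y := by
  have h := quaternion_identities (gen_negW_sq _) (gen_negW_sq _) (gen_negW_sq _)
    (gen_anticomm (w := negW n) (i := ⟨1, by omega⟩) (j := ⟨0, by omega⟩) (by simp))
    (gen_anticomm (i := ⟨2, by omega⟩) (by simp)) (gen_anticomm (by simp)) (y 0) (y 1) (y 2) (y 3)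
  have h1 : star (quatMap hn y) * quatMap hn y = 1 := by rw [star_quatMap_mul, hy, one_smul]
  have hcomm : ∀ i : Fin n, 3 ≤ i.val →
      quatMap hn y * gen (negW n) i = gen (negW n) i * quatMap hn y := by
    intro i hi
    have key : ∀ a b : Fin n, a ≠ i → b ≠ i →
        gen (negW n) a * gen (negW n) b * gen (negW n) i
          = gen (negW n) i * (gen (negW n) a * gen (negW n) b) := by
      intro a b ha hb
      rw [mul_assoc, gen_anticomm hb, mul_neg, ← mul_assoc, gen_anticomm ha, neg_mul, neg_neg,
        mul_assoc]
    have n0 : (⟨0, by omega⟩ : Fin n) ≠ i := fun h => by rw [← h] at hi; simp at hi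
    have n1 : (⟨1, by omega⟩ : Fin n) ≠ i := fun h => by rw [← h] at hi; simp at hi
    have n2 : (⟨2, by omega⟩ : Fin n) ≠ i := fun h => by rw [← h] at hi; simp at hi
    rw [quatMap_apply]
    simp only [add_mul, mul_add, smul_mul_assoc, mul_smul_comm, one_mul, mul_one, key _ _ n1 n0,
      key _ _ n2 n0, key _ _ n2 n1]
  have hgen : ∀ i : Fin n, ∃ u, quatMap hn y * gen (negW n) i
      = ι (diagForm (negW n)) u * quatMap hn y := by
    intro i
    by_cases hi : 3 ≤ i.val
    · exact ⟨_, hcomm i hi⟩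
    have hlin (a b c : ℝ) (i j k : Fin n) : a • gen (negW n) i + b • gen (negW n) j
        + c • gen (negW n) k = ι (diagForm (negW n))
          (a • Pi.single i 1 + b • Pi.single j 1 + c • Pi.single k 1) := by
      simp only [map_add, map_smul, gen]
    have hmul (x z : CliffordAlgebra (diagForm (negW n)))
        (hz : quatMap hn y * x * star (quatMap hn y) = z) :
        quatMap hn y * x = z * quatMap hn y := by
      rw [← hz, mul_assoc, h1, mul_one]
    rw [← quatMap_apply hn, ← star_quatMap hn] at h
    obtain ⟨i, hin⟩ := i
    obtain rfl | rfl | rfl : i = 0 ∨ i = 1 ∨ i = 2 := by simp at hi; omega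
    · exact ⟨_, hmul _ _ (h.2.2.1.trans (hlin _ _ _ _ _ _))⟩
    · exact ⟨_, hmul _ _ (h.2.2.2.1.trans (hlin _ _ _ _ _ _))⟩
    · exact ⟨_, hmul _ _ (h.2.2.2.2.trans (hlin _ _ _ _ _ _))⟩
  choose u hu using hgen
  have hmem : quatMap hn y ∈ spinGroup (diagForm (negW n)) := by
    refine mem_spinGroup_of negW_ne ?_ h1 ?_ fun v => ⟨∑ i, v i • u i, ?_⟩
    · rw [quatMap_apply]
      simp only [map_add, map_smul, map_one, map_mul, gen, involute_ι, neg_mul_neg]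
    · rw [star_quatMap, quatMap_apply, h.1, hy, one_smul]
    · rw [ι_eq_sum_gen, Finset.mul_sum, map_sum, Finset.sum_mul]
      refine Finset.sum_congr rfl fun i _ => ?_
      rw [mul_smul_comm, hu, map_smul, smul_mul_assoc]
  exact ⟨⟨_, hmem⟩, fun i hi => vecAct_eq_of_mul (hcomm i hi), rfl⟩

theorem exists_quatMap_of_mem {g : spinGroup (diagForm (negW n))} (hg : g ∈ subSpin n 3) :
    ∃ y : Fin 4 → ℝ, y 0 ^ 2 + y 1 ^ 2 + y 2 ^ 2 + y 3 ^ 2 = 1 ∧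
      (g : CliffordAlgebra (diagForm (negW n))) = quatMap hn y := by
  have hinv : involute (g : CliffordAlgebra (diagForm (negW n))) = g :=
    spinGroup.involute_eq g.2
  have hlow : (g : CliffordAlgebra (diagForm (negW n))) ∈ lowAlg (negW n) 3 := by
    refine mem_lowAlg_of_dContr hn fun i hi => ?_
    have h1 := gen_mul_sub i (g : CliffordAlgebra (diagForm (negW n)))
    have h2 := ι_vecAct_mul g (Pi.single i 1)
    rw [hg i hi] at h2
    rw [hinv] at h1
    have h3 : gen (negW n) i * (g : CliffordAlgebra (diagForm (negW n))) - g * gen (negW n) i = 0 :=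
      sub_eq_zero.2 h2
    rw [h3] at h1
    exact (smul_eq_zero.1 h1.symm).resolve_left (by simp [negW])
  have h0 : ∀ x ∈ lowAlg (negW n) 0, ∃ r : ℝ, x = r • 1 := by
    intro x hx
    obtain ⟨r, hr⟩ := exists_algebraMap_of_dContr (x := x) fun i =>
      dContr_of_mem_lowAlg (Nat.zero_le _) hx
    exact ⟨r, by rw [hr, Algebra.algebraMap_eq_smul_one]⟩
  have h1 : ∀ x ∈ lowAlg (negW n) 1, ∃ r s : ℝ, x = r • 1 + s • gen (negW n) ⟨0, by omega⟩ := by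
    intro x hx
    obtain ⟨a, ha, b, hb, rfl⟩ := exists_of_mem_lowAlg_succ (by omega) hx
    obtain ⟨r, rfl⟩ := h0 a ha
    obtain ⟨s, rfl⟩ := h0 b hb
    exact ⟨r, s, by rw [mul_smul_comm, mul_one]⟩
  have h2 : ∀ x ∈ lowAlg (negW n) 2, ∃ r s t u : ℝ, x = r • 1 + s • gen (negW n) ⟨0, by omega⟩
      + t • gen (negW n) ⟨1, by omega⟩
      + u • (gen (negW n) ⟨1, by omega⟩ * gen (negW n) ⟨0, by omega⟩) := by
    intro x hx
    obtain ⟨a, ha, b, hb, rfl⟩ := exists_of_mem_lowAlg_succ (by omega) hx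
    obtain ⟨r, s, rfl⟩ := h1 a ha
    obtain ⟨t, u, rfl⟩ := h1 b hb
    exact ⟨r, s, t, u, by rw [mul_add, mul_smul_comm, mul_one, mul_smul_comm, ← add_assoc]⟩
  obtain ⟨a, ha, b, hb, hab⟩ := exists_of_mem_lowAlg_succ (by omega) hlow
  obtain ⟨r, s, t, u, rfl⟩ := h2 a ha
  obtain ⟨r', s', t', u', rfl⟩ := h2 b hb
  have heq : (g : CliffordAlgebra (diagForm (negW n))) = quatMap hn ![r, u, s', t'] := by
    have h3 : (2 : ℝ) • (g : CliffordAlgebra (diagForm (negW n)))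
        = (2 : ℝ) • quatMap hn ![r, u, s', t'] := by
      have hg0 (i : Fin n) : involute (gen (negW n) i) = -gen (negW n) i := involute_ι _
      rw [two_smul]
      nth_rewrite 2 [← hinv]
      rw [hab, quatMap_apply]
      simp only [map_add, map_smul, map_mul, map_one, hg0, mul_add, mul_smul_comm, mul_neg,
        neg_mul, neg_neg, mul_one, smul_neg, Matrix.cons_val_zero, Matrix.cons_val_one,
        Matrix.cons_val]
      module
    exact smul_right_injective _ (two_ne_zero' ℝ) h3
  refine ⟨_, ?_, heq⟩
  have h4 := spinGroup.coe_star_mul_self g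
  rw [heq, star_quatMap_mul, ← Algebra.algebraMap_eq_smul_one] at h4
  exact algebraMap_clifford_injective (h4.trans (map_one _).symm)

theorem simplyConnectedSpace_subSpin_three (hn : 3 ≤ n) [NeZero n] : SimplyConnectedSpace (subSpin n 3) := by
  have hinj : Function.Injective (quatMap hn) := by
    refine (injective_iff_map_eq_zero _).2 fun y hy => ?_
    have h1 := star_quatMap_mul hn y
    rw [hy, mul_zero, ← Algebra.algebraMap_eq_smul_one] at h1
    have h2 := algebraMap_clifford_injective ((map_zero _).trans h1)
    have e0 : y 0 ^ 2 = 0 := by nlinarith [sq_nonneg (y 0), sq_nonneg (y 1), sq_nonneg (y 2), sq_nonneg (y 3)]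
    have e1 : y 1 ^ 2 = 0 := by nlinarith [sq_nonneg (y 0), sq_nonneg (y 1), sq_nonneg (y 2), sq_nonneg (y 3)]
    have e2 : y 2 ^ 2 = 0 := by nlinarith [sq_nonneg (y 0), sq_nonneg (y 1), sq_nonneg (y 2), sq_nonneg (y 3)]
    have e3 : y 3 ^ 2 = 0 := by nlinarith [sq_nonneg (y 0), sq_nonneg (y 1), sq_nonneg (y 2), sq_nonneg (y 3)]
    ext i
    fin_cases i
    · simpa using e0
    · simpa using e1
    · simpa using e2
    · simpa using e3
  obtain ⟨L, hL⟩ := LinearMap.exists_leftInverse_of_injective _ (LinearMap.ker_eq_bot.2 hinj)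
  have hL' (y) : L (quatMap hn y) = y := LinearMap.congr_fun hL y
  have hsph (y : EuclideanSpace ℝ (Fin 4)) : y ∈ Metric.sphere (0 : EuclideanSpace ℝ (Fin 4)) 1 ↔
      y 0 ^ 2 + y 1 ^ 2 + y 2 ^ 2 + y 3 ^ 2 = 1 := by
    rw [mem_sphere_zero_iff_norm, EuclideanSpace.norm_eq, Real.sqrt_eq_one]
    simp [Fin.sum_univ_four]
  choose y hy1 hy2 using fun g : subSpin n 3 => exists_quatMap_of_mem hn g.2
  choose G hG1 hG2 using fun z : Metric.sphere (0 : EuclideanSpace ℝ (Fin 4)) 1 =>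
    quatMap_mem hn ((hsph z.1).1 z.2)
  have hyL (g) : y g = L ((g : spinGroup (diagForm (negW n))) : CliffordAlgebra _) := by
    rw [hy2, hL']
  let f : subSpin n 3 ≃ₜ Metric.sphere (0 : EuclideanSpace ℝ (Fin 4)) 1 :=
    { toFun := fun g => ⟨WithLp.toLp 2 (y g), (hsph _).2 (hy1 g)⟩
      invFun := fun z => ⟨G z, hG1 z⟩
      left_inv := fun g => by
        apply Subtype.ext; apply Subtype.ext
        rw [hG2, hy2 g]
      right_inv := fun z => by
        apply Subtype.ext
        change WithLp.toLp 2 (y ⟨G z, hG1 z⟩) = z.1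
        rw [hyL]
        change WithLp.toLp 2 (L (G z : CliffordAlgebra _)) = z.1
        rw [hG2, hL']
      continuous_toFun := by
        refine Continuous.subtype_mk ((PiLp.continuous_toLp 2 _).comp ?_) _
        have h : y = fun g : subSpin n 3 =>
            L ((g : spinGroup (diagForm (negW n))) : CliffordAlgebra _) := funext hyL
        rw [h]
        exact (continuous_clifford_linear L).comp
          (continuous_subtype_val.comp continuous_subtype_val)
      continuous_invFun := by
        refine Continuous.subtype_mk (Continuous.subtype_mk ?_ _) _
        have h : (fun z => (G z : CliffordAlgebra (diagForm (negW n))))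
            = fun z : Metric.sphere (0 : EuclideanSpace ℝ (Fin 4)) 1 => quatMap hn z.1 :=
          funext hG2
        change Continuous fun z => (G z : CliffordAlgebra (diagForm (negW n)))
        rw [h]
        exact (LinearMap.continuous_of_finiteDimensional
          (quatMap hn)).comp ((PiLp.continuous_ofLp 2 _).comp continuous_subtype_val) }
  exact simplyConnectedSpace_of_homeomorph f (simplyConnectedSpace_sphere (by simp))

theorem simplyConnectedSpace_subSpin [NeZero n] {k : ℕ} (hk : 3 ≤ k) (hkn : k ≤ n) :
    SimplyConnectedSpace (subSpin n k) := by
  induction k, hk using Nat.le_induction with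
  | base => exact simplyConnectedSpace_subSpin_three hkn
  | succ k hk ih => exact simplyConnectedSpace_subSpin_succ (by omega) (by omega) (ih (by omega))

end Base

instance simplyConnectedSpace_Spin7 : SimplyConnectedSpace Spin7 := by
  have h : subSpin 7 7 = ⊤ := eq_top_iff.2 fun g _ i hi => absurd i.2 (by omega)
  have h1 := simplyConnectedSpace_subSpin (n := 7) (k := 7) (by norm_num) le_rfl
  have f : spinGroup (diagForm (negW 7)) ≃ₜ subSpin 7 7 :=
    (Homeomorph.Set.univ _).symm.trans (Homeomorph.setCongr (by rw [h]; rfl))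
  exact simplyConnectedSpace_of_homeomorph f h1

end ExoticSpinor
end

noncomputable section
namespace ExoticSpinor
open CliffordAlgebra

/-! ### Matrix models of even Clifford algebras -/

section EvenModel

variable {n : ℕ} {w : Fin n → ℝ}

theorem finrank_clifford (Q : QuadraticForm ℝ (Fin n → ℝ)) :
    Module.finrank ℝ (CliffordAlgebra Q) = 2 ^ n := by
  rw [(CliffordAlgebra.equivExterior Q).finrank_eq,
    Module.finrank_eq_card_basis ((Pi.basisFun ℝ (Fin n)).ExteriorAlgebra)]
  simp

theorem finrank_even (hw : ∀ i, w i ≠ 0) [NeZero n] :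
    2 ^ n ≤ 2 * Module.finrank ℝ (evenOdd (diagForm w) 0) := by
  have h1 := Submodule.finrank_add_eq_of_isCompl (evenOdd_isCompl (diagForm w))
  rw [finrank_clifford] at h1
  have h2 : Module.finrank ℝ (evenOdd (diagForm w) 1) ≤ Module.finrank ℝ (evenOdd (diagForm w) 0) := by
    have hmem : ∀ x ∈ evenOdd (diagForm w) 1,
        LinearMap.mulLeft ℝ (gen w 0) x ∈ evenOdd (diagForm w) 0 := fun x hx => by
      have h := evenOdd_mul_le (diagForm w) 1 1
        (Submodule.mul_mem_mul (ι_mem_evenOdd_one (diagForm w) (Pi.single 0 1)) hx)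
      exact h
    refine LinearMap.finrank_le_finrank_of_injective
      (f := (LinearMap.mulLeft ℝ (gen w 0)).restrict hmem) fun x y hxy => Subtype.ext ?_
    have h3 : gen w 0 * x.1 = gen w 0 * y.1 := congrArg Subtype.val hxy
    have h4 := congrArg (gen w 0 * ·) h3
    simp only [← mul_assoc, gen_sq, ← Algebra.smul_def] at h4
    exact smul_right_injective _ (hw 0) h4
  omega

variable {S : Type*} [Fintype S] [DecidableEq S] [Nonempty S]

theorem evenMap_injective (hw : ∀ i, w i ≠ 0) (f : CliffordAlgebra (diagForm w) →ₐ[ℝ] Matrix S S ℝ) :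
    Function.Injective (f.toLinearMap.domRestrict (evenOdd (diagForm w) 0)) := fun x y h =>
  Subtype.ext (eq_of_map_eq_of_even hw f (involute_eq_of_mem_even x.2) (involute_eq_of_mem_even y.2) h)

theorem evenMap_bijective (hw : ∀ i, w i ≠ 0) [NeZero n]
    (f : CliffordAlgebra (diagForm w) →ₐ[ℝ] Matrix S S ℝ)
    (hS : 2 * (Fintype.card S * Fintype.card S) = 2 ^ n) :
    Function.Bijective (f.toLinearMap.domRestrict (evenOdd (diagForm w) 0)) := by
  have hinj := evenMap_injective hw f
  refine ⟨hinj, (LinearMap.injective_iff_surjective_of_finrank_eq_finrank ?_).1 hinj⟩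
  have h1 := finrank_even (w := w) hw
  have h2 := LinearMap.finrank_le_finrank_of_injective hinj
  have h3 : Module.finrank ℝ (Matrix S S ℝ) = Fintype.card S * Fintype.card S := by
    rw [Module.finrank_matrix]; simp
  omega

/-- The even element of a Clifford algebra with a given matrix, for a representation whose
dimension makes it faithful and full on the even part. -/
theorem exists_evenSection (hw : ∀ i, w i ≠ 0) [NeZero n]
    (f : CliffordAlgebra (diagForm w) →ₐ[ℝ] Matrix S S ℝ)
    (hS : 2 * (Fintype.card S * Fintype.card S) = 2 ^ n) :
    ∃ s : Matrix S S ℝ →ₗ[ℝ] CliffordAlgebra (diagForm w),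
      (∀ D, f (s D) = D) ∧ ∀ D, involute (s D) = s D := by
  let E := LinearEquiv.ofBijective _ (evenMap_bijective hw f hS)
  refine ⟨(evenOdd (diagForm w) 0).subtype ∘ₗ E.symm.toLinearMap, fun D => ?_, fun D => ?_⟩
  · exact E.apply_symm_apply D
  · exact involute_eq_of_mem_even (E.symm D).2

theorem eq_of_map_eq_of_odd (hw : ∀ i, w i ≠ 0) [NeZero n] {B : Type*} [Ring B] [Nontrivial B]
    [Algebra ℝ B] (f : CliffordAlgebra (diagForm w) →ₐ[ℝ] B) {x y : CliffordAlgebra (diagForm w)}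
    (hx : involute x = -x) (hy : involute y = -y) (h : f x = f y) : x = y := by
  have hg : involute (gen w 0) = -gen w 0 := involute_ι _
  have h1 : gen w 0 * x = gen w 0 * y :=
    eq_of_map_eq_of_even hw f (by rw [map_mul, hx, hg, neg_mul_neg])
      (by rw [map_mul, hy, hg, neg_mul_neg]) (by rw [map_mul, map_mul, h])
  have h4 := congrArg (gen w 0 * ·) h1
  simp only [← mul_assoc, gen_sq, ← Algebra.smul_def] at h4
  exact smul_right_injective _ (hw 0) h4

end EvenModel

/-! ### The two matrix representations and transposition -/

theorem octLZ_transpose : ∀ i, (octLZ i)ᵀ = -octLZ i := by decide +kernel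

theorem octL_transpose (i : Fin 7) : (octL i)ᵀ = -octL i := by
  have h := congrArg (fun M : Matrix (Fin 8) (Fin 8) ℤ => M.map (Int.castRingHom ℝ))
    (octLZ_transpose i)
  ext a b
  have := congrFun (congrFun h a) b
  simpa [octL] using this

theorem octLin_transpose (x : Fin 7 → ℝ) : (octLin x)ᵀ = -octLin x := by
  simp only [octLin_apply, Matrix.transpose_sum, Matrix.transpose_smul, octL_transpose, smul_neg,
    Finset.sum_neg_distrib]

theorem rho7_ι (v : Fin 7 → ℝ) : rho7 (ι Q7 v) = octLin v := lift_ι_apply _ _ _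

theorem rho7_star (x : CliffordAlgebra Q7) : rho7 (star x) = (rho7 x)ᵀ := by
  induction x using CliffordAlgebra.induction with
  | algebraMap r =>
    rw [CliffordAlgebra.star_algebraMap, AlgHom.commutes, Algebra.algebraMap_eq_smul_one, Matrix.transpose_smul,
      Matrix.transpose_one]
  | ι v => rw [star_ι, map_neg, rho7_ι, octLin_transpose]
  | mul a b ha hb => rw [star_mul, map_mul, ha, hb, map_mul, Matrix.transpose_mul]
  | add a b ha hb => rw [star_add, map_add, ha, hb, map_add, Matrix.transpose_add]

/-- The coordinates of a vector of Minkowski space along `e₁, …, e₈`. -/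
def proj8 : Mink →ₗ[ℝ] (Fin 8 → ℝ) := LinearMap.pi fun i => LinearMap.proj (idx8 i)

/-- The embedding of `𝔼⁸` in Minkowski space. -/
def incl8 : (Fin 8 → ℝ) →ₗ[ℝ] Mink := Fintype.linearCombination ℝ fun i => e (idx8 i)

theorem proj8_apply (x : Mink) (i : Fin 8) : proj8 x i = x (idx8 i) := rfl

theorem incl8_eq (y : Fin 8 → ℝ) : incl8 y = ∑ i, y i • e (idx8 i) := rfl

theorem idx8_injective : Function.Injective idx8 := fun i j h => by
  have := congrArg Fin.val h
  simp only [idx8] at this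
  exact Fin.ext (by omega)

theorem idx8_ne_zero (i : Fin 8) : idx8 i ≠ 0 := fun h => by
  have := congrArg Fin.val h; simp [idx8] at this

theorem idx8_ne_nine (i : Fin 8) : idx8 i ≠ 9 := fun h => by
  have := congrArg Fin.val h; simp [idx8] at this; omega

theorem idx8_ne_ten (i : Fin 8) : idx8 i ≠ 10 := fun h => by
  have := congrArg Fin.val h; simp [idx8] at this; omega

theorem fin11_cases {p : Fin 11 → Prop} (h0 : p 0) (h9 : p 9) (h10 : p 10) (h8 : ∀ i, p (idx8 i))
    (M : Fin 11) : p M := by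
  have h : M = 0 ∨ M = 9 ∨ M = 10 ∨ ∃ i, M = idx8 i := by revert M; decide
  rcases h with rfl | rfl | rfl | ⟨i, rfl⟩
  exacts [h0, h9, h10, h8 i]

theorem sum_fin11 {A : Type*} [AddCommMonoid A] (f : Fin 11 → A) :
    ∑ M, f M = f 0 + f 9 + f 10 + ∑ i, f (idx8 i) := by
  rw [Fin.sum_univ_succ, Fin.sum_univ_castSucc, Fin.sum_univ_castSucc]
  have : ∀ i : Fin 8, (i.castSucc.castSucc.succ : Fin 11) = idx8 i := fun i => rfl
  simp only [this]
  change f 0 + (∑ i, f (idx8 i) + f 9 + f 10) = _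
  abel

theorem e_apply (M N : Fin 11) : e M N = if N = M then 1 else 0 := Pi.single_apply _ _ _

theorem incl8_idx (y : Fin 8 → ℝ) (i : Fin 8) : incl8 y (idx8 i) = y i := by
  simp [incl8_eq, e_apply, idx8_injective.eq_iff]

theorem incl8_of_ne (y : Fin 8 → ℝ) {M : Fin 11} (hM : ∀ i, M ≠ idx8 i) : incl8 y M = 0 := by
  simp [incl8_eq, e_apply, hM]

theorem incl8_zero_coord (y : Fin 8 → ℝ) : incl8 y 0 = 0 := incl8_of_ne y fun i => (idx8_ne_zero i).symm
theorem incl8_nine (y : Fin 8 → ℝ) : incl8 y 9 = 0 := incl8_of_ne y fun i => (idx8_ne_nine i).symm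
theorem incl8_ten (y : Fin 8 → ℝ) : incl8 y 10 = 0 := incl8_of_ne y fun i => (idx8_ne_ten i).symm

theorem proj8_incl8 (y : Fin 8 → ℝ) : proj8 (incl8 y) = y := funext fun i => incl8_idx y i

theorem mink_eq (x : Mink) : x = x 0 • e 0 + x 9 • e 9 + x 10 • e 10 + incl8 (proj8 x) := by
  funext M
  refine fin11_cases (p := fun M => x M = (x 0 • e 0 + x 9 • e 9 + x 10 • e 10 + incl8 (proj8 x)) M)
    ?_ ?_ ?_ (fun i => ?_) M
  · simp [e_apply, incl8_zero_coord]
  · simp [e_apply, incl8_nine]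
  · simp [e_apply, incl8_ten]
  · simp [e_apply, incl8_idx, idx8_ne_zero, idx8_ne_nine, idx8_ne_ten, proj8_apply]

/-- The off-diagonal block of Clifford multiplication on `S⁻ → S⁺`. -/
def octN : (Fin 8 → ℝ) →ₗ[ℝ] Matrix (Fin 8) (Fin 8) ℝ where
  toFun v := octLin (Fin.init v) + v (Fin.last 7) • 1
  map_add' v u := by
    have : (Fin.init (v + u) : Fin 7 → ℝ) = Fin.init v + Fin.init u := rfl
    rw [this, map_add, Pi.add_apply]; module
  map_smul' c v := by
    have : (Fin.init (c • v) : Fin 7 → ℝ) = c • Fin.init v := rfl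
    rw [this, map_smul, Pi.smul_apply, RingHom.id_apply, smul_eq_mul]; module

theorem octN_apply (v : Fin 8 → ℝ) : octN v = octLin (Fin.init v) + v (Fin.last 7) • 1 := rfl

theorem gammaPLin_blocks (v : Fin 8 → ℝ) :
    gammaPLin v = Matrix.fromBlocks 0 (-(octN v)ᵀ) (octN v) 0 := by
  rw [gammaPLin_eq, octN_apply, Matrix.transpose_add, octLin_transpose, Matrix.transpose_smul,
    Matrix.transpose_one]
  congr 1; module

theorem gammaPLin_transpose (v : Fin 8 → ℝ) : (gammaPLin v)ᵀ = -gammaPLin v := by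
  rw [gammaPLin_blocks, Matrix.fromBlocks_transpose, Matrix.fromBlocks_neg]
  simp

theorem octN_transpose_mul (v : Fin 8 → ℝ) : (octN v)ᵀ * octN v = (∑ i, v i ^ 2) • 1 := by
  have h := gammaPLin_mul_self v
  rw [gammaPLin_blocks, Matrix.fromBlocks_multiply, ← Matrix.fromBlocks_one,
    Matrix.fromBlocks_smul] at h
  have h1 := (Matrix.fromBlocks_inj.1 h).1
  simp only [mul_zero, zero_add, neg_mul, neg_smul] at h1
  exact neg_injective h1

theorem gammaLin_blocks (x : Mink) : gammaLin x =
    Matrix.fromBlocks (x 10 • 1) (x 9 • 1 - (x 0 • gammaP9 + gammaPLin (proj8 x)))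
      (x 9 • 1 + (x 0 • gammaP9 + gammaPLin (proj8 x))) (-(x 10 • 1)) := by
  have h : gammaLin x = ∑ i, x i • gamma i := rfl
  have hp : gammaPLin (proj8 x) = ∑ i, x (idx8 i) • gammaP i := rfl
  rw [h, hp]
  simp only [Fin.sum_univ_succ, gamma, idx8]
  ext (i | i) (j | j) <;> simp <;> ring_nf

theorem rho_ι (v : Mink) : rho (ι Qmink v) = gammaLin v := lift_ι_apply _ _ _

theorem gammaP9_sq : gammaP9 * gammaP9 = 1 := by
  rw [gammaP9_eq, Matrix.fromBlocks_multiply]; simp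

theorem gammaP9_anticomm (y : Fin 8 → ℝ) : gammaP9 * gammaPLin y = -(gammaPLin y * gammaP9) := by
  rw [gammaP9_eq, gammaPLin_blocks, Matrix.fromBlocks_multiply, Matrix.fromBlocks_multiply,
    Matrix.fromBlocks_neg]
  simp

theorem gammaP9_transpose : gammaP9ᵀ = gammaP9 := by
  rw [gammaP9_eq, Matrix.fromBlocks_transpose]; simp

/-- Clifford multiplication by `e₀`. -/
def gamma0 : Matrix S11 S11 ℝ := Matrix.fromBlocks 0 (-gammaP9) gammaP9 0

theorem gamma0_sq : gamma0 * gamma0 = -1 := by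
  rw [gamma0, Matrix.fromBlocks_multiply, ← Matrix.fromBlocks_one, Matrix.fromBlocks_neg]
  simp [gammaP9_sq]

theorem gammaLin_transpose (x : Mink) : gamma0 * (gammaLin x)ᵀ * gamma0 = gammaLin x := by
  rw [gammaLin_blocks, gamma0, Matrix.fromBlocks_transpose, Matrix.fromBlocks_multiply,
    Matrix.fromBlocks_multiply]
  simp only [Matrix.transpose_sub, Matrix.transpose_add, Matrix.transpose_smul,
    Matrix.transpose_one, Matrix.transpose_neg, gammaP9_transpose, gammaPLin_transpose]
  congr 1 <;>
  simp [mul_add, add_mul, mul_sub, sub_mul, gammaP9_anticomm, mul_assoc, gammaP9_sq] <;> abel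

theorem rho_star (x : Cl) : rho (star x) = -(gamma0 * (rho x)ᵀ * gamma0) := by
  induction x using CliffordAlgebra.induction with
  | algebraMap r =>
    rw [CliffordAlgebra.star_algebraMap, AlgHom.commutes, Algebra.algebraMap_eq_smul_one, Matrix.transpose_smul,
      Matrix.transpose_one, mul_smul_comm, mul_one, smul_mul_assoc, gamma0_sq, smul_neg, neg_neg]
  | ι v => rw [star_ι, map_neg, rho_ι, gammaLin_transpose]
  | mul a b ha hb =>
    rw [star_mul, map_mul, ha, hb, map_mul, Matrix.transpose_mul]
    have : -(gamma0 * (rho b)ᵀ * gamma0) * -(gamma0 * (rho a)ᵀ * gamma0)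
        = gamma0 * (rho b)ᵀ * (gamma0 * gamma0) * ((rho a)ᵀ * gamma0) := by noncomm_ring
    rw [this, gamma0_sq]
    noncomm_ring
  | add a b ha hb => rw [star_add, map_add, ha, hb, map_add, Matrix.transpose_add]; noncomm_ring

end ExoticSpinor
end

noncomputable section
namespace ExoticSpinor
open CliffordAlgebra

/-! ### Null rotations -/

theorem eta_ne (M : Fin 11) : eta M ≠ 0 := by unfold eta; split_ifs <;> norm_num

theorem eta_idx8 (i : Fin 8) : eta (idx8 i) = 1 := if_neg (idx8_ne_zero i)

/-- The Minkowski inner product. -/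
def mip : Mink →ₗ[ℝ] Mink →ₗ[ℝ] ℝ := (1 / 2 : ℝ) • Qmink.polarBilin

theorem polar_eq_mip (u v : Mink) : QuadraticMap.polar Qmink u v = 2 * mip u v := by
  simp [mip]

theorem mip_eq_sum (u v : Mink) : mip u v = ∑ M, eta M * (u M * v M) := by
  have h : QuadraticMap.polar Qmink u v = 2 * ∑ i, eta i * (u i * v i) := polar_diagForm u v
  have := polar_eq_mip u v
  linarith

theorem mip_apply (u v : Mink) :
    mip u v = -(u 0 * v 0) + u 9 * v 9 + u 10 * v 10 + proj8 u ⬝ᵥ proj8 v := by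
  rw [mip_eq_sum, sum_fin11]
  have h9 : eta 9 = 1 := if_neg (by decide)
  have h10 : eta 10 = 1 := if_neg (by decide)
  have h0 : eta 0 = -1 := if_pos rfl
  simp only [h0, h9, h10, eta_idx8, dotProduct, proj8_apply]
  simp

theorem mip_comm (u v : Mink) : mip u v = mip v u := by
  rw [mip_eq_sum, mip_eq_sum]
  exact Finset.sum_congr rfl fun M _ => by ring

theorem Qmink_eq_mip (u : Mink) : Qmink u = mip u u := by
  have h := polar_self_real (Q := Qmink) u
  rw [polar_eq_mip] at h
  linarith

theorem mip_single (M : Fin 11) (v : Mink) : mip (e M) v = eta M * v M := by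
  rw [mip_eq_sum, Finset.sum_eq_single M]
  · simp [e_apply]
  · intro N _ hN; simp [e_apply, hN]
  · simp

theorem mip_ext {u v : Mink} (h : ∀ w, mip w u = mip w v) : u = v := by
  funext M
  have := h (e M)
  rw [mip_single, mip_single] at this
  exact mul_left_cancel₀ (eta_ne M) this

theorem mip_vecAct (g : Spin101) (u v : Mink) : mip (vecAct g u) (vecAct g v) = mip u v := by
  have h := polar_vecAct g u v
  rw [polar_eq_mip, polar_eq_mip] at h
  linarith

theorem mip_ePlus (v : Mink) : mip ePlus v = v 9 - v 0 := by
  rw [ePlus, map_add, LinearMap.add_apply, mip_single, mip_single]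
  have h9 : eta 9 = 1 := if_neg (by decide)
  have h0 : eta 0 = -1 := if_pos rfl
  rw [h9, h0]; ring

theorem ePlus_zero : ePlus 0 = 1 := by simp [ePlus, e_apply]
theorem ePlus_nine : ePlus 9 = 1 := by simp [ePlus, e_apply]
theorem ePlus_ten : ePlus 10 = 0 := by simp [ePlus, e_apply]
theorem proj8_ePlus : proj8 ePlus = 0 := by
  funext i; simp [ePlus, e_apply, proj8_apply, idx8_ne_zero, idx8_ne_nine]

theorem mip_ePlus_self : mip ePlus ePlus = 0 := by rw [mip_ePlus, ePlus_zero, ePlus_nine, sub_self]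

theorem ι_sq_mink (v : Mink) : ι Qmink v * ι Qmink v = mip v v • 1 := by
  rw [ι_sq_scalar, Qmink_eq_mip, Algebra.algebraMap_eq_smul_one]

theorem ι_mul_swap (u v : Mink) : ι Qmink u * ι Qmink v = (2 * mip u v) • 1 - ι Qmink v * ι Qmink u := by
  rw [eq_sub_iff_add_eq, ι_mul_ι_add_swap, polar_eq_mip, Algebra.algebraMap_eq_smul_one]

theorem lie_Sig (a b c : Mink) :
    ⁅Sig a b, ι Qmink c⁆ = ι Qmink (mip a c • b - mip b c • a) := by
  rw [Sig, smul_lie, lie_lie_ι_eq, ← map_smul, polar_eq_mip, polar_eq_mip]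
  congr 1; module

theorem Sig_mem (a b : Mink) : Sig a b ∈ spinLie Qmink :=
  (spinLie Qmink).smul_mem _ (lie_mem_spinLie a b)

/-- The vector `bⁱ eᵢ + c e_♮`. -/
def nullVec (b : Fin 8 → ℝ) (c : ℝ) : Mink := incl8 b + c • e 10

theorem Sig_add_right (a b c : Mink) : Sig a (b + c) = Sig a b + Sig a c := by
  simp [Sig]

theorem Sig_smul_right (a b : Mink) (r : ℝ) : Sig a (r • b) = r • Sig a b := by
  simp only [Sig, map_smul, lie_smul]; rw [smul_comm]

theorem Sig_sum_right {I : Type*} (s : Finset I) (a : Mink) (f : I → Mink) :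
    Sig a (∑ i ∈ s, f i) = ∑ i ∈ s, Sig a (f i) := by
  simp only [Sig, map_sum, lie_sum, Finset.smul_sum]

theorem nullGen_eq (b : Fin 8 → ℝ) (c : ℝ) : nullGen b c = Sig ePlus (nullVec b c) := by
  rw [nullVec, Sig_add_right, Sig_smul_right, incl8_eq, Sig_sum_right, nullGen]
  simp only [Sig_smul_right]

theorem mip_ePlus_nullVec (b : Fin 8 → ℝ) (c : ℝ) : mip ePlus (nullVec b c) = 0 := by
  rw [mip_ePlus]; simp [nullVec, incl8_nine, incl8_zero_coord, e_apply]

theorem mip_nullVec_self (b : Fin 8 → ℝ) (c : ℝ) :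
    mip (nullVec b c) (nullVec b c) = c * c + b ⬝ᵥ b := by
  rw [mip_apply]
  have : proj8 (nullVec b c) = b := by
    funext i; simp [nullVec, incl8_idx, e_apply, proj8_apply, idx8_ne_ten]
  rw [this]
  simp [nullVec, incl8_nine, incl8_zero_coord, incl8_ten, e_apply]

theorem Sig_ePlus {v : Mink} (hv : mip ePlus v = 0) :
    Sig ePlus v = -(1 / 2 : ℝ) • (ι Qmink ePlus * ι Qmink v) := by
  rw [Sig, LieRing.of_associative_ring_bracket, ι_mul_swap v, mip_comm v, hv]
  module

theorem Sig_ePlus_mul {v v' : Mink} (hv : mip ePlus v = 0) (hv' : mip ePlus v' = 0) :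
    Sig ePlus v * Sig ePlus v' = 0 := by
  rw [Sig_ePlus hv, Sig_ePlus hv', smul_mul_smul_comm, mul_assoc, ← mul_assoc (ι Qmink v),
    ι_mul_swap v, mip_comm v, hv, mul_zero, zero_smul, zero_sub]
  simp only [neg_mul, mul_neg, ← mul_assoc, ι_sq_mink, mip_ePlus_self, zero_smul, zero_mul,
    neg_zero, smul_zero]

theorem exp_nullGen (b : Fin 8 → ℝ) (c : ℝ) : NormedSpace.exp (nullGen b c) = 1 + nullGen b c :=
  clifford_exp_of_sq_eq_zero (by
    rw [nullGen_eq]; exact Sig_ePlus_mul (mip_ePlus_nullVec b c) (mip_ePlus_nullVec b c))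

theorem nullGen_mem (b : Fin 8 → ℝ) (c : ℝ) : nullGen b c ∈ spinLie Qmink := by
  rw [nullGen_eq]; exact Sig_mem _ _

theorem exp_mem_Spin101 {X : Cl} (hX : X ∈ spinLie Qmink) : NormedSpace.exp X ∈ spinGroup Qmink :=
  exp_mem_spinGroup (w := eta) eta_ne hX

/-- The null rotation `exp (bⁱ Σ₊ᵢ + c Σ₊_♮)` in the spin group. -/
def nullSpin (b : Fin 8 → ℝ) (c : ℝ) : Spin101 :=
  ⟨NormedSpace.exp (nullGen b c), exp_mem_Spin101 (nullGen_mem b c)⟩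

theorem coe_nullSpin (b : Fin 8 → ℝ) (c : ℝ) : (nullSpin b c : Cl) = 1 + nullGen b c :=
  exp_nullGen b c

theorem nullVec_add (b b' : Fin 8 → ℝ) (c c' : ℝ) :
    nullVec (b + b') (c + c') = nullVec b c + nullVec b' c' := by
  simp only [nullVec, map_add]; module

theorem nullGen_add (b b' : Fin 8 → ℝ) (c c' : ℝ) :
    nullGen (b + b') (c + c') = nullGen b c + nullGen b' c' := by
  rw [nullGen_eq, nullGen_eq, nullGen_eq, nullVec_add, Sig_add_right]

theorem nullSpin_mul (b b' : Fin 8 → ℝ) (c c' : ℝ) :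
    nullSpin b c * nullSpin b' c' = nullSpin (b + b') (c + c') := by
  apply Subtype.ext
  have h : nullGen b c * nullGen b' c' = 0 := by
    rw [nullGen_eq, nullGen_eq]
    exact Sig_ePlus_mul (mip_ePlus_nullVec b c) (mip_ePlus_nullVec b' c')
  rw [Submonoid.coe_mul, coe_nullSpin, coe_nullSpin, coe_nullSpin, nullGen_add]
  simp only [mul_add, add_mul, h, mul_one, one_mul]
  abel

theorem nullSpin_zero : nullSpin 0 0 = 1 := by
  apply Subtype.ext
  rw [coe_nullSpin, nullGen_eq]
  simp [nullVec, Sig]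

theorem nullSpin_inv (b : Fin 8 → ℝ) (c : ℝ) : (nullSpin b c)⁻¹ = nullSpin (-b) (-c) := by
  rw [inv_eq_iff_mul_eq_one, nullSpin_mul, add_neg_cancel, add_neg_cancel, nullSpin_zero]

theorem vecAct_nullSpin (b : Fin 8 → ℝ) (c : ℝ) (u : Mink) :
    vecAct (nullSpin b c) u = u + mip ePlus u • nullVec b c
      - (mip (nullVec b c) u + 1 / 2 * mip ePlus u * mip (nullVec b c) (nullVec b c)) • ePlus := by
  apply vecAct_eq_of_mul
  have hv := mip_ePlus_nullVec b c
  rw [coe_nullSpin, nullGen_eq]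
  generalize nullVec b c = v at *
  have h1 : Sig ePlus v * ι Qmink u = ι Qmink u * Sig ePlus v
      + ι Qmink (mip ePlus u • v - mip v u • ePlus) := by
    rw [← lie_Sig, LieRing.of_associative_ring_bracket]; abel
  have h2 : ι Qmink ePlus * Sig ePlus v = 0 := by
    rw [Sig_ePlus hv, mul_smul_comm, ← mul_assoc, ι_sq_mink, mip_ePlus_self]; simp
  have h3 : ι Qmink v * Sig ePlus v = (1 / 2 * mip v v) • ι Qmink ePlus := by
    rw [Sig_ePlus hv, mul_smul_comm, ← mul_assoc, ι_mul_swap v, mip_comm v ePlus, hv, mul_zero,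
      zero_smul, zero_sub, neg_mul, mul_assoc, ι_sq_mink, mul_smul_comm, mul_one]
    module
  rw [add_mul, one_mul, h1, mul_add, mul_one]
  simp only [map_sub, map_add, map_smul, add_mul, sub_mul, smul_mul_assoc, h2, h3]
  module

theorem ePlus_ne_zero : ePlus ≠ 0 := fun h => by
  have := congrFun h 0; rw [ePlus_zero] at this; simp at this

theorem isNullRotation_nullSpin {b : Fin 8 → ℝ} {c : ℝ} (h : b ≠ 0 ∨ c ≠ 0) :
    IsNullRotation ePlus (vecAct (nullSpin b c)) := by
  have hpos : mip (nullVec b c) (nullVec b c) ≠ 0 := by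
    rw [mip_nullVec_self]
    intro h0
    have h1 : 0 ≤ b ⬝ᵥ b := Finset.sum_nonneg fun i _ => mul_self_nonneg _
    have hc : c = 0 := by nlinarith [mul_self_nonneg c]
    have hb : b ⬝ᵥ b = 0 := by nlinarith [mul_self_nonneg c]
    rcases h with h | h
    · exact h (dotProduct_self_eq_zero.1 hb)
    · exact h hc
  have hv := mip_ePlus_nullVec b c
  refine ⟨quadraticForm_vecAct _, ePlus_ne_zero, by rw [Qmink_eq_mip, mip_ePlus_self], ?_, ?_, ?_⟩
  · rw [vecAct_nullSpin, mip_ePlus_self, mip_comm, hv]; simp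
  · intro u hu
    have hu' : mip ePlus u = 0 := by rw [polar_eq_mip] at hu; linarith
    rw [vecAct_nullSpin, hu']
    exact Submodule.mem_span_singleton.2 ⟨-mip (nullVec b c) u, by module⟩
  · rintro u hu ⟨t, ht⟩
    rw [Qmink_eq_mip] at hu
    have hpu : mip ePlus u = 0 := by
      by_contra hne
      have h1 := congrArg (mip ePlus) ht
      rw [vecAct_nullSpin] at h1
      simp only [map_sub, map_add, map_smul, smul_eq_mul, hv, mip_ePlus_self, mul_zero, add_zero,
        sub_zero] at h1
      have ht1 : t = 1 := mul_right_cancel₀ hne (by linarith)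
      rw [ht1, one_smul, vecAct_nullSpin] at ht
      have h2 := congrArg (mip (nullVec b c)) ht
      simp only [map_sub, map_add, map_smul, smul_eq_mul, mip_comm (nullVec b c) ePlus, hv,
        mul_zero, sub_zero, add_eq_left] at h2
      exact (mul_ne_zero hne hpos) h2
    have h3 : u 9 = u 0 := by rw [mip_ePlus] at hpu; linarith
    rw [mip_apply, h3] at hu
    have h4 : 0 ≤ proj8 u ⬝ᵥ proj8 u := Finset.sum_nonneg fun i _ => mul_self_nonneg _
    have h5 : u 10 = 0 := by nlinarith [mul_self_nonneg (u 10)]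
    have h6 : proj8 u ⬝ᵥ proj8 u = 0 := by nlinarith [mul_self_nonneg (u 10)]
    refine Submodule.mem_span_singleton.2 ⟨u 0, ?_⟩
    conv_rhs => rw [mink_eq u, dotProduct_self_eq_zero.1 h6, h5, h3]
    simp [ePlus]

/-! ### The isotropy group and the isotropy algebra -/

variable {ψ : S8 → ℝ}

theorem gammaLin_eps (hchir : gammaP9 *ᵥ ψ = -ψ) (x : Mink) : gammaLin x *ᵥ eps ψ
    = Sum.elim (x 10 • ψ) (mip ePlus x • ψ + gammaPLin (proj8 x) *ᵥ ψ) := by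
  rw [gammaLin_blocks, eps, Matrix.fromBlocks_mulVec, mip_ePlus]
  simp only [Sum.elim_comp_inl, Sum.elim_comp_inr, Matrix.mulVec_zero, add_zero,
    Matrix.add_mulVec, Matrix.smul_mulVec, Matrix.one_mulVec, hchir]
  congr 1
  module

theorem dotProduct_gammaPLin (y : Fin 8 → ℝ) (ψ : S8 → ℝ) : ψ ⬝ᵥ (gammaPLin y *ᵥ ψ) = 0 := by
  have h : ψ ⬝ᵥ (gammaPLin y *ᵥ ψ) = -(ψ ⬝ᵥ (gammaPLin y *ᵥ ψ)) := by
    conv_lhs => rw [Matrix.dotProduct_mulVec, ← Matrix.mulVec_transpose, gammaPLin_transpose,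
      Matrix.neg_mulVec, neg_dotProduct, dotProduct_comm]
  linarith

theorem dotProduct_gamma0_gammaLin (hchir : gammaP9 *ᵥ ψ = -ψ) (x : Mink) :
    eps ψ ⬝ᵥ (gamma0 *ᵥ (gammaLin x *ᵥ eps ψ)) = (ψ ⬝ᵥ ψ) * mip ePlus x := by
  rw [gammaLin_eps hchir, gamma0, Matrix.fromBlocks_mulVec, eps, sumElim_dotProduct_sumElim]
  simp only [Sum.elim_comp_inl, Sum.elim_comp_inr, Matrix.zero_mulVec, zero_add, zero_dotProduct,
    add_zero, Matrix.neg_mulVec, dotProduct_neg]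
  rw [Matrix.dotProduct_mulVec, ← Matrix.mulVec_transpose, gammaP9_transpose, hchir,
    neg_dotProduct, neg_neg, dotProduct_add, dotProduct_gammaPLin, dotProduct_smul, smul_eq_mul]
  ring

theorem dotProduct_self_ne (hψ : ψ ≠ 0) : ψ ⬝ᵥ ψ ≠ 0 := fun h => hψ (dotProduct_self_eq_zero.1 h)

theorem eq_zero_of_gammaPLin {y : Fin 8 → ℝ} (hψ : ψ ≠ 0) (h : gammaPLin y *ᵥ ψ = 0) : y = 0 := by
  have h1 : (gammaPLin y * gammaPLin y) *ᵥ ψ = 0 := by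
    rw [← Matrix.mulVec_mulVec, h, Matrix.mulVec_zero]
  rw [gammaPLin_mul_self, Matrix.smul_mulVec, Matrix.one_mulVec] at h1
  have h2 := (smul_eq_zero.1 h1).resolve_right hψ
  have h3 : y ⬝ᵥ y = 0 := by
    have : y ⬝ᵥ y = ∑ i, y i ^ 2 := Finset.sum_congr rfl fun i _ => by ring
    linarith
  exact dotProduct_self_eq_zero.1 h3

theorem gammaLin_ePlus_eps (hchir : gammaP9 *ᵥ ψ = -ψ) : gammaLin ePlus *ᵥ eps ψ = 0 := by
  rw [gammaLin_eps hchir, ePlus_ten, mip_ePlus_self, proj8_ePlus]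
  ext (i | i) <;> simp

theorem gammaLin_e10_eps (hchir : gammaP9 *ᵥ ψ = -ψ) : gammaLin (e 10) *ᵥ eps ψ = eps ψ := by
  have h1 : proj8 (e 10) = 0 := by funext i; simp [proj8_apply, e_apply, idx8_ne_ten]
  rw [gammaLin_eps hchir, mip_ePlus, h1]
  ext (i | i) <;> simp [e_apply, eps]

theorem rho_nullGen_eps (hchir : gammaP9 *ᵥ ψ = -ψ) (b : Fin 8 → ℝ) (c : ℝ) :
    rho (nullGen b c) *ᵥ eps ψ = 0 := by
  rw [nullGen_eq, Sig_ePlus (mip_ePlus_nullVec b c), ι_mul_swap, mip_ePlus_nullVec, mul_zero,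
    zero_smul, zero_sub, map_smul, map_neg, map_mul, Matrix.smul_mulVec, Matrix.neg_mulVec,
    ← Matrix.mulVec_mulVec, rho_ι ePlus, gammaLin_ePlus_eps hchir]
  simp

theorem nullGen_mem_isotropy (hchir : gammaP9 *ᵥ ψ = -ψ) (b : Fin 8 → ℝ) (c : ℝ) :
    nullGen b c ∈ isotropyAlgebra (eps ψ) := ⟨nullGen_mem b c, rho_nullGen_eps hchir b c⟩

theorem exp_mem_expGroup {χ : S11 → ℝ} {X : Cl} (hX : X ∈ isotropyAlgebra χ) :
    (⟨NormedSpace.exp X, exp_mem_Spin101 hX.1⟩ : Spin101) ∈ expGroup χ :=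
  Subgroup.subset_closure ⟨X, hX, rfl⟩

theorem nullSpin_mem_expGroup (hchir : gammaP9 *ᵥ ψ = -ψ) (b : Fin 8 → ℝ) (c : ℝ) :
    nullSpin b c ∈ expGroup (eps ψ) := exp_mem_expGroup (nullGen_mem_isotropy hchir b c)

/-- The action of the Clifford algebra on a fixed spinor. -/
def actOn (χ : S11 → ℝ) : Cl →ₗ[ℝ] (S11 → ℝ) where
  toFun x := rho x *ᵥ χ
  map_add' x y := by rw [map_add, Matrix.add_mulVec]
  map_smul' c x := by rw [map_smul, Matrix.smul_mulVec, RingHom.id_apply]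

theorem actOn_apply (χ : S11 → ℝ) (x : Cl) : actOn χ x = rho x *ᵥ χ := rfl

theorem rho_exp_mulVec {χ : S11 → ℝ} {X : Cl} (h : rho X *ᵥ χ = 0) :
    rho (NormedSpace.exp X) *ᵥ χ = χ := by
  have h1 := clifford_map_hasSum_exp (actOn χ) X
  refine h1.unique ?_
  have h0 : ∀ n ∉ Finset.range 1, ((n.factorial : ℝ)⁻¹) • actOn χ (X ^ n) = 0 := by
    intro n hn
    rw [Finset.mem_range, not_lt] at hn
    obtain ⟨k, rfl⟩ := Nat.exists_eq_add_of_le hn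
    rw [add_comm, pow_succ, actOn_apply, map_mul, ← Matrix.mulVec_mulVec, h, Matrix.mulVec_zero,
      smul_zero]
  have := hasSum_sum_of_ne_finset_zero (L := SummationFilter.unconditional ℕ) h0
  simpa [actOn_apply] using this

theorem expGroup_le_isotropyGroup (χ : S11 → ℝ) : expGroup χ ≤ isotropyGroup χ := by
  refine (Subgroup.closure_le _).2 ?_
  rintro g ⟨X, hX, hg⟩
  change rho g *ᵥ χ = χ
  rw [hg]; exact rho_exp_mulVec hX.2

theorem isClosed_isotropyGroup (χ : S11 → ℝ) : IsClosed (isotropyGroup χ : Set Spin101) :=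
  isClosed_eq ((continuous_clifford_linear (actOn χ)).comp continuous_subtype_val) continuous_const

theorem mem_isotropyAlgebra_of_exp {χ : S11 → ℝ} {X : Cl}
    (h : ∀ t : ℝ, ∃ g ∈ isotropyGroup χ, (g : Cl) = NormedSpace.exp (t • X)) :
    X ∈ isotropyAlgebra χ := by
  refine ⟨mem_spinLie_of_exp (w := eta) eta_ne fun t => ?_, ?_⟩
  · obtain ⟨g, -, hg⟩ := h t
    exact hg ▸ g.2
  · funext s
    have d1 := clifford_hasDerivAt_exp (LinearMap.proj s ∘ₗ actOn χ) X 0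
    have hc : (fun t : ℝ => (LinearMap.proj s ∘ₗ actOn χ) (NormedSpace.exp (t • X)))
        = fun _ => χ s := by
      funext t
      obtain ⟨g, hg1, hg⟩ := h t
      rw [← hg]
      exact congrFun hg1 s
    rw [hc] at d1
    have := d1.unique (hasDerivAt_const (0 : ℝ) (χ s))
    simpa [actOn_apply] using this

theorem rho_transpose_mul (g : Spin101) : (rho g)ᵀ * gamma0 * rho g = gamma0 := by
  have h := congrArg rho (spinGroup.coe_star_mul_self g)
  rw [map_mul, map_one, rho_star] at h
  have h2 := congrArg (gamma0 * ·) h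
  simp only [mul_one] at h2
  have h3 : gamma0 * (-(gamma0 * (rho g)ᵀ * gamma0) * rho g)
      = -(gamma0 * gamma0) * ((rho g)ᵀ * gamma0 * rho g) := by noncomm_ring
  rw [h3, gamma0_sq, neg_neg, one_mul] at h2
  exact h2

theorem gammaLin_vecAct (g : Spin101) (v : Mink) :
    gammaLin (vecAct g v) * rho g = rho g * gammaLin v := by
  rw [← rho_ι, ← rho_ι, ← map_mul, ← map_mul, ι_vecAct_mul]

theorem dotProduct_gamma0_rho (g : Spin101) (χ χ' : S11 → ℝ) :
    (rho g *ᵥ χ) ⬝ᵥ (gamma0 *ᵥ (rho g *ᵥ χ')) = χ ⬝ᵥ (gamma0 *ᵥ χ') := by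
  rw [← Matrix.vecMul_transpose, ← Matrix.dotProduct_mulVec, Matrix.mulVec_mulVec,
    Matrix.mulVec_mulVec, rho_transpose_mul]

theorem vecAct_ePlus (hψ : ψ ≠ 0) (hchir : gammaP9 *ᵥ ψ = -ψ) {g : Spin101}
    (hg : g ∈ isotropyGroup (eps ψ)) : vecAct g ePlus = ePlus := by
  have hg' : rho g *ᵥ eps ψ = eps ψ := hg
  have key : ∀ v, mip ePlus (vecAct g v) = mip ePlus v := by
    intro v
    apply mul_left_cancel₀ (dotProduct_self_ne hψ)
    rw [← dotProduct_gamma0_gammaLin hchir, ← dotProduct_gamma0_gammaLin hchir]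
    conv_lhs => rw [← hg']
    rw [Matrix.mulVec_mulVec _ (gammaLin (vecAct g v)), gammaLin_vecAct,
      ← Matrix.mulVec_mulVec, dotProduct_gamma0_rho]
  refine mip_ext fun w => ?_
  nth_rewrite 1 [← vecAct_vecAct_inv g w]
  rw [mip_vecAct, mip_comm, ← key, vecAct_vecAct_inv, mip_comm]

/-- An isotropy element is a null rotation times an element fixing `e₀, e₉, e_♮`. -/
theorem exists_eq_nullSpin_mul (hψ : ψ ≠ 0) (hchir : gammaP9 *ᵥ ψ = -ψ) {g : Spin101}
    (hg : g ∈ isotropyGroup (eps ψ)) : ∃ (b : Fin 8 → ℝ) (c : ℝ), ∃ h ∈ isotropyGroup (eps ψ),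
      vecAct h (e 0) = e 0 ∧ vecAct h (e 9) = e 9 ∧ vecAct h (e 10) = e 10 ∧
      g = nullSpin b c * h := by
  have hgp := vecAct_ePlus hψ hchir hg
  let u := vecAct g (e 0 - e 9)
  have hm : mip ePlus (e 0 - e 9) = -2 := by
    rw [mip_ePlus]; simp [e_apply]; norm_num
  have hu1 : mip ePlus u = -2 := by
    have := mip_vecAct g ePlus (e 0 - e 9)
    rw [hgp, hm] at this
    exact this
  have hu2 : mip u u = 0 := by
    rw [mip_vecAct, mip_apply]
    have : proj8 (e 0 - e 9) = 0 := by
      funext i; simp [proj8_apply, e_apply, idx8_ne_zero, idx8_ne_nine]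
    rw [this]; simp [e_apply]
  let b : Fin 8 → ℝ := -(1 / 2 : ℝ) • proj8 u
  let c : ℝ := -(1 / 2 : ℝ) * u 10
  let h := (nullSpin b c)⁻¹ * g
  have hb : nullSpin b c ∈ isotropyGroup (eps ψ) :=
    expGroup_le_isotropyGroup _ (nullSpin_mem_expGroup hchir b c)
  have hh : h ∈ isotropyGroup (eps ψ) := mul_mem (inv_mem hb) hg
  have hnu : vecAct (nullSpin b c) (e 0 - e 9) = u := by
    rw [vecAct_nullSpin, hm, mip_nullVec_self]
    have h1 : mip (nullVec b c) (e 0 - e 9) = 0 := by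
      rw [mip_comm, map_sub, LinearMap.sub_apply, mip_single, mip_single]
      simp [nullVec, incl8_nine, incl8_zero_coord, e_apply]
    have h2 : u 9 = u 0 - 2 := by rw [mip_ePlus] at hu1; linarith
    have h3 : b ⬝ᵥ b = 1 / 4 * (proj8 u ⬝ᵥ proj8 u) := by
      simp only [b, smul_dotProduct, dotProduct_smul, smul_eq_mul]; ring
    rw [mip_apply, h2] at hu2
    have h4 : u 0 = 1 + 1 / 4 * (u 10 * u 10 + proj8 u ⬝ᵥ proj8 u) := by linarith
    rw [h1, h3]
    conv_rhs => rw [mink_eq u, h2, h4]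
    simp only [nullVec, b, c, map_smul, ePlus]
    module
  have hhm : vecAct h (e 0 - e 9) = e 0 - e 9 := by
    rw [vecAct_mul_apply]
    change vecAct _ u = _
    rw [← hnu, vecAct_inv_vecAct]
  have hhp : vecAct h (e 0 + e 9) = e 0 + e 9 := vecAct_ePlus hψ hchir hh
  have h0 : vecAct h (e 0) = e 0 := by
    have : e 0 = (1 / 2 : ℝ) • ((e 0 + e 9) + (e 0 - e 9)) := by module
    rw [this, map_smul, map_add, hhm, hhp]
  have h9 : vecAct h (e 9) = e 9 := by
    have : e 9 = (1 / 2 : ℝ) • ((e 0 + e 9) - (e 0 - e 9)) := by module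
    rw [this, map_smul, map_sub, hhm, hhp]
  refine ⟨b, c, h, hh, h0, h9, ?_, (mul_inv_cancel_left _ _).symm⟩
  have hx0 : vecAct h (e 10) 0 = 0 := by
    have := mip_vecAct h (e 0) (e 10)
    rw [h0, mip_single, mip_single] at this
    simpa [eta_ne, e_apply] using this
  have hx9 : vecAct h (e 10) 9 = 0 := by
    have := mip_vecAct h (e 9) (e 10)
    rw [h9, mip_single, mip_single] at this
    simpa [eta_ne, e_apply] using this
  have hε : gammaLin (vecAct h (e 10)) *ᵥ eps ψ = eps ψ := by
    have hh' : rho h *ᵥ eps ψ = eps ψ := hh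
    nth_rewrite 1 [← hh']
    rw [Matrix.mulVec_mulVec, gammaLin_vecAct, ← Matrix.mulVec_mulVec, gammaLin_e10_eps hchir, hh']
  rw [gammaLin_eps hchir, mip_ePlus, hx0, hx9, sub_zero, zero_smul, zero_add] at hε
  have hl : vecAct h (e 10) 10 • ψ = ψ := by
    funext i; exact congrFun hε (Sum.inl i)
  have hr : gammaPLin (proj8 (vecAct h (e 10))) *ᵥ ψ = 0 := by
    funext i; exact congrFun hε (Sum.inr i)
  have hx10 : vecAct h (e 10) 10 = 1 := by
    have : (vecAct h (e 10) 10 - 1) • ψ = 0 := by rw [sub_smul, hl, one_smul, sub_self]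
    have := (smul_eq_zero.1 this).resolve_right hψ
    linarith
  rw [mink_eq (vecAct h (e 10)), hx0, hx9, hx10, eq_zero_of_gammaPLin hψ hr]
  simp

theorem mink_eq_of_lie {X Y : Cl} (hX : X ∈ spinLie Qmink) (hY : Y ∈ spinLie Qmink)
    (h : ∀ M, ⁅X, ι Qmink (e M)⁆ = ⁅Y, ι Qmink (e M)⁆) : X = Y :=
  eq_of_lie_ι_eq (w := eta) eta_ne hX hY h

/-- The infinitesimal action of `so_{10,1}` on vectors. -/
def lieAct {X : Cl} (hX : X ∈ spinLie Qmink) : Mink →ₗ[ℝ] Mink :=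
  vecPart ∘ₗ (LinearMap.mulLeft ℝ X - LinearMap.mulRight ℝ X) ∘ₗ ι Qmink

theorem ι_lieAct {X : Cl} (hX : X ∈ spinLie Qmink) (v : Mink) :
    ι Qmink (lieAct hX v) = ⁅X, ι Qmink v⁆ := by
  obtain ⟨u, hu⟩ := lie_ι_of_mem_spinLie hX v
  simp only [lieAct, LinearMap.comp_apply, LinearMap.sub_apply, LinearMap.mulLeft_apply,
    LinearMap.mulRight_apply, LieRing.of_associative_ring_bracket]
  rw [hu, vecPart_ι]

theorem mip_lieAct {X : Cl} (hX : X ∈ spinLie Qmink) (u v : Mink) :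
    mip (lieAct hX u) v = -mip u (lieAct hX v) := by
  have h := congrArg (fun z : Cl => ⁅X, z⁆) (ι_mul_swap u v)
  have hl (a b : Cl) : ⁅X, a * b⁆ = ⁅X, a⁆ * b + a * ⁅X, b⁆ := by
    simp only [LieRing.of_associative_ring_bracket]; noncomm_ring
  have h1 : ⁅X, (2 * mip u v) • (1 : Cl)⁆ = 0 := by
    rw [lie_smul, LieRing.of_associative_ring_bracket]; simp
  simp only [lie_sub, hl, h1, zero_sub, ← ι_lieAct hX] at h
  rw [ι_mul_swap (lieAct hX u), ι_mul_swap u (lieAct hX v)] at h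
  have h2 : (2 * (mip (lieAct hX u) v + mip u (lieAct hX v))) • (1 : Cl) = 0 := by
    have : (2 * (mip (lieAct hX u) v + mip u (lieAct hX v))) • (1 : Cl)
      = (2 * mip (lieAct hX u) v) • (1 : Cl) - ι Qmink v * ι Qmink (lieAct hX u)
      + ((2 * mip u (lieAct hX v)) • (1 : Cl) - ι Qmink (lieAct hX v) * ι Qmink u)
      + (ι Qmink (lieAct hX v) * ι Qmink u + ι Qmink v * ι Qmink (lieAct hX u)) := by module
    rw [this, h]; abel
  have h3 := (smul_eq_zero.1 h2).resolve_right one_ne_zero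
  linarith

end ExoticSpinor
end

noncomputable section
namespace ExoticSpinor
open CliffordAlgebra

variable {ψ : S8 → ℝ}

theorem rho_transpose_of_mem_spinLie {X : Cl} (hX : X ∈ spinLie Qmink) :
    (rho X)ᵀ * gamma0 = -(gamma0 * rho X) := by
  have h := congrArg rho (star_of_mem_spinLie hX)
  rw [rho_star, map_neg, neg_inj] at h
  have h1 : gamma0 * (gamma0 * (rho X)ᵀ * gamma0) = (gamma0 * gamma0) * ((rho X)ᵀ * gamma0) := by
    noncomm_ring
  rw [h, gamma0_sq, neg_one_mul] at h1
  rw [h1, neg_neg]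

theorem gammaLin_lieAct {X : Cl} (hX : X ∈ spinLie Qmink) (v : Mink) :
    gammaLin (lieAct hX v) = rho X * gammaLin v - gammaLin v * rho X := by
  rw [← rho_ι, ι_lieAct, LieRing.of_associative_ring_bracket, map_sub, map_mul, map_mul, rho_ι]

theorem lieAct_ePlus (hψ : ψ ≠ 0) (hchir : gammaP9 *ᵥ ψ = -ψ) {X : Cl}
    (hX : X ∈ isotropyAlgebra (eps ψ)) : lieAct hX.1 ePlus = 0 := by
  have key : ∀ v, mip ePlus (lieAct hX.1 v) = 0 := by
    intro v
    apply mul_left_cancel₀ (dotProduct_self_ne hψ)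
    rw [← dotProduct_gamma0_gammaLin hchir, gammaLin_lieAct, Matrix.sub_mulVec,
      ← Matrix.mulVec_mulVec _ (gammaLin v), hX.2, Matrix.mulVec_zero, sub_zero,
      Matrix.mulVec_mulVec, ← mul_assoc, ← neg_neg (gamma0 * rho X),
      ← rho_transpose_of_mem_spinLie hX.1, neg_mul, Matrix.neg_mulVec, mul_assoc,
      ← Matrix.mulVec_mulVec _ (rho X)ᵀ,
      dotProduct_neg, Matrix.dotProduct_mulVec, Matrix.vecMul_transpose, hX.2, zero_dotProduct,
      neg_zero, mul_zero]
  refine mip_ext fun w => ?_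
  rw [mip_comm, mip_lieAct, key, neg_zero, map_zero]

/-- An element of the isotropy algebra is an infinitesimal null rotation plus an element
annihilating `e₀, e₉, e_♮`. -/
theorem exists_eq_nullGen_add (hψ : ψ ≠ 0) (hchir : gammaP9 *ᵥ ψ = -ψ) {X : Cl}
    (hX : X ∈ isotropyAlgebra (eps ψ)) : ∃ (b : Fin 8 → ℝ) (c : ℝ) (Y : Cl)
      (hY : Y ∈ isotropyAlgebra (eps ψ)), lieAct hY.1 (e 0) = 0 ∧ lieAct hY.1 (e 9) = 0 ∧
      lieAct hY.1 (e 10) = 0 ∧ X = Y + nullGen b c := by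
  have hXp := lieAct_ePlus hψ hchir hX
  let u := lieAct hX.1 (e 0 - e 9)
  have hu1 : mip ePlus u = 0 := by
    have := mip_lieAct hX.1 ePlus (e 0 - e 9)
    rw [hXp, map_zero, LinearMap.zero_apply] at this
    change mip ePlus (lieAct hX.1 (e 0 - e 9)) = 0
    linarith
  have hu2 : mip (e 0 - e 9) u = 0 := by
    have := mip_lieAct hX.1 (e 0 - e 9) (e 0 - e 9)
    rw [mip_comm] at this
    change mip (e 0 - e 9) (lieAct hX.1 (e 0 - e 9)) = 0
    linarith
  have hu0 : u 0 = 0 ∧ u 9 = 0 := by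
    rw [mip_ePlus] at hu1
    rw [map_sub, LinearMap.sub_apply, mip_single, mip_single] at hu2
    have h9 : eta 9 = 1 := if_neg (by decide)
    have h0 : eta 0 = -1 := if_pos rfl
    rw [h9, h0] at hu2
    constructor <;> linarith
  let b : Fin 8 → ℝ := -(1 / 2 : ℝ) • proj8 u
  let c : ℝ := -(1 / 2 : ℝ) * u 10
  have hY : X - nullGen b c ∈ isotropyAlgebra (eps ψ) := sub_mem hX (nullGen_mem_isotropy hchir b c)
  have hv := mip_ePlus_nullVec b c
  have hact (v : Mink) : lieAct hY.1 v
      = lieAct hX.1 v - (mip ePlus v • nullVec b c - mip (nullVec b c) v • ePlus) := by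
    apply ι_inj (Q := Qmink)
    rw [ι_lieAct, map_sub, ι_lieAct, ← lie_Sig, ← nullGen_eq, sub_lie]
  have hm : mip ePlus (e 0 - e 9) = -2 := by
    rw [mip_ePlus]; simp [e_apply]; norm_num
  have hminus : lieAct hY.1 (e 0 - e 9) = 0 := by
    have h1 : mip (nullVec b c) (e 0 - e 9) = 0 := by
      rw [mip_comm, map_sub, LinearMap.sub_apply, mip_single, mip_single]
      simp [nullVec, incl8_nine, incl8_zero_coord, e_apply]
    rw [hact, hm, h1]
    change u - _ = 0
    rw [mink_eq u, hu0.1, hu0.2]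
    simp only [nullVec, b, c, map_smul]
    module
  have hplus : lieAct hY.1 (e 0 + e 9) = 0 := lieAct_ePlus hψ hchir hY
  have h0 : lieAct hY.1 (e 0) = 0 := by
    have : e 0 = (1 / 2 : ℝ) • ((e 0 + e 9) + (e 0 - e 9)) := by module
    rw [this, map_smul, map_add, hminus, hplus]; simp
  have h9 : lieAct hY.1 (e 9) = 0 := by
    have : e 9 = (1 / 2 : ℝ) • ((e 0 + e 9) - (e 0 - e 9)) := by module
    rw [this, map_smul, map_sub, hminus, hplus]; simp
  refine ⟨b, c, _, hY, h0, h9, ?_, by abel⟩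
  have hx0 : lieAct hY.1 (e 10) 0 = 0 := by
    have := mip_lieAct hY.1 (e 0) (e 10)
    rw [h0, map_zero, LinearMap.zero_apply, mip_single] at this
    simpa [eta_ne] using this
  have hx9 : lieAct hY.1 (e 10) 9 = 0 := by
    have := mip_lieAct hY.1 (e 9) (e 10)
    rw [h9, map_zero, LinearMap.zero_apply, mip_single] at this
    simpa [eta_ne] using this
  have hε : gammaLin (lieAct hY.1 (e 10)) *ᵥ eps ψ = 0 := by
    rw [gammaLin_lieAct, Matrix.sub_mulVec, ← Matrix.mulVec_mulVec, ← Matrix.mulVec_mulVec,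
      gammaLin_e10_eps hchir, hY.2]
    simp
  rw [gammaLin_eps hchir, mip_ePlus, hx0, hx9, sub_zero, zero_smul, zero_add] at hε
  have hl : lieAct hY.1 (e 10) 10 • ψ = 0 := by
    funext i; exact congrFun hε (Sum.inl i)
  have hr : gammaPLin (proj8 (lieAct hY.1 (e 10))) *ᵥ ψ = 0 := by
    funext i; exact congrFun hε (Sum.inr i)
  rw [mink_eq (lieAct hY.1 (e 10)), hx0, hx9, (smul_eq_zero.1 hl).resolve_right hψ,
    eq_zero_of_gammaPLin hψ hr]
  simp

theorem proj8_e (i : Fin 8) : proj8 (e (idx8 i)) = Pi.single i 1 := by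
  funext j; simp [proj8_apply, e_apply, idx8_injective.eq_iff, Pi.single_apply]

theorem gammaLin_idx8 (i : Fin 8) :
    gammaLin (e (idx8 i)) = Matrix.fromBlocks 0 (-gammaP i) (gammaP i) 0 := by
  have h : gammaPLin (Pi.single i 1) = gammaP i := by
    have : gammaPLin (Pi.single i 1) = ∑ j, (Pi.single i 1 : Fin 8 → ℝ) j • gammaP j := rfl
    rw [this, Finset.sum_eq_single i]
    · simp
    · intro j _ hj; simp [hj]
    · simp
  rw [gammaLin_blocks, proj8_e, h]
  simp [e_apply, (idx8_ne_zero i).symm, (idx8_ne_nine i).symm, (idx8_ne_ten i).symm]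

theorem rho_Sig_idx8 (i j : Fin 8) : rho (Sig (e (idx8 i)) (e (idx8 j)))
    = Matrix.fromBlocks (SigP i j) 0 0 (SigP i j) := by
  rw [Sig, map_smul, LieRing.of_associative_ring_bracket, map_sub, map_mul, map_mul, rho_ι, rho_ι,
    gammaLin_idx8, gammaLin_idx8, Matrix.fromBlocks_multiply, Matrix.fromBlocks_multiply,
    SigP, LieRing.of_associative_ring_bracket]
  ext (a | a) (b | b) <;> simp <;> ring

/-- The rotation generators of `𝔼⁸`. -/
def rotGen (a : Matrix (Fin 8) (Fin 8) ℝ) : Cl :=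
  (1 / 2 : ℝ) • ∑ i, ∑ j, a i j • Sig (e (idx8 i)) (e (idx8 j))

theorem rotGen_mem (a : Matrix (Fin 8) (Fin 8) ℝ) : rotGen a ∈ spinLie Qmink := by
  refine (spinLie Qmink).smul_mem _ ?_
  refine sum_mem fun i _ => sum_mem fun j _ => (spinLie Qmink).smul_mem _ (Sig_mem _ _)

theorem rho_rotGen (a : Matrix (Fin 8) (Fin 8) ℝ) : rho (rotGen a)
    = Matrix.fromBlocks ((1 / 2 : ℝ) • ∑ i, ∑ j, a i j • SigP i j) 0 0
      ((1 / 2 : ℝ) • ∑ i, ∑ j, a i j • SigP i j) := by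
  simp only [rotGen, map_smul, map_sum, rho_Sig_idx8]
  ext (a | a) (b | b) <;> simp [Matrix.sum_apply]

theorem rho_rotGen_eps (a : Matrix (Fin 8) (Fin 8) ℝ) : rho (rotGen a) *ᵥ eps ψ
    = eps (((1 / 2 : ℝ) • ∑ i, ∑ j, a i j • SigP i j) *ᵥ ψ) := by
  rw [rho_rotGen, eps, Matrix.fromBlocks_mulVec]
  ext (i | i) <;> simp [eps, Sum.elim_comp_inl, Sum.elim_comp_inr]

theorem lie_rotGen {a : Matrix (Fin 8) (Fin 8) ℝ} (ha : aᵀ = -a) (v : Mink) :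
    ⁅rotGen a, ι Qmink v⁆ = ι Qmink (incl8 (aᵀ *ᵥ proj8 v)) := by
  have ha' (i j : Fin 8) : a i j = -a j i := by
    have := congrFun (congrFun ha j) i
    simpa using this
  have hm (i : Fin 8) : mip (e (idx8 i)) v = proj8 v i := by
    rw [mip_single, eta_idx8, one_mul]; rfl
  rw [rotGen, smul_lie, sum_lie]
  simp only [sum_lie, smul_lie, lie_Sig, ← map_smul, ← map_sum]
  congr 1
  simp only [hm, smul_sub, Finset.sum_sub_distrib]
  have h1 : ∑ i, ∑ j, a i j • proj8 v j • e (idx8 i)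
      = -∑ i, ∑ j, a i j • proj8 v i • e (idx8 j) := by
    rw [Finset.sum_comm, ← Finset.sum_neg_distrib]
    refine Finset.sum_congr rfl fun i _ => ?_
    rw [← Finset.sum_neg_distrib]
    refine Finset.sum_congr rfl fun j _ => ?_
    rw [ha' j i]; module
  rw [h1, smul_neg, sub_neg_eq_add, ← add_smul, incl8_eq]
  norm_num
  rw [Finset.sum_comm]
  refine Finset.sum_congr rfl fun i _ => ?_
  rw [Matrix.mulVec, dotProduct, Finset.sum_smul]
  refine Finset.sum_congr rfl fun j _ => ?_
  rw [smul_smul, Matrix.transpose_apply]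

theorem eq_rotGen_of_lieAct {Y : Cl} (hY : Y ∈ spinLie Qmink) (h0 : lieAct hY (e 0) = 0)
    (h9 : lieAct hY (e 9) = 0) (h10 : lieAct hY (e 10) = 0) :
    ∃ a : Matrix (Fin 8) (Fin 8) ℝ, aᵀ = -a ∧ Y = rotGen a := by
  let a : Matrix (Fin 8) (Fin 8) ℝ := Matrix.of fun i j => lieAct hY (e (idx8 i)) (idx8 j)
  have hskew (M N : Fin 11) : eta N * lieAct hY (e M) N = -(eta M * lieAct hY (e N) M) := by
    rw [← mip_single, ← mip_single, mip_comm, mip_lieAct]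
  have ha : aᵀ = -a := by
    ext i j
    have := hskew (idx8 j) (idx8 i)
    rw [eta_idx8, eta_idx8, one_mul, one_mul] at this
    exact this
  have hz (M : Fin 11) (i : Fin 8) (hM : lieAct hY (e M) = 0) : lieAct hY (e (idx8 i)) M = 0 := by
    have := hskew (idx8 i) M
    rw [hM, Pi.zero_apply, mul_zero, neg_zero] at this
    exact (mul_eq_zero.1 this).resolve_left (eta_ne M)
  refine ⟨a, ha, mink_eq_of_lie hY (rotGen_mem a) fun M => ?_⟩
  rw [← ι_lieAct hY, lie_rotGen ha]
  congr 1
  refine fin11_cases (p := fun M => lieAct hY (e M) = incl8 (aᵀ *ᵥ proj8 (e M))) ?_ ?_ ?_ ?_ M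
  · have : proj8 (e 0) = 0 := by funext i; simp [proj8_apply, e_apply, idx8_ne_zero]
    rw [this, h0]; simp
  · have : proj8 (e 9) = 0 := by funext i; simp [proj8_apply, e_apply, idx8_ne_nine]
    rw [this, h9]; simp
  · have : proj8 (e 10) = 0 := by funext i; simp [proj8_apply, e_apply, idx8_ne_ten]
    rw [this, h10]; simp
  · intro i
    rw [proj8_e, mink_eq (lieAct hY (e (idx8 i))), hz 0 i h0, hz 9 i h9, hz 10 i h10]
    simp only [zero_smul, zero_add, add_zero]
    congr 1
    funext j
    simp [a, proj8_apply]

theorem mem_isotropyAlgebra_iff (hψ : ψ ≠ 0) (hchir : gammaP9 *ᵥ ψ = -ψ) (X : Cl) :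
    X ∈ isotropyAlgebra (eps ψ) ↔
      ∃ (a : Matrix (Fin 8) (Fin 8) ℝ) (b : Fin 8 → ℝ) (c : ℝ), aᵀ = -a ∧
        ((1 / 2 : ℝ) • ∑ i, ∑ j, a i j • SigP i j) *ᵥ ψ = 0 ∧
        X = (1 / 2 : ℝ) • ∑ i, ∑ j, a i j • Sig (e (idx8 i)) (e (idx8 j)) + nullGen b c := by
  constructor
  · intro hX
    obtain ⟨b, c, Y, hY, h0, h9, h10, rfl⟩ := exists_eq_nullGen_add hψ hchir hX
    obtain ⟨a, ha, hYa⟩ := eq_rotGen_of_lieAct hY.1 h0 h9 h10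
    refine ⟨a, b, c, ha, ?_, by rw [hYa]; rfl⟩
    have := hY.2
    rw [hYa, rho_rotGen_eps] at this
    funext i
    exact congrFun this (Sum.inl i)
  · rintro ⟨a, b, c, -, ha, rfl⟩
    have hr : rotGen a ∈ isotropyAlgebra (eps ψ) := ⟨rotGen_mem a, ?_⟩
    · exact add_mem hr (nullGen_mem_isotropy hchir b c)
    rw [rho_rotGen_eps, ha]
    ext (i | i) <;> simp [eps]

/-! ### Reducibility and indecomposability -/

theorem exists_invariant_subspace (hψ : ψ ≠ 0) (hchir : gammaP9 *ᵥ ψ = -ψ) :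
    ∃ U : Submodule ℝ Mink, U ≠ ⊥ ∧ U ≠ ⊤ ∧
      ∀ g ∈ expGroup (eps ψ), ∀ v ∈ U, vecAct g v ∈ U := by
  refine ⟨Submodule.span ℝ {ePlus}, ?_, ?_, ?_⟩
  · rw [Ne, Submodule.span_singleton_eq_bot]; exact ePlus_ne_zero
  · intro h
    have h1 : e 10 ∈ Submodule.span ℝ {ePlus} := by rw [h]; trivial
    obtain ⟨c, hc⟩ := Submodule.mem_span_singleton.1 h1
    have := congrFun hc 10
    rw [Pi.smul_apply, ePlus_ten] at this
    simp [e_apply] at this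
  · intro g hg v hv
    obtain ⟨c, rfl⟩ := Submodule.mem_span_singleton.1 hv
    rw [map_smul, vecAct_ePlus hψ hchir (expGroup_le_isotropyGroup _ hg)]
    exact hv

theorem eq_top_of_invariant {U : Submodule ℝ Mink} (hchir : gammaP9 *ᵥ ψ = -ψ)
    (hU : ∀ g ∈ expGroup (eps ψ), ∀ v ∈ U, vecAct g v ∈ U) {u : Mink} (hu : u ∈ U)
    (hne : mip ePlus u ≠ 0) : U = ⊤ := by
  have hn (b c) : mip ePlus u • nullVec b c
      - (mip (nullVec b c) u + 1 / 2 * mip ePlus u * mip (nullVec b c) (nullVec b c)) • ePlus ∈ U := by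
    have h := U.sub_mem (hU _ (nullSpin_mem_expGroup hchir b c) u hu) hu
    rw [vecAct_nullSpin] at h
    convert h using 1; module
  have hneg (b c) : nullVec (-b) (-c) = -nullVec b c := by
    simp only [nullVec, map_neg]; module
  have hp : ePlus ∈ U := by
    have h := U.add_mem (hn 0 1) (hn (-0) (-1))
    rw [hneg] at h
    have h1 := mip_nullVec_self 0 1
    have h2 : mip ePlus u • nullVec 0 1 - (mip (nullVec 0 1) u
        + 1 / 2 * mip ePlus u * mip (nullVec 0 1) (nullVec 0 1)) • ePlus
        + (mip ePlus u • -nullVec 0 1 - (mip (-nullVec 0 1) u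
        + 1 / 2 * mip ePlus u * mip (-nullVec 0 1) (-nullVec 0 1)) • ePlus)
        = (-mip ePlus u) • ePlus := by
      simp only [map_neg, LinearMap.neg_apply, neg_neg, h1]
      simp only [mul_one, zero_dotProduct, add_zero]
      module
    rw [h2] at h
    exact (U.smul_mem_iff (neg_ne_zero.2 hne)).1 h
  have hv (b c) : nullVec b c ∈ U := by
    have h := U.add_mem (hn b c) (U.smul_mem
      (mip (nullVec b c) u + 1 / 2 * mip ePlus u * mip (nullVec b c) (nullVec b c)) hp)
    rw [sub_add_cancel] at h
    exact (U.smul_mem_iff hne).1 h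
  have hdec (x : Mink) : x = nullVec (proj8 x) (x 10) + x 0 • ePlus + (x 9 - x 0) • e 9 := by
    conv_lhs => rw [mink_eq x]
    simp only [nullVec, ePlus]; module
  have h9 : e 9 ∈ U := by
    have h := U.sub_mem hu (U.add_mem (hv (proj8 u) (u 10)) (U.smul_mem (u 0) hp))
    have h' : u - (nullVec (proj8 u) (u 10) + u 0 • ePlus) = mip ePlus u • e 9 := by
      rw [mip_ePlus]
      nth_rewrite 1 [hdec u]; abel
    rw [h'] at h
    exact (U.smul_mem_iff hne).1 h
  rw [eq_top_iff]
  intro x _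
  rw [hdec x]
  exact U.add_mem (U.add_mem (hv _ _) (U.smul_mem _ hp)) (U.smul_mem _ h9)

theorem indecomposable (hchir : gammaP9 *ᵥ ψ = -ψ) (U W : Submodule ℝ Mink) (hUW : IsCompl U W)
    (hU : ∀ g ∈ expGroup (eps ψ), ∀ v ∈ U, vecAct g v ∈ U)
    (hW : ∀ g ∈ expGroup (eps ψ), ∀ v ∈ W, vecAct g v ∈ W) : U = ⊥ ∨ W = ⊥ := by
  by_cases h1 : ∃ u ∈ U, mip ePlus u ≠ 0
  · obtain ⟨u, hu, hne⟩ := h1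
    right
    have := hUW.inf_eq_bot
    rwa [eq_top_of_invariant hchir hU hu hne, top_inf_eq] at this
  by_cases h2 : ∃ u ∈ W, mip ePlus u ≠ 0
  · obtain ⟨u, hu, hne⟩ := h2
    left
    have := hUW.inf_eq_bot
    rwa [eq_top_of_invariant hchir hW hu hne, inf_top_eq] at this
  push Not at h1 h2
  exfalso
  have h9 : e 9 ∈ U ⊔ W := by rw [hUW.sup_eq_top]; trivial
  obtain ⟨u, hu, w, hw, huw⟩ := Submodule.mem_sup.1 h9
  have h3 : mip ePlus (e 9) = 0 := by rw [← huw, map_add, h1 u hu, h2 w hw, add_zero]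
  rw [mip_ePlus] at h3
  simp [e_apply] at h3

end ExoticSpinor
end

noncomputable section
namespace ExoticSpinor
open CliffordAlgebra

/-! ### Spin elements with a given matrix -/

section Faithful

variable {n : ℕ} {w : Fin n → ℝ} [NeZero n] {B : Type*} [Ring B] [Nontrivial B] [Algebra ℝ B]
  (f : CliffordAlgebra (diagForm w) →ₐ[ℝ] B)

theorem involute_star {V : Type*} [AddCommGroup V] [Module ℝ V] {Q : QuadraticForm ℝ V}
    {x : CliffordAlgebra Q} (hx : involute x = x) : involute (star x) = star x := by
  rw [star_def, hx, ← reverse_involute, hx]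

theorem mem_spinGroup_of_map (hw : ∀ i, w i ≠ 0) {x : CliffordAlgebra (diagForm w)}
    (hx : involute x = x) (h1 : f (star x) * f x = 1) (h2 : f x * f (star x) = 1)
    (hv : ∀ v, ∃ v', f x * f (ι (diagForm w) v) = f (ι (diagForm w) v') * f x) :
    x ∈ spinGroup (diagForm w) := by
  have hs := involute_star hx
  refine mem_spinGroup_of hw hx ?_ ?_ fun v => ?_
  · exact eq_of_map_eq_of_even hw f (by rw [map_mul, hx, hs]) (map_one _)
      (by rw [map_mul, h1, map_one])
  · exact eq_of_map_eq_of_even hw f (by rw [map_mul, hx, hs]) (map_one _)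
      (by rw [map_mul, h2, map_one])
  · obtain ⟨v', hv'⟩ := hv v
    exact ⟨v', eq_of_map_eq_of_odd hw f (by rw [map_mul, hx, involute_ι, mul_neg])
      (by rw [map_mul, hx, involute_ι, neg_mul]) (by rw [map_mul, map_mul, hv'])⟩

theorem mem_spinLie_of_map (hw : ∀ i, w i ≠ 0) {x : CliffordAlgebra (diagForm w)}
    (hx : involute x = x) (h1 : f (star x) = -f x)
    (hv : ∀ v, ∃ v', f x * f (ι (diagForm w) v) - f (ι (diagForm w) v) * f x
      = f (ι (diagForm w) v')) :
    x ∈ spinLie (diagForm w) := by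
  refine mem_spinLie_of hw hx ?_ fun v => ?_
  · exact eq_of_map_eq_of_even hw f (involute_star hx) (by rw [map_neg, hx])
      (by rw [map_neg, h1])
  · obtain ⟨v', hv'⟩ := hv v
    exact ⟨v', eq_of_map_eq_of_odd hw f
      (by rw [map_sub, map_mul, map_mul, hx, involute_ι]; noncomm_ring)
      (involute_ι _) (by rw [map_sub, map_mul, map_mul, hv'])⟩

end Faithful

/-- The even element of `Cl_{1,10}` with a given matrix. -/
def rhoSec : Matrix S11 S11 ℝ →ₗ[ℝ] Cl :=
  (exists_evenSection (w := eta) eta_ne rho (by simp)).choose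

theorem rho_rhoSec (D : Matrix S11 S11 ℝ) : rho (rhoSec D) = D :=
  (exists_evenSection (w := eta) eta_ne rho (by simp)).choose_spec.1 D

theorem involute_rhoSec (D : Matrix S11 S11 ℝ) : involute (rhoSec D) = rhoSec D :=
  (exists_evenSection (w := eta) eta_ne rho (by simp)).choose_spec.2 D

theorem rho_even_inj {x y : Cl} (hx : involute x = x) (hy : involute y = y) (h : rho x = rho y) :
    x = y := eq_of_map_eq_of_even (w := eta) eta_ne rho hx hy h

theorem rho_odd_inj {x y : Cl} (hx : involute x = -x) (hy : involute y = -y) (h : rho x = rho y) :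
    x = y := eq_of_map_eq_of_odd (w := eta) eta_ne rho hx hy h

theorem Spin101_ext {g h : Spin101} (H : rho g = rho h) : g = h :=
  Subtype.ext (rho_even_inj (spinGroup.involute_eq g.2) (spinGroup.involute_eq h.2) H)

/-- The even element of `Cl₇` with a given matrix. -/
def rho7Sec : Matrix (Fin 8) (Fin 8) ℝ →ₗ[ℝ] CliffordAlgebra Q7 :=
  (exists_evenSection (w := negW 7) negW_ne rho7 (by simp)).choose

theorem rho7_rho7Sec (D : Matrix (Fin 8) (Fin 8) ℝ) : rho7 (rho7Sec D) = D :=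
  (exists_evenSection (w := negW 7) negW_ne rho7 (by simp)).choose_spec.1 D

theorem involute_rho7Sec (D : Matrix (Fin 8) (Fin 8) ℝ) : involute (rho7Sec D) = rho7Sec D :=
  (exists_evenSection (w := negW 7) negW_ne rho7 (by simp)).choose_spec.2 D

theorem rho7_even_inj {x y : CliffordAlgebra Q7} (hx : involute x = x) (hy : involute y = y)
    (h : rho7 x = rho7 y) : x = y := eq_of_map_eq_of_even (w := negW 7) negW_ne rho7 hx hy h

theorem rho7_odd_inj {x y : CliffordAlgebra Q7} (hx : involute x = -x) (hy : involute y = -y)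
    (h : rho7 x = rho7 y) : x = y := eq_of_map_eq_of_odd (w := negW 7) negW_ne rho7 hx hy h

theorem rhoSec_mem_spinGroup {D : Matrix S11 S11 ℝ} (h0 : D * gamma0 = gamma0 * D)
    (h1 : Dᵀ * D = 1) (hv : ∀ v, ∃ v', D * gammaLin v = gammaLin v' * D) :
    rhoSec D ∈ spinGroup Qmink := by
  have h1' : D * Dᵀ = 1 := mul_eq_one_comm.1 h1
  have h2 : gamma0 * Dᵀ = Dᵀ * gamma0 := by
    calc gamma0 * Dᵀ = Dᵀ * D * gamma0 * Dᵀ := by rw [h1, one_mul]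
      _ = Dᵀ * gamma0 * (D * Dᵀ) := by rw [mul_assoc Dᵀ D, h0]; noncomm_ring
      _ = _ := by rw [h1', mul_one]
  have hs : rho (star (rhoSec D)) = Dᵀ := by
    rw [rho_star, rho_rhoSec, h2, mul_assoc, gamma0_sq]; simp
  refine mem_spinGroup_of_map (w := eta) rho eta_ne (involute_rhoSec D) ?_ ?_ fun v => ?_
  · exact (congrArg₂ (· * ·) hs (rho_rhoSec D)).trans h1
  · exact (congrArg₂ (· * ·) (rho_rhoSec D) hs).trans h1'
  · obtain ⟨v', hv'⟩ := hv v
    refine ⟨v', ?_⟩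
    change rho (rhoSec D) * rho (ι Qmink v) = rho (ι Qmink v') * rho (rhoSec D)
    rw [rho_rhoSec, rho_ι, rho_ι, hv']

theorem rhoSec_mem_spinLie {D : Matrix S11 S11 ℝ} (h0 : D * gamma0 = gamma0 * D)
    (h1 : Dᵀ = -D) (hv : ∀ v, ∃ v', D * gammaLin v - gammaLin v * D = gammaLin v') :
    rhoSec D ∈ spinLie Qmink := by
  have hs : rho (star (rhoSec D)) = -D := by
    rw [rho_star, rho_rhoSec, h1, mul_neg, neg_mul, neg_neg, ← h0, mul_assoc, gamma0_sq]; simp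
  refine mem_spinLie_of_map (w := eta) rho eta_ne (involute_rhoSec D) ?_ fun v => ?_
  · exact hs.trans (congrArg Neg.neg (rho_rhoSec D)).symm
  · obtain ⟨v', hv'⟩ := hv v
    refine ⟨v', ?_⟩
    change rho (rhoSec D) * rho (ι Qmink v) - rho (ι Qmink v) * rho (rhoSec D) = rho (ι Qmink v')
    rw [rho_rhoSec, rho_ι, rho_ι, hv']

theorem rho7Sec_mem_spinGroup {D : Matrix (Fin 8) (Fin 8) ℝ}
    (h1 : Dᵀ * D = 1) (hv : ∀ v, ∃ v', D * octLin v = octLin v' * D) :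
    rho7Sec D ∈ spinGroup Q7 := by
  have hs : rho7 (star (rho7Sec D)) = Dᵀ := by rw [rho7_star, rho7_rho7Sec]
  refine mem_spinGroup_of_map (w := negW 7) rho7 negW_ne (involute_rho7Sec D) ?_ ?_ fun v => ?_
  · exact (congrArg₂ (· * ·) hs (rho7_rho7Sec D)).trans h1
  · exact (congrArg₂ (· * ·) (rho7_rho7Sec D) hs).trans (mul_eq_one_comm.1 h1)
  · obtain ⟨v', hv'⟩ := hv v
    refine ⟨v', ?_⟩
    change rho7 (rho7Sec D) * rho7 (ι Q7 v) = rho7 (ι Q7 v') * rho7 (rho7Sec D)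
    rw [rho7_rho7Sec, rho7_ι, rho7_ι, hv']

theorem rho7Sec_mem_spinLie {D : Matrix (Fin 8) (Fin 8) ℝ}
    (h1 : Dᵀ = -D) (hv : ∀ v, ∃ v', D * octLin v - octLin v * D = octLin v') :
    rho7Sec D ∈ spinLie Q7 := by
  have hs : rho7 (star (rho7Sec D)) = -D := by rw [rho7_star, rho7_rho7Sec, h1]
  refine mem_spinLie_of_map (w := negW 7) rho7 negW_ne (involute_rho7Sec D) ?_ fun v => ?_
  · exact hs.trans (congrArg Neg.neg (rho7_rho7Sec D)).symm
  · obtain ⟨v', hv'⟩ := hv v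
    refine ⟨v', ?_⟩
    change rho7 (rho7Sec D) * rho7 (ι Q7 v) - rho7 (ι Q7 v) * rho7 (rho7Sec D) = rho7 (ι Q7 v')
    rw [rho7_rho7Sec, rho7_ι, rho7_ι, hv']

theorem octLin_vecAct (g : Spin7) (v : Fin 7 → ℝ) :
    rho7 g * octLin v = octLin (vecAct g v) * rho7 g := by
  rw [← rho7_ι, ← rho7_ι, ← map_mul, ← map_mul, ι_vecAct_mul]

theorem rho7_transpose_mul (g : Spin7) : (rho7 g)ᵀ * rho7 g = 1 := by
  rw [← rho7_star, ← map_mul, spinGroup.coe_star_mul_self, map_one]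

/-! ### Conjugation of octonions -/

/-- The matrix of octonion conjugation. -/
def cMat : Matrix (Fin 8) (Fin 8) ℝ := Matrix.diagonal fun i => if i = 0 then 1 else -1

theorem cMat_sq : cMat * cMat = 1 := by
  rw [cMat, Matrix.diagonal_mul_diagonal, ← Matrix.diagonal_one]
  congr 1; funext i; split_ifs <;> norm_num

theorem cMat_transpose : cMatᵀ = cMat := Matrix.diagonal_transpose _

theorem cMat_conj_mul (D D' : Matrix (Fin 8) (Fin 8) ℝ) :
    cMat * D * cMat * (cMat * D' * cMat) = cMat * (D * D') * cMat := by
  have : cMat * D * cMat * (cMat * D' * cMat) = cMat * D * (cMat * cMat) * D' * cMat := by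
    noncomm_ring
  rw [this, cMat_sq]; noncomm_ring

/-- Left multiplication by the conjugates of the octonion units. -/
def conjLZ : Fin 8 → Matrix (Fin 8) (Fin 8) ℤ :=
  Fin.cons (α := fun _ => Matrix (Fin 8) (Fin 8) ℤ) 1 fun i => -octLZ i

theorem conjLZ_swap : ∀ a b r, conjLZ a r b = (if r = 0 then 1 else -1) * conjLZ b r a := by
  decide +kernel

/-- Left multiplication by the conjugate of an octonion. -/
def conjLin (x : Fin 8 → ℝ) : Matrix (Fin 8) (Fin 8) ℝ :=
  ∑ a, x a • (conjLZ a).map (Int.castRingHom ℝ)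

theorem conjLin_swap (x z : Fin 8 → ℝ) : conjLin x *ᵥ z = cMat *ᵥ (conjLin z *ᵥ x) := by
  funext r
  rw [cMat, Matrix.mulVec_diagonal]
  simp only [conjLin, Matrix.mulVec, dotProduct, Matrix.sum_apply, Matrix.smul_apply,
    Matrix.map_apply, Finset.sum_mul, smul_eq_mul, Finset.mul_sum]
  rw [Finset.sum_comm]
  refine Finset.sum_congr rfl fun a _ => Finset.sum_congr rfl fun b _ => ?_
  rw [conjLZ_swap a b r]
  split_ifs <;> simp <;> ring

theorem conjLin_eq (x : Fin 8 → ℝ) : conjLin x = x 0 • 1 - octLin (Fin.tail x) := by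
  rw [conjLin, Fin.sum_univ_succ, octLin_apply, sub_eq_add_neg, ← Finset.sum_neg_distrib]
  congr 1
  · congr 1
    ext i j
    simp [conjLZ, Matrix.one_apply]
  · refine Finset.sum_congr rfl fun i _ => ?_
    ext r s
    simp [conjLZ, octL, Fin.tail]

/-- The underlying function of `conjEquiv`. -/
def conjFun (x : Fin 8 → ℝ) : Fin 8 → ℝ :=
  Fin.snoc (α := fun _ => ℝ) (fun i : Fin 7 => -x i.succ) (x 0)

theorem conjFun_last (x : Fin 8 → ℝ) : conjFun x (Fin.last 7) = x 0 :=
  Fin.snoc_last (α := fun _ => ℝ) _ _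

theorem conjFun_castSucc (x : Fin 8 → ℝ) (i : Fin 7) : conjFun x i.castSucc = -x i.succ :=
  Fin.snoc_castSucc (α := fun _ => ℝ) _ _ _

/-- The identification of `S⁺ = ℝ⁸` with `𝔼⁸`. -/
def conjEquiv : (Fin 8 → ℝ) ≃ₗ[ℝ] (Fin 8 → ℝ) where
  toFun := conjFun
  invFun v := Fin.cons (α := fun _ => ℝ) (v (Fin.last 7)) fun i : Fin 7 => -v i.castSucc
  map_add' x y := by
    funext i
    refine Fin.lastCases ?_ (fun i => ?_) i
    · rw [Pi.add_apply, conjFun_last, conjFun_last, conjFun_last, Pi.add_apply]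
    · rw [Pi.add_apply, conjFun_castSucc, conjFun_castSucc, conjFun_castSucc, Pi.add_apply]; ring
  map_smul' c x := by
    funext i
    refine Fin.lastCases ?_ (fun i => ?_) i
    · rw [Pi.smul_apply, conjFun_last, conjFun_last]; rfl
    · rw [Pi.smul_apply, conjFun_castSucc, conjFun_castSucc]; simp
  left_inv x := by
    funext i
    refine Fin.cases ?_ (fun i => ?_) i
    · exact conjFun_last x
    · exact (congrArg Neg.neg (conjFun_castSucc x i)).trans (neg_neg _)
  right_inv x := by
    funext i
    refine Fin.lastCases ?_ (fun i => ?_) i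
    · exact conjFun_last _
    · exact (conjFun_castSucc _ i).trans (neg_neg _)

theorem conjEquiv_last (x : Fin 8 → ℝ) : conjEquiv x (Fin.last 7) = x 0 := conjFun_last x

theorem conjEquiv_castSucc (x : Fin 8 → ℝ) (i : Fin 7) : conjEquiv x i.castSucc = -x i.succ :=
  conjFun_castSucc x i

theorem octN_conjEquiv (x : Fin 8 → ℝ) : octN (conjEquiv x) = conjLin x := by
  have h1 : (Fin.init (conjEquiv x) : Fin 7 → ℝ) = -Fin.tail x := by
    funext i; exact conjEquiv_castSucc x i
  rw [octN_apply, h1, conjEquiv_last, conjLin_eq, map_neg]; abel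

theorem sum_sq_conjEquiv (x : Fin 8 → ℝ) : ∑ i, conjEquiv x i ^ 2 = x ⬝ᵥ x := by
  rw [Fin.sum_univ_castSucc, dotProduct, Fin.sum_univ_succ (fun i : Fin 8 => x i * x i),
    conjEquiv_last, add_comm]
  simp only [conjEquiv_castSucc, neg_sq, pow_two, neg_mul_neg]

/-- The block matrix of a transformation of the imaginary octonions, acting on `1` by `s`. -/
def extMat (s : ℝ) (R : (Fin 7 → ℝ) →ₗ[ℝ] (Fin 7 → ℝ)) : Matrix (Fin 8) (Fin 8) ℝ :=
  LinearMap.toMatrix' (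
    { toFun := fun z => Fin.cons (α := fun _ => ℝ) (s * z 0) (R (Fin.tail z))
      map_add' := fun x y => by
        have : (Fin.tail (x + y) : Fin 7 → ℝ) = Fin.tail x + Fin.tail y := rfl
        funext i
        refine Fin.cases ?_ (fun i => ?_) i
        · simp [mul_add]
        · simp [this]
      map_smul' := fun c x => by
        have : (Fin.tail (c • x) : Fin 7 → ℝ) = c • Fin.tail x := rfl
        funext i
        refine Fin.cases ?_ (fun i => ?_) i
        · simp; ring
        · simp [this] } : (Fin 8 → ℝ) →ₗ[ℝ] (Fin 8 → ℝ))

theorem extMat_mulVec (s : ℝ) (R : (Fin 7 → ℝ) →ₗ[ℝ] (Fin 7 → ℝ)) (z : Fin 8 → ℝ) :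
    extMat s R *ᵥ z = Fin.cons (α := fun _ => ℝ) (s * z 0) (R (Fin.tail z)) := by
  rw [extMat, LinearMap.toMatrix'_mulVec]; rfl

theorem matrix_ext_mulVec {m n : Type*} [Fintype n] [DecidableEq n] {A B : Matrix m n ℝ}
    (h : ∀ v, A *ᵥ v = B *ᵥ v) : A = B := Matrix.toLin'.injective (LinearMap.ext h)

theorem conj_mul_conjLin (D : Matrix (Fin 8) (Fin 8) ℝ) (x z : Fin 8 → ℝ) :
    (cMat * D * cMat * conjLin x) *ᵥ z = cMat *ᵥ ((D * conjLin z) *ᵥ x) := by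
  rw [← Matrix.mulVec_mulVec, conjLin_swap, Matrix.mulVec_mulVec, mul_assoc (cMat * D), cMat_sq,
    mul_one, Matrix.mulVec_mulVec, Matrix.mulVec_mulVec, mul_assoc]

/-- Group version of triality for the spin representation of `Spin₇`. -/
theorem conj_mul_octN {D : Matrix (Fin 8) (Fin 8) ℝ} {R : (Fin 7 → ℝ) →ₗ[ℝ] (Fin 7 → ℝ)}
    (h : ∀ w, D * octLin w = octLin (R w) * D) (x : Fin 8 → ℝ) :
    cMat * D * cMat * octN (conjEquiv x) = octN (conjEquiv (D *ᵥ x)) * extMat 1 R := by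
  refine matrix_ext_mulVec fun z => ?_
  have h1 : D * conjLin z = conjLin (extMat 1 R *ᵥ z) * D := by
    rw [conjLin_eq, conjLin_eq, extMat_mulVec, mul_sub, sub_mul, h]
    simp
  have h2 : (conjLin (D *ᵥ x) * extMat 1 R) *ᵥ z
      = cMat *ᵥ (conjLin (extMat 1 R *ᵥ z) *ᵥ (D *ᵥ x)) := by
    rw [← Matrix.mulVec_mulVec, conjLin_swap]
  rw [octN_conjEquiv, octN_conjEquiv, h2, conj_mul_conjLin, h1]
  simp only [Matrix.mulVec_mulVec, mul_assoc]

/-- Lie algebra version of triality for the spin representation of `so₇`. -/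
theorem conj_lie_octN {D : Matrix (Fin 8) (Fin 8) ℝ} {R : (Fin 7 → ℝ) →ₗ[ℝ] (Fin 7 → ℝ)}
    (h : ∀ w, D * octLin w - octLin w * D = octLin (R w)) (x : Fin 8 → ℝ) :
    cMat * D * cMat * octN (conjEquiv x)
      = octN (conjEquiv (D *ᵥ x)) + octN (conjEquiv x) * extMat 0 R := by
  refine matrix_ext_mulVec fun z => ?_
  have h1 : D * conjLin z = conjLin z * D + conjLin (extMat 0 R *ᵥ z) := by
    have h2 := h (Fin.tail z)
    rw [conjLin_eq, conjLin_eq, extMat_mulVec]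
    simp only [Fin.cons_zero, Fin.tail_cons, ← h2, zero_mul, zero_smul, zero_sub, mul_sub, sub_mul,
      mul_smul_comm, smul_mul_assoc, mul_one, one_mul]
    abel
  have h2 : (conjLin (D *ᵥ x) + conjLin x * extMat 0 R) *ᵥ z
      = cMat *ᵥ (conjLin z *ᵥ (D *ᵥ x)) + cMat *ᵥ (conjLin (extMat 0 R *ᵥ z) *ᵥ x) := by
    rw [Matrix.add_mulVec, ← Matrix.mulVec_mulVec, conjLin_swap, conjLin_swap x]
  rw [octN_conjEquiv, octN_conjEquiv, h2, conj_mul_conjLin, h1]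
  simp only [Matrix.mulVec_mulVec, mul_assoc, mul_add, Matrix.add_mulVec, Matrix.mulVec_add]

end ExoticSpinor
end

noncomputable section
namespace ExoticSpinor
open CliffordAlgebra

/-! ### Block diagonal operators on spinors -/

/-- The operator on `Δ` acting by `B₁` and `B₂` on the two chiral halves of each summand `ℝ¹⁶`. -/
def Dmat (B₁ B₂ : Matrix (Fin 8) (Fin 8) ℝ) : Matrix S11 S11 ℝ :=
  Matrix.fromBlocks (Matrix.fromBlocks B₁ 0 0 B₂) 0 0 (Matrix.fromBlocks B₁ 0 0 B₂)

variable {B₁ B₂ C₁ C₂ : Matrix (Fin 8) (Fin 8) ℝ}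

theorem Dmat_mul : Dmat B₁ B₂ * Dmat C₁ C₂ = Dmat (B₁ * C₁) (B₂ * C₂) := by
  simp [Dmat, Matrix.fromBlocks_multiply]

theorem Dmat_one : Dmat 1 1 = 1 := by simp [Dmat]

theorem Dmat_sub : Dmat B₁ B₂ - Dmat C₁ C₂ = Dmat (B₁ - C₁) (B₂ - C₂) := by
  simp only [Dmat]
  ext ((i | i) | (i | i)) ((j | j) | (j | j)) <;> simp

theorem Dmat_add : Dmat B₁ B₂ + Dmat C₁ C₂ = Dmat (B₁ + C₁) (B₂ + C₂) := by
  simp only [Dmat]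
  ext ((i | i) | (i | i)) ((j | j) | (j | j)) <;> simp

theorem Dmat_smul (r : ℝ) : r • Dmat B₁ B₂ = Dmat (r • B₁) (r • B₂) := by
  simp only [Dmat]
  ext ((i | i) | (i | i)) ((j | j) | (j | j)) <;> simp

theorem Dmat_neg : -Dmat B₁ B₂ = Dmat (-B₁) (-B₂) := by
  simp [Dmat, Matrix.fromBlocks_neg]

theorem Dmat_transpose : (Dmat B₁ B₂)ᵀ = Dmat B₁ᵀ B₂ᵀ := by
  simp [Dmat, Matrix.fromBlocks_transpose]

theorem Dmat_inj (h : Dmat B₁ B₂ = Dmat C₁ C₂) : B₁ = C₁ ∧ B₂ = C₂ := by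
  have h1 := Matrix.fromBlocks_inj.1 (Matrix.fromBlocks_inj.1 h).1
  exact ⟨h1.1, h1.2.2.2⟩

theorem Dmat_gamma0 : Dmat B₁ B₂ * gamma0 = gamma0 * Dmat B₁ B₂ := by
  simp [Dmat, gamma0, gammaP9_eq, Matrix.fromBlocks_multiply, Matrix.fromBlocks_neg]

theorem Dmat_mulVec (x : Fin 8 → ℝ) :
    Dmat B₁ B₂ *ᵥ eps (Sum.elim x 0) = eps (Sum.elim (B₁ *ᵥ x) 0) := by
  simp [Dmat, eps, Matrix.fromBlocks_mulVec]

/-- The vectors spanned by `e₀, e₉, e_♮`. -/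
def timePart (v : Mink) : Mink := v 0 • e 0 + v 9 • e 9 + v 10 • e 10

theorem timePart_zero (v : Mink) : timePart v 0 = v 0 := by simp [timePart, e_apply]
theorem timePart_nine (v : Mink) : timePart v 9 = v 9 := by simp [timePart, e_apply]
theorem timePart_ten (v : Mink) : timePart v 10 = v 10 := by simp [timePart, e_apply]
theorem proj8_timePart (v : Mink) : proj8 (timePart v) = 0 := by
  funext i; simp [timePart, e_apply, proj8_apply, idx8_ne_zero, idx8_ne_nine, idx8_ne_ten]

theorem gammaLin_timePart (v : Mink) (y : Fin 8 → ℝ) : gammaLin (timePart v + incl8 y)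
    = Matrix.fromBlocks (v 10 • 1) (v 9 • 1 - (v 0 • gammaP9 + gammaPLin y))
      (v 9 • 1 + (v 0 • gammaP9 + gammaPLin y)) (-(v 10 • 1)) := by
  rw [gammaLin_blocks]
  simp only [Pi.add_apply, timePart_zero, timePart_nine, timePart_ten, incl8_zero_coord,
    incl8_nine, incl8_ten, add_zero, map_add, proj8_timePart, proj8_incl8, zero_add]

theorem mink_eq_timePart (v : Mink) : v = timePart v + incl8 (proj8 v) := mink_eq v

theorem Dmat_mul_gammaLin {y y' : Fin 8 → ℝ} (h1 : B₁ᵀ * B₁ = 1) (h2 : B₂ᵀ * B₂ = 1)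
    (h : B₂ * octN y = octN y' * B₁) (v : Mink) :
    Dmat B₁ B₂ * gammaLin (timePart v + incl8 y) = gammaLin (timePart v + incl8 y') * Dmat B₁ B₂ := by
  have h1' : B₁ * B₁ᵀ = 1 := mul_eq_one_comm.1 h1
  have h' : B₁ * (octN y)ᵀ = (octN y')ᵀ * B₂ := by
    have := congrArg Matrix.transpose h
    rw [Matrix.transpose_mul, Matrix.transpose_mul] at this
    calc B₁ * (octN y)ᵀ = B₁ * ((octN y)ᵀ * B₂ᵀ) * B₂ := by rw [mul_assoc, mul_assoc, h2, mul_one]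
      _ = _ := by rw [this, ← mul_assoc, h1', one_mul]
  have hg : Matrix.fromBlocks B₁ 0 0 B₂ * gammaPLin y = gammaPLin y' * Matrix.fromBlocks B₁ 0 0 B₂ := by
    rw [gammaPLin_blocks, gammaPLin_blocks, Matrix.fromBlocks_multiply, Matrix.fromBlocks_multiply]
    simp [h, h']
  have h9 : Matrix.fromBlocks B₁ 0 0 B₂ * gammaP9 = gammaP9 * Matrix.fromBlocks B₁ 0 0 B₂ := by
    simp [gammaP9_eq, Matrix.fromBlocks_multiply]
  rw [gammaLin_timePart, gammaLin_timePart, Dmat, Matrix.fromBlocks_multiply,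
    Matrix.fromBlocks_multiply]
  simp [mul_sub, sub_mul, mul_add, add_mul, hg, h9]

theorem Dmat_lie_gammaLin {y y' : Fin 8 → ℝ} (h1 : B₁ᵀ = -B₁) (h2 : B₂ᵀ = -B₂)
    (h : B₂ * octN y = octN y' + octN y * B₁) (v : Mink) :
    Dmat B₁ B₂ * gammaLin (timePart v + incl8 y) - gammaLin (timePart v + incl8 y) * Dmat B₁ B₂
      = gammaLin (incl8 y') := by
  have h' : B₁ * (octN y)ᵀ = (octN y')ᵀ + (octN y)ᵀ * B₂ := by
    have := congrArg Matrix.transpose h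
    rw [Matrix.transpose_add, Matrix.transpose_mul, Matrix.transpose_mul, h1, h2, mul_neg,
      neg_mul, ← sub_eq_add_neg, eq_sub_iff_add_eq] at this
    rw [← this]; abel
  have hg : Matrix.fromBlocks B₁ 0 0 B₂ * gammaPLin y
      = gammaPLin y' + gammaPLin y * Matrix.fromBlocks B₁ 0 0 B₂ := by
    rw [gammaPLin_blocks, gammaPLin_blocks, Matrix.fromBlocks_multiply, Matrix.fromBlocks_multiply,
      Matrix.fromBlocks_add]
    simp [h, h']; abel
  have h9 : Matrix.fromBlocks B₁ 0 0 B₂ * gammaP9 = gammaP9 * Matrix.fromBlocks B₁ 0 0 B₂ := by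
    simp [gammaP9_eq, Matrix.fromBlocks_multiply]
  have h0 : gammaLin (incl8 y') = gammaLin (timePart 0 + incl8 y') := by simp [timePart]
  rw [h0, gammaLin_timePart, gammaLin_timePart, Dmat, Matrix.fromBlocks_multiply,
    Matrix.fromBlocks_multiply, sub_eq_add_neg, Matrix.fromBlocks_neg, Matrix.fromBlocks_add]
  simp only [mul_sub, sub_mul, mul_add, add_mul, hg, h9, zero_mul, mul_zero, add_zero, zero_add,
    Pi.zero_apply, zero_smul, mul_smul_comm, smul_mul_assoc, mul_one, one_mul, mul_neg, neg_mul,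
    smul_zero, neg_zero, sub_zero]
  congr 1 <;> abel

theorem gammaLin_e0 : gammaLin (e 0) = gamma0 := by
  have h : proj8 (e 0) = 0 := by funext i; simp [proj8_apply, e_apply, idx8_ne_zero]
  rw [gammaLin_blocks, h]; simp [e_apply, gamma0]

theorem gammaLin_e9 : gammaLin (e 9) = Matrix.fromBlocks 0 1 1 0 := by
  have h : proj8 (e 9) = 0 := by funext i; simp [proj8_apply, e_apply, idx8_ne_nine]
  rw [gammaLin_blocks, h]; simp [e_apply]

theorem gammaLin_e10 : gammaLin (e 10) = Matrix.fromBlocks 1 0 0 (-1) := by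
  have h : proj8 (e 10) = 0 := by funext i; simp [proj8_apply, e_apply, idx8_ne_ten]
  rw [gammaLin_blocks, h]; simp [e_apply]

theorem eq_zero_of_eq_neg_matrix {m n : Type*} {A : Matrix m n ℝ} (h : A = -A) : A = 0 := by
  ext i j
  have := congrFun (congrFun h i) j
  simp only [Matrix.neg_apply] at this
  simp only [Matrix.zero_apply]; linarith

/-- An operator commuting with `Γ₀, Γ₉, Γ_♮` is block diagonal. -/
theorem exists_eq_Dmat {D : Matrix S11 S11 ℝ} (h0 : D * gammaLin (e 0) = gammaLin (e 0) * D)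
    (h9 : D * gammaLin (e 9) = gammaLin (e 9) * D)
    (h10 : D * gammaLin (e 10) = gammaLin (e 10) * D) : ∃ B₁ B₂, D = Dmat B₁ B₂ := by
  rw [gammaLin_e0, gamma0] at h0
  rw [gammaLin_e9] at h9
  rw [gammaLin_e10] at h10
  rw [← Matrix.fromBlocks_toBlocks D] at h0 h9 h10 ⊢
  generalize D.toBlocks₁₁ = P at *
  generalize D.toBlocks₁₂ = Q at *
  generalize D.toBlocks₂₁ = R at *
  generalize D.toBlocks₂₂ = S at *
  rw [Matrix.fromBlocks_multiply, Matrix.fromBlocks_multiply, Matrix.fromBlocks_inj] at h0 h9 h10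
  simp only [mul_zero, mul_one, zero_mul, one_mul, add_zero, zero_add, mul_neg, neg_mul] at h0 h9 h10
  have hQ : Q = 0 := eq_zero_of_eq_neg_matrix h10.2.1.symm
  have hR : R = 0 := eq_zero_of_eq_neg_matrix h10.2.2.1
  have hS : S = P := h9.2.1.symm
  subst hQ hR hS
  have h := h0.2.2.1
  rw [gammaP9_eq, ← Matrix.fromBlocks_toBlocks S, Matrix.fromBlocks_multiply,
    Matrix.fromBlocks_multiply, Matrix.fromBlocks_inj] at h
  simp only [mul_zero, mul_one, zero_mul, one_mul, add_zero, zero_add, mul_neg, neg_mul] at h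
  refine ⟨S.toBlocks₁₁, S.toBlocks₂₂, ?_⟩
  have h12 := eq_zero_of_eq_neg_matrix h.2.1
  have h21 := eq_zero_of_eq_neg_matrix h.2.2.1.symm
  rw [Dmat]
  conv_lhs => rw [← Matrix.fromBlocks_toBlocks S, h12, h21]

theorem octLin_injective : Function.Injective octLin := by
  rw [injective_iff_map_eq_zero]
  intro w hw
  have h := octLin_mul_self w
  rw [hw, mul_zero] at h
  have h1 := congrFun (congrFun h 0) 0
  simp only [Matrix.zero_apply, Matrix.smul_apply, Matrix.one_apply_eq, smul_eq_mul, mul_one] at h1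
  have h2 : ∑ i, w i ^ 2 = 0 := by linarith
  funext i
  exact pow_eq_zero_iff (two_ne_zero) |>.1
    ((Finset.sum_eq_zero_iff_of_nonneg fun i _ => sq_nonneg (w i)).1 h2 i (Finset.mem_univ i))

/-! ### Lifting `Spin₇` to `Spin_{10,1}` -/

/-- The positive octonion unit. -/
def one8 : Fin 8 → ℝ := Pi.single 0 1

theorem one8_zero : one8 0 = 1 := by simp [one8]
theorem tail_one8 : (Fin.tail one8 : Fin 7 → ℝ) = 0 := by
  funext i; simp [Fin.tail, one8]

theorem conjLin_one8 : conjLin one8 = 1 := by rw [conjLin_eq, one8_zero, tail_one8]; simp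

/-- The standard spinor of negative chirality. -/
def psi0 : S8 → ℝ := Sum.elim one8 0

theorem psi0_chir : gammaP9 *ᵥ psi0 = -psi0 := by
  rw [gammaP9_eq, psi0, Matrix.fromBlocks_mulVec]
  ext (i | i) <;> simp [Matrix.neg_mulVec]

theorem psi0_ne : psi0 ≠ 0 := fun h => by
  have := congrFun h (Sum.inl 0); simp [psi0, one8] at this

theorem extMat_one8 (s : ℝ) (R : (Fin 7 → ℝ) →ₗ[ℝ] (Fin 7 → ℝ)) : extMat s R *ᵥ one8 = s • one8 := by
  rw [extMat_mulVec, tail_one8, map_zero, one8_zero]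
  funext i
  refine Fin.cases ?_ (fun i => ?_) i <;> simp [one8]

theorem extMat_mul (s t : ℝ) (R S : (Fin 7 → ℝ) →ₗ[ℝ] (Fin 7 → ℝ)) :
    extMat s R * extMat t S = extMat (s * t) (R ∘ₗ S) := by
  refine matrix_ext_mulVec fun z => ?_
  rw [← Matrix.mulVec_mulVec, extMat_mulVec, extMat_mulVec, extMat_mulVec, mul_assoc]
  rfl

theorem extMat_id : extMat 1 LinearMap.id = 1 := by
  refine matrix_ext_mulVec fun z => ?_
  rw [extMat_mulVec, one_mul, Matrix.one_mulVec]
  exact Fin.cons_self_tail z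

variable {D : Matrix (Fin 8) (Fin 8) ℝ} {R : (Fin 7 → ℝ) →ₗ[ℝ] (Fin 7 → ℝ)}

theorem conj_transpose_mul (h1 : Dᵀ * D = 1) :
    (cMat * D * cMat)ᵀ * (cMat * D * cMat) = 1 := by
  rw [Matrix.transpose_mul, Matrix.transpose_mul, cMat_transpose, ← mul_assoc cMat, cMat_conj_mul,
    h1, mul_one, cMat_sq]

theorem dotProduct_mulVec_mulVec {n : Type*} [Fintype n] [DecidableEq n] {B : Matrix n n ℝ}
    (h : Bᵀ * B = 1) (x y : n → ℝ) : (B *ᵥ x) ⬝ᵥ (B *ᵥ y) = x ⬝ᵥ y := by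
  rw [Matrix.dotProduct_mulVec, ← Matrix.mulVec_transpose, Matrix.mulVec_mulVec, h,
    Matrix.one_mulVec]

theorem extMat_orthogonal (h1 : Dᵀ * D = 1) (h : ∀ w, D * octLin w = octLin (R w) * D) :
    (extMat 1 R)ᵀ * extMat 1 R = 1 := by
  have h2 := conj_mul_octN h one8
  rw [octN_conjEquiv, conjLin_one8, mul_one] at h2
  have h3 : (octN (conjEquiv (D *ᵥ one8)))ᵀ * octN (conjEquiv (D *ᵥ one8)) = 1 := by
    rw [octN_transpose_mul, sum_sq_conjEquiv, dotProduct_mulVec_mulVec h1]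
    simp [one8]
  have h4 : extMat 1 R = (octN (conjEquiv (D *ᵥ one8)))ᵀ * (cMat * D * cMat) := by
    rw [h2, ← mul_assoc, h3, one_mul]
  rw [h4, Matrix.transpose_mul, Matrix.transpose_transpose, mul_assoc, ← mul_assoc _ _ (cMat * D * cMat),
    mul_eq_one_comm.1 h3, one_mul, conj_transpose_mul h1]

/-- The image in `Spin₈` acting on `Δ` of an element of `Spin₇` with spin matrix `D` and
vector matrix `R`. -/
theorem Dmat_mul_gammaLin_conj (h1 : Dᵀ * D = 1) (h : ∀ w, D * octLin w = octLin (R w) * D)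
    (v : Mink) : Dmat (extMat 1 R) (cMat * D * cMat) * gammaLin v
      = gammaLin (timePart v + incl8 (conjEquiv (D *ᵥ conjEquiv.symm (proj8 v))))
        * Dmat (extMat 1 R) (cMat * D * cMat) := by
  conv_lhs => rw [mink_eq_timePart v]
  refine Dmat_mul_gammaLin (extMat_orthogonal h1 h) (conj_transpose_mul h1) ?_ v
  have := conj_mul_octN h (conjEquiv.symm (proj8 v))
  rwa [LinearEquiv.apply_symm_apply] at this

/-- The operator on `Δ` of an element of `Spin₇`. -/
def spinD (g : Spin7) : Matrix S11 S11 ℝ := Dmat (extMat 1 (vecAct g)) (cMat * rho7 g * cMat)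

theorem spinD_mul (g h : Spin7) : spinD (g * h) = spinD g * spinD h := by
  rw [spinD, spinD, spinD, Dmat_mul, extMat_mul, cMat_conj_mul, vecAct_mul, Submonoid.coe_mul,
    map_mul, one_mul]

theorem spinD_one : spinD 1 = 1 := by
  rw [spinD, vecAct_one, extMat_id, Submonoid.coe_one, map_one, mul_one, cMat_sq, Dmat_one]

/-- The inclusion of `Spin₇` in `Spin_{10,1}` as the isotropy group of `psi0` in `Spin₈`. -/
def spinLift : Spin7 →* Spin101 where
  toFun g := ⟨rhoSec (spinD g), rhoSec_mem_spinGroup Dmat_gamma0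
    (by rw [spinD, Dmat_transpose, Dmat_mul, extMat_orthogonal (rho7_transpose_mul g) (octLin_vecAct g),
      conj_transpose_mul (rho7_transpose_mul g), Dmat_one])
    fun v => ⟨_, Dmat_mul_gammaLin_conj (rho7_transpose_mul g) (octLin_vecAct g) v⟩⟩
  map_one' := Spin101_ext (by rw [rho_rhoSec, spinD_one, Submonoid.coe_one, map_one])
  map_mul' g h := Spin101_ext (by
    rw [rho_rhoSec, spinD_mul, Submonoid.coe_mul, map_mul, rho_rhoSec, rho_rhoSec])

theorem rho_spinLift (g : Spin7) : rho (spinLift g) = spinD g := rho_rhoSec _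

theorem vecAct_eq_of_rho {g : Spin101} {v u : Mink} (h : rho g * gammaLin v = gammaLin u * rho g) :
    vecAct g v = u := by
  apply vecAct_eq_of_mul
  refine rho_odd_inj ?_ ?_ ?_
  · rw [map_mul, involute_ι, spinGroup.involute_eq g.2, mul_neg]
  · rw [map_mul, involute_ι, spinGroup.involute_eq g.2, neg_mul]
  · rw [map_mul, map_mul, rho_ι, rho_ι, h]

theorem vecAct_spinLift (g : Spin7) (v : Mink) : vecAct (spinLift g) v
    = timePart v + incl8 (conjEquiv (rho7 g *ᵥ conjEquiv.symm (proj8 v))) :=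
  vecAct_eq_of_rho (by
    rw [rho_spinLift]; exact Dmat_mul_gammaLin_conj (rho7_transpose_mul g) (octLin_vecAct g) v)

theorem vecAct_spinLift_timePart (g : Spin7) {v : Mink} (h : proj8 v = 0) :
    vecAct (spinLift g) v = v := by
  rw [vecAct_spinLift, h, map_zero, Matrix.mulVec_zero, map_zero]
  conv_rhs => rw [mink_eq_timePart v, h]

theorem proj8_e0 : proj8 (e 0) = 0 := by funext i; simp [proj8_apply, e_apply, idx8_ne_zero]
theorem proj8_e9 : proj8 (e 9) = 0 := by funext i; simp [proj8_apply, e_apply, idx8_ne_nine]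
theorem proj8_e10 : proj8 (e 10) = 0 := by funext i; simp [proj8_apply, e_apply, idx8_ne_ten]

theorem spinLift_mem (g : Spin7) : spinLift g ∈ isotropyGroup (eps psi0) := by
  change rho (spinLift g) *ᵥ eps psi0 = eps psi0
  rw [rho_spinLift, spinD, psi0, Dmat_mulVec, extMat_one8, one_smul]

theorem incl8_proj8_of_fix {h : Spin101} (h0 : vecAct h (e 0) = e 0) (h9 : vecAct h (e 9) = e 9)
    (h10 : vecAct h (e 10) = e 10) (y : Fin 8 → ℝ) :
    vecAct h (incl8 y) = incl8 (proj8 (vecAct h (incl8 y))) := by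
  have key (M : Fin 11) (hM : vecAct h (e M) = e M) (hy : incl8 y M = 0) :
      vecAct h (incl8 y) M = 0 := by
    have h1 := mip_vecAct h (e M) (incl8 y)
    rw [hM, mip_single, mip_single, hy, mul_zero] at h1
    exact (mul_eq_zero.1 h1).resolve_left (eta_ne M)
  conv_lhs => rw [mink_eq (vecAct h (incl8 y)), key 0 h0 (incl8_zero_coord y), key 9 h9 (incl8_nine y),
    key 10 h10 (incl8_ten y)]
  simp

/-- Elements of `Spin_{10,1}` fixing `e₀, e₉, e_♮` are block diagonal and orthogonal. -/
theorem exists_rho_eq_Dmat {h : Spin101} (h0 : vecAct h (e 0) = e 0) (h9 : vecAct h (e 9) = e 9)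
    (h10 : vecAct h (e 10) = e 10) : ∃ B₁ B₂, rho h = Dmat B₁ B₂ ∧ B₁ᵀ * B₁ = 1 ∧ B₂ᵀ * B₂ = 1 ∧
      ∀ y, B₂ * octN y = octN (proj8 (vecAct h (incl8 y))) * B₁ := by
  have hc (M : Fin 11) (hM : vecAct h (e M) = e M) :
      rho h * gammaLin (e M) = gammaLin (e M) * rho h := by
    rw [← gammaLin_vecAct, hM]
  obtain ⟨B₁, B₂, hB⟩ := exists_eq_Dmat (hc 0 h0) (hc 9 h9) (hc 10 h10)
  have ho := rho_transpose_mul h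
  rw [hB, mul_assoc, ← Dmat_gamma0, ← mul_assoc, Dmat_transpose, Dmat_mul] at ho
  have ho' : Dmat (B₁ᵀ * B₁) (B₂ᵀ * B₂) = Dmat 1 1 := by
    have := congrArg (· * (-gamma0)) ho
    simp only [mul_assoc, mul_neg, gamma0_sq, neg_neg, mul_one] at this
    rw [this, Dmat_one]
  refine ⟨B₁, B₂, hB, (Dmat_inj ho').1, (Dmat_inj ho').2, fun y => ?_⟩
  have hv := gammaLin_vecAct h (incl8 y)
  rw [incl8_proj8_of_fix h0 h9 h10 y, hB] at hv
  set y' := proj8 (vecAct h (incl8 y))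
  have hb (z : Fin 8 → ℝ) : gammaLin (incl8 z)
      = Matrix.fromBlocks 0 (-gammaPLin z) (gammaPLin z) 0 := by
    have : incl8 z = timePart 0 + incl8 z := by simp [timePart]
    rw [this, gammaLin_timePart]; simp
  rw [hb, hb, Dmat, Matrix.fromBlocks_multiply, Matrix.fromBlocks_multiply] at hv
  have h21 := (Matrix.fromBlocks_inj.1 hv).2.2.1
  rw [gammaPLin_blocks, gammaPLin_blocks] at h21
  simp only [zero_mul, mul_zero, add_zero, zero_add, Matrix.fromBlocks_multiply] at h21
  exact (Matrix.fromBlocks_inj.1 h21).2.2.1.symm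

theorem eps_inj {ψ φ : S8 → ℝ} (h : eps ψ = eps φ) : ψ = φ := by
  funext i; exact congrFun h (Sum.inl i)

theorem sumElim_inj {x y : Fin 8 → ℝ} (h : (Sum.elim x 0 : S8 → ℝ) = Sum.elim y 0) : x = y := by
  funext i; exact congrFun h (Sum.inl i)

theorem mul_octLin_of_conj {B₁ B₂ : Matrix (Fin 8) (Fin 8) ℝ} {T : (Fin 8 → ℝ) → (Fin 8 → ℝ)}
    (h : ∀ y, B₂ * octN y = octN (T y) * B₁) (hone : B₁ *ᵥ one8 = one8) (z : Fin 8 → ℝ) :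
    cMat * B₂ * cMat * conjLin z = conjLin (B₁ *ᵥ z) * (cMat * B₂ * cMat) := by
  have h1 (x z) : (cMat * B₂ * cMat * conjLin z) *ᵥ x
      = conjLin (B₁ *ᵥ z) *ᵥ (conjEquiv.symm (T (conjEquiv x))) := by
    have h2 := h (conjEquiv x)
    rw [octN_conjEquiv, ← conjEquiv.apply_symm_apply (T (conjEquiv x)), octN_conjEquiv] at h2
    have h3 := congrArg (fun M => cMat *ᵥ (M *ᵥ z)) h2
    rw [← Matrix.mulVec_mulVec, ← Matrix.mulVec_mulVec, conjLin_swap x,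
      conjLin_swap _ (B₁ *ᵥ z), Matrix.mulVec_mulVec _ cMat cMat, cMat_sq, Matrix.one_mulVec] at h3
    rw [← h3]
    simp only [Matrix.mulVec_mulVec, mul_assoc]
  refine matrix_ext_mulVec fun x => ?_
  have h0 := h1 x one8
  rw [conjLin_one8, mul_one, hone, conjLin_one8, Matrix.one_mulVec] at h0
  rw [h1, ← h0, Matrix.mulVec_mulVec]

theorem conjLin_cons (w : Fin 7 → ℝ) :
    conjLin (Fin.cons (α := fun _ => ℝ) 0 w) = -octLin w := by
  rw [conjLin_eq]; simp

/-- The lower right block of an operator on the first summand of `Δ`. -/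
def lowBlock : Matrix S11 S11 ℝ →ₗ[ℝ] Matrix (Fin 8) (Fin 8) ℝ where
  toFun D := D.toBlocks₁₁.toBlocks₂₂
  map_add' _ _ := rfl
  map_smul' _ _ := rfl

theorem lowBlock_Dmat : lowBlock (Dmat B₁ B₂) = B₂ := rfl

theorem eq_spinLift {h : Spin101} (hh : h ∈ isotropyGroup (eps psi0)) (h0 : vecAct h (e 0) = e 0)
    (h9 : vecAct h (e 9) = e 9) (h10 : vecAct h (e 10) = e 10) : ∃ g, h = spinLift g := by
  obtain ⟨B₁, B₂, hB, hB1, hB2, hN⟩ := exists_rho_eq_Dmat h0 h9 h10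
  have hh' : rho h *ᵥ eps psi0 = eps psi0 := hh
  rw [hB, psi0, Dmat_mulVec] at hh'
  have hone : B₁ *ᵥ one8 = one8 := sumElim_inj (eps_inj hh')
  have hz (z : Fin 8 → ℝ) : (B₁ *ᵥ z) 0 = z 0 := by
    have h1 : one8 ⬝ᵥ (B₁ *ᵥ z) = one8 ⬝ᵥ z := by
      conv_lhs => rw [← hone]
      exact dotProduct_mulVec_mulVec hB1 _ _
    simpa [one8] using h1
  let R : (Fin 7 → ℝ) →ₗ[ℝ] (Fin 7 → ℝ) :=
    { toFun := fun w => Fin.tail (B₁ *ᵥ (Fin.cons (α := fun _ => ℝ) 0 w : Fin 8 → ℝ))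
      map_add' := fun x y => by
        have : (Fin.cons (α := fun _ => ℝ) 0 (x + y) : Fin 8 → ℝ)
            = Fin.cons (α := fun _ => ℝ) 0 x + Fin.cons (α := fun _ => ℝ) 0 y := by
          funext i; refine Fin.cases ?_ (fun i => ?_) i <;> simp
        rw [this, Matrix.mulVec_add]; rfl
      map_smul' := fun c x => by
        have : (Fin.cons (α := fun _ => ℝ) 0 (c • x) : Fin 8 → ℝ)
            = c • Fin.cons (α := fun _ => ℝ) 0 x := by
          funext i; refine Fin.cases ?_ (fun i => ?_) i <;> simp
        rw [this, Matrix.mulVec_smul]; rfl }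
  have hR (w : Fin 7 → ℝ) : B₁ *ᵥ (Fin.cons (α := fun _ => ℝ) 0 w : Fin 8 → ℝ)
      = Fin.cons (α := fun _ => ℝ) 0 (R w) := by
    rw [← Fin.cons_self_tail (B₁ *ᵥ (Fin.cons (α := fun _ => ℝ) 0 w : Fin 8 → ℝ)), hz]; rfl
  have hoct (w : Fin 7 → ℝ) : cMat * B₂ * cMat * octLin w = octLin (R w) * (cMat * B₂ * cMat) := by
    have := mul_octLin_of_conj hN hone (Fin.cons (α := fun _ => ℝ) 0 w)
    rw [hR, conjLin_cons, conjLin_cons, mul_neg, neg_mul, neg_inj] at this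
    exact this
  let g : Spin7 := ⟨rho7Sec (cMat * B₂ * cMat),
    rho7Sec_mem_spinGroup (conj_transpose_mul hB2) fun v => ⟨_, hoct v⟩⟩
  have hg : rho7 g = cMat * B₂ * cMat := rho7_rho7Sec _
  have hRg : vecAct g = R := by
    refine LinearMap.ext fun w => octLin_injective ?_
    have h1 := octLin_vecAct g w
    rw [hg, hoct] at h1
    have h2 := congrArg (· * (cMat * B₂ * cMat)ᵀ) h1
    simp only [mul_assoc _ (cMat * B₂ * cMat)] at h2
    rw [mul_eq_one_comm.1 (conj_transpose_mul hB2), mul_one, mul_one] at h2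
    exact h2.symm
  refine ⟨g, Spin101_ext ?_⟩
  rw [rho_spinLift, spinD, hg, hRg, hB]
  congr 1
  · refine matrix_ext_mulVec fun z => ?_
    have hdec : z = z 0 • one8 + Fin.cons (α := fun _ => ℝ) 0 (Fin.tail z) := by
      funext i; refine Fin.cases ?_ (fun i => ?_) i <;> simp [one8, Fin.tail]
    rw [extMat_mulVec]
    conv_lhs => rw [hdec, Matrix.mulVec_add, Matrix.mulVec_smul, hone, hR]
    funext i; refine Fin.cases ?_ (fun i => ?_) i <;> simp [one8]
  · have : cMat * (cMat * B₂ * cMat) * cMat = (cMat * cMat) * B₂ * (cMat * cMat) := by noncomm_ring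
    rw [this, cMat_sq, one_mul, mul_one]

theorem coe_eq_of_spinLift (g : Spin7) :
    (g : CliffordAlgebra Q7) = rho7Sec (cMat * lowBlock (rho (spinLift g)) * cMat) := by
  refine rho7_even_inj (spinGroup.involute_eq g.2) (involute_rho7Sec _) ?_
  rw [rho7_rho7Sec, rho_spinLift, spinD, lowBlock_Dmat]
  have : cMat * (cMat * rho7 g * cMat) * cMat = (cMat * cMat) * rho7 g * (cMat * cMat) := by
    noncomm_ring
  rw [this, cMat_sq, one_mul, mul_one]

theorem continuous_spinLift : Continuous spinLift := by
  have h1 : Continuous fun g : Spin7 => extMat 1 (vecAct g) := by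
    refine continuous_matrix fun i j => ?_
    have h2 (g : Spin7) : extMat 1 (vecAct g) i j
        = (Fin.cons (α := fun _ => ℝ) ((Pi.single j 1 : Fin 8 → ℝ) 0)
          (vecAct g (Fin.tail (Pi.single j 1 : Fin 8 → ℝ))) : Fin 8 → ℝ) i := by
      rw [← one_mul ((Pi.single j 1 : Fin 8 → ℝ) 0), ← extMat_mulVec, Matrix.mulVec_single_one]; rfl
    simp only [h2]
    refine Fin.cases ?_ (fun i => ?_) i
    · simp only [Fin.cons_zero]; exact continuous_const
    · simp only [Fin.cons_succ]
      exact (continuous_apply i).comp (continuous_vecAct _)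
  have h3 : Continuous fun g : Spin7 => rho7 g :=
    (continuous_clifford_linear rho7.toLinearMap).comp continuous_subtype_val
  have h4 : Continuous spinD := by
    unfold spinD Dmat
    have h5 := (continuous_const (y := cMat)).matrix_mul h3 |>.matrix_mul (continuous_const (y := cMat))
    exact ((h1.matrix_fromBlocks continuous_const continuous_const h5).matrix_fromBlocks
      continuous_const continuous_const
      (h1.matrix_fromBlocks continuous_const continuous_const h5))
  exact Continuous.subtype_mk ((LinearMap.continuous_of_finiteDimensional rhoSec).comp h4) _

end ExoticSpinor
end

noncomputable section
namespace ExoticSpinor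
open CliffordAlgebra

/-! ### Lifting `so₇` to `so_{10,1}` -/

variable {B₁ B₂ : Matrix (Fin 8) (Fin 8) ℝ}

/-- The operator of `A ∈ so₇` on the octonions through the vector representation. -/
def vecMat (A : Matrix (Fin 7) (Fin 7) ℝ) : Matrix (Fin 8) (Fin 8) ℝ := extMat 0 A.mulVecLin

theorem vecMat_mulVec (A : Matrix (Fin 7) (Fin 7) ℝ) (z : Fin 8 → ℝ) :
    vecMat A *ᵥ z = Fin.cons (α := fun _ => ℝ) 0 (A *ᵥ Fin.tail z) := by
  rw [vecMat, extMat_mulVec, zero_mul]; rfl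

theorem vecMat_zero_left (A : Matrix (Fin 7) (Fin 7) ℝ) (j : Fin 8) : vecMat A 0 j = 0 := by
  have h := congrFun (vecMat_mulVec A (Pi.single j 1)) 0
  rw [Matrix.mulVec_single_one, Fin.cons_zero] at h
  exact h

theorem vecMat_zero_right (A : Matrix (Fin 7) (Fin 7) ℝ) (i : Fin 8) : vecMat A i 0 = 0 := by
  have h := congrFun (extMat_one8 0 A.mulVecLin) i
  rw [one8, Matrix.mulVec_single_one, zero_smul] at h
  exact h

theorem vecMat_succ (A : Matrix (Fin 7) (Fin 7) ℝ) (i j : Fin 7) :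
    vecMat A i.succ j.succ = A i j := by
  have h := congrFun (vecMat_mulVec A (Pi.single j.succ 1)) i.succ
  have ht : (Fin.tail (Pi.single j.succ 1 : Fin 8 → ℝ) : Fin 7 → ℝ) = Pi.single j 1 := by
    funext k; simp [Fin.tail, Pi.single_apply]
  rw [Matrix.mulVec_single_one, Fin.cons_succ, ht, Matrix.mulVec_single_one] at h
  exact h

theorem vecMat_ext {A : Matrix (Fin 7) (Fin 7) ℝ} (h0 : ∀ j, B₁ 0 j = 0) (h1 : ∀ i, B₁ i 0 = 0)
    (h2 : ∀ i j, B₁ (Fin.succ i) (Fin.succ j) = A i j) : B₁ = vecMat A := by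
  ext i j
  refine Fin.cases ?_ (fun i => ?_) i
  · rw [h0, vecMat_zero_left]
  · refine Fin.cases ?_ (fun j => ?_) j
    · rw [h1, vecMat_zero_right]
    · rw [h2, vecMat_succ]

theorem vecMat_add (A B : Matrix (Fin 7) (Fin 7) ℝ) : vecMat (A + B) = vecMat A + vecMat B :=
  (vecMat_ext (fun j => by simp [vecMat_zero_left]) (fun j => by simp [vecMat_zero_right])
    fun i j => by simp [vecMat_succ]).symm

theorem vecMat_smul (r : ℝ) (A : Matrix (Fin 7) (Fin 7) ℝ) : vecMat (r • A) = r • vecMat A :=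
  (vecMat_ext (fun j => by simp [vecMat_zero_left]) (fun j => by simp [vecMat_zero_right])
    fun i j => by simp [vecMat_succ]).symm

theorem vecMat_transpose (A : Matrix (Fin 7) (Fin 7) ℝ) : (vecMat A)ᵀ = vecMat Aᵀ :=
  vecMat_ext (fun j => by simp [vecMat_zero_right]) (fun j => by simp [vecMat_zero_left])
    fun i j => by simp [vecMat_succ]

theorem vecMat_neg (A : Matrix (Fin 7) (Fin 7) ℝ) : vecMat (-A) = -vecMat A :=
  (vecMat_ext (fun j => by simp [vecMat_zero_left]) (fun j => by simp [vecMat_zero_right])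
    fun i j => by simp [vecMat_succ]).symm

theorem vecMat_sub (A B : Matrix (Fin 7) (Fin 7) ℝ) : vecMat (A - B) = vecMat A - vecMat B := by
  rw [sub_eq_add_neg, vecMat_add, vecMat_neg, ← sub_eq_add_neg]

theorem vecMat_mul (A B : Matrix (Fin 7) (Fin 7) ℝ) : vecMat (A * B) = vecMat A * vecMat B := by
  rw [vecMat, Matrix.mulVecLin_mul, vecMat, vecMat, extMat_mul, zero_mul]

theorem spinMat_transpose {A : Matrix (Fin 7) (Fin 7) ℝ} (hA : Aᵀ = -A) :
    (spinMat A)ᵀ = -spinMat A := by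
  have hA' (i j : Fin 7) : A i j = -A j i := by
    have := congrFun (congrFun hA j) i; simpa using this
  simp only [spinMat_apply, Matrix.transpose_smul, Matrix.transpose_sum, Matrix.transpose_mul,
    octL_transpose, neg_mul_neg]
  rw [← smul_neg, Finset.sum_comm, ← Finset.sum_neg_distrib]
  congr 1
  refine Finset.sum_congr rfl fun i _ => ?_
  rw [← Finset.sum_neg_distrib]
  refine Finset.sum_congr rfl fun j _ => ?_
  rw [hA' j i, neg_smul]

theorem spinMat_octLin {A : Matrix (Fin 7) (Fin 7) ℝ} (hA : Aᵀ = -A) (w : Fin 7 → ℝ) :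
    spinMat A * octLin w - octLin w * spinMat A = octLin (A *ᵥ w) := by
  have h : ⁅spinMat A, octLin w⁆ = octLin (A *ᵥ w) := by
    rw [octLin_apply, octLin_apply, lie_sum]
    simp only [lie_smul, lie_spinMat_octL A hA, Finset.smul_sum, smul_smul, Matrix.mulVec,
      dotProduct, Finset.sum_smul]
    rw [Finset.sum_comm]
    simp only [mul_comm]
  rw [← h, LieRing.of_associative_ring_bracket]

theorem conj_skew {D : Matrix (Fin 8) (Fin 8) ℝ} (h : Dᵀ = -D) :
    (cMat * D * cMat)ᵀ = -(cMat * D * cMat) := by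
  rw [Matrix.transpose_mul, Matrix.transpose_mul, cMat_transpose, h]; noncomm_ring

theorem conj_conj (D : Matrix (Fin 8) (Fin 8) ℝ) : cMat * (cMat * D * cMat) * cMat = D := by
  have : cMat * (cMat * D * cMat) * cMat = (cMat * cMat) * D * (cMat * cMat) := by noncomm_ring
  rw [this, cMat_sq, one_mul, mul_one]

/-- The operator on `Δ` of an element of `so₇`. -/
def soD : Matrix (Fin 7) (Fin 7) ℝ →ₗ[ℝ] Matrix S11 S11 ℝ where
  toFun A := Dmat (vecMat A) (cMat * spinMat A * cMat)
  map_add' A B := by rw [vecMat_add, map_add, mul_add, add_mul, Dmat_add]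
  map_smul' r A := by
    rw [vecMat_smul, map_smul, mul_smul_comm, smul_mul_assoc, RingHom.id_apply, Dmat_smul]

theorem soD_apply (A : Matrix (Fin 7) (Fin 7) ℝ) :
    soD A = Dmat (vecMat A) (cMat * spinMat A * cMat) := rfl

/-- The inclusion of `so₇` in `so_{10,1}` as the isotropy algebra of `psi0` in `so₈`. -/
def soLift : Matrix (Fin 7) (Fin 7) ℝ →ₗ[ℝ] Cl := rhoSec ∘ₗ soD

theorem rho_soLift (A : Matrix (Fin 7) (Fin 7) ℝ) : rho (soLift A) = soD A := rho_rhoSec _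

theorem soD_lie_gammaLin {A : Matrix (Fin 7) (Fin 7) ℝ} (hA : Aᵀ = -A) (v : Mink) :
    soD A * gammaLin v - gammaLin v * soD A
      = gammaLin (incl8 (conjEquiv (spinMat A *ᵥ conjEquiv.symm (proj8 v)))) := by
  conv_lhs => rw [mink_eq_timePart v]
  refine Dmat_lie_gammaLin (by rw [vecMat_transpose, hA, vecMat_neg])
    (conj_skew (spinMat_transpose hA)) ?_ v
  have := conj_lie_octN (R := A.mulVecLin) (spinMat_octLin hA) (conjEquiv.symm (proj8 v))
  rwa [LinearEquiv.apply_symm_apply] at this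

theorem soLift_mem {A : Matrix (Fin 7) (Fin 7) ℝ} (hA : Aᵀ = -A) :
    soLift A ∈ isotropyAlgebra (eps psi0) := by
  refine ⟨rhoSec_mem_spinLie Dmat_gamma0 ?_ fun v => ⟨_, soD_lie_gammaLin hA v⟩, ?_⟩
  · rw [soD_apply, Dmat_transpose, vecMat_transpose, hA, vecMat_neg,
      conj_skew (spinMat_transpose hA), Dmat_neg]
  · rw [rho_soLift, soD_apply, psi0, Dmat_mulVec, vecMat, extMat_one8, zero_smul]
    funext i; rcases i with (i | i) | i <;> simp [eps]

theorem lie_soLift {A : Matrix (Fin 7) (Fin 7) ℝ} (hA : Aᵀ = -A) (v : Mink) :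
    ⁅soLift A, ι Qmink v⁆ = ι Qmink (incl8 (conjEquiv (spinMat A *ᵥ conjEquiv.symm (proj8 v)))) := by
  have hi := involute_of_mem_spinLie (soLift_mem hA).1
  refine rho_odd_inj ?_ (involute_ι _) ?_
  · rw [LieRing.of_associative_ring_bracket, map_sub, map_mul, map_mul, hi, involute_ι]
    noncomm_ring
  · rw [LieRing.of_associative_ring_bracket, map_sub, map_mul, map_mul, rho_ι, rho_ι, rho_soLift,
      soD_lie_gammaLin hA]

theorem soLift_lie {A B : Matrix (Fin 7) (Fin 7) ℝ} (hA : Aᵀ = -A) (hB : Bᵀ = -B) :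
    soLift ⁅A, B⁆ = ⁅soLift A, soLift B⁆ := by
  have hAB : ⁅A, B⁆ᵀ = -⁅A, B⁆ := by
    rw [LieRing.of_associative_ring_bracket, Matrix.transpose_sub, Matrix.transpose_mul,
      Matrix.transpose_mul, hA, hB]
    noncomm_ring
  have hi := involute_of_mem_spinLie (soLift_mem hA).1
  have hj := involute_of_mem_spinLie (soLift_mem hB).1
  refine rho_even_inj (involute_of_mem_spinLie (soLift_mem hAB).1) ?_ ?_
  · rw [LieRing.of_associative_ring_bracket, map_sub, map_mul, map_mul, hi, hj]
  · rw [LieRing.of_associative_ring_bracket (soLift A), map_sub, map_mul, map_mul, rho_soLift,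
      rho_soLift, rho_soLift, soD_apply, soD_apply, soD_apply, Dmat_mul, Dmat_mul, Dmat_sub,
      cMat_conj_mul, cMat_conj_mul, spinMat_lie A B hA, LieRing.of_associative_ring_bracket,
      LieRing.of_associative_ring_bracket, vecMat_sub, vecMat_mul, vecMat_mul, mul_sub, sub_mul]

theorem lie_Sig_of_lie {X : Cl} {a b a' b' : Mink} (ha : ⁅X, ι Qmink a⁆ = ι Qmink a')
    (hb : ⁅X, ι Qmink b⁆ = ι Qmink b') : ⁅X, Sig a b⁆ = Sig a' b + Sig a b' := by
  simp only [Sig]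
  rw [lie_smul, leibniz_lie, ha, hb, smul_add]

theorem proj8_nullVec (b : Fin 8 → ℝ) (c : ℝ) : proj8 (nullVec b c) = b := by
  rw [nullVec, map_add, map_smul, proj8_e10, smul_zero, add_zero, proj8_incl8]

theorem lie_soLift_nullGen {A : Matrix (Fin 7) (Fin 7) ℝ} (hA : Aᵀ = -A) (b : Fin 8 → ℝ) (c : ℝ) :
    ⁅soLift A, nullGen b c⁆ = nullGen (conjEquiv (spinMat A *ᵥ conjEquiv.symm b)) 0 := by
  rw [nullGen_eq, nullGen_eq, lie_Sig_of_lie (lie_soLift hA _) (lie_soLift hA _), proj8_ePlus,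
    proj8_nullVec, map_zero, Matrix.mulVec_zero, map_zero, map_zero]
  simp [Sig, nullVec]

theorem nullGen_lie (b b' : Fin 8 → ℝ) (c c' : ℝ) : ⁅nullGen b c, nullGen b' c'⁆ = 0 := by
  have h1 (v : Mink) (hv : mip ePlus v = 0) :
      ⁅nullGen b c, ι Qmink v⁆ = ι Qmink (-mip (nullVec b c) v • ePlus) := by
    rw [nullGen_eq, lie_Sig, hv]; congr 1; module
  rw [nullGen_eq b', lie_Sig_of_lie (h1 _ mip_ePlus_self) (h1 _ (mip_ePlus_nullVec b' c')),
    mip_comm, mip_ePlus_nullVec]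
  simp [Sig]

/-! ### The isotropy algebra of `psi0` -/

theorem incl8_proj8_of_lieAct {X : Cl} (hX : X ∈ spinLie Qmink) (h0 : lieAct hX (e 0) = 0)
    (h9 : lieAct hX (e 9) = 0) (h10 : lieAct hX (e 10) = 0) (y : Mink) :
    lieAct hX y = incl8 (proj8 (lieAct hX y)) := by
  have key (M : Fin 11) (hM : lieAct hX (e M) = 0) : lieAct hX y M = 0 := by
    have h1 := mip_lieAct hX (e M) y
    rw [hM, map_zero, LinearMap.zero_apply, mip_single, eq_comm, neg_eq_zero] at h1
    exact (mul_eq_zero.1 h1).resolve_left (eta_ne M)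
  conv_lhs => rw [mink_eq (lieAct hX y), key 0 h0, key 9 h9, key 10 h10]
  simp

theorem lie_octLin_of_conj {T : (Fin 8 → ℝ) → (Fin 8 → ℝ)}
    (h : ∀ y, B₂ * octN y = octN (T y) + octN y * B₁) (hone : B₁ *ᵥ one8 = 0) (z : Fin 8 → ℝ) :
    cMat * B₂ * cMat * conjLin z = conjLin z * (cMat * B₂ * cMat) + conjLin (B₁ *ᵥ z) := by
  have h1 (x z) : (cMat * B₂ * cMat * conjLin z) *ᵥ x
      = conjLin z *ᵥ (conjEquiv.symm (T (conjEquiv x))) + conjLin (B₁ *ᵥ z) *ᵥ x := by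
    have h2 := h (conjEquiv x)
    rw [octN_conjEquiv, ← conjEquiv.apply_symm_apply (T (conjEquiv x)), octN_conjEquiv] at h2
    have h3 := congrArg (fun M => cMat *ᵥ (M *ᵥ z)) h2
    rw [Matrix.add_mulVec, ← Matrix.mulVec_mulVec, ← Matrix.mulVec_mulVec, conjLin_swap x z,
      conjLin_swap x (B₁ *ᵥ z), conjLin_swap _ z, Matrix.mulVec_add,
      Matrix.mulVec_mulVec _ cMat cMat, Matrix.mulVec_mulVec _ cMat cMat, cMat_sq,
      Matrix.one_mulVec, Matrix.one_mulVec] at h3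
    rw [← h3]
    simp only [Matrix.mulVec_mulVec, mul_assoc]
  refine matrix_ext_mulVec fun x => ?_
  have h0 := h1 x one8
  have hc : conjLin 0 = 0 := by simp [conjLin]
  rw [conjLin_one8, mul_one, hone, hc, Matrix.one_mulVec, Matrix.zero_mulVec, add_zero] at h0
  rw [h1, ← h0, Matrix.mulVec_mulVec, Matrix.add_mulVec]

theorem eq_soLift {X : Cl} (hX : X ∈ isotropyAlgebra (eps psi0)) (h0 : lieAct hX.1 (e 0) = 0)
    (h9 : lieAct hX.1 (e 9) = 0) (h10 : lieAct hX.1 (e 10) = 0) :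
    ∃ A : Matrix (Fin 7) (Fin 7) ℝ, Aᵀ = -A ∧ X = soLift A := by
  have hc (M : Fin 11) (hM : lieAct hX.1 (e M) = 0) :
      rho X * gammaLin (e M) = gammaLin (e M) * rho X := by
    rw [← sub_eq_zero, ← gammaLin_lieAct hX.1, hM, map_zero]
  obtain ⟨B₁, B₂, hB⟩ := exists_eq_Dmat (hc 0 h0) (hc 9 h9) (hc 10 h10)
  have ho := rho_transpose_of_mem_spinLie hX.1
  rw [hB, ← Dmat_gamma0, Dmat_transpose, ← neg_mul, Dmat_neg] at ho
  have ho' : Dmat B₁ᵀ B₂ᵀ = Dmat (-B₁) (-B₂) := by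
    have := congrArg (· * (-gamma0)) ho
    simp only [mul_assoc, mul_neg, gamma0_sq, neg_neg, mul_one] at this
    exact this
  have hs1 := (Dmat_inj ho').1
  have hs2 := (Dmat_inj ho').2
  have hN (y : Fin 8 → ℝ) :
      B₂ * octN y = octN (proj8 (lieAct hX.1 (incl8 y))) + octN y * B₁ := by
    have hv := gammaLin_lieAct hX.1 (incl8 y)
    rw [incl8_proj8_of_lieAct hX.1 h0 h9 h10 (incl8 y)] at hv
    generalize proj8 (lieAct hX.1 (incl8 y)) = y' at hv ⊢
    have hb (z : Fin 8 → ℝ) : gammaLin (incl8 z)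
        = Matrix.fromBlocks 0 (-gammaPLin z) (gammaPLin z) 0 := by
      have : incl8 z = timePart 0 + incl8 z := by simp [timePart]
      rw [this, gammaLin_timePart]; simp
    rw [hB, hb, hb, Dmat, eq_sub_iff_add_eq, Matrix.fromBlocks_multiply, Matrix.fromBlocks_multiply,
      Matrix.fromBlocks_add] at hv
    have h21 := (Matrix.fromBlocks_inj.1 hv).2.2.1
    rw [gammaPLin_blocks, gammaPLin_blocks] at h21
    simp only [zero_mul, mul_zero, add_zero, zero_add, Matrix.fromBlocks_multiply,
      Matrix.fromBlocks_add] at h21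
    exact (Matrix.fromBlocks_inj.1 h21).2.2.1.symm
  have hone : B₁ *ᵥ one8 = 0 := by
    have h := hX.2
    rw [hB, psi0, Dmat_mulVec] at h
    funext i; exact congrFun h (Sum.inl (Sum.inl i))
  have hcol (i : Fin 8) : B₁ i 0 = 0 := by
    have := congrFun hone i
    rw [one8, Matrix.mulVec_single_one] at this; exact this
  have hsk (i j : Fin 8) : B₁ i j = -B₁ j i := by
    have := congrFun (congrFun hs1 j) i; simpa using this
  let A : Matrix (Fin 7) (Fin 7) ℝ := Matrix.of fun i j => B₁ i.succ j.succ
  have hA : Aᵀ = -A := by ext i j; simp [A, hsk j.succ i.succ]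
  have hB1 : B₁ = vecMat A :=
    vecMat_ext (fun j => by rw [hsk, hcol, neg_zero]) hcol fun i j => rfl
  have hoct (w : Fin 7 → ℝ) : cMat * B₂ * cMat * octLin w - octLin w * (cMat * B₂ * cMat)
      = octLin (A *ᵥ w) := by
    have := lie_octLin_of_conj hN hone (Fin.cons (α := fun _ => ℝ) 0 w)
    rw [hB1, vecMat_mulVec, Fin.tail_cons, conjLin_cons, conjLin_cons, mul_neg, neg_mul,
      ← neg_add, neg_inj] at this
    rw [this]; abel
  have hY1 := rho7Sec_mem_spinLie (conj_skew hs2) fun v => ⟨_, hoct v⟩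
  have hY2 := rho7Sec_mem_spinLie (spinMat_transpose hA) fun v => ⟨_, spinMat_octLin hA v⟩
  have hl (D : Matrix (Fin 8) (Fin 8) ℝ) (hD : ∀ w, D * octLin w - octLin w * D = octLin (A *ᵥ w))
      (w : Fin 7 → ℝ) : ⁅rho7Sec D, ι Q7 w⁆ = ι Q7 (A *ᵥ w) := by
    refine rho7_odd_inj ?_ (involute_ι _) ?_
    · rw [LieRing.of_associative_ring_bracket, map_sub, map_mul, map_mul, involute_rho7Sec,
        involute_ι]
      noncomm_ring
    · rw [LieRing.of_associative_ring_bracket, map_sub, map_mul, map_mul, rho7_ι, rho7_ι,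
        rho7_rho7Sec, hD]
  have heq : rho7Sec (cMat * B₂ * cMat) = rho7Sec (spinMat A) :=
    eq_of_lie_ι_eq (w := negW 7) negW_ne hY1 hY2 fun i =>
      (hl _ hoct _).trans (hl _ (spinMat_octLin hA) _).symm
  have hD : cMat * B₂ * cMat = spinMat A := by
    rw [← rho7_rho7Sec (cMat * B₂ * cMat), heq, rho7_rho7Sec]
  refine ⟨A, hA, rho_even_inj (involute_of_mem_spinLie hX.1)
    (involute_of_mem_spinLie (soLift_mem hA).1) ?_⟩
  rw [rho_soLift, soD_apply, ← hD, conj_conj, hB, hB1]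

/-- The semidirect sum of `ℝ⁸` and `so₇` through the spin representation, times `ℝ`. -/
abbrev ModelLie : Type :=
  LieAlgebra.SemiDirectSum (Fin 8 → ℝ) (LieAlgebra.Orthogonal.so (Fin 7) ℝ) spinDer × ℝ

theorem so_transpose (A : LieAlgebra.Orthogonal.so (Fin 7) ℝ) : (A.1)ᵀ = -A.1 :=
  (LieAlgebra.Orthogonal.mem_so _ _ A.1).mp A.2

theorem nullGen_smul (r : ℝ) (b : Fin 8 → ℝ) (c : ℝ) : nullGen (r • b) (r * c) = r • nullGen b c := by
  simp only [nullGen, Pi.smul_apply, smul_eq_mul, mul_smul, smul_add, Finset.smul_sum]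

/-- The isotropy algebra of `psi0` as a vector space. -/
def modelLin : ModelLie →ₗ[ℝ] isotropyAlgebra (eps psi0) where
  toFun x := ⟨soLift x.1.right.1 + nullGen (conjEquiv x.1.left) x.2,
    add_mem (soLift_mem (so_transpose _)) (nullGen_mem_isotropy psi0_chir _ _)⟩
  map_add' x y := Subtype.ext (by
    change soLift (x.1.right.1 + y.1.right.1) + nullGen (conjEquiv (x.1.left + y.1.left)) (x.2 + y.2)
      = soLift x.1.right.1 + nullGen (conjEquiv x.1.left) x.2
        + (soLift y.1.right.1 + nullGen (conjEquiv y.1.left) y.2)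
    rw [map_add, map_add, nullGen_add]; abel)
  map_smul' r x := Subtype.ext (by
    change soLift (r • x.1.right.1) + nullGen (conjEquiv (r • x.1.left)) (r * x.2)
      = r • (soLift x.1.right.1 + nullGen (conjEquiv x.1.left) x.2)
    rw [map_smul, map_smul, nullGen_smul, smul_add])

theorem coe_modelLin (x : ModelLie) : (modelLin x : Cl)
    = soLift x.1.right.1 + nullGen (conjEquiv x.1.left) x.2 := rfl

theorem modelLin_bijective : Function.Bijective modelLin := by
  constructor
  · rw [injective_iff_map_eq_zero]
    intro x hx
    have hx' : soLift x.1.right.1 + nullGen (conjEquiv x.1.left) x.2 = 0 := congrArg Subtype.val hx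
    have h1 : ⁅soLift x.1.right.1 + nullGen (conjEquiv x.1.left) x.2, ι Qmink (e 0)⁆
        = ι Qmink (-nullVec (conjEquiv x.1.left) x.2) := by
      have hm : mip (nullVec (conjEquiv x.1.left) x.2) (e 0) = 0 := by
        rw [mip_comm, mip_single]; simp [nullVec, incl8_zero_coord, e_apply]
      rw [add_lie, lie_soLift (so_transpose _), proj8_e0, map_zero, Matrix.mulVec_zero, map_zero,
        map_zero, map_zero, zero_add, nullGen_eq, lie_Sig, hm, mip_ePlus]
      congr 1; simp [e_apply]
    rw [hx', zero_lie, ← map_zero (ι Qmink)] at h1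
    have h2 := neg_eq_zero.1 (ι_inj h1).symm
    have hb : x.1.left = 0 := by
      have := congrArg proj8 h2
      rw [proj8_nullVec, map_zero] at this
      exact (LinearEquiv.map_eq_zero_iff conjEquiv).1 this
    have hc : x.2 = 0 := by
      have := congrFun h2 10
      simpa [nullVec, incl8_ten, e_apply] using this
    have hA : x.1.right.1 = 0 := by
      have h0 : nullGen (conjEquiv x.1.left) x.2 = 0 := by
        rw [hb, hc, map_zero]; simp [nullGen]
      rw [h0, add_zero] at hx'
      have h3 := congrArg rho hx'
      rw [rho_soLift, soD_apply, map_zero] at h3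
      have h4 : Dmat (vecMat x.1.right.1) (cMat * spinMat x.1.right.1 * cMat) = Dmat 0 0 := by
        rw [h3]; simp [Dmat]
      ext i j
      exact (vecMat_succ x.1.right.1 i j).symm.trans
        (congrFun (congrFun (Dmat_inj h4).1 i.succ) j.succ)
    obtain ⟨⟨b, A⟩, c⟩ := x
    simp only at hb hc hA
    subst hb hc
    have : A = 0 := Subtype.ext hA
    subst this; rfl
  · rintro ⟨X, hX⟩
    obtain ⟨b, c, Y, hY, h0, h9, h10, rfl⟩ := exists_eq_nullGen_add psi0_ne psi0_chir hX
    obtain ⟨A, hA, rfl⟩ := eq_soLift hY h0 h9 h10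
    refine ⟨(⟨conjEquiv.symm b, ⟨A, (LieAlgebra.Orthogonal.mem_so _ _ A).mpr hA⟩⟩, c),
      Subtype.ext ?_⟩
    rw [coe_modelLin]
    simp

/-- The structure of the isotropy algebra of `psi0`. -/
def modelLieEquiv : ModelLie ≃ₗ⁅ℝ⁆ isotropyAlgebra (eps psi0) where
  __ := LinearEquiv.ofBijective modelLin modelLin_bijective
  map_lie' := by
    intro x y
    apply Subtype.ext
    change soLift ⁅x.1.right.1, y.1.right.1⁆ + nullGen (conjEquiv (⁅x.1.left, y.1.left⁆
        + spinMat x.1.right.1 *ᵥ y.1.left - spinMat y.1.right.1 *ᵥ x.1.left)) ⁅x.2, y.2⁆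
      = ⁅soLift x.1.right.1 + nullGen (conjEquiv x.1.left) x.2,
        soLift y.1.right.1 + nullGen (conjEquiv y.1.left) y.2⁆
    have h1 : ⁅x.1.left, y.1.left⁆ = 0 := by
      rw [LieRing.of_associative_ring_bracket, mul_comm, sub_self]
    have h2 : ⁅x.2, y.2⁆ = 0 := by
      rw [LieRing.of_associative_ring_bracket, mul_comm, sub_self]
    have h3 (b : Fin 8 → ℝ) (c : ℝ) : ⁅nullGen b c, soLift y.1.right.1⁆
        = -nullGen (conjEquiv (spinMat y.1.right.1 *ᵥ conjEquiv.symm b)) 0 := by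
      rw [← lie_skew, lie_soLift_nullGen (so_transpose _)]
    have h4 : nullGen (-conjEquiv (spinMat y.1.right.1 *ᵥ x.1.left)) 0
        = -nullGen (conjEquiv (spinMat y.1.right.1 *ᵥ x.1.left)) 0 := by
      simp [nullGen]
    rw [soLift_lie (so_transpose _) (so_transpose _), h1, h2, zero_add, map_sub, sub_eq_add_neg,
      lie_add, add_lie, add_lie, lie_soLift_nullGen (so_transpose _), h3, nullGen_lie,
      conjEquiv.symm_apply_apply, conjEquiv.symm_apply_apply, ← h4, ← add_zero (0 : ℝ), nullGen_add]
    simp only [add_zero]; abel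

/-! ### Dimension and non-reductivity -/

/-- A skew matrix is determined by its entries above the diagonal. -/
def soEquiv : LieAlgebra.Orthogonal.so (Fin 7) ℝ ≃ₗ[ℝ] ({p : Fin 7 × Fin 7 // p.1 < p.2} → ℝ) where
  toFun A p := A.1 p.1.1 p.1.2
  map_add' _ _ := rfl
  map_smul' _ _ := rfl
  invFun f := ⟨Matrix.of fun i j => if h : i < j then f ⟨(i, j), h⟩ else
      if h : j < i then -f ⟨(j, i), h⟩ else 0, (LieAlgebra.Orthogonal.mem_so _ _ _).mpr (by
    ext i j
    rcases lt_trichotomy i j with h | h | h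
    · simp [h, h.not_gt]
    · simp [h]
    · simp [h, h.not_gt])⟩
  left_inv A := by
    have hA (i j : Fin 7) : A.1 j i = -A.1 i j := by
      have := congrFun (congrFun (so_transpose A) i) j; simpa using this
    apply Subtype.ext
    ext i j
    rcases lt_trichotomy i j with h | h | h
    · simp [h]
    · subst h
      have := hA i i
      simp only [lt_self_iff_false, dite_false, Matrix.of_apply]
      linarith
    · simp [h, h.not_gt, hA i j]
  right_inv f := by
    funext ⟨p, hp⟩
    simp [hp]

theorem finrank_modelLie : Module.finrank ℝ ModelLie = 30 := by
  have h1 : Module.finrank ℝ (LieAlgebra.Orthogonal.so (Fin 7) ℝ) = 21 := by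
    rw [soEquiv.finrank_eq, Module.finrank_fintype_fun_eq_card]
    decide
  have : Module.Finite ℝ (LieAlgebra.Orthogonal.so (Fin 7) ℝ) := Module.Finite.equiv soEquiv.symm
  let f := (LieAlgebra.SemiDirectSum.toProdl (R := ℝ) spinDer)
  have : Module.Finite ℝ (LieAlgebra.SemiDirectSum (Fin 8 → ℝ) (LieAlgebra.Orthogonal.so (Fin 7) ℝ)
      spinDer) := Module.Finite.equiv f.symm
  rw [Module.finrank_prod, f.finrank_eq, Module.finrank_prod, h1]
  simp

instance : Module.Finite ℝ ModelLie :=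
  Module.finite_of_finrank_pos (by rw [finrank_modelLie]; norm_num)

/-- The abelian ideal `ℝ⁸ × ℝ`. -/
def modelIdeal : LieIdeal ℝ ModelLie where
  carrier := {x | x.1.right = 0}
  add_mem' := fun {x y} hx hy => by
    change x.1.right + y.1.right = 0
    rw [show x.1.right = 0 from hx, show y.1.right = 0 from hy, add_zero]
  zero_mem' := rfl
  smul_mem' := fun r x hx => by
    change r • x.1.right = 0
    rw [show x.1.right = 0 from hx, smul_zero]
  lie_mem := fun {x y} hy => by
    change ⁅x.1.right, y.1.right⁆ = 0
    rw [show y.1.right = 0 from hy, lie_zero]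

theorem not_hasCentralRadical {L : Type*} [LieRing L] [LieAlgebra ℝ L] (f : L ≃ₗ⁅ℝ⁆ ModelLie) :
    ¬LieAlgebra.HasCentralRadical ℝ L := by
  intro hL
  have : Module.Finite ℝ L := Module.Finite.equiv f.toLinearEquiv.symm
  let I : LieIdeal ℝ L := modelIdeal.comap f.toLieHom
  have hab : IsLieAbelian I := ⟨fun x y => by
    apply Subtype.ext
    apply f.injective
    have hx : (f x.1).1.right = 0 := x.2
    have hy : (f y.1).1.right = 0 := y.2
    change f ⁅x.1, y.1⁆ = f 0
    rw [LieEquiv.map_lie, map_zero]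
    generalize f x.1 = u at *
    generalize f y.1 = v at *
    obtain ⟨⟨b, A⟩, c⟩ := u
    obtain ⟨⟨b', A'⟩, c'⟩ := v
    simp only at hx hy
    subst hx hy
    have h1 : ⁅b, b'⁆ = 0 := by rw [LieRing.of_associative_ring_bracket, mul_comm, sub_self]
    have h2 : ⁅c, c'⁆ = 0 := by rw [LieRing.of_associative_ring_bracket, mul_comm, sub_self]
    refine Prod.ext (LieAlgebra.SemiDirectSum.ext ?_ ?_) h2
    · change ⁅b, b'⁆ + spinMat (0 : Matrix _ _ ℝ) *ᵥ b' - spinMat (0 : Matrix _ _ ℝ) *ᵥ b = 0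
      rw [h1]; simp
    · exact lie_zero _⟩
  have hrad : I ≤ LieAlgebra.radical ℝ L := (LieAlgebra.LieIdeal.solvable_iff_le_radical ℝ L I).1 inferInstance
  rw [LieAlgebra.HasCentralRadical.radical_eq_center] at hrad
  let A : Matrix (Fin 7) (Fin 7) ℝ := Matrix.single 0 1 1 - Matrix.single 1 0 1
  have hA : Aᵀ = -A := by simp [A, Matrix.transpose_sub, Matrix.transpose_single]
  have hA' : spinMat A ≠ 0 := fun h => by
    have h1 := spinMat_octLin hA (Pi.single 1 1)
    rw [h, zero_mul, mul_zero, sub_zero, eq_comm, ← map_zero octLin] at h1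
    have := congrFun (octLin_injective h1) 0
    simp [A] at this
  obtain ⟨b, hb⟩ : ∃ b, spinMat A *ᵥ b ≠ 0 := by
    by_contra! h
    exact hA' (matrix_ext_mulVec fun v => by rw [h v, Matrix.zero_mulVec])
  let x : ModelLie := (⟨b, 0⟩, 0)
  let y : ModelLie := (⟨0, ⟨A, (LieAlgebra.Orthogonal.mem_so _ _ A).mpr hA⟩⟩, 0)
  have hx : f.symm x ∈ I := by
    change (f (f.symm x)).1.right = 0
    rw [LieEquiv.apply_symm_apply]
  have hc := (LieModule.mem_maxTrivSubmodule ℝ L L _).1 (hrad hx) (f.symm y)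
  have h1 : ⁅y, x⁆ = 0 := by
    have h2 := congrArg f hc
    rwa [LieEquiv.map_lie, LieEquiv.apply_symm_apply, LieEquiv.apply_symm_apply, map_zero] at h2
  have h3 : ⁅(0 : Fin 8 → ℝ), b⁆ + spinMat A *ᵥ b - spinMat (0 : Matrix _ _ ℝ) *ᵥ (0 : Fin 8 → ℝ) = 0 :=
    congrArg (fun z : ModelLie => z.1.left) h1
  rw [zero_lie, zero_add, Matrix.mulVec_zero, sub_zero] at h3
  exact hb h3

end ExoticSpinor
end

noncomputable section
namespace ExoticSpinor
open CliffordAlgebra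

/-! ### Exponentials generate `Spin₇` -/

theorem clifford_map_exp_congr {V W E : Type*} [AddCommGroup V] [Module ℝ V] [Module.Finite ℝ V]
    [AddCommGroup W] [Module ℝ W] [Module.Finite ℝ W] {Q : QuadraticForm ℝ V}
    {Q' : QuadraticForm ℝ W} [AddCommGroup E] [Module ℝ E] [TopologicalSpace E] [ContinuousAdd E]
    [ContinuousSMul ℝ E] [T2Space E] {f : CliffordAlgebra Q →ₗ[ℝ] E}
    {f' : CliffordAlgebra Q' →ₗ[ℝ] E} {X : CliffordAlgebra Q} {Y : CliffordAlgebra Q'}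
    (h : ∀ n : ℕ, f (X ^ n) = f' (Y ^ n)) : f (NormedSpace.exp X) = f' (NormedSpace.exp Y) := by
  have h1 := clifford_map_hasSum_exp f X
  have h2 := clifford_map_hasSum_exp f' Y
  simp only [h] at h1
  exact h1.unique h2

theorem clifford_exp_commute {V : Type*} [AddCommGroup V] [Module ℝ V] [Module.Finite ℝ V]
    {Q : QuadraticForm ℝ V} {X Z : CliffordAlgebra Q} (h : Commute X Z) :
    NormedSpace.exp X * Z = Z * NormedSpace.exp X :=
  clifford_map_exp_congr (f := LinearMap.mulRight ℝ Z) (f' := LinearMap.mulLeft ℝ Z)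
    fun n => (h.pow_left n).eq

theorem clifford_exp_of_sq_eq_neg_one {V : Type*} [AddCommGroup V] [Module ℝ V] [Module.Finite ℝ V]
    {Q : QuadraticForm ℝ V} {J : CliffordAlgebra Q} (hJ : J * J = -1) (z : ℂ) :
    NormedSpace.exp (z.re • 1 + z.im • J) = (Complex.exp z).re • (1 : CliffordAlgebra Q)
      + (Complex.exp z).im • J := by
  let f : ℂ →ₐ[ℝ] CliffordAlgebra Q := Complex.lift ⟨J, hJ⟩
  have hf (w : ℂ) : f w = w.re • 1 + w.im • J := by
    rw [← Algebra.algebraMap_eq_smul_one]; exact Complex.liftAux_apply J hJ w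
  rw [← hf, ← hf]
  have h1 := NormedSpace.exp_series_hasSum_exp' (𝕂 := ℝ) z
  rw [← Complex.exp_eq_exp_ℂ] at h1
  have h2 := h1.map f.toLinearMap (LinearMap.continuous_of_finiteDimensional f.toLinearMap)
  refine (clifford_hasSum_exp (f z)).unique ?_
  simp only [Function.comp_def, map_smul, AlgHom.toLinearMap_apply, map_pow] at h2
  exact h2

section Generation

local notation "Cl7" => CliffordAlgebra (diagForm (negW 7))
local notation "ι7" => ι (diagForm (negW 7))

/-- The subgroup of `Spin₇` generated by exponentials. -/
def expSpin7 : Subgroup (spinGroup (diagForm (negW 7))) :=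
  Subgroup.closure {g | ∃ Y ∈ spinLie (diagForm (negW 7)), (g : Cl7) = NormedSpace.exp Y}

/-- Being the underlying element of a member of `expSpin7`. -/
def IsExpProd (x : Cl7) : Prop := ∃ g ∈ expSpin7, (g : Cl7) = x

theorem IsExpProd.mul {x y : Cl7} (hx : IsExpProd x) (hy : IsExpProd y) : IsExpProd (x * y) := by
  obtain ⟨g, hg, rfl⟩ := hx
  obtain ⟨h, hh, rfl⟩ := hy
  exact ⟨g * h, mul_mem hg hh, rfl⟩

theorem isExpProd_exp {Y : Cl7} (hY : Y ∈ spinLie (diagForm (negW 7))) :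
    IsExpProd (NormedSpace.exp Y) :=
  ⟨⟨_, exp_mem_spinGroup negW_ne hY⟩, Subgroup.subset_closure ⟨Y, hY, rfl⟩, rfl⟩

theorem polar_negW (u w : Fin 7 → ℝ) :
    QuadraticMap.polar (diagForm (negW 7)) u w = -2 * (u ⬝ᵥ w) := by
  rw [polar_diagForm]; simp [dotProduct]

theorem isExpProd_of_orthonormal {u w : Fin 7 → ℝ} (hu : u ⬝ᵥ u = 1) (hw : w ⬝ᵥ w = 1)
    (huw : u ⬝ᵥ w = 0) {a s : ℝ} (has : a ^ 2 + s ^ 2 = 1) :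
    IsExpProd (a • 1 + s • (ι7 u * ι7 w)) := by
  have hsq (v : Fin 7 → ℝ) (hv : v ⬝ᵥ v = 1) : ι7 v * ι7 v = -1 := by
    have : diagForm (negW 7) v = -1 := by
      rw [diagForm_negW, ← hv]; simp [dotProduct, pow_two]
    rw [ι_sq_scalar, this]; simp
  have hanti : ι7 w * ι7 u = -(ι7 u * ι7 w) := by
    rw [eq_neg_iff_add_eq_zero, ι_mul_ι_add_swap, polar_negW, dotProduct_comm, huw]; simp
  have hJ : (ι7 u * ι7 w) * (ι7 u * ι7 w) = -1 := by
    calc (ι7 u * ι7 w) * (ι7 u * ι7 w) = ι7 u * (ι7 w * ι7 u) * ι7 w := by noncomm_ring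
      _ = -((ι7 u * ι7 u) * (ι7 w * ι7 w)) := by rw [hanti]; noncomm_ring
      _ = -1 := by rw [hsq u hu, hsq w hw]; simp
  obtain ⟨t, ht⟩ : ∃ t : ℝ, Complex.exp (t * Complex.I) = ⟨a, s⟩ := by
    rw [← Complex.norm_eq_one_iff, ← sq_eq_sq₀ (norm_nonneg _) zero_le_one, Complex.sq_norm,
      Complex.normSq_mk]
    linarith
  have h := clifford_exp_of_sq_eq_neg_one hJ (t * Complex.I)
  rw [ht] at h
  simp only [Complex.mul_re, Complex.ofReal_re, Complex.I_re, mul_zero, Complex.ofReal_im,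
    Complex.I_im, zero_mul, sub_zero, zero_smul, zero_add, Complex.mul_im, mul_one, add_zero] at h
  rw [← h]
  refine isExpProd_exp ((spinLie _).smul_mem _ ?_)
  have hl : ι7 u * ι7 w = (1 / 2 : ℝ) • ⁅ι7 u, ι7 w⁆ := by
    rw [LieRing.of_associative_ring_bracket, hanti, sub_neg_eq_add, ← two_smul ℝ, smul_smul]
    norm_num
  rw [hl]
  exact (spinLie _).smul_mem _ (lie_mem_spinLie u w)

theorem exists_orthonormal (u v : Fin 7 → ℝ) (hu : u ⬝ᵥ u = 1) (hv : v ⬝ᵥ v = 1) :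
    ∃ (w : Fin 7 → ℝ) (a s : ℝ), w ⬝ᵥ w = 1 ∧ u ⬝ᵥ w = 0 ∧ a ^ 2 + s ^ 2 = 1 ∧ v = a • u + s • w := by
  set a := u ⬝ᵥ v with ha
  set r := v - a • u with hr
  have hur : u ⬝ᵥ r = 0 := by rw [hr, dotProduct_sub, dotProduct_smul, hu, ← ha]; simp
  have hrr : r ⬝ᵥ r = 1 - a ^ 2 := by
    have : r ⬝ᵥ r = v ⬝ᵥ r - a * (u ⬝ᵥ r) := by
      conv_lhs => rw [hr, sub_dotProduct, smul_dotProduct, smul_eq_mul]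
    rw [this, hur, hr, dotProduct_sub, dotProduct_smul, hv, dotProduct_comm v u, ← ha, smul_eq_mul]
    ring
  by_cases h0 : r = 0
  · have hunit : ∃ w : Fin 7 → ℝ, w ≠ 0 ∧ u ⬝ᵥ w = 0 := by
      by_cases h : u 0 = 0
      · exact ⟨Pi.single 0 1, by simp, by simp [h]⟩
      · refine ⟨u 1 • Pi.single 0 1 - u 0 • Pi.single 1 1, fun h' => h ?_, ?_⟩
        · have := congrFun h' 1; simpa using this
        · simp [dotProduct_sub, mul_comm]
    obtain ⟨w, hw, huw⟩ := hunit
    have hww : 0 < w ⬝ᵥ w := lt_of_le_of_ne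
      (Finset.sum_nonneg fun i _ => mul_self_nonneg _) (Ne.symm (by simpa using hw))
    refine ⟨(Real.sqrt (w ⬝ᵥ w))⁻¹ • w, a, 0, ?_, ?_, ?_, ?_⟩
    · rw [smul_dotProduct, dotProduct_smul, smul_eq_mul, smul_eq_mul, ← mul_assoc, ← mul_inv,
        Real.mul_self_sqrt hww.le, inv_mul_cancel₀ hww.ne']
    · rw [dotProduct_smul, huw, smul_zero]
    · rw [h0, dotProduct_zero] at hrr; linarith
    · rw [zero_smul, add_zero]; exact sub_eq_zero.1 h0
  · have hpos : 0 < r ⬝ᵥ r := lt_of_le_of_ne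
      (Finset.sum_nonneg fun i _ => mul_self_nonneg _) (Ne.symm (by simpa using h0))
    have hs := Real.mul_self_sqrt hpos.le
    have hs0 : Real.sqrt (r ⬝ᵥ r) ≠ 0 := (Real.sqrt_pos.2 hpos).ne'
    refine ⟨(Real.sqrt (r ⬝ᵥ r))⁻¹ • r, a, Real.sqrt (r ⬝ᵥ r), ?_, ?_, ?_, ?_⟩
    · rw [smul_dotProduct, dotProduct_smul, smul_eq_mul, smul_eq_mul, ← mul_assoc, ← mul_inv,
        hs, inv_mul_cancel₀ hpos.ne']
    · rw [dotProduct_smul, hur, smul_zero]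
    · rw [pow_two (Real.sqrt _), hs, hrr]; ring
    · rw [smul_smul, mul_inv_cancel₀ hs0, one_smul, hr]; abel

theorem isExpProd_ι_mul_ι {u v : Fin 7 → ℝ} (hu : u ⬝ᵥ u = 1) (hv : v ⬝ᵥ v = 1) :
    IsExpProd (ι7 u * ι7 v) := by
  obtain ⟨w, a, s, hw, huw, has, rfl⟩ := exists_orthonormal u v hu hv
  have hQ : diagForm (negW 7) u = -1 := by
    rw [diagForm_negW, ← hu]; simp [dotProduct, pow_two]
  have : ι7 u * ι7 (a • u + s • w) = (-a) • 1 + s • (ι7 u * ι7 w) := by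
    rw [map_add, map_smul, map_smul, mul_add, mul_smul_comm, mul_smul_comm, ι_sq_scalar, hQ]
    simp
  rw [this]
  exact isExpProd_of_orthonormal hu hw huw (by rw [neg_sq, has])

theorem isExpProd_neg_one : IsExpProd (-1) := by
  have h := isExpProd_of_orthonormal (u := Pi.single 0 1) (w := Pi.single 1 1) (by simp) (by simp)
    (by simp) (a := -1) (s := 0) (by norm_num)
  simpa using h

theorem isExpProd_list : ∀ l : List (Fin 7 → ℝ), (∀ v ∈ l, v ⬝ᵥ v = 1) → Even l.length →
    IsExpProd (l.map ι7).prod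
  | [], _, _ => ⟨1, one_mem _, rfl⟩
  | [_], _, h => by simp at h
  | u :: v :: l, h, hl => by
    have h1 := isExpProd_list l (fun x hx => h x (by simp [hx])) (by
      simpa [Nat.even_add, Nat.add_assoc] using hl)
    rw [List.map_cons, List.map_cons, List.prod_cons, List.prod_cons, ← mul_assoc]
    exact (isExpProd_ι_mul_ι (h u (by simp)) (h v (by simp))).mul h1

theorem expSpin7_eq_top : expSpin7 = ⊤ := by
  rw [eq_top_iff]
  intro g _
  obtain ⟨l, hl, hev, hg⟩ := exists_list_of_mem_spinGroup negW_ne g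
  have hl' : ∀ v ∈ l, v ⬝ᵥ v = 1 := by
    intro v hv
    have h0 : diagForm (negW 7) v = -(v ⬝ᵥ v) := by
      rw [diagForm_negW]; simp [dotProduct, pow_two]
    have hnn : 0 ≤ v ⬝ᵥ v := Finset.sum_nonneg fun i _ => mul_self_nonneg _
    rcases hl v hv with h | h <;> rw [h0] at h <;> linarith
  have h1 := isExpProd_list l hl' hev
  have h2 : IsExpProd (g : Cl7) := by
    rcases hg with h | h
    · rw [h]; exact h1
    · rw [h, ← neg_one_mul]; exact isExpProd_neg_one.mul h1
  obtain ⟨g', hg', h⟩ := h2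
  rwa [← Subtype.ext h]

end Generation

/-! ### The isotropy group of `psi0` is generated by exponentials -/

theorem exists_spinMat {Y : CliffordAlgebra Q7} (hY : Y ∈ spinLie Q7) :
    ∃ A : Matrix (Fin 7) (Fin 7) ℝ, Aᵀ = -A ∧ rho7 Y = spinMat A := by
  refine spinLie_induction (p := fun Y => ∃ A : Matrix (Fin 7) (Fin 7) ℝ,
    Aᵀ = -A ∧ rho7 Y = spinMat A) ⟨0, by simp, by simp⟩ ?_ ?_ ?_ hY
  · rintro x y ⟨A, hA, hx⟩ ⟨B, hB, hy⟩
    exact ⟨A + B, by rw [Matrix.transpose_add, hA, hB, neg_add], by rw [map_add, map_add, hx, hy]⟩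
  · rintro c x ⟨A, hA, hx⟩
    exact ⟨c • A, by rw [Matrix.transpose_smul, hA, smul_neg], by rw [map_smul, map_smul, hx]⟩
  · intro a b
    refine ⟨-(4 : ℝ) • (Matrix.vecMulVec a b - Matrix.vecMulVec b a), ?_, ?_⟩
    · rw [Matrix.transpose_smul, Matrix.transpose_sub, Matrix.transpose_vecMulVec,
        Matrix.transpose_vecMulVec, ← smul_neg, neg_sub]
    · rw [LieRing.of_associative_ring_bracket, map_sub, map_mul, map_mul, rho7_ι, rho7_ι, map_smul,
        spinMat_apply, smul_smul, octLin_apply, octLin_apply, Finset.sum_mul_sum,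
        Finset.sum_mul_sum]
      norm_num
      simp only [Matrix.vecMulVec_apply, sub_smul, Finset.sum_sub_distrib, smul_mul_smul_comm]
      congr 1 <;> refine Finset.sum_congr rfl fun i _ => Finset.sum_congr rfl fun j _ => ?_ <;>
        rw [smul_smul, mul_comm]

theorem conj_pow (D : Matrix (Fin 8) (Fin 8) ℝ) (n : ℕ) :
    (cMat * D * cMat) ^ n = cMat * D ^ n * cMat := by
  induction n with
  | zero => rw [pow_zero, pow_zero, mul_one, cMat_sq]
  | succ n ih => rw [pow_succ, ih, cMat_conj_mul, pow_succ]

theorem Dmat_pow (B₁ B₂ : Matrix (Fin 8) (Fin 8) ℝ) (n : ℕ) :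
    Dmat B₁ B₂ ^ n = Dmat (B₁ ^ n) (B₂ ^ n) := by
  induction n with
  | zero => simp [Dmat_one]
  | succ n ih => rw [pow_succ, ih, Dmat_mul, pow_succ, pow_succ]

theorem spinLift_exp_mem {g : Spin7} {Y : CliffordAlgebra Q7} (hY : Y ∈ spinLie Q7)
    (hg : (g : CliffordAlgebra Q7) = NormedSpace.exp Y) : spinLift g ∈ expGroup (eps psi0) := by
  obtain ⟨A, hA, hYA⟩ := exists_spinMat hY
  have hX := soLift_mem hA
  set h : Spin101 := ⟨NormedSpace.exp (soLift A), exp_mem_Spin101 hX.1⟩ with hh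
  have hmem : h ∈ expGroup (eps psi0) := exp_mem_expGroup hX
  have hfix {v : Mink} (hv : proj8 v = 0) : vecAct h v = v := by
    apply vecAct_eq_of_mul
    refine clifford_exp_commute ?_
    have h1 := lie_soLift hA v
    rw [hv, map_zero, Matrix.mulVec_zero, map_zero, map_zero, map_zero,
      LieRing.of_associative_ring_bracket, sub_eq_zero] at h1
    exact h1
  obtain ⟨g', hg'⟩ := eq_spinLift (expGroup_le_isotropyGroup _ hmem) (hfix proj8_e0) (hfix proj8_e9)
    (hfix proj8_e10)
  have key : lowBlock (rho (NormedSpace.exp (soLift A))) = cMat * rho7 (NormedSpace.exp Y) * cMat := by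
    refine clifford_map_exp_congr (f := lowBlock ∘ₗ rho.toLinearMap)
      (f' := LinearMap.mulLeftRight ℝ (cMat, cMat) ∘ₗ rho7.toLinearMap) fun n => ?_
    simp only [LinearMap.comp_apply, AlgHom.toLinearMap_apply, map_pow, rho_soLift, hYA, soD_apply,
      Dmat_pow, lowBlock_Dmat, conj_pow, LinearMap.mulLeftRight_apply]
  have : g' = g := by
    apply Subtype.ext
    rw [coe_eq_of_spinLift g', ← hg', hh]
    change rho7Sec (cMat * lowBlock (rho (NormedSpace.exp (soLift A))) * cMat) = _
    rw [key, ← hg, conj_conj]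
    exact rho7_even_inj (involute_rho7Sec _) (spinGroup.involute_eq g.2) (rho7_rho7Sec _)
  rw [← this, ← hg']
  exact hmem

theorem spinLift_mem_expGroup (g : Spin7) : spinLift g ∈ expGroup (eps psi0) := by
  have hg : g ∈ expSpin7 := by rw [expSpin7_eq_top]; trivial
  change g ∈ (expGroup (eps psi0)).comap spinLift
  refine (Subgroup.closure_le ((expGroup (eps psi0)).comap spinLift)).2 ?_ hg
  rintro g ⟨Y, hY, hg⟩
  exact spinLift_exp_mem hY hg

theorem expGroup_psi0 : expGroup (eps psi0) = isotropyGroup (eps psi0) := by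
  refine le_antisymm (expGroup_le_isotropyGroup _) fun g hg => ?_
  obtain ⟨b, c, h, hh, h0, h9, h10, rfl⟩ := exists_eq_nullSpin_mul psi0_ne psi0_chir hg
  obtain ⟨k, rfl⟩ := eq_spinLift hh h0 h9 h10
  exact mul_mem (nullSpin_mem_expGroup psi0_chir b c) (spinLift_mem_expGroup k)

/-! ### The structure of the isotropy group of `psi0` -/

theorem mul_Sig (g : Spin101) (a b : Mink) :
    (g : Cl) * Sig a b = Sig (vecAct g a) (vecAct g b) * g := by
  simp only [Sig, LieRing.of_associative_ring_bracket, mul_smul_comm, smul_mul_assoc, mul_sub, sub_mul]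
  rw [mul_assoc (ι Qmink (vecAct g a)), ι_vecAct_mul, mul_assoc (ι Qmink (vecAct g b)), ι_vecAct_mul,
    ← mul_assoc (ι Qmink (vecAct g a)), ι_vecAct_mul, ← mul_assoc (ι Qmink (vecAct g b)), ι_vecAct_mul,
    mul_assoc, mul_assoc]

theorem mul_nullSpin {g : Spin101} {b b' : Fin 8 → ℝ} {c c' : ℝ} (h1 : vecAct g ePlus = ePlus)
    (h2 : vecAct g (nullVec b c) = nullVec b' c') : g * nullSpin b c = nullSpin b' c' * g := by
  apply Subtype.ext
  rw [Submonoid.coe_mul, Submonoid.coe_mul, coe_nullSpin, coe_nullSpin, mul_add, add_mul, mul_one,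
    one_mul, nullGen_eq, nullGen_eq, mul_Sig, h1, h2]

theorem vecAct_spinLift_nullVec (g : Spin7) (b : Fin 8 → ℝ) (c : ℝ) :
    vecAct (spinLift g) (nullVec (conjEquiv b) c) = nullVec (conjEquiv (rho7 g *ᵥ b)) c := by
  rw [vecAct_spinLift, proj8_nullVec, conjEquiv.symm_apply_apply, nullVec, add_comm]
  congr 1
  simp [timePart, incl8_zero_coord, incl8_nine, incl8_ten, e_apply]

theorem spinLift_mul_nullSpin (g : Spin7) (b : Fin 8 → ℝ) (c : ℝ) :
    spinLift g * nullSpin (conjEquiv b) c = nullSpin (conjEquiv (rho7 g *ᵥ b)) c * spinLift g :=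
  mul_nullSpin (vecAct_spinLift_timePart g proj8_ePlus) (vecAct_spinLift_nullVec g b c)

/-- `ℝ × (ℝ⁸ ⋊ Spin₇)`. -/
abbrev ModelGroup : Type := Multiplicative ℝ × (Multiplicative (Fin 8 → ℝ) ⋊[spinAction] Spin7)

/-- The parametrization of the isotropy group of `psi0`. -/
def modelHom : ModelGroup →* isotropyGroup (eps psi0) where
  toFun x := ⟨nullSpin (conjEquiv x.2.left.toAdd) x.1.toAdd * spinLift x.2.right,
    mul_mem (expGroup_le_isotropyGroup _ (nullSpin_mem_expGroup psi0_chir _ _)) (spinLift_mem _)⟩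
  map_one' := Subtype.ext (by
    change nullSpin (conjEquiv 0) 0 * spinLift 1 = 1
    rw [map_zero, nullSpin_zero, map_one, mul_one])
  map_mul' x y := Subtype.ext (by
    change nullSpin (conjEquiv (x.2.left.toAdd + rho7 x.2.right *ᵥ y.2.left.toAdd))
        (x.1.toAdd + y.1.toAdd) * spinLift (x.2.right * y.2.right)
      = nullSpin (conjEquiv x.2.left.toAdd) x.1.toAdd * spinLift x.2.right
        * (nullSpin (conjEquiv y.2.left.toAdd) y.1.toAdd * spinLift y.2.right)
    rw [map_add, ← nullSpin_mul, map_mul, mul_assoc _ _ (_ * _), mul_assoc _ (spinLift _) (_ * _),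
      ← mul_assoc (spinLift _) (nullSpin _ _), spinLift_mul_nullSpin, mul_assoc])

theorem coe_modelHom (x : ModelGroup) : (modelHom x : Spin101)
    = nullSpin (conjEquiv x.2.left.toAdd) x.1.toAdd * spinLift x.2.right := rfl

theorem vecAct_modelHom_e0 (x : ModelGroup) : ∃ r : ℝ, vecAct (modelHom x : Spin101) (e 0)
    = e 0 - nullVec (conjEquiv x.2.left.toAdd) x.1.toAdd - r • ePlus := by
  rw [coe_modelHom, vecAct_mul_apply, vecAct_spinLift_timePart _ proj8_e0, vecAct_nullSpin]
  have : mip ePlus (e 0) = -1 := by rw [mip_ePlus]; simp [e_apply]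
  rw [this, neg_one_smul, ← sub_eq_add_neg]
  exact ⟨_, rfl⟩

theorem toAdd_left_modelHom (x : ModelGroup) :
    conjEquiv.symm (-proj8 (vecAct (modelHom x : Spin101) (e 0))) = x.2.left.toAdd := by
  obtain ⟨r, hr⟩ := vecAct_modelHom_e0 x
  rw [hr, map_sub, map_sub, map_smul, proj8_e0, proj8_nullVec, proj8_ePlus, smul_zero, sub_zero,
    zero_sub, neg_neg, conjEquiv.symm_apply_apply]

theorem toAdd_fst_modelHom (x : ModelGroup) :
    -vecAct (modelHom x : Spin101) (e 0) 10 = x.1.toAdd := by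
  obtain ⟨r, hr⟩ := vecAct_modelHom_e0 x
  rw [hr]
  simp [nullVec, incl8_ten, e_apply, ePlus_ten]

theorem right_modelHom (x : ModelGroup) : (x.2.right : CliffordAlgebra Q7) = rho7Sec (cMat * lowBlock
    (rho ((nullSpin (proj8 (vecAct (modelHom x : Spin101) (e 0)))
      (vecAct (modelHom x : Spin101) (e 0) 10) * (modelHom x : Spin101) : Spin101) : Cl)) * cMat) := by
  rw [coe_eq_of_spinLift]
  congr 5
  have h1 : proj8 (vecAct (modelHom x : Spin101) (e 0)) = -conjEquiv x.2.left.toAdd := by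
    rw [← toAdd_left_modelHom x, conjEquiv.apply_symm_apply, neg_neg]
  have h2 : vecAct (modelHom x : Spin101) (e 0) 10 = -x.1.toAdd := by
    rw [← toAdd_fst_modelHom x, neg_neg]
  rw [h1, h2, ← nullSpin_inv, coe_modelHom, inv_mul_cancel_left]

theorem modelHom_bijective : Function.Bijective modelHom := by
  constructor
  · intro x y h
    refine Prod.ext ?_ (SemidirectProduct.ext ?_ (Subtype.ext ?_))
    · apply Multiplicative.toAdd.injective
      rw [← toAdd_fst_modelHom, ← toAdd_fst_modelHom, h]
    · apply Multiplicative.toAdd.injective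
      rw [← toAdd_left_modelHom, ← toAdd_left_modelHom, h]
    · rw [right_modelHom, right_modelHom, h]
  · rintro ⟨g, hg⟩
    obtain ⟨b, c, h, hh, h0, h9, h10, rfl⟩ := exists_eq_nullSpin_mul psi0_ne psi0_chir hg
    obtain ⟨k, rfl⟩ := eq_spinLift hh h0 h9 h10
    refine ⟨(Multiplicative.ofAdd c, ⟨Multiplicative.ofAdd (conjEquiv.symm b), k⟩), Subtype.ext ?_⟩
    rw [coe_modelHom]
    simp

theorem continuous_nullSpin {X : Type*} [TopologicalSpace X] {f : X → Fin 8 → ℝ} {k : X → ℝ}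
    (hf : Continuous f) (hk : Continuous k) : Continuous fun x => nullSpin (f x) (k x) := by
  refine continuous_induced_rng.2 ?_
  have : (Subtype.val ∘ fun x => nullSpin (f x) (k x))
      = fun x => 1 + (∑ i, f x i • Sig ePlus (e (idx8 i)) + k x • Sig ePlus (e 10)) :=
    funext fun x => coe_nullSpin _ _
  rw [this]
  have h1 : Continuous fun x => ∑ i, f x i • Sig ePlus (e (idx8 i)) :=
    continuous_finsetSum _ fun i _ => by
      have hi : Continuous fun x => f x i := (continuous_apply i).comp hf
      exact hi.smul (continuous_const (y := Sig ePlus (e (idx8 i))))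
  have h2 : Continuous fun x => k x • Sig ePlus (e 10) :=
    hk.smul (continuous_const (y := Sig ePlus (e 10)))
  exact (continuous_const (y := (1 : Cl))).add (h1.add h2)

theorem continuous_semidirect_mk {X : Type*} [TopologicalSpace X]
    {f : X → Multiplicative (Fin 8 → ℝ)} {k : X → Spin7} (hf : Continuous f) (hk : Continuous k) :
    Continuous fun x => (⟨f x, k x⟩ : Multiplicative (Fin 8 → ℝ) ⋊[spinAction] Spin7) :=
  continuous_induced_rng.2 (hf.prodMk hk)

theorem continuous_semidirect :
    Continuous fun x : Multiplicative (Fin 8 → ℝ) ⋊[spinAction] Spin7 => (x.left, x.right) :=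
  continuous_induced_dom

/-- The structure of the isotropy group of `psi0`. -/
def modelEquiv : ModelGroup ≃ₜ* isotropyGroup (eps psi0) where
  __ := MulEquiv.ofBijective modelHom modelHom_bijective
  continuous_toFun := by
    refine Continuous.subtype_mk (Continuous.mul (continuous_nullSpin ?_ ?_) ?_) _
    · exact (LinearMap.continuous_of_finiteDimensional conjEquiv.toLinearMap).comp
        (continuous_toAdd.comp
          ((continuous_fst.comp continuous_semidirect).comp continuous_snd))
    · exact continuous_toAdd.comp continuous_fst
    · exact continuous_spinLift.comp ((continuous_snd.comp continuous_semidirect).comp continuous_snd)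
  continuous_invFun := by
    let E := MulEquiv.ofBijective modelHom modelHom_bijective
    have hE (y) : modelHom (E.symm y) = y := E.apply_symm_apply y
    have hv : Continuous fun y : isotropyGroup (eps psi0) => vecAct (y : Spin101) (e 0) :=
      (continuous_vecAct (e 0)).comp continuous_subtype_val
    have hp : Continuous fun y : isotropyGroup (eps psi0) => proj8 (vecAct (y : Spin101) (e 0)) :=
      (LinearMap.continuous_of_finiteDimensional proj8).comp hv
    have h10 : Continuous fun y : isotropyGroup (eps psi0) => vecAct (y : Spin101) (e 0) 10 :=
      (continuous_apply 10).comp hv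
    have hc : Continuous fun y => (E.symm y).1 := by
      have : (fun y => (E.symm y).1)
          = fun y : isotropyGroup (eps psi0) => Multiplicative.ofAdd (-vecAct (y : Spin101) (e 0) 10) := by
        funext y
        have := toAdd_fst_modelHom (E.symm y)
        rw [hE] at this
        rw [this]; rfl
      rw [this]
      exact continuous_ofAdd.comp h10.neg
    have hb : Continuous fun y => (E.symm y).2.left := by
      have : (fun y => (E.symm y).2.left) = fun y : isotropyGroup (eps psi0) => Multiplicative.ofAdd
          (conjEquiv.symm (-proj8 (vecAct (y : Spin101) (e 0)))) := by
        funext y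
        have := toAdd_left_modelHom (E.symm y)
        rw [hE] at this
        rw [this]; rfl
      rw [this]
      exact continuous_ofAdd.comp
        ((LinearMap.continuous_of_finiteDimensional conjEquiv.symm.toLinearMap).comp hp.neg)
    have hg : Continuous fun y => (E.symm y).2.right := by
      refine continuous_induced_rng.2 ?_
      have : (Subtype.val ∘ fun y => (E.symm y).2.right) = fun y : isotropyGroup (eps psi0) => rho7Sec (cMat * lowBlock
          (rho ((nullSpin (proj8 (vecAct (y : Spin101) (e 0)))
            (vecAct (y : Spin101) (e 0) 10) * (y : Spin101) : Spin101) : Cl)) * cMat) := by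
        funext y
        have := right_modelHom (E.symm y)
        rw [hE] at this
        exact this
      rw [this]
      let f : Cl →ₗ[ℝ] CliffordAlgebra Q7 := rho7Sec ∘ₗ LinearMap.mulLeftRight ℝ (cMat, cMat) ∘ₗ
        lowBlock ∘ₗ rho.toLinearMap
      exact (continuous_clifford_linear f).comp (continuous_subtype_val.comp
        ((continuous_nullSpin hp h10).mul continuous_subtype_val))
    exact hc.prodMk (continuous_semidirect_mk hb hg)

instance simplyConnectedSpace_modelGroup : SimplyConnectedSpace ModelGroup := by
  refine simplyConnectedSpace_of_retract (Y := Spin7) inferInstance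
    ⟨fun g => (1, ⟨1, g⟩), continuous_const.prodMk (continuous_semidirect_mk continuous_const continuous_id)⟩
    ⟨fun x => x.2.right, (continuous_snd.comp continuous_semidirect).comp continuous_snd⟩
    (fun g => rfl)
    (fun p => (Multiplicative.ofAdd ((1 - p.1) * p.2.1.toAdd),
      ⟨Multiplicative.ofAdd ((1 - p.1) • p.2.2.left.toAdd), p.2.2.right⟩)) ?_ ?_ ?_
  · have h1 : Continuous fun p : ℝ × ModelGroup => p.2.2.left :=
      (continuous_fst.comp continuous_semidirect).comp (continuous_snd.comp continuous_snd)
    have h2 : Continuous fun p : ℝ × ModelGroup => p.2.2.right :=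
      (continuous_snd.comp continuous_semidirect).comp (continuous_snd.comp continuous_snd)
    refine Continuous.continuousOn (Continuous.prodMk ?_ (continuous_semidirect_mk ?_ h2))
    · exact continuous_ofAdd.comp ((continuous_const.sub continuous_fst).mul
        (continuous_toAdd.comp (continuous_fst.comp continuous_snd)))
    · exact continuous_ofAdd.comp ((continuous_const.sub continuous_fst).smul
        (continuous_toAdd.comp h1))
  · rintro ⟨c, ⟨b, g⟩⟩
    simp
  · rintro ⟨c, ⟨b, g⟩⟩
    simp

end ExoticSpinor
end

noncomputable section
namespace ExoticSpinor
open CliffordAlgebra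

/-! ### Rotating `psi0` to an arbitrary spinor of negative chirality -/

theorem octLin_one8 (w : Fin 7 → ℝ) : octLin w *ᵥ one8 = Fin.cons (α := fun _ => ℝ) 0 w := by
  have h (i : Fin 7) (j : Fin 8) : octL i j 0 = if j = i.succ then 1 else 0 := by
    refine Fin.cases ?_ (fun j => ?_) j
    · simp [octL, octLZ, Ne.symm (Fin.succ_ne_zero i)]
    · simp [octL, octLZ]
  rw [one8, Matrix.mulVec_single_one]
  funext j
  simp only [octLin_apply, Matrix.col_apply, Matrix.sum_apply, Matrix.smul_apply, h, smul_eq_mul,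
    mul_ite, mul_one, mul_zero]
  refine Fin.cases ?_ (fun j => ?_) j
  · simp [Ne.symm (Fin.succ_ne_zero _)]
  · simp

theorem conjLin_transpose_one8 (x : Fin 8 → ℝ) : (conjLin x)ᵀ *ᵥ one8 = x := by
  rw [conjLin_eq, Matrix.transpose_sub, octLin_transpose, Matrix.transpose_smul,
    Matrix.transpose_one, sub_neg_eq_add, Matrix.add_mulVec, Matrix.smul_mulVec, Matrix.one_mulVec,
    octLin_one8]
  funext i
  refine Fin.cases ?_ (fun i => ?_) i <;> simp [one8, Fin.tail]

theorem exists_eq_sumElim {ψ : S8 → ℝ} (hchir : gammaP9 *ᵥ ψ = -ψ) :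
    ∃ x : Fin 8 → ℝ, ψ = Sum.elim x 0 := by
  refine ⟨fun i => ψ (Sum.inl i), ?_⟩
  rw [gammaP9_eq, Matrix.fromBlocks_mulVec] at hchir
  funext i
  rcases i with i | i
  · rfl
  · have := congrFun hchir (Sum.inr i)
    simp at this
    simp only [Sum.elim_inr, Pi.zero_apply]; linarith

theorem mip_incl8 (x y : Fin 8 → ℝ) : mip (incl8 x) (incl8 y) = x ⬝ᵥ y := by
  rw [mip_apply, proj8_incl8, proj8_incl8]
  simp [incl8_zero_coord, incl8_nine, incl8_ten]

theorem gammaLin_incl8 (y : Fin 8 → ℝ) : gammaLin (incl8 y)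
    = Matrix.fromBlocks 0 (-gammaPLin y) (gammaPLin y) 0 := by
  rw [gammaLin_blocks, proj8_incl8]
  simp [incl8_zero_coord, incl8_nine, incl8_ten]

/-- The product of two unit vectors of `𝔼⁸`. -/
theorem exists_spin_mul {z u : Mink} (hz : mip z z = 1) (hu : mip u u = 1) :
    ∃ U : Spin101, (U : Cl) = ι Qmink z * ι Qmink u := by
  have hz' : ι Qmink z * ι Qmink z = 1 := by rw [ι_sq_mink, hz, one_smul]
  have hu' : ι Qmink u * ι Qmink u = 1 := by rw [ι_sq_mink, hu, one_smul]
  have hs : star (ι Qmink z * ι Qmink u) = ι Qmink u * ι Qmink z := by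
    rw [star_mul, star_ι, star_ι, neg_mul_neg]
  have hz0 : Qmink z ≠ 0 := by rw [Qmink_eq_mip, hz]; exact one_ne_zero
  have hu0 : Qmink u ≠ 0 := by rw [Qmink_eq_mip, hu]; exact one_ne_zero
  have h1 : ι Qmink u * ι Qmink z * (ι Qmink z * ι Qmink u) = 1 := by
    rw [mul_assoc, ← mul_assoc (ι Qmink z), hz', one_mul, hu']
  have h2 : ι Qmink z * ι Qmink u * (ι Qmink u * ι Qmink z) = 1 := by
    rw [mul_assoc, ← mul_assoc (ι Qmink u), hu', one_mul, hz']
  have hi : involute (ι Qmink z * ι Qmink u) = ι Qmink z * ι Qmink u := by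
    rw [map_mul, involute_ι, involute_ι, neg_mul_neg]
  refine ⟨⟨_, mem_spinGroup_of (w := eta) eta_ne (x := ι Qmink z * ι Qmink u) ?_ ?_ ?_ fun v =>
    ⟨_, ι_mul_ι_mul_ι hz0 hu0 v⟩⟩, rfl⟩
  · exact hi
  · exact (congrArg (· * (ι Qmink z * ι Qmink u)) hs).trans h1
  · exact (congrArg ((ι Qmink z * ι Qmink u) * ·) hs).trans h2

theorem exists_rotation {ψ : S8 → ℝ} (hψ : ψ ≠ 0) (hchir : gammaP9 *ᵥ ψ = -ψ) :
    ∃ (U : Spin101) (r : ℝ), r ≠ 0 ∧ rho U *ᵥ eps psi0 = r • eps ψ ∧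
      vecAct U (e 0) = e 0 ∧ vecAct U (e 9) = e 9 ∧ vecAct U (e 10) = e 10 := by
  obtain ⟨x, rfl⟩ := exists_eq_sumElim hchir
  have hx : x ≠ 0 := fun h => hψ (by rw [h]; ext (i | i) <;> rfl)
  have hxx : 0 < x ⬝ᵥ x := lt_of_le_of_ne
    (Finset.sum_nonneg fun i _ => mul_self_nonneg _) (Ne.symm (by simpa using hx))
  set r := (Real.sqrt (x ⬝ᵥ x))⁻¹ with hr
  have hr0 : r ≠ 0 := inv_ne_zero (Real.sqrt_pos.2 hxx).ne'
  have hrr : r * r * (x ⬝ᵥ x) = 1 := by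
    rw [hr, ← mul_inv, Real.mul_self_sqrt hxx.le, inv_mul_cancel₀ hxx.ne']
  have hdot (y : Fin 8 → ℝ) : conjEquiv y ⬝ᵥ conjEquiv y = y ⬝ᵥ y := by
    rw [← sum_sq_conjEquiv y]; simp only [dotProduct, pow_two]
  obtain ⟨U, hU⟩ := exists_spin_mul (z := incl8 (conjEquiv (r • x))) (u := incl8 (conjEquiv one8))
    (by rw [mip_incl8, hdot, smul_dotProduct, dotProduct_smul, smul_eq_mul, smul_eq_mul, ← mul_assoc,
      hrr])
    (by rw [mip_incl8, hdot]; simp [one8])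
  refine ⟨U, r, hr0, ?_, ?_⟩
  · rw [hU, map_mul, rho_ι, rho_ι, gammaLin_incl8, gammaLin_incl8, Matrix.fromBlocks_multiply,
      gammaPLin_blocks, gammaPLin_blocks, octN_conjEquiv, octN_conjEquiv, conjLin_one8]
    have h1 := conjLin_transpose_one8 (r • x)
    funext i
    rcases i with (i | i) | i
    · simp [eps, psi0, Matrix.fromBlocks_mulVec, Matrix.fromBlocks_multiply,
        Matrix.fromBlocks_neg, h1]
    · simp [eps, psi0, Matrix.fromBlocks_mulVec, Matrix.fromBlocks_multiply, Matrix.fromBlocks_neg]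
    · simp [eps, psi0, Matrix.fromBlocks_mulVec]
  · have hfix (M : Fin 11) (hM : ∀ y, incl8 y M = 0) : vecAct U (e M) = e M := by
      apply vecAct_eq_of_mul
      have h (y : Fin 8 → ℝ) : ι Qmink (incl8 y) * ι Qmink (e M) = -(ι Qmink (e M) * ι Qmink (incl8 y)) := by
        rw [ι_mul_swap, mip_comm, mip_single, hM]; simp
      rw [hU, mul_assoc, h, mul_neg, ← mul_assoc, h, neg_mul, neg_neg, mul_assoc]
    exact ⟨hfix 0 incl8_zero_coord, hfix 9 incl8_nine, hfix 10 incl8_ten⟩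

/-! ### Transport of isotropy along the spin group -/

section Transport

variable {U : Spin101} {χ χ' : S11 → ℝ} {r : ℝ}

theorem rho_inv_mulVec (hr : r ≠ 0) (hU : rho U *ᵥ χ = r • χ') :
    rho ((U⁻¹ : Spin101) : Cl) *ᵥ χ' = r⁻¹ • χ := by
  have h : χ' = r⁻¹ • (rho U *ᵥ χ) := by rw [hU, smul_smul, inv_mul_cancel₀ hr, one_smul]
  rw [h, Matrix.mulVec_smul, Matrix.mulVec_mulVec, ← map_mul, ← Submonoid.coe_mul, inv_mul_cancel,
    Submonoid.coe_one, map_one, Matrix.one_mulVec]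

theorem conj_mem_isotropyGroup (hr : r ≠ 0) (hU : rho U *ᵥ χ = r • χ') {g : Spin101}
    (hg : g ∈ isotropyGroup χ) : U * g * U⁻¹ ∈ isotropyGroup χ' := by
  change rho ((U * g * U⁻¹ : Spin101) : Cl) *ᵥ χ' = χ'
  have hg' : rho g *ᵥ χ = χ := hg
  rw [Submonoid.coe_mul, Submonoid.coe_mul, map_mul, map_mul, ← Matrix.mulVec_mulVec,
    rho_inv_mulVec hr hU, ← Matrix.mulVec_mulVec, Matrix.mulVec_smul, hg', Matrix.mulVec_smul, hU,
    smul_smul, inv_mul_cancel₀ hr, one_smul]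

theorem conj_mem_spinLie (U : Spin101) {X : Cl} (hX : X ∈ spinLie Qmink) :
    (U : Cl) * X * ((U⁻¹ : Spin101) : Cl) ∈ spinLie Qmink := by
  refine spinLie_induction (p := fun X => (U : Cl) * X * ((U⁻¹ : Spin101) : Cl) ∈ spinLie Qmink)
    (by simp) (fun x y hx hy => by rw [mul_add, add_mul]; exact add_mem hx hy)
    (fun c x hx => by rw [mul_smul_comm, smul_mul_assoc]; exact (spinLie Qmink).smul_mem c hx)
    (fun a b => ?_) hX
  have h1 : ((U⁻¹ : Spin101) : Cl) * U = 1 := by rw [← Submonoid.coe_mul, inv_mul_cancel]; rfl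
  have h (a b : Mink) : (U : Cl) * (ι Qmink a * ι Qmink b) * ((U⁻¹ : Spin101) : Cl)
      = ι Qmink (vecAct U a) * ι Qmink (vecAct U b) := by
    rw [ι_vecAct, ι_vecAct]
    calc (U : Cl) * (ι Qmink a * ι Qmink b) * ((U⁻¹ : Spin101) : Cl)
        = (U : Cl) * ι Qmink a * 1 * ι Qmink b * ((U⁻¹ : Spin101) : Cl) := by noncomm_ring
      _ = _ := by rw [← h1]; noncomm_ring
  rw [LieRing.of_associative_ring_bracket, mul_sub, sub_mul, h, h,
    ← LieRing.of_associative_ring_bracket]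
  exact lie_mem_spinLie _ _

theorem conj_mem_isotropyAlgebra (hr : r ≠ 0) (hU : rho U *ᵥ χ = r • χ') {X : Cl}
    (hX : X ∈ isotropyAlgebra χ) : (U : Cl) * X * ((U⁻¹ : Spin101) : Cl) ∈ isotropyAlgebra χ' := by
  refine ⟨conj_mem_spinLie U hX.1, ?_⟩
  rw [map_mul, map_mul, ← Matrix.mulVec_mulVec, rho_inv_mulVec hr hU, ← Matrix.mulVec_mulVec,
    Matrix.mulVec_smul, hX.2]
  simp

theorem coe_mul_inv (U : Spin101) : (U : Cl) * ((U⁻¹ : Spin101) : Cl) = 1 := by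
  rw [← Submonoid.coe_mul, mul_inv_cancel]; rfl

theorem coe_inv_mul (U : Spin101) : ((U⁻¹ : Spin101) : Cl) * (U : Cl) = 1 := by
  rw [← Submonoid.coe_mul, inv_mul_cancel]; rfl

theorem conj_mul_conj (U : Spin101) (X Y : Cl) :
    ((U : Cl) * X * ((U⁻¹ : Spin101) : Cl)) * ((U : Cl) * Y * ((U⁻¹ : Spin101) : Cl))
      = (U : Cl) * (X * Y) * ((U⁻¹ : Spin101) : Cl) := by
  calc ((U : Cl) * X * ((U⁻¹ : Spin101) : Cl)) * ((U : Cl) * Y * ((U⁻¹ : Spin101) : Cl))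
      = (U : Cl) * X * (((U⁻¹ : Spin101) : Cl) * (U : Cl)) * Y * ((U⁻¹ : Spin101) : Cl) := by
        noncomm_ring
    _ = _ := by rw [coe_inv_mul]; noncomm_ring

theorem exp_conj (U : Spin101) (X : Cl) : NormedSpace.exp ((U : Cl) * X * ((U⁻¹ : Spin101) : Cl))
    = (U : Cl) * NormedSpace.exp X * ((U⁻¹ : Spin101) : Cl) := by
  refine clifford_map_exp_congr (f := LinearMap.id)
    (f' := LinearMap.mulLeftRight ℝ ((U : Cl), ((U⁻¹ : Spin101) : Cl))) fun n => ?_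
  rw [LinearMap.id_apply, LinearMap.mulLeftRight_apply]
  induction n with
  | zero => rw [pow_zero, pow_zero, mul_one, coe_mul_inv]
  | succ n ih => rw [pow_succ, ih, conj_mul_conj, pow_succ]

theorem conj_mem_expGroup (hr : r ≠ 0) (hU : rho U *ᵥ χ = r • χ') {g : Spin101}
    (hg : g ∈ expGroup χ) : U * g * U⁻¹ ∈ expGroup χ' := by
  change g ∈ (expGroup χ').comap (MulAut.conj U).toMonoidHom
  refine (Subgroup.closure_le ((expGroup χ').comap (MulAut.conj U).toMonoidHom)).2 ?_ hg
  rintro g ⟨X, hX, hg⟩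
  refine Subgroup.subset_closure ⟨_, conj_mem_isotropyAlgebra hr hU hX, ?_⟩
  rw [exp_conj, ← hg]
  rfl

theorem expGroup_eq_of_rotation (hr : r ≠ 0) (hU : rho U *ᵥ χ = r • χ')
    (h : expGroup χ = isotropyGroup χ) : expGroup χ' = isotropyGroup χ' := by
  refine le_antisymm (expGroup_le_isotropyGroup _) fun g hg => ?_
  have h1 := conj_mem_isotropyGroup (inv_ne_zero hr) (rho_inv_mulVec hr hU) hg
  rw [← h] at h1
  have h2 := conj_mem_expGroup hr hU h1
  have h3 : U * (U⁻¹ * g * U⁻¹⁻¹) * U⁻¹ = g := by group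
  rwa [h3] at h2

/-- Conjugation identifies the isotropy algebras of two spinors in one orbit. -/
def isotropyLieEquiv (hr : r ≠ 0) (hU : rho U *ᵥ χ = r • χ') :
    isotropyAlgebra χ ≃ₗ⁅ℝ⁆ isotropyAlgebra χ' where
  toFun X := ⟨_, conj_mem_isotropyAlgebra hr hU X.2⟩
  invFun X := ⟨_, conj_mem_isotropyAlgebra (inv_ne_zero hr) (rho_inv_mulVec hr hU) X.2⟩
  map_add' X Y := Subtype.ext (by simp [mul_add, add_mul])
  map_smul' c X := Subtype.ext (by simp)
  map_lie' := fun {X Y} => Subtype.ext (by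
    change (U : Cl) * ⁅(X : Cl), (Y : Cl)⁆ * ((U⁻¹ : Spin101) : Cl)
      = ⁅(U : Cl) * X * ((U⁻¹ : Spin101) : Cl), (U : Cl) * Y * ((U⁻¹ : Spin101) : Cl)⁆
    rw [LieRing.of_associative_ring_bracket, LieRing.of_associative_ring_bracket, conj_mul_conj,
      conj_mul_conj]
    noncomm_ring)
  left_inv X := Subtype.ext (by
    change ((U⁻¹ : Spin101) : Cl) * ((U : Cl) * X * ((U⁻¹ : Spin101) : Cl)) * ((U⁻¹⁻¹ : Spin101) : Cl) = X
    rw [inv_inv]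
    calc _ = (((U⁻¹ : Spin101) : Cl) * (U : Cl)) * X * (((U⁻¹ : Spin101) : Cl) * (U : Cl)) := by
          noncomm_ring
      _ = X := by rw [coe_inv_mul, one_mul, mul_one])
  right_inv X := Subtype.ext (by
    change (U : Cl) * (((U⁻¹ : Spin101) : Cl) * X * ((U⁻¹⁻¹ : Spin101) : Cl)) * ((U⁻¹ : Spin101) : Cl) = X
    rw [inv_inv]
    calc _ = ((U : Cl) * ((U⁻¹ : Spin101) : Cl)) * X * ((U : Cl) * ((U⁻¹ : Spin101) : Cl)) := by
          noncomm_ring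
      _ = X := by rw [coe_mul_inv, one_mul, mul_one])

/-- Conjugation identifies the isotropy groups of two spinors in one orbit. -/
def isotropyGroupEquiv (hr : r ≠ 0) (hU : rho U *ᵥ χ = r • χ') :
    isotropyGroup χ ≃ₜ* isotropyGroup χ' where
  toFun g := ⟨_, conj_mem_isotropyGroup hr hU g.2⟩
  invFun g := ⟨_, conj_mem_isotropyGroup (inv_ne_zero hr) (rho_inv_mulVec hr hU) g.2⟩
  map_mul' g h := Subtype.ext (by
    change U * ((g : Spin101) * h) * U⁻¹ = U * g * U⁻¹ * (U * h * U⁻¹)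
    group)
  left_inv g := Subtype.ext (by
    change U⁻¹ * (U * (g : Spin101) * U⁻¹) * U⁻¹⁻¹ = g
    group)
  right_inv g := Subtype.ext (by
    change U * (U⁻¹ * (g : Spin101) * U⁻¹⁻¹) * U⁻¹ = g
    group)
  continuous_toFun := Continuous.subtype_mk
    ((continuous_const.mul continuous_subtype_val).mul continuous_const) _
  continuous_invFun := Continuous.subtype_mk
    ((continuous_const.mul continuous_subtype_val).mul continuous_const) _

end Transport

/-! ### The structure theorems for a general spinor -/

/-- The rotation of `𝔼⁸` induced by an element of the spin group fixing `e₀, e₉, e_♮`. -/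
def rot8 (U : Spin101) : (Fin 8 → ℝ) →ₗ[ℝ] (Fin 8 → ℝ) := proj8 ∘ₗ vecAct U ∘ₗ incl8

variable {U : Spin101}

theorem incl8_rot8 (h0 : vecAct U (e 0) = e 0) (h9 : vecAct U (e 9) = e 9)
    (h10 : vecAct U (e 10) = e 10) (y : Fin 8 → ℝ) : incl8 (rot8 U y) = vecAct U (incl8 y) :=
  (incl8_proj8_of_fix h0 h9 h10 y).symm

theorem vecAct_inv_fix {v : Mink} (h : vecAct U v = v) : vecAct U⁻¹ v = v := by
  nth_rewrite 1 [← h]; exact vecAct_inv_vecAct U v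

/-- `rot8` as a linear equivalence. -/
def rot8Equiv (h0 : vecAct U (e 0) = e 0) (h9 : vecAct U (e 9) = e 9)
    (h10 : vecAct U (e 10) = e 10) : (Fin 8 → ℝ) ≃ₗ[ℝ] (Fin 8 → ℝ) where
  __ := rot8 U
  invFun := rot8 U⁻¹
  left_inv y := by
    change rot8 U⁻¹ (rot8 U y) = y
    change proj8 (vecAct U⁻¹ (incl8 (rot8 U y))) = y
    rw [incl8_rot8 h0 h9 h10, vecAct_inv_vecAct, proj8_incl8]
  right_inv y := by
    change rot8 U (rot8 U⁻¹ y) = y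
    change proj8 (vecAct U (incl8 (rot8 U⁻¹ y))) = y
    rw [incl8_rot8 (vecAct_inv_fix h0) (vecAct_inv_fix h9) (vecAct_inv_fix h10), vecAct_vecAct_inv,
      proj8_incl8]

theorem conj_nullSpin (h0 : vecAct U (e 0) = e 0) (h9 : vecAct U (e 9) = e 9)
    (h10 : vecAct U (e 10) = e 10) (b : Fin 8 → ℝ) (c : ℝ) :
    U * nullSpin b c * U⁻¹ = nullSpin (rot8 U b) c := by
  rw [mul_inv_eq_iff_eq_mul]
  apply mul_nullSpin
  · rw [ePlus, map_add, h0, h9]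
  · rw [nullVec, nullVec, map_add, map_smul, h10, incl8_rot8 h0 h9 h10]

variable {ψ : S8 → ℝ}

theorem expGroup_eq_isotropyGroup (hψ : ψ ≠ 0) (hchir : gammaP9 *ᵥ ψ = -ψ) :
    expGroup (eps ψ) = isotropyGroup (eps ψ) := by
  obtain ⟨U, r, hr, hU, -⟩ := exists_rotation hψ hchir
  exact expGroup_eq_of_rotation hr hU expGroup_psi0

theorem nonempty_lieEquiv (hψ : ψ ≠ 0) (hchir : gammaP9 *ᵥ ψ = -ψ) :
    Nonempty (isotropyAlgebra (eps ψ) ≃ₗ⁅ℝ⁆ ModelLie) := by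
  obtain ⟨U, r, hr, hU, -⟩ := exists_rotation hψ hchir
  exact ⟨(modelLieEquiv.trans (isotropyLieEquiv hr hU)).symm⟩

theorem mem_isotropyAlgebra_iff_exp (hψ : ψ ≠ 0) (hchir : gammaP9 *ᵥ ψ = -ψ) (X : Cl) :
    X ∈ isotropyAlgebra (eps ψ) ↔
      ∀ t : ℝ, ∃ g ∈ expGroup (eps ψ), (g : Cl) = NormedSpace.exp (t • X) := by
  refine ⟨fun hX t => ⟨_, exp_mem_expGroup ((isotropyAlgebra (eps ψ)).smul_mem t hX), rfl⟩,
    fun h => mem_isotropyAlgebra_of_exp ?_⟩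
  rwa [← expGroup_eq_isotropyGroup hψ hchir]

/-- Equal subgroups are isomorphic as topological groups. -/
def subgroupCongr {G : Type*} [Group G] [TopologicalSpace G] {H K : Subgroup G} (h : H = K) :
    H ≃ₜ* K where
  __ := MulEquiv.subgroupCongr h
  continuous_toFun := Continuous.subtype_mk continuous_subtype_val _
  continuous_invFun := Continuous.subtype_mk continuous_subtype_val _

theorem exists_groupEquiv (hψ : ψ ≠ 0) (hchir : gammaP9 *ᵥ ψ = -ψ) :
    ∃ (A : (Fin 8 → ℝ) ≃ₗ[ℝ] (Fin 8 → ℝ)) (Φ : ModelGroup ≃ₜ* expGroup (eps ψ)),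
      (∀ (b : Fin 8 → ℝ) (c : ℝ),
        (Φ (Multiplicative.ofAdd c, SemidirectProduct.inl (Multiplicative.ofAdd b)) : Spin101)
          = nullSpin (A b) c) ∧
      (∀ (σ : Spin7) (M : Fin 11), M = 0 ∨ M = 9 ∨ M = 10 →
        vecAct (Φ (1, SemidirectProduct.inr σ) : Spin101) (e M) = e M) := by
  obtain ⟨U, r, hr, hU, h0, h9, h10⟩ := exists_rotation hψ hchir
  let Φ : ModelGroup ≃ₜ* expGroup (eps ψ) := (modelEquiv.trans (isotropyGroupEquiv hr hU)).trans
    (subgroupCongr (expGroup_eq_isotropyGroup hψ hchir).symm)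
  have hΦ (x : ModelGroup) : (Φ x : Spin101)
      = U * (nullSpin (conjEquiv x.2.left.toAdd) x.1.toAdd * spinLift x.2.right) * U⁻¹ := rfl
  refine ⟨conjEquiv.trans (rot8Equiv h0 h9 h10), Φ, fun b c => ?_, fun σ M hM => ?_⟩
  · rw [hΦ]
    simp only [SemidirectProduct.left_inl, SemidirectProduct.right_inl, map_one, mul_one, toAdd_ofAdd]
    exact conj_nullSpin h0 h9 h10 _ _
  · rw [hΦ]
    simp only [SemidirectProduct.left_inr, SemidirectProduct.right_inr, toAdd_one, map_zero,
      nullSpin_zero, one_mul]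
    rw [vecAct_mul_apply, vecAct_mul_apply]
    rcases hM with rfl | rfl | rfl
    · rw [vecAct_inv_fix h0, vecAct_spinLift_timePart _ proj8_e0, h0]
    · rw [vecAct_inv_fix h9, vecAct_spinLift_timePart _ proj8_e9, h9]
    · rw [vecAct_inv_fix h10, vecAct_spinLift_timePart _ proj8_e10, h10]

/-! ### Invariant spinors -/

theorem exists_spin7 {x : CliffordAlgebra Q7} (h : IsExpProd x) :
    ∃ g : Spin7, (g : CliffordAlgebra Q7) = x := by
  obtain ⟨g, -, hg⟩ := h
  exact ⟨g, hg⟩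

theorem vecAct_ι_mul_ι {g : spinGroup (diagForm (negW 7))} {i j : Fin 7} (hj : j ≠ i)
    (hg : (g : CliffordAlgebra (diagForm (negW 7)))
      = ι (diagForm (negW 7)) (Pi.single j 1) * ι (diagForm (negW 7)) (Pi.single i 1))
    (w : Fin 7 → ℝ) : vecAct g w i = -w i := by
  have hQ (k : Fin 7) : diagForm (negW 7) (Pi.single k 1) = -1 := by
    rw [diagForm_negW]; simp [Pi.single_apply]
  rw [← one_smul ℝ (ι (diagForm (negW 7)) (Pi.single j 1) * _)] at hg
  rw [vecAct_of_coe_eq (by rw [hQ]; norm_num) (by rw [hQ]; norm_num) hg w]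
  simp [hyperRefl, polar_negW, hQ, hj]
  ring

theorem gammaLin_ePlus_of_invariant {χ : S11 → ℝ}
    (h : ∀ b c, rho (nullSpin b c) *ᵥ χ = χ) : gammaLin ePlus *ᵥ χ = 0 := by
  have h1 := h 0 1
  rw [coe_nullSpin, map_add, map_one, Matrix.add_mulVec, Matrix.one_mulVec, add_eq_left,
    nullGen_eq, Sig_ePlus (mip_ePlus_nullVec _ _), ι_mul_swap, mip_ePlus_nullVec, mul_zero,
    zero_smul, zero_sub, map_smul, map_neg, map_mul, rho_ι, rho_ι] at h1
  have h2 := congrArg (fun v => gammaLin (nullVec 0 1) *ᵥ v) h1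
  simp only [Matrix.smul_mulVec, Matrix.neg_mulVec, Matrix.mulVec_smul, Matrix.mulVec_neg,
    Matrix.mulVec_mulVec, ← mul_assoc, gammaLin_mul_self, Matrix.mulVec_zero] at h2
  rw [Qmink_eq_mip, mip_nullVec_self] at h2
  simpa using h2

theorem span_of_invariant_psi0 {χ : S11 → ℝ}
    (h : ∀ g ∈ isotropyGroup (eps psi0), rho g *ᵥ χ = χ) : ∃ r : ℝ, χ = r • eps psi0 := by
  have hp := gammaLin_ePlus_of_invariant fun b c =>
    h _ (expGroup_le_isotropyGroup _ (nullSpin_mem_expGroup psi0_chir b c))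
  have hs (g : Spin7) := h _ (spinLift_mem g)
  have hdec : χ = Sum.elim (Sum.elim (fun i => χ (.inl (.inl i))) fun i => χ (.inl (.inr i)))
      (Sum.elim (fun i => χ (.inr (.inl i))) fun i => χ (.inr (.inr i))) := by
    funext i; rcases i with (i | i) | (i | i) <;> rfl
  generalize (fun i => χ (.inl (.inl i))) = a₁ at hdec
  generalize (fun i => χ (.inl (.inr i))) = a₂ at hdec
  generalize (fun i => χ (.inr (.inl i))) = b₁ at hdec
  generalize (fun i => χ (.inr (.inr i))) = b₂ at hdec
  subst hdec
  have hb₁ : a₂ = 0 ∧ b₁ = 0 := by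
    rw [gammaLin_blocks, ePlus_zero, ePlus_nine, ePlus_ten, proj8_ePlus, gammaP9_eq] at hp
    simp only [map_zero, one_smul, add_zero, zero_smul, Matrix.fromBlocks_mulVec,
      Sum.elim_comp_inl, Sum.elim_comp_inr, Matrix.sub_mulVec, Matrix.add_mulVec, Matrix.one_mulVec,
      Matrix.zero_mulVec, zero_add, neg_zero] at hp
    constructor
    · funext i
      have := congrFun hp (.inr (.inr i))
      simp at this
      simp only [Pi.zero_apply]; linarith
    · funext i
      have := congrFun hp (.inl (.inl i))
      simp [Matrix.neg_mulVec] at this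
      simp only [Pi.zero_apply]; linarith
  have hB (g : Spin7) : extMat 1 (vecAct g) *ᵥ a₁ = a₁ ∧ (cMat * rho7 g * cMat) *ᵥ b₂ = b₂ := by
    have h1 := hs g
    rw [rho_spinLift, spinD, Dmat, Matrix.fromBlocks_mulVec] at h1
    simp only [Matrix.fromBlocks_mulVec, Sum.elim_comp_inl, Sum.elim_comp_inr, Matrix.zero_mulVec,
      zero_add, add_zero] at h1
    exact ⟨funext fun i => congrFun h1 (.inl (.inl i)), funext fun i => congrFun h1 (.inr (.inr i))⟩
  have hb₂ : b₂ = 0 := by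
    obtain ⟨g, hg⟩ := exists_spin7 isExpProd_neg_one
    have h1 := (hB g).2
    rw [hg] at h1
    have h2 : rho7 (-1 : CliffordAlgebra Q7) = -1 := by rw [map_neg, map_one]
    have h3 : (cMat * rho7 (-1 : CliffordAlgebra Q7) * cMat) *ᵥ b₂ = b₂ := h1
    rw [h2, mul_neg, mul_one, neg_mul, cMat_sq, Matrix.neg_mulVec, Matrix.one_mulVec] at h3
    funext i
    have := congrFun h3 i
    simp only [Pi.neg_apply] at this
    simp only [Pi.zero_apply]; linarith
  have ha₁ : ∀ i : Fin 7, a₁ i.succ = 0 := by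
    intro i
    obtain ⟨j, hj⟩ : ∃ j : Fin 7, j ≠ i := exists_ne i
    obtain ⟨g, hg⟩ := exists_spin7 (isExpProd_ι_mul_ι (u := Pi.single j 1) (v := Pi.single i 1)
      (by simp) (by simp))
    have hv (w : Fin 7 → ℝ) : vecAct g w i = -w i := vecAct_ι_mul_ι hj hg w
    have h1 := congrFun (hB g).1 i.succ
    rw [extMat_mulVec, Fin.cons_succ, hv] at h1
    simp only [Fin.tail] at h1
    linarith
  refine ⟨a₁ 0, ?_⟩
  rw [hb₁.1, hb₁.2, hb₂]
  funext k
  rcases k with (k | k) | (k | k)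
  · simp only [Sum.elim_inl, Pi.smul_apply, eps, psi0, smul_eq_mul]
    refine Fin.cases ?_ (fun k => ?_) k
    · simp [one8]
    · rw [ha₁]; simp [one8]
  all_goals simp [eps, psi0]

theorem invariant_spinor_iff (hψ : ψ ≠ 0) (hchir : gammaP9 *ᵥ ψ = -ψ) (χ : S11 → ℝ) :
    (∀ g ∈ expGroup (eps ψ), rho g *ᵥ χ = χ) ↔ χ ∈ Submodule.span ℝ {eps ψ} := by
  rw [expGroup_eq_isotropyGroup hψ hchir]
  constructor
  · intro h
    obtain ⟨U, r, hr, hU, -⟩ := exists_rotation hψ hchir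
    obtain ⟨s, hs⟩ := span_of_invariant_psi0 (χ := rho ((U⁻¹ : Spin101) : Cl) *ᵥ χ) fun g hg => by
      have h1 := h _ (conj_mem_isotropyGroup hr hU hg)
      rw [Submonoid.coe_mul, Submonoid.coe_mul, map_mul, map_mul] at h1
      have h2 := congrArg (fun v => rho ((U⁻¹ : Spin101) : Cl) *ᵥ v) h1
      simp only [Matrix.mulVec_mulVec, ← mul_assoc] at h2
      rwa [← map_mul, coe_inv_mul, map_one, one_mul, ← Matrix.mulVec_mulVec] at h2
    have h3 := congrArg (fun v => rho (U : Cl) *ᵥ v) hs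
    simp only [Matrix.mulVec_mulVec, Matrix.mulVec_smul] at h3
    rw [← map_mul, coe_mul_inv, map_one, Matrix.one_mulVec, hU] at h3
    rw [h3]
    exact Submodule.smul_mem _ _ (Submodule.smul_mem _ _ (Submodule.mem_span_singleton_self _))
  · intro h g hg
    obtain ⟨s, rfl⟩ := Submodule.mem_span_singleton.1 h
    have hg' : rho g *ᵥ eps ψ = eps ψ := hg
    rw [Matrix.mulVec_smul, hg']

end ExoticSpinor
end

noncomputable section
namespace ExoticSpinor
open CliffordAlgebra

/-! ### The action on forms -/

/-- Pull-back of forms by an element of the spin group. -/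
def pull (g : Spin101) : Forms →ₐ[ℝ] Forms := ExteriorAlgebra.map (vecAct g).dualMap

theorem sum_eta_smul_proj (v : Mink) :
    ∑ M, (eta M * v M) • (LinearMap.proj M : Mink →ₗ[ℝ] ℝ) = mip v := by
  ext M
  simp [mip_eq_sum, Finset.sum_apply, mul_assoc]

theorem dualForm_eq (v : Mink) : dualForm v = ExteriorAlgebra.ι ℝ (mip v) := by
  rw [dualForm, sum_eta_smul_proj]

/-- `dualForm` as a linear map. -/
def dualFormLin : Mink →ₗ[ℝ] Forms := ExteriorAlgebra.ι ℝ ∘ₗ mip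

theorem dualFormLin_apply (v : Mink) : dualFormLin v = dualForm v := (dualForm_eq v).symm

theorem dualForm_add (u v : Mink) : dualForm (u + v) = dualForm u + dualForm v := by
  simp only [← dualFormLin_apply, map_add]

theorem dualForm_smul (c : ℝ) (v : Mink) : dualForm (c • v) = c • dualForm v := by
  simp only [← dualFormLin_apply, map_smul]

theorem dualForm_mul_self (v : Mink) : dualForm v * dualForm v = 0 := ExteriorAlgebra.ι_sq_zero _

theorem dualForm_swap (u v : Mink) : dualForm u * dualForm v = -(dualForm v * dualForm u) :=
  eq_neg_of_add_eq_zero_left (ExteriorAlgebra.ι_add_mul_swap _ _)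

theorem pull_dualForm (g : Spin101) (v : Mink) : pull g (dualForm v) = dualForm (vecAct g⁻¹ v) := by
  rw [dualForm_eq, dualForm_eq, pull, ExteriorAlgebra.map_apply_ι]
  congr 1
  ext M
  have := mip_vecAct g (vecAct g⁻¹ v) (Pi.single M 1)
  rw [vecAct_vecAct_inv] at this
  simpa using this

theorem pull_pull (g h : Spin101) (ω : Forms) : pull h (pull g ω) = pull (g * h) ω := by
  have : (pull h).comp (pull g) = pull (g * h) := by
    rw [pull, pull, pull, ExteriorAlgebra.map_comp_map, vecAct_mul]
    rfl
  exact DFunLike.congr_fun this ω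

theorem pull_one (ω : Forms) : pull 1 ω = ω := by
  rw [pull, vecAct_one]
  exact DFunLike.congr_fun ExteriorAlgebra.map_id ω

theorem pull_inv_pull (g : Spin101) (ω : Forms) : pull g⁻¹ (pull g ω) = ω := by
  rw [pull_pull, mul_inv_cancel, pull_one]

theorem coe_exteriorPower_map {k : ℕ} (φ : Module.Dual ℝ Mink →ₗ[ℝ] Module.Dual ℝ Mink)
    (ω : ⋀[ℝ]^k (Module.Dual ℝ Mink)) :
    (exteriorPower.map k φ ω : Forms) = ExteriorAlgebra.map φ (ω : Forms) := by
  have : (Submodule.subtype _) ∘ₗ exteriorPower.map k φ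
      = (ExteriorAlgebra.map φ).toLinearMap ∘ₗ Submodule.subtype _ := by
    refine exteriorPower.linearMap_ext ?_
    ext v
    simp [ExteriorAlgebra.map_apply_ιMulti, Function.comp_def]
  exact LinearMap.congr_fun this ω

theorem pull_mem {k : ℕ} (g : Spin101) {ω : Forms} (h : ω ∈ ⋀[ℝ]^k (Module.Dual ℝ Mink)) :
    pull g ω ∈ ⋀[ℝ]^k (Module.Dual ℝ Mink) := by
  have := (exteriorPower.map k (vecAct g).dualMap ⟨ω, h⟩).2
  rwa [coe_exteriorPower_map] at this

/-- A form of degree `k` as an alternating map. -/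
def evalForm (k : ℕ) (ω : ⋀[ℝ]^k (Module.Dual ℝ Mink)) : Mink [⋀^Fin k]→ₗ[ℝ] ℝ :=
  (exteriorPower.pairingDual ℝ Mink k ω).compAlternatingMap (exteriorPower.ιMulti ℝ k)

theorem evalForm_apply {k : ℕ} (ω : ⋀[ℝ]^k (Module.Dual ℝ Mink)) (v : Fin k → Mink) :
    evalForm k ω v = exteriorPower.pairingDual ℝ Mink k ω (exteriorPower.ιMulti ℝ k v) := rfl

theorem eq_zero_of_evalForm {k : ℕ} {ω : ⋀[ℝ]^k (Module.Dual ℝ Mink)} (h : evalForm k ω = 0) :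
    ω = 0 := by
  set b := Pi.basisFun ℝ (Fin 11)
  have hb : ⇑b.dualBasis = b.coord := b.coe_dualBasis
  set B := b.dualBasis.exteriorPower k
  rw [← B.forall_coord_eq_zero_iff]
  intro t
  have h1 : ∀ ω' : ⋀[ℝ]^k (Module.Dual ℝ Mink), B.coord t ω'
      = exteriorPower.pairingDual ℝ Mink k ω' (exteriorPower.ιMulti_family ℝ k b t) := by
    intro ω'
    have : B.coord t = (Module.Dual.eval ℝ _ (exteriorPower.ιMulti_family ℝ k b t)) ∘ₗ
        exteriorPower.pairingDual ℝ Mink k := by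
      refine B.ext fun s => ?_
      rw [Module.Basis.coord_apply, Module.Basis.repr_self, exteriorPower.basis_apply, hb,
        LinearMap.comp_apply, Module.Dual.eval_apply]
      by_cases hst : s = t
      · subst hst
        rw [Finsupp.single_eq_same]
        exact (exteriorPower.ιMultiDual_apply_diag ℝ k b s).symm
      · rw [Finsupp.single_eq_of_ne (Ne.symm hst)]
        exact (exteriorPower.ιMultiDual_apply_nondiag ℝ k b s t hst).symm
    rw [this]; rfl
  rw [h1]
  exact DFunLike.congr_fun h _

theorem evalForm_map {k : ℕ} (g : Spin101) (ω : ⋀[ℝ]^k (Module.Dual ℝ Mink)) (v : Fin k → Mink) :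
    evalForm k (exteriorPower.map k (vecAct g).dualMap ω) v
      = evalForm k ω fun i => vecAct g (v i) := by
  have : Module.Dual.eval ℝ _ (exteriorPower.ιMulti ℝ k v) ∘ₗ exteriorPower.pairingDual ℝ Mink k ∘ₗ
        exteriorPower.map k (vecAct g).dualMap
      = Module.Dual.eval ℝ _ (exteriorPower.ιMulti ℝ k fun i => vecAct g (v i)) ∘ₗ
        exteriorPower.pairingDual ℝ Mink k := by
    refine exteriorPower.linearMap_ext ?_
    ext f
    simp [exteriorPower.pairingDual_ιMulti_ιMulti]
  exact LinearMap.congr_fun this ω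

/-- Evaluating an invariant form. -/
theorem evalForm_invariant {G : Subgroup Spin101} {k : ℕ} {ω : Forms}
    (h : ω ∈ invariantForms G k) {g : Spin101} (hg : g ∈ G) (v : Fin k → Mink) :
    evalForm k ⟨ω, h.1⟩ (fun i => vecAct g (v i)) = evalForm k ⟨ω, h.1⟩ v := by
  rw [← evalForm_map]
  congr 2
  exact Subtype.ext ((coe_exteriorPower_map _ _).trans (h.2 g hg))

/-! ### Covariance of the Cayley form -/

/-- The matrix with entries in a real algebra obtained from a real matrix and a scalar. -/
def tmul {n : Type*} {A : Type*} [Ring A] [Algebra ℝ A] (M : Matrix n n ℝ) (ω : A) : Matrix n n A :=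
  M.map (· • ω)

section TMul

variable {n A : Type*} [Fintype n] [Ring A] [Algebra ℝ A]

theorem tmul_mul (M M' : Matrix n n ℝ) (ω ω' : A) :
    tmul M ω * tmul M' ω' = tmul (M * M') (ω * ω') := by
  ext i j
  simp only [tmul, Matrix.mul_apply, Matrix.map_apply, smul_mul_smul_comm, Finset.sum_smul]

theorem map_mul_tmul_mul (M M' N : Matrix n n ℝ) (ω : A) :
    M.map (algebraMap ℝ A) * tmul N ω * M'.map (algebraMap ℝ A) = tmul (M * N * M') ω := by
  have h (X : Matrix n n ℝ) : X.map (algebraMap ℝ A) = tmul X 1 := by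
    ext i j; simp [tmul, Algebra.algebraMap_eq_smul_one]
  rw [h, h, tmul_mul, tmul_mul, one_mul, mul_one]

theorem dotProduct_tmul (x : n → ℝ) (M : Matrix n n ℝ) (ω : A) :
    (algebraMap ℝ A ∘ x) ⬝ᵥ (tmul M ω *ᵥ (algebraMap ℝ A ∘ x)) = (x ⬝ᵥ (M *ᵥ x)) • ω := by
  simp only [dotProduct, Matrix.mulVec, tmul, Finset.sum_smul, Finset.mul_sum, Function.comp_apply,
    Matrix.map_apply, Algebra.algebraMap_eq_smul_one, smul_mul_smul_comm, mul_one, one_mul]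

end TMul

/-- The Clifford-valued one-form `∑ᵢ eᵢ^* ⊗ Γ'ᵢ` on `𝔼⁸`. -/
def gammaForm : Matrix S8 S8 Forms := ∑ i, tmul (gammaP i) (dualForm (e (idx8 i)))

theorem cayley_eq (ψ : S8 → ℝ) : cayley ψ = -(24 * (ψ ⬝ᵥ ψ))⁻¹ •
    ((algebraMap ℝ Forms ∘ ψ) ⬝ᵥ ((gammaForm * gammaForm * gammaForm * gammaForm) *ᵥ
      (algebraMap ℝ Forms ∘ ψ))) := by
  rw [cayley]
  refine congrArg _ ?_
  have h (a : Fin 8 → Matrix S8 S8 Forms) : (∑ i, a i) * (∑ i, a i) * (∑ i, a i) * (∑ i, a i)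
      = ∑ i, ∑ j, ∑ k, ∑ l, a i * a j * a k * a l := by
    rw [Finset.sum_mul_sum]
    simp only [Finset.sum_mul]
    simp only [Finset.mul_sum, Finset.sum_mul]
    exact Finset.sum_congr rfl fun _ _ => Finset.sum_congr rfl fun _ _ => Finset.sum_comm
  rw [gammaForm, h]
  simp only [tmul_mul, Matrix.sum_mulVec, dotProduct_sum, dotProduct_tmul]

theorem tmul_sum_left {n A ι : Type*} [Ring A] [Algebra ℝ A] (s : Finset ι) (M : ι → Matrix n n ℝ)
    (ω : A) : tmul (∑ i ∈ s, M i) ω = ∑ i ∈ s, tmul (M i) ω := by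
  ext i j; simp [tmul, Matrix.sum_apply, Finset.sum_smul]

theorem tmul_sum_right {n A ι : Type*} [Ring A] [Algebra ℝ A] (s : Finset ι) (M : Matrix n n ℝ)
    (ω : ι → A) : tmul M (∑ i ∈ s, ω i) = ∑ i ∈ s, tmul M (ω i) := by
  ext i j; simp [tmul, Matrix.sum_apply, Finset.smul_sum]

theorem dualForm_incl8 (y : Fin 8 → ℝ) : dualForm (incl8 y) = ∑ i, y i • dualForm (e (idx8 i)) := by
  simp only [← dualFormLin_apply, incl8_eq, map_sum, map_smul]

section Covariance

variable {U : Spin101} (h0 : vecAct U (e 0) = e 0) (h9 : vecAct U (e 9) = e 9)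
  (h10 : vecAct U (e 10) = e 10)
include h0 h9 h10

theorem exists_rho_eq_block : ∃ B : Matrix S8 S8 ℝ, rho U = Matrix.fromBlocks B 0 0 B ∧
    Bᵀ * B = 1 ∧ ∀ y, B * gammaPLin y = gammaPLin (rot8 U y) * B := by
  obtain ⟨B₁, B₂, hB, h1, h2, -⟩ := exists_rho_eq_Dmat h0 h9 h10
  refine ⟨Matrix.fromBlocks B₁ 0 0 B₂, hB, ?_, fun y => ?_⟩
  · simp [Matrix.fromBlocks_transpose, Matrix.fromBlocks_multiply, h1, h2]
  · have h : rho U * gammaLin (incl8 y) = gammaLin (incl8 (rot8 U y)) * rho U := by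
      rw [incl8_rot8 h0 h9 h10, ← rho_ι, ← rho_ι, ← map_mul, ← map_mul, ← ι_vecAct_mul]
    rw [hB, Dmat, gammaLin_incl8, gammaLin_incl8, Matrix.fromBlocks_multiply,
      Matrix.fromBlocks_multiply] at h
    simpa using (Matrix.fromBlocks_inj.1 h).2.2.1

theorem rot8_inv_apply (i j : Fin 8) :
    rot8 U⁻¹ (Pi.single i 1) j = rot8 U (Pi.single j 1) i := by
  have h (y : Fin 8 → ℝ) (i : Fin 8) : mip (incl8 y) (incl8 (Pi.single i 1)) = y i := by
    rw [mip_incl8]; simp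
  rw [← h (rot8 U⁻¹ (Pi.single i 1)) j, ← h (rot8 U (Pi.single j 1)) i, incl8_rot8 h0 h9 h10, incl8_rot8 (vecAct_inv_fix h0) (vecAct_inv_fix h9)
    (vecAct_inv_fix h10), ← mip_vecAct U, vecAct_vecAct_inv, mip_comm]

theorem pull_gammaForm {B : Matrix S8 S8 ℝ} (hB : Bᵀ * B = 1)
    (hy : ∀ y, B * gammaPLin y = gammaPLin (rot8 U y) * B) :
    gammaForm.map (pull U) = B.map (algebraMap ℝ Forms) * gammaForm * Bᵀ.map (algebraMap ℝ Forms) := by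
  have hB' : B * Bᵀ = 1 := mul_eq_one_comm.1 hB
  have e1 (i : Fin 8) : (tmul (gammaP i) (dualForm (e (idx8 i)))).map (pull U)
      = ∑ j, rot8 U (Pi.single j 1) i • tmul (gammaP i) (dualForm (e (idx8 j))) := by
    have : (tmul (gammaP i) (dualForm (e (idx8 i)))).map (pull U)
        = tmul (gammaP i) (pull U (dualForm (e (idx8 i)))) := by
      ext; simp [tmul]
    rw [this, pull_dualForm]
    have h2 : vecAct U⁻¹ (e (idx8 i)) = incl8 (rot8 U⁻¹ (Pi.single i 1)) := by
      rw [incl8_rot8 (vecAct_inv_fix h0) (vecAct_inv_fix h9) (vecAct_inv_fix h10)]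
      simp [incl8_eq, Pi.single_apply]
    rw [h2, dualForm_incl8, tmul_sum_right]
    refine Finset.sum_congr rfl fun j _ => ?_
    rw [rot8_inv_apply h0 h9 h10]
    ext; simp [tmul, smul_smul, mul_comm]
  have e2 (j : Fin 8) : B * gammaP j * Bᵀ = ∑ i, rot8 U (Pi.single j 1) i • gammaP i := by
    have h3 : gammaP j = gammaPLin (Pi.single j 1) := by
      simp [gammaPLin, Fintype.linearCombination_apply, Pi.single_apply]
    rw [h3, hy, mul_assoc, hB', mul_one]; rfl
  have e3 : gammaForm.map (pull U) = ∑ i, (tmul (gammaP i) (dualForm (e (idx8 i)))).map (pull U) := by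
    rw [gammaForm]; exact map_sum (pull U).toRingHom.mapMatrix _ _
  rw [e3]
  simp only [e1]
  rw [Finset.sum_comm, gammaForm, Finset.mul_sum, Finset.sum_mul]
  refine Finset.sum_congr rfl fun j _ => ?_
  rw [map_mul_tmul_mul, e2, tmul_sum_left]
  refine Finset.sum_congr rfl fun i _ => ?_
  ext; simp [tmul, smul_smul]

theorem pull_cayley {B : Matrix S8 S8 ℝ} (hU : rho U = Matrix.fromBlocks B 0 0 B) (hB : Bᵀ * B = 1)
    (hy : ∀ y, B * gammaPLin y = gammaPLin (rot8 U y) * B) (ψ : S8 → ℝ) :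
    pull U (cayley ψ) = cayley (Bᵀ *ᵥ ψ) := by
  have hB' : B * Bᵀ = 1 := mul_eq_one_comm.1 hB
  have hd : (Bᵀ *ᵥ ψ) ⬝ᵥ (Bᵀ *ᵥ ψ) = ψ ⬝ᵥ ψ := by
    rw [Matrix.dotProduct_mulVec, Matrix.vecMul_transpose, Matrix.mulVec_mulVec, hB', Matrix.one_mulVec]
  rw [cayley_eq, cayley_eq, hd, map_smul]
  refine congrArg _ ?_
  set C := B.map (algebraMap ℝ Forms)
  set C' := Bᵀ.map (algebraMap ℝ Forms)
  have hC : C' * C = 1 := by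
    have := congrArg (algebraMap ℝ Forms).mapMatrix hB
    rwa [map_mul, map_one] at this
  have hG := pull_gammaForm h0 h9 h10 hB hy
  set x := algebraMap ℝ Forms ∘ ψ
  have hx' : algebraMap ℝ Forms ∘ (Bᵀ *ᵥ ψ) = C' *ᵥ x := by
    funext i; exact RingHom.map_mulVec _ _ _ _
  have hx'' : algebraMap ℝ Forms ∘ (Bᵀ *ᵥ ψ) = x ᵥ* C := by
    rw [Matrix.mulVec_transpose]; funext i; exact RingHom.map_vecMul _ _ _ _
  have hpx : pull U ∘ x = x := by funext i; simp [x]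
  have e1 : pull U (x ⬝ᵥ ((gammaForm * gammaForm * gammaForm * gammaForm) *ᵥ x))
      = x ⬝ᵥ ((gammaForm.map (pull U) * gammaForm.map (pull U) * gammaForm.map (pull U)
        * gammaForm.map (pull U)) *ᵥ x) := by
    have h1 := RingHom.map_dotProduct (pull U).toRingHom x
      ((gammaForm * gammaForm * gammaForm * gammaForm) *ᵥ x)
    refine h1.trans ?_
    have h2 : (pull U).toRingHom ∘ ((gammaForm * gammaForm * gammaForm * gammaForm) *ᵥ x)
        = ((pull U).toRingHom.mapMatrix (gammaForm * gammaForm * gammaForm * gammaForm)) *ᵥ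
          (pull U ∘ x) := by
      funext i; exact RingHom.map_mulVec _ _ _ _
    rw [h2, map_mul, map_mul, map_mul, hpx]
    exact congrArg (· ⬝ᵥ _) hpx
  have e2 : C * gammaForm * C' * (C * gammaForm * C') * (C * gammaForm * C') * (C * gammaForm * C')
      = C * (gammaForm * gammaForm * gammaForm * gammaForm) * C' := by
    have hC2 (X : Matrix S8 S8 Forms) : C' * (C * X) = X := by rw [← mul_assoc, hC, one_mul]
    simp only [mul_assoc, hC2]
  rw [e1, hG, e2]
  nth_rewrite 1 [hx'']
  rw [hx', ← Matrix.dotProduct_mulVec, Matrix.mulVec_mulVec, Matrix.mulVec_mulVec]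

end Covariance

theorem cayley_smul {r : ℝ} (hr : r ≠ 0) (ψ : S8 → ℝ) : cayley (r • ψ) = cayley ψ := by
  simp only [cayley, smul_dotProduct, dotProduct_smul, Matrix.mulVec_smul, smul_eq_mul, ← mul_assoc,
    mul_smul, ← Finset.smul_sum]
  simp only [smul_smul]
  congr 1
  field_simp

end ExoticSpinor
end

noncomputable section
namespace ExoticSpinor
open CliffordAlgebra

/-! ### The Cayley form of the standard spinor -/

/-- The coordinate one-forms of `𝔼⁸`. -/
def E8 (i : Fin 8) : Forms := dualForm (e (idx8 i))

theorem E8_sq (i : Fin 8) : E8 i * E8 i = 0 := dualForm_mul_self _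

theorem E8_sq_mul (i : Fin 8) (x : Forms) : E8 i * (E8 i * x) = 0 := by
  rw [← mul_assoc, E8_sq, zero_mul]

theorem E8_swap {i j : Fin 8} (_ : i < j) : E8 j * E8 i = -(E8 i * E8 j) := dualForm_swap _ _

theorem E8_swap_mul {i j : Fin 8} (h : i < j) (x : Forms) :
    E8 j * (E8 i * x) = -(E8 i * (E8 j * x)) := by
  rw [← mul_assoc, E8_swap h, neg_mul, mul_assoc]

/-- The integral matrices of `octN` on the standard basis. -/
def octNZ : Fin 8 → Matrix (Fin 8) (Fin 8) ℤ :=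
  Fin.snoc (α := fun _ => Matrix (Fin 8) (Fin 8) ℤ) octLZ 1

/-- The index of the nonzero entry of `octNZ · s t`. -/
def octIdx : Fin 8 → Fin 8 → Fin 8 :=
  ![![7, 0, 1, 2, 3, 4, 5, 6], ![0, 7, 3, 6, 1, 5, 4, 2], ![1, 3, 7, 4, 0, 2, 6, 5],
    ![2, 6, 4, 7, 5, 1, 3, 0], ![3, 1, 0, 5, 7, 6, 2, 4], ![4, 5, 2, 1, 6, 7, 0, 3],
    ![5, 4, 6, 3, 2, 0, 7, 1], ![6, 2, 5, 0, 4, 3, 1, 7]]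

/-- The sign of the nonzero entry of `octNZ · s t`. -/
def octSgn : Fin 8 → Fin 8 → ℤ :=
  ![![1, -1, -1, -1, -1, -1, -1, -1], ![1, 1, -1, -1, 1, -1, 1, 1], ![1, 1, 1, -1, -1, 1, -1, 1],
    ![1, 1, 1, 1, -1, -1, 1, -1], ![1, -1, 1, 1, 1, -1, -1, 1], ![1, 1, -1, 1, 1, 1, -1, -1],
    ![1, -1, 1, -1, 1, 1, 1, -1], ![1, -1, -1, 1, -1, 1, 1, 1]]

theorem octNZ_eq (i s t : Fin 8) : octNZ i s t = if i = octIdx s t then octSgn s t else 0 := by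
  have h : ∀ i, octNZ i = Matrix.of fun s t => if i = octIdx s t then octSgn s t else 0 := by
    decide +kernel
  rw [h]; rfl

theorem octN_single (i : Fin 8) : octN (Pi.single i 1) = (octNZ i).map (Int.castRingHom ℝ) := by
  rw [octN_apply]
  induction i using Fin.lastCases with
  | last =>
    have : (Fin.init (Pi.single (Fin.last 7) 1 : Fin 8 → ℝ) : Fin 7 → ℝ) = 0 := by
      funext j; exact Pi.single_eq_of_ne (Fin.castSucc_lt_last j).ne _
    rw [this, map_zero, Pi.single_eq_same, zero_add, one_smul, octNZ, Fin.snoc_last]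
    simp
  | cast i =>
    have : (Fin.init (Pi.single i.castSucc 1 : Fin 8 → ℝ) : Fin 7 → ℝ) = Pi.single i 1 := by
      funext j; simp [Fin.init, Pi.single_apply]
    rw [this, Pi.single_eq_of_ne (Fin.castSucc_lt_last i).ne', zero_smul, add_zero, octNZ,
      Fin.snoc_castSucc]
    simp [octLin_apply, Pi.single_apply, octL]

theorem gammaP_eq (i : Fin 8) : gammaP i
    = Matrix.fromBlocks 0 (-(octN (Pi.single i 1))ᵀ) (octN (Pi.single i 1)) 0 := by
  rw [← gammaPLin_blocks]
  simp [gammaPLin, Fintype.linearCombination_apply, Pi.single_apply]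

theorem gammaForm_inr_inl (s t : Fin 8) :
    gammaForm (Sum.inr s) (Sum.inl t) = (octSgn s t : ℝ) • E8 (octIdx s t) := by
  simp only [gammaForm, Matrix.sum_apply, tmul, Matrix.map_apply, gammaP_eq,
    Matrix.fromBlocks_apply₂₁, octN_single, octNZ_eq]
  simp [E8]

theorem gammaForm_inl_inr (s t : Fin 8) :
    gammaForm (Sum.inl t) (Sum.inr s) = -((octSgn s t : ℝ) • E8 (octIdx s t)) := by
  simp only [gammaForm, Matrix.sum_apply, tmul, Matrix.map_apply, gammaP_eq,
    Matrix.fromBlocks_apply₁₂, Matrix.neg_apply, Matrix.transpose_apply, octN_single, octNZ_eq]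
  simp [E8]

theorem gammaForm_inl_inl (s t : Fin 8) : gammaForm (Sum.inl t) (Sum.inl s) = 0 := by
  simp [gammaForm, Matrix.sum_apply, tmul, gammaP_eq]

theorem gammaForm_inr_inr (s t : Fin 8) : gammaForm (Sum.inr t) (Sum.inr s) = 0 := by
  simp [gammaForm, Matrix.sum_apply, tmul, gammaP_eq]

/-- The two-forms `∑ₛ nₛ₀ nₛₜ`. -/
def octTwoForm (t : Fin 8) : Forms :=
  ∑ s, ((octSgn s 0 : ℝ) • E8 (octIdx s 0)) * ((octSgn s t : ℝ) • E8 (octIdx s t))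

theorem gammaForm_sq_zero (t : Fin 8) :
    (gammaForm * gammaForm) (Sum.inl 0) (Sum.inl t) = -octTwoForm t := by
  simp [Matrix.mul_apply, Fintype.sum_sum_type, gammaForm_inl_inl, gammaForm_inl_inr,
    gammaForm_inr_inl, octTwoForm]

theorem gammaForm_sq_zero_inr (t : Fin 8) :
    (gammaForm * gammaForm) (Sum.inl 0) (Sum.inr t) = 0 := by
  simp [Matrix.mul_apply, Fintype.sum_sum_type, gammaForm_inl_inl, gammaForm_inr_inr]

theorem gammaForm_sq_zero' (t : Fin 8) :
    (gammaForm * gammaForm) (Sum.inl t) (Sum.inl 0) = octTwoForm t := by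
  simp only [Matrix.mul_apply, Fintype.sum_sum_type, gammaForm_inl_inl, gammaForm_inl_inr,
    gammaForm_inr_inl, octTwoForm, mul_zero, Finset.sum_const_zero, zero_add]
  refine Finset.sum_congr rfl fun s _ => ?_
  rw [neg_mul, smul_mul_smul_comm, smul_mul_smul_comm, E8, E8, dualForm_swap, smul_neg, neg_neg,
    mul_comm]

theorem cayley_psi0_eq_sum : cayley psi0 = (1 / 24 : ℝ) • ∑ t, octTwoForm t * octTwoForm t := by
  have h1 : psi0 = Pi.single (Sum.inl 0) 1 := by
    funext i
    rcases i with i | i <;> simp [psi0, one8, Pi.single_apply]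
  have h2 : algebraMap ℝ Forms ∘ psi0 = Pi.single (Sum.inl 0) 1 := by
    rw [h1]; funext i; by_cases hi : i = Sum.inl 0 <;> simp [Pi.single_apply, hi]
  have h3 : psi0 ⬝ᵥ psi0 = 1 := by rw [h1]; simp
  have h4 : (gammaForm * gammaForm * gammaForm * gammaForm) (Sum.inl 0) (Sum.inl 0)
      = -∑ t, octTwoForm t * octTwoForm t := by
    rw [mul_assoc (gammaForm * gammaForm), Matrix.mul_apply, Fintype.sum_sum_type]
    simp only [gammaForm_sq_zero, gammaForm_sq_zero_inr, gammaForm_sq_zero', zero_mul, neg_mul,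
      Finset.sum_const_zero, add_zero, Finset.sum_neg_distrib]
  rw [cayley_eq, h3, h2]
  simp [h4]

theorem octTwoForm_eq :
    octTwoForm 0 = 0 ∧
    octTwoForm 1 = (2 : ℝ) • (E8 0 * E8 7 + E8 1 * E8 3 + E8 2 * E8 6 + E8 4 * E8 5) ∧
    octTwoForm 2 = (2 : ℝ) • (-(E8 0 * E8 3) + E8 1 * E8 7 + E8 2 * E8 4 + E8 5 * E8 6) ∧
    octTwoForm 3 = (2 : ℝ) • (-(E8 0 * E8 6) - E8 1 * E8 4 + E8 2 * E8 7 + E8 3 * E8 5) ∧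
    octTwoForm 4 = (2 : ℝ) • (E8 0 * E8 1 - E8 2 * E8 5 + E8 3 * E8 7 + E8 4 * E8 6) ∧
    octTwoForm 5 = (2 : ℝ) • (-(E8 0 * E8 5) + E8 1 * E8 2 - E8 3 * E8 6 + E8 4 * E8 7) ∧
    octTwoForm 6 = (2 : ℝ) • (E8 0 * E8 4 - E8 1 * E8 6 + E8 2 * E8 3 + E8 5 * E8 7) ∧
    octTwoForm 7 = (2 : ℝ) • (E8 0 * E8 2 + E8 1 * E8 5 + E8 3 * E8 4 + E8 6 * E8 7) := by
  refine ⟨?_, ?_, ?_, ?_, ?_, ?_, ?_, ?_⟩ <;>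
  · simp [octTwoForm, Fin.sum_univ_eight, octSgn, octIdx, E8_sq, E8_swap]
    try module

theorem cayley_psi0 : cayley psi0 =
    -(E8 0 * (E8 1 * (E8 2 * E8 5))) + E8 0 * (E8 1 * (E8 3 * E8 7))
    + E8 0 * (E8 1 * (E8 4 * E8 6)) + E8 0 * (E8 2 * (E8 3 * E8 4))
    + E8 0 * (E8 2 * (E8 6 * E8 7)) - E8 0 * (E8 3 * (E8 5 * E8 6))
    + E8 0 * (E8 4 * (E8 5 * E8 7)) - E8 1 * (E8 2 * (E8 3 * E8 6))
    + E8 1 * (E8 2 * (E8 4 * E8 7)) + E8 1 * (E8 3 * (E8 4 * E8 5))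
    + E8 1 * (E8 5 * (E8 6 * E8 7)) + E8 2 * (E8 3 * (E8 5 * E8 7))
    + E8 2 * (E8 4 * (E8 5 * E8 6)) + E8 3 * (E8 4 * (E8 6 * E8 7)) := by
  obtain ⟨h0, h1, h2, h3, h4, h5, h6, h7⟩ := octTwoForm_eq
  rw [cayley_psi0_eq_sum, Fin.sum_univ_eight, h0, h1, h2, h3, h4, h5, h6, h7]
  simp only [mul_add, add_mul, mul_sub, sub_mul, smul_mul_smul_comm, mul_neg, neg_mul, neg_neg,
    mul_assoc]
  simp [E8_sq, E8_sq_mul, E8_swap, E8_swap_mul]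
  module

end ExoticSpinor
end

noncomputable section
namespace ExoticSpinor
open CliffordAlgebra

/-! ### Volume forms -/

theorem alternatingMap_apply_linearMap {n : ℕ} {N : Type*} [AddCommGroup N] [Module ℝ N]
    (f : (Fin n → ℝ) [⋀^Fin n]→ₗ[ℝ] N) (T : (Fin n → ℝ) →ₗ[ℝ] (Fin n → ℝ)) :
    f (fun i => T (Pi.single i 1)) = LinearMap.det T • f fun i => Pi.single i 1 := by
  set b := Pi.basisFun ℝ (Fin n)
  have hb (i : Fin n) : b i = Pi.single i 1 := Pi.basisFun_apply _ _ _
  have h : f = (LinearMap.toSpanSingleton ℝ N (f b)).compAlternatingMap b.det := by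
    refine Module.Basis.ext_alternating b fun v hv => ?_
    obtain ⟨σ, hσ⟩ : ∃ σ : Equiv.Perm (Fin n), ∀ i, σ i = v i :=
      ⟨Equiv.ofBijective v (Finite.injective_iff_bijective.1 hv), fun _ => rfl⟩
    have hv' : (fun i => b (v i)) = b ∘ σ := by funext i; simp [hσ]
    rw [hv', AlternatingMap.map_perm, AlternatingMap.map_perm]
    simp [Module.Basis.det_self]
  have h2 : b.det (fun i => T (Pi.single i 1)) = LinearMap.det T := by
    have := b.det_comp T b
    simp only [Module.Basis.det_self, mul_one] at this
    rw [← this]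
    congr 1
    funext i; rw [Function.comp_apply, hb]
  have hbf : ⇑b = fun i => Pi.single i 1 := funext hb
  have h3 : b.det (fun i => Pi.single i 1) = 1 := by rw [← hbf, Module.Basis.det_self]
  rw [h]
  simp [h2, h3, hbf]

theorem pull_vol11 (g : Spin101) : pull g vol11 = LinearMap.det (vecAct g⁻¹) • vol11 := by
  have h := alternatingMap_apply_linearMap ((ExteriorAlgebra.ιMulti ℝ 11).compLinearMap mip)
    (vecAct g⁻¹)
  simp only [AlternatingMap.compLinearMap_apply, ExteriorAlgebra.ιMulti_apply, ← dualForm_eq] at h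
  rw [vol11, map_list_prod, List.map_ofFn]
  refine Eq.trans ?_ h
  congr 2
  funext i
  exact pull_dualForm g _

theorem pull_vol8 {U : Spin101} (h0 : vecAct U (e 0) = e 0) (h9 : vecAct U (e 9) = e 9)
    (h10 : vecAct U (e 10) = e 10) : pull U vol8 = LinearMap.det (rot8 U⁻¹) • vol8 := by
  have h := alternatingMap_apply_linearMap ((ExteriorAlgebra.ιMulti ℝ 8).compLinearMap
    (mip ∘ₗ incl8)) (rot8 U⁻¹)
  simp only [AlternatingMap.compLinearMap_apply, ExteriorAlgebra.ιMulti_apply,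
    LinearMap.comp_apply, ← dualForm_eq] at h
  have hs (i : Fin 8) : incl8 (Pi.single i 1) = e (idx8 i) := by simp [incl8_eq, Pi.single_apply]
  simp only [incl8_rot8 (vecAct_inv_fix h0) (vecAct_inv_fix h9) (vecAct_inv_fix h10), hs] at h
  rw [vol8, map_list_prod, List.map_ofFn]
  refine Eq.trans ?_ h
  congr 2
  funext i
  exact pull_dualForm U _

theorem vol8_eq : vol8 = E8 0 * (E8 1 * (E8 2 * (E8 3 * (E8 4 * (E8 5 * (E8 6 * E8 7)))))) := by
  simp [vol8, List.ofFn_succ, E8]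

theorem commute_dualForm_mul (v a b : Mink) : Commute (dualForm v) (dualForm a * dualForm b) := by
  rw [commute_iff_eq, ← mul_assoc, dualForm_swap v a, neg_mul, mul_assoc, dualForm_swap v b, mul_neg,
    neg_neg, mul_assoc]

theorem commute_dualForm_vol8 (v : Mink) : Commute (dualForm v) vol8 := by
  have : vol8 = E8 0 * E8 1 * (E8 2 * E8 3) * (E8 4 * E8 5) * (E8 6 * E8 7) := by
    rw [vol8_eq]; simp only [mul_assoc]
  rw [this]
  exact (((commute_dualForm_mul _ _ _).mul_right (commute_dualForm_mul _ _ _)).mul_right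
    (commute_dualForm_mul _ _ _)).mul_right (commute_dualForm_mul _ _ _)

theorem vol11_eq : vol11 = dualForm (e 0) * vol8 * dualForm (e 9) * dualForm (e 10) := by
  rw [vol8_eq]
  simp [vol11, List.ofFn_succ, E8, mul_assoc]
  rfl

theorem vol11_ne_zero : vol11 ≠ 0 := by
  intro h
  have h1 : exteriorPower.ιMulti ℝ 11 (fun M => mip (e M)) = 0 := by
    apply Subtype.ext
    rw [exteriorPower.ιMulti_apply_coe, ExteriorAlgebra.ιMulti_apply]
    simp only [← dualForm_eq]
    exact h
  have h2 := exteriorPower.pairingDual_ιMulti_ιMulti (fun M => mip (e M)) e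
  rw [h1, map_zero, LinearMap.zero_apply] at h2
  have h3 : (Matrix.of fun i j : Fin 11 => mip (e j) (e i)) = Matrix.diagonal eta := by
    ext i j
    simp only [Matrix.of_apply, mip_single, e_apply, Matrix.diagonal_apply]
    by_cases hij : i = j
    · simp [hij]
    · simp [hij, Ne.symm hij]
  rw [h3, Matrix.det_diagonal] at h2
  exact Finset.prod_ne_zero_iff.2 (fun i _ => eta_ne i) h2.symm

theorem pull_vol8_det {U : Spin101} (h0 : vecAct U (e 0) = e 0) (h9 : vecAct U (e 9) = e 9)
    (h10 : vecAct U (e 10) = e 10) : LinearMap.det (rot8 U⁻¹) = LinearMap.det (vecAct U⁻¹) := by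
  have h1 := pull_vol11 U
  rw [vol11_eq, map_mul, map_mul, map_mul, pull_vol8 h0 h9 h10, pull_dualForm, pull_dualForm,
    pull_dualForm, vecAct_inv_fix h0, vecAct_inv_fix h9, vecAct_inv_fix h10, mul_smul_comm,
    smul_mul_assoc, smul_mul_assoc, ← vol11_eq] at h1
  exact smul_left_injective ℝ vol11_ne_zero h1

theorem det_vecAct_sq (g : Spin101) : LinearMap.det (vecAct g) * LinearMap.det (vecAct g) = 1 := by
  set M := LinearMap.toMatrix' (vecAct g)
  have hM : LinearMap.det (vecAct g) = M.det := (LinearMap.det_toMatrix' _).symm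
  have h : Mᵀ * Matrix.diagonal eta * M = Matrix.diagonal eta := by
    ext i j
    have h1 := mip_vecAct g (e i) (e j)
    rw [mip_eq_sum, mip_single] at h1
    rw [Matrix.mul_apply, Matrix.diagonal_apply]
    simp only [Matrix.mul_diagonal, Matrix.transpose_apply]
    have h2 (a b : Fin 11) : M a b = vecAct g (e b) a := by
      simp [M, LinearMap.toMatrix'_apply, e]
    simp only [h2]
    rw [show (if i = j then eta i else 0) = eta i * e j i by simp [e_apply], ← h1]
    exact Finset.sum_congr rfl fun _ _ => by ring
  have h2 := congrArg Matrix.det h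
  rw [Matrix.det_mul, Matrix.det_mul, Matrix.det_transpose, Matrix.det_diagonal] at h2
  have h3 : ∏ i, eta i ≠ 0 := Finset.prod_ne_zero_iff.2 fun i _ => eta_ne i
  rw [hM]
  have : (∏ i, eta i) * (M.det * M.det) = (∏ i, eta i) * 1 := by linarith
  exact mul_left_cancel₀ h3 this

theorem det_vecAct_of_mem_expGroup {χ : S11 → ℝ} {g : Spin101} (hg : g ∈ expGroup χ) :
    LinearMap.det (vecAct g) = 1 := by
  induction hg using Subgroup.closure_induction with
  | mem g hg =>
    obtain ⟨X, hX, hg⟩ := hg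
    have hX' : (1 / 2 : ℝ) • X ∈ spinLie Qmink := (spinLie Qmink).smul_mem _ hX.1
    set h : Spin101 := ⟨NormedSpace.exp ((1 / 2 : ℝ) • X), exp_mem_Spin101 hX'⟩
    have : g = h * h := by
      apply Subtype.ext
      rw [hg, Submonoid.coe_mul]
      change _ = NormedSpace.exp ((1 / 2 : ℝ) • X) * NormedSpace.exp ((1 / 2 : ℝ) • X)
      rw [← clifford_exp_add (Commute.refl _), ← add_smul]
      norm_num
    rw [this, vecAct_mul, LinearMap.det_comp, det_vecAct_sq]
  | one => rw [vecAct_one, LinearMap.det_id]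
  | mul g h _ _ hg hh => rw [vecAct_mul, LinearMap.det_comp, hg, hh, one_mul]
  | inv g _ hg =>
    have := congrArg LinearMap.det (vecAct_mul g g⁻¹)
    rw [mul_inv_cancel, vecAct_one, LinearMap.det_id, LinearMap.det_comp, hg, one_mul] at this
    exact this.symm

/-! ### Covariance of the table of forms -/

section Table

variable {ψ χ : S8 → ℝ} {U : Spin101}

theorem pull_cayley_of_rho {r : ℝ} (hr : r ≠ 0) (hU : rho U *ᵥ eps χ = r • eps ψ)
    (h0 : vecAct U (e 0) = e 0) (h9 : vecAct U (e 9) = e 9) (h10 : vecAct U (e 10) = e 10) :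
    pull U (cayley ψ) = cayley χ := by
  obtain ⟨B, hB, h1, hy⟩ := exists_rho_eq_block h0 h9 h10
  have h2 : B *ᵥ χ = r • ψ := by
    rw [hB, eps, eps, Matrix.fromBlocks_mulVec] at hU
    funext i
    have := congrFun hU (Sum.inl i)
    simpa using this
  have h3 : Bᵀ *ᵥ ψ = r⁻¹ • χ := by
    have : ψ = r⁻¹ • (B *ᵥ χ) := by rw [h2, smul_smul, inv_mul_cancel₀ hr, one_smul]
    rw [this, Matrix.mulVec_smul, Matrix.mulVec_mulVec, h1, Matrix.one_mulVec]
  rw [pull_cayley h0 h9 h10 hB h1 hy, h3, cayley_smul (inv_ne_zero hr)]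

theorem pull_tableForm {Ω Ω' : Forms} (hΩ : pull U Ω = Ω') (h0 : vecAct U (e 0) = e 0)
    (h9 : vecAct U (e 9) = e 9) (h10 : vecAct U (e 10) = e 10) (k : ℕ) :
    ∃ c : ℝ, (c = 1 ∨ c = LinearMap.det (vecAct U⁻¹)) ∧
      pull U (tableForm Ω k) = c • tableForm Ω' k := by
  have hP : pull U (dualForm ePlus) = dualForm ePlus := by
    rw [pull_dualForm, ePlus, map_add, vecAct_inv_fix h0, vecAct_inv_fix h9]
  have hH : pull U (dualForm (e 10)) = dualForm (e 10) := by
    rw [pull_dualForm, vecAct_inv_fix h10]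
  have hV := pull_vol8 h0 h9 h10
  rw [pull_vol8_det h0 h9 h10] at hV
  match k with
  | 0 => exact ⟨1, Or.inl rfl, by simp [tableForm]⟩
  | 1 => exact ⟨1, Or.inl rfl, by simp [tableForm, hP]⟩
  | 2 => exact ⟨1, Or.inl rfl, by simp [tableForm, hP, hH]⟩
  | 3 => exact ⟨1, Or.inl rfl, by simp [tableForm]⟩
  | 4 => exact ⟨1, Or.inl rfl, by simp [tableForm]⟩
  | 5 => exact ⟨1, Or.inl rfl, by simp [tableForm, hP, hΩ]⟩
  | 6 => exact ⟨1, Or.inl rfl, by simp [tableForm, hP, hH, hΩ]⟩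
  | 7 => exact ⟨1, Or.inl rfl, by simp [tableForm]⟩
  | 8 => exact ⟨1, Or.inl rfl, by simp [tableForm]⟩
  | 9 => exact ⟨_, Or.inr rfl, by simp [tableForm, hP, hV]⟩
  | 10 => exact ⟨_, Or.inr rfl, by simp [tableForm, hP, hH, hV]⟩
  | 11 => exact ⟨_, Or.inr rfl, by simp [tableForm, pull_vol11]⟩
  | n + 12 => exact ⟨1, Or.inl rfl, by simp [tableForm]⟩

theorem dualForm_mul_pull_mul {n : Spin101} (hn : vecAct n⁻¹ ePlus = ePlus) {v : Mink} {x : Forms}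
    {s : ℝ} (hv : vecAct n⁻¹ v = v + s • ePlus)
    (hx : dualForm ePlus * pull n x = dualForm ePlus * x) :
    dualForm ePlus * pull n (dualForm v * x) = dualForm ePlus * (dualForm v * x) := by
  rw [map_mul, pull_dualForm, hv, dualForm_add, dualForm_smul, add_mul, mul_add, ← mul_assoc,
    smul_mul_assoc, mul_smul_comm, ← mul_assoc (dualForm ePlus) (dualForm ePlus), dualForm_mul_self,
    zero_mul, smul_zero, add_zero, dualForm_swap, neg_mul, mul_assoc, hx, ← mul_assoc, ← neg_mul,
    ← dualForm_swap, mul_assoc]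

theorem pull_nullSpin_tableForm (b : Fin 8 → ℝ) (c : ℝ) (k : ℕ) (hdet : LinearMap.det (vecAct (nullSpin b c)⁻¹) = 1) :
    pull (nullSpin b c) (tableForm (cayley ψ) k) = tableForm (cayley ψ) k := by
  set n := nullSpin b c
  have hn' : vecAct n ePlus = ePlus := by
    rw [vecAct_nullSpin, mip_ePlus_self, mip_comm, mip_ePlus_nullVec]; simp
  have hn : vecAct n⁻¹ ePlus = ePlus := vecAct_inv_fix hn'
  have hv {v : Mink} (hv : mip ePlus v = 0) : vecAct n⁻¹ v = v + mip (nullVec b c) v • ePlus := by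
    have h1 : vecAct n v = v - mip (nullVec b c) v • ePlus := by
      rw [vecAct_nullSpin, hv]; simp
    calc vecAct n⁻¹ v = vecAct n⁻¹ (vecAct n v + mip (nullVec b c) v • ePlus) := by
          rw [h1, sub_add_cancel]
      _ = v + mip (nullVec b c) v • ePlus := by
          rw [map_add, vecAct_inv_vecAct, map_smul, hn]
  have hP : pull n (dualForm ePlus) = dualForm ePlus := by rw [pull_dualForm, hn]
  have h10 : mip ePlus (e 10) = 0 := by rw [mip_ePlus]; simp [e_apply]
  have h8 (i : Fin 8) : mip ePlus (e (idx8 i)) = 0 := by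
    rw [mip_ePlus]; simp [e_apply, (idx8_ne_nine i).symm, (idx8_ne_zero i).symm]
  have s1 : dualForm ePlus * pull n 1 = dualForm ePlus * 1 := by rw [map_one]
  have s8 (i : Fin 8) {x : Forms} (hx : dualForm ePlus * pull n x = dualForm ePlus * x) :=
    dualForm_mul_pull_mul hn (hv (h8 i)) hx
  have s10 {x : Forms} (hx : dualForm ePlus * pull n x = dualForm ePlus * x) :=
    dualForm_mul_pull_mul hn (hv h10) hx
  have sV : dualForm ePlus * pull n vol8 = dualForm ePlus * vol8 := by
    rw [vol8_eq, ← mul_one (E8 7)]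
    exact s8 _ (s8 _ (s8 _ (s8 _ (s8 _ (s8 _ (s8 _ (s8 _ s1)))))))
  have sΩ : dualForm ePlus * pull n (cayley ψ) = dualForm ePlus * cayley ψ := by
    simp only [cayley, map_smul, map_sum, mul_smul_comm, Finset.mul_sum]
    refine congrArg _ ?_
    refine Finset.sum_congr rfl fun i _ => Finset.sum_congr rfl fun j _ =>
      Finset.sum_congr rfl fun k _ => Finset.sum_congr rfl fun l _ => congrArg _ ?_
    rw [mul_assoc, mul_assoc, ← mul_one (dualForm (e (idx8 l)))]
    exact s8 _ (s8 _ (s8 _ (s8 _ s1)))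
  have aux {x : Forms} (hx : dualForm ePlus * pull n x = dualForm ePlus * x) :
      pull n (dualForm ePlus * x) = dualForm ePlus * x := by rw [map_mul, hP, hx]
  match k with
  | 0 => exact map_one _
  | 1 => exact hP
  | 2 =>
    change pull n (dualForm ePlus * dualForm (e 10)) = dualForm ePlus * dualForm (e 10)
    rw [← mul_one (dualForm (e 10))]
    exact aux (s10 s1)
  | 3 => exact map_zero _
  | 4 => exact map_zero _
  | 5 => exact aux sΩ
  | 6 =>
    change pull n (dualForm ePlus * dualForm (e 10) * cayley ψ) = dualForm ePlus * dualForm (e 10) * cayley ψ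
    rw [mul_assoc]
    exact aux (s10 sΩ)
  | 7 => exact map_zero _
  | 8 => exact map_zero _
  | 9 => exact aux sV
  | 10 =>
    change pull n (dualForm ePlus * dualForm (e 10) * vol8) = dualForm ePlus * dualForm (e 10) * vol8
    rw [mul_assoc]
    exact aux (s10 sV)
  | 11 =>
    change pull n vol11 = vol11
    rw [pull_vol11, hdet, one_smul]
  | n + 12 => exact map_zero _

theorem dualForm_mem (v : Mink) : dualForm v ∈ ⋀[ℝ]^1 (Module.Dual ℝ Mink) := by
  rw [dualForm_eq, ExteriorAlgebra.exteriorPower, pow_one]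
  exact ⟨_, rfl⟩

theorem mul_mem_exteriorPower {i j k : ℕ} (hk : i + j = k) {x y : Forms}
    (hx : x ∈ ⋀[ℝ]^i (Module.Dual ℝ Mink)) (hy : y ∈ ⋀[ℝ]^j (Module.Dual ℝ Mink)) :
    x * y ∈ ⋀[ℝ]^k (Module.Dual ℝ Mink) := by
  subst hk
  rw [ExteriorAlgebra.exteriorPower, pow_add]
  exact Submodule.mul_mem_mul hx hy

theorem tableForm_mem (k : ℕ) : tableForm (cayley ψ) k ∈ ⋀[ℝ]^k (Module.Dual ℝ Mink) := by
  have hV : vol8 ∈ ⋀[ℝ]^8 (Module.Dual ℝ Mink) := by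
    rw [vol8]; simp only [dualForm_eq]
    rw [← ExteriorAlgebra.ιMulti_apply]
    exact ExteriorAlgebra.ιMulti_range ℝ 8 ⟨_, rfl⟩
  have hV11 : vol11 ∈ ⋀[ℝ]^11 (Module.Dual ℝ Mink) := by
    rw [vol11]; simp only [dualForm_eq]
    rw [← ExteriorAlgebra.ιMulti_apply]
    exact ExteriorAlgebra.ιMulti_range ℝ 11 ⟨_, rfl⟩
  have hΩ : cayley ψ ∈ ⋀[ℝ]^4 (Module.Dual ℝ Mink) := by
    refine Submodule.smul_mem _ _ (Submodule.sum_mem _ fun i _ => Submodule.sum_mem _ fun j _ =>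
      Submodule.sum_mem _ fun k _ => Submodule.sum_mem _ fun l _ => Submodule.smul_mem _ _ ?_)
    exact mul_mem_exteriorPower (i := 3) (j := 1) rfl (mul_mem_exteriorPower (i := 2) (j := 1) rfl
      (mul_mem_exteriorPower (i := 1) (j := 1) rfl (dualForm_mem _) (dualForm_mem _)) (dualForm_mem _))
      (dualForm_mem _)
  have hPH := mul_mem_exteriorPower (i := 1) (j := 1) rfl (dualForm_mem ePlus) (dualForm_mem (e 10))
  match k with
  | 0 =>
    change (1 : Forms) ∈ (⋀[ℝ]^0 (Module.Dual ℝ Mink))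
    rw [ExteriorAlgebra.exteriorPower, pow_zero]
    exact Submodule.one_le.1 le_rfl
  | 1 => exact dualForm_mem _
  | 2 => exact hPH
  | 3 => exact zero_mem _
  | 4 => exact zero_mem _
  | 5 => exact mul_mem_exteriorPower rfl (dualForm_mem _) hΩ
  | 6 => exact mul_mem_exteriorPower rfl hPH hΩ
  | 7 => exact zero_mem _
  | 8 => exact zero_mem _
  | 9 => exact mul_mem_exteriorPower rfl (dualForm_mem _) hV
  | 10 => exact mul_mem_exteriorPower rfl hPH hV
  | 11 => exact hV11
  | n + 12 => exact zero_mem _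

theorem tableForm_mem_invariantForms (hψ : ψ ≠ 0) (hchir : gammaP9 *ᵥ ψ = -ψ) (k : ℕ) :
    tableForm (cayley ψ) k ∈ invariantForms (expGroup (eps ψ)) k := by
  refine ⟨tableForm_mem k, fun g hg => ?_⟩
  have hiso : g ∈ isotropyGroup (eps ψ) := expGroup_le_isotropyGroup _ hg
  obtain ⟨b, c, h, hh, h0, h9, h10, rfl⟩ := exists_eq_nullSpin_mul hψ hchir hiso
  have hh' : h ∈ expGroup (eps ψ) := by rw [expGroup_eq_isotropyGroup hψ hchir]; exact hh
  have h2 : rho h *ᵥ eps ψ = (1 : ℝ) • eps ψ := by rw [one_smul]; exact hh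
  obtain ⟨d, hd, hU⟩ := pull_tableForm (pull_cayley_of_rho one_ne_zero h2 h0 h9 h10) h0 h9 h10 k
  rw [det_vecAct_of_mem_expGroup (inv_mem hh'), or_self] at hd
  change pull (nullSpin b c * h) _ = _
  rw [← pull_pull, pull_nullSpin_tableForm b c k
    (det_vecAct_of_mem_expGroup (inv_mem (nullSpin_mem_expGroup hchir b c))), hU, hd, one_smul]

theorem tableForm_psi0_ne_zero {k : ℕ} (hk : k ∈ ({0, 1, 2, 5, 6, 9, 10, 11} : Finset ℕ)) :
    tableForm (cayley psi0) k ≠ 0 := by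
  have h10 : dualForm ePlus * dualForm (e 10) * vol8 ≠ 0 := by
    intro h
    apply vol11_ne_zero
    have h1 := congrArg (· * dualForm (e 9)) h
    simp only [zero_mul] at h1
    have h2 : dualForm ePlus * dualForm (e 10) * vol8 * dualForm (e 9)
        = -vol11 := by
      rw [mul_assoc, ← (commute_dualForm_vol8 (e 9)).eq, mul_assoc, ← mul_assoc (dualForm (e 10)),
        dualForm_swap (e 10), neg_mul, mul_neg, mul_assoc, (commute_dualForm_vol8 (e 10)).eq,
        ← mul_assoc, ePlus, dualForm_add, add_mul, dualForm_mul_self, add_zero, vol11_eq, mul_assoc,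
        ← mul_assoc (dualForm (e 9)), (commute_dualForm_vol8 (e 9)).eq]
      simp only [mul_assoc]
    rw [h2] at h1
    exact neg_eq_zero.1 h1
  have h6 : dualForm ePlus * dualForm (e 10) * cayley psi0 ≠ 0 := by
    intro h
    apply h10
    have h1 := congrArg (· * (E8 3 * (E8 4 * (E8 6 * E8 7)))) h
    simp only [zero_mul] at h1
    have h2 : cayley psi0 * (E8 3 * (E8 4 * (E8 6 * E8 7))) = -vol8 := by
      rw [cayley_psi0, vol8_eq]
      simp only [mul_add, add_mul, mul_sub, sub_mul, mul_neg, neg_mul, neg_neg, mul_assoc]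
      simp [E8_sq, E8_sq_mul, E8_swap, E8_swap_mul]
    rw [mul_assoc, h2, mul_neg] at h1
    exact neg_eq_zero.1 h1
  have h2 : dualForm ePlus * dualForm (e 10) ≠ 0 := fun h => h10 (by rw [h, zero_mul])
  have h1 : dualForm ePlus ≠ 0 := fun h => h2 (by rw [h, zero_mul])
  have h9 : dualForm ePlus * vol8 ≠ 0 := fun h => h10 (by
    rw [mul_assoc, (commute_dualForm_vol8 (e 10)).eq, ← mul_assoc, h, zero_mul])
  have h5 : dualForm ePlus * cayley psi0 ≠ 0 := fun h => h6 (by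
    have : Commute (dualForm (e 10)) (cayley psi0) := by
      refine Commute.smul_right (Commute.sum_right _ _ _ fun i _ => Commute.sum_right _ _ _ fun j _ =>
        Commute.sum_right _ _ _ fun k _ => Commute.sum_right _ _ _ fun l _ => Commute.smul_right ?_ _) _
      rw [mul_assoc (dualForm _ * dualForm _)]
      exact (commute_dualForm_mul _ _ _).mul_right (commute_dualForm_mul _ _ _)
    rw [mul_assoc, this.eq, ← mul_assoc, h, zero_mul])
  simp only [Finset.mem_insert, Finset.mem_singleton] at hk
  rcases hk with rfl | rfl | rfl | rfl | rfl | rfl | rfl | rfl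
  · exact one_ne_zero
  · exact h1
  · exact h2
  · exact h5
  · exact h6
  · exact h9
  · exact h10
  · exact vol11_ne_zero

end Table

end ExoticSpinor
end

noncomputable section
namespace ExoticSpinor
open CliffordAlgebra

/-! ### The Cayley form is standard in an orthonormal coframe -/

/-- The standard Cayley form in a coframe. -/
def stdCayley (f : Fin 8 → Forms) : Forms :=
  let w (i j k l : Fin 8) : Forms := f i * f j * f k * f l
  w 0 1 2 3 + w 0 1 4 5 + w 0 1 6 7 + w 0 2 4 6 - w 0 2 5 7 - w 0 3 4 7 - w 0 3 5 6
    - w 1 2 4 7 - w 1 2 5 6 - w 1 3 4 6 + w 1 3 5 7 + w 2 3 4 5 + w 2 3 6 7 + w 4 5 6 7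

theorem pull_stdCayley (g : Spin101) (f : Fin 8 → Forms) :
    pull g (stdCayley f) = stdCayley fun i => pull g (f i) := by
  simp only [stdCayley, map_add, map_sub, map_mul]

/-- The permutation matrix of a coframe adapted to `cayley psi0`. -/
def coframePerm : Equiv.Perm (Fin 8) where
  toFun := ![0, 1, 2, 5, 3, 7, 4, 6]
  invFun := ![0, 1, 2, 4, 6, 3, 7, 5]
  left_inv := by decide
  right_inv := by decide

/-- The signs of a coframe adapted to `cayley psi0`. -/
def coframeSign : Fin 8 → ℝ := fun i => if i = 3 then -1 else 1

theorem cayley_psi0_eq_stdCayley :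
    cayley psi0 = stdCayley fun i => coframeSign i • E8 (coframePerm i) := by
  rw [cayley_psi0]
  simp [stdCayley, coframeSign, coframePerm, mul_assoc, E8_swap, E8_swap_mul]

/-- A matrix of the coframe adapted to `cayley psi0`. -/
def coframeMat : Matrix (Fin 8) (Fin 8) ℝ :=
  Matrix.of fun i j => if coframePerm i = j then coframeSign i else 0

theorem coframeMat_mul_transpose : coframeMat * coframeMatᵀ = 1 := by
  ext i k
  simp only [Matrix.mul_apply, coframeMat, Matrix.of_apply, Matrix.transpose_apply, ite_mul, zero_mul,
    Finset.sum_ite_eq, Finset.mem_univ, if_true, coframePerm.injective.eq_iff, Matrix.one_apply]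
  by_cases h : i = k
  · subst h
    by_cases h3 : i = 3 <;> simp [coframeSign, h3]
  · simp [h, Ne.symm h]

theorem isCayleyForm_cayley {ψ : S8 → ℝ} (hψ : ψ ≠ 0) (hchir : gammaP9 *ᵥ ψ = -ψ) :
    IsCayleyForm (cayley ψ) := by
  obtain ⟨U, r, hr, hU, h0, h9, h10⟩ := exists_rotation hψ hchir
  have h1 : cayley ψ = pull U⁻¹ (cayley psi0) := by
    rw [← pull_cayley_of_rho hr hU h0 h9 h10, pull_inv_pull]
  have h0' := vecAct_inv_fix h0
  have h9' := vecAct_inv_fix h9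
  have h10' := vecAct_inv_fix h10
  set R : Matrix (Fin 8) (Fin 8) ℝ := Matrix.of fun i j => rot8 U (Pi.single j 1) i
  have hR : Rᵀ * R = 1 := by
    ext i j
    have h2 : rot8 U (Pi.single i 1) ⬝ᵥ rot8 U (Pi.single j 1) = (1 : Matrix (Fin 8) (Fin 8) ℝ) i j := by
      rw [← mip_incl8, incl8_rot8 h0 h9 h10, incl8_rot8 h0 h9 h10, mip_vecAct, mip_incl8,
        Matrix.one_apply]
      simp [Pi.single_apply, eq_comm]
    rw [← h2]; rfl
  refine ⟨coframeMat * Rᵀ, ?_, ?_⟩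
  · rw [Matrix.mem_orthogonalGroup_iff,Matrix.transpose_mul, Matrix.transpose_transpose,
      mul_assoc, ← mul_assoc Rᵀ, hR, one_mul, coframeMat_mul_transpose]
  · change cayley ψ = stdCayley fun i => ∑ j, (coframeMat * Rᵀ) i j • dualForm (e (idx8 j))
    rw [h1, cayley_psi0_eq_stdCayley, pull_stdCayley]
    congr 1
    funext i
    rw [map_smul, E8, pull_dualForm, inv_inv]
    have h3 : vecAct U (e (idx8 (coframePerm i))) = incl8 (rot8 U (Pi.single (coframePerm i) 1)) := by
      rw [incl8_rot8 h0 h9 h10]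
      simp [incl8_eq, Pi.single_apply]
    rw [h3, dualForm_incl8, Finset.smul_sum]
    refine Finset.sum_congr rfl fun j _ => ?_
    rw [smul_smul]
    congr 1
    simp [Matrix.mul_apply, coframeMat, R]

end ExoticSpinor
end

noncomputable section
namespace ExoticSpinor
open CliffordAlgebra

/-! ### Components of invariant forms -/

/-- The basis `e₀, …, e₈, e₊, e_♮`. -/
def nb (M : Fin 11) : Mink := if M = 9 then ePlus else e M

theorem nb_nine : nb 9 = ePlus := if_pos rfl
theorem nb_of_ne {M : Fin 11} (h : M ≠ 9) : nb M = e M := if_neg h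

theorem top_le_span_nb : ⊤ ≤ Submodule.span ℝ (Set.range nb) := by
  rw [← (Pi.basisFun ℝ (Fin 11)).span_eq, Submodule.span_le]
  rintro _ ⟨M, rfl⟩
  rw [Pi.basisFun_apply]
  by_cases hM : M = 9
  · subst hM
    have : (Pi.single 9 1 : Mink) = nb 9 - nb 0 := by
      rw [nb_nine, nb_of_ne (by decide), ePlus, e, e]; abel
    rw [this]
    exact sub_mem (Submodule.subset_span ⟨9, rfl⟩) (Submodule.subset_span ⟨0, rfl⟩)
  · exact Submodule.subset_span ⟨M, nb_of_ne hM⟩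

theorem eq_zero_of_nb {k : ℕ} {f : Mink [⋀^Fin k]→ₗ[ℝ] ℝ}
    (h : ∀ s : Fin k → Fin 11, Function.Injective s → f (nb ∘ s) = 0) : f = 0 := by
  refine Module.Basis.ext_alternating
    (basisOfTopLeSpanOfCardEqFinrank nb top_le_span_nb (by simp)) fun s hs => ?_
  rw [coe_basisOfTopLeSpanOfCardEqFinrank]
  exact h s hs

theorem exists_null_rotation {ψ : S8 → ℝ} (hchir : gammaP9 *ᵥ ψ = -ψ) {j : Fin 11} (h0 : j ≠ 0)
    (h9 : j ≠ 9) (t : ℝ) : ∃ n ∈ expGroup (eps ψ), vecAct n (nb 0) = nb 0 - t • nb j + (1 / 2 * t ^ 2) • nb 9 ∧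
      vecAct n (nb j) = nb j - t • nb 9 ∧ ∀ M, M ≠ 0 → M ≠ j → vecAct n (nb M) = nb M := by
  obtain ⟨b, c, hbc⟩ : ∃ b c, nullVec b c = t • e j := by
    revert h0 h9
    refine fin11_cases (p := fun j => j ≠ 0 → j ≠ 9 → ∃ b c, nullVec b c = t • e j)
      (fun h => absurd rfl h) (fun _ h => absurd rfl h) (fun _ _ => ⟨0, t, by simp [nullVec]⟩)
      (fun i _ _ => ⟨Pi.single i t, 0, ?_⟩) j
    simp [nullVec, incl8_eq, Pi.single_apply]
  have hj : eta j = 1 := if_neg h0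
  have hsq : mip (nullVec b c) (nullVec b c) = t ^ 2 := by
    rw [hbc, map_smul, map_smul, LinearMap.smul_apply, mip_single, hj]; simp [e_apply]; ring
  have hu (u : Mink) : mip (nullVec b c) u = t * u j := by
    rw [hbc, map_smul, LinearMap.smul_apply, mip_single, hj, one_mul, smul_eq_mul]
  refine ⟨nullSpin b c, nullSpin_mem_expGroup hchir b c, ?_, ?_, fun M hM0 hMj => ?_⟩
  · rw [vecAct_nullSpin, hsq, hu, hbc, nb_nine, nb_of_ne (by decide), nb_of_ne h9, mip_ePlus]
    simp [e_apply, h0]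
    module
  · rw [vecAct_nullSpin, hsq, hu, hbc, nb_nine, nb_of_ne h9, mip_ePlus]
    simp [e_apply, Ne.symm h0, Ne.symm h9]
  · by_cases hM : M = 9
    · subst hM
      rw [vecAct_nullSpin, hsq, hu, nb_nine, mip_ePlus_self]
      simp [ePlus, e_apply, h0, h9]
    · rw [vecAct_nullSpin, hsq, hu, nb_of_ne hM, mip_ePlus]
      simp [e_apply, Ne.symm hM0, Ne.symm hM, Ne.symm hMj]

/-- All components of `f` with index set `I` vanish. -/
def Vanish {k : ℕ} (f : Mink [⋀^Fin k]→ₗ[ℝ] ℝ) (I : Finset (Fin 11)) : Prop :=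
  ∀ s : Fin k → Fin 11, Function.Injective s → Finset.univ.image s = I → f (nb ∘ s) = 0

theorem vanish_of_eq_zero {k : ℕ} {f : Mink [⋀^Fin k]→ₗ[ℝ] ℝ} {s : Fin k → Fin 11}
    (h : f (nb ∘ s) = 0) : Vanish f (Finset.univ.image s) := by
  intro s' hs' hI
  have h1 : ∀ i, ∃ j, s j = s' i := fun i => by
    have : s' i ∈ Finset.univ.image s := by
      rw [← hI]; exact Finset.mem_image_of_mem _ (Finset.mem_univ i)
    simpa using this
  choose σ hσ using h1
  have hinj : Function.Injective σ := fun i j hij => hs' (by rw [← hσ i, ← hσ j, hij])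
  set τ : Equiv.Perm (Fin k) := Equiv.ofBijective σ (Finite.injective_iff_bijective.1 hinj)
  have h2 : nb ∘ s' = (nb ∘ s) ∘ τ := by funext i; simp [τ, hσ]
  rw [h2, AlternatingMap.map_perm, h, smul_zero]

section Null

variable {k : ℕ} {f : Mink [⋀^Fin k]→ₗ[ℝ] ℝ} {ψ : S8 → ℝ} (hchir : gammaP9 *ᵥ ψ = -ψ)
  (hf : ∀ g ∈ expGroup (eps ψ), ∀ v, f (fun i => vecAct g (v i)) = f v)
  {s : Fin k → Fin 11} (hs : Function.Injective s)
include hchir hf hs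

theorem apply_update_of_notMem {p : Fin k} (hp : s p = 0) {j : Fin 11} (h0 : j ≠ 0) (h9 : j ≠ 9)
    (hj : ∀ i, s i ≠ j) : f (nb ∘ Function.update s p j) = 0 ∧ f (nb ∘ Function.update s p 9) = 0 := by
  have key (t : ℝ) : -t * f (nb ∘ Function.update s p j) + 1 / 2 * t ^ 2 * f (nb ∘ Function.update s p 9) = 0 := by
    obtain ⟨n, hn, hn0, -, hnM⟩ := exists_null_rotation hchir h0 h9 t
    have h1 : (fun i => vecAct n ((nb ∘ s) i)) = Function.update (nb ∘ s) p
        (nb 0 + (-t) • nb j + (1 / 2 * t ^ 2) • nb 9) := by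
      funext i
      by_cases hi : i = p
      · subst hi
        rw [Function.update_self, Function.comp_apply, hp, hn0]; module
      · rw [Function.update_of_ne hi]
        exact hnM _ (fun h => hi (hs (h.trans hp.symm))) (hj i)
    have h2 := hf n hn (nb ∘ s)
    rw [h1, AlternatingMap.map_update_add, AlternatingMap.map_update_add, AlternatingMap.map_update_smul,
      AlternatingMap.map_update_smul, ← hp, show nb (s p) = (nb ∘ s) p from rfl,
      Function.update_eq_self] at h2
    rw [Function.comp_update, Function.comp_update]
    simp only [smul_eq_mul] at h2
    linarith
  have k1 := key 1
  have k2 := key (-1)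
  constructor <;> linarith

theorem apply_update_nine {p q : Fin k} (hp : s p = 0) {j : Fin 11} (hq : s q = j) (h0 : j ≠ 0)
    (h9 : j ≠ 9) : f (nb ∘ Function.update s q 9) = 0 := by
  have hpq : p ≠ q := fun h => h0 (by rw [← hq, ← h, hp])
  set F : Mink → Mink → ℝ := fun x y => f (Function.update (Function.update (nb ∘ s) p x) q y)
  have hF0 (x : Mink) : F x x = 0 := by
    refine f.map_eq_zero_of_eq _ ?_ hpq
    rw [Function.update_self, Function.update_of_ne hpq, Function.update_self]
  have hadd (x x' y : Mink) : F (x + x') y = F x y + F x' y := by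
    simp only [F, Function.update_comm hpq _ _ (nb ∘ s), AlternatingMap.map_update_add]
  have hsmul (c : ℝ) (x y : Mink) : F (c • x) y = c * F x y := by
    simp only [F, Function.update_comm hpq _ _ (nb ∘ s), AlternatingMap.map_update_smul, smul_eq_mul]
  have hadd' (x y y' : Mink) : F x (y + y') = F x y + F x y' := by
    simp only [F, AlternatingMap.map_update_add]
  have hsmul' (c : ℝ) (x y : Mink) : F x (c • y) = c * F x y := by
    simp only [F, AlternatingMap.map_update_smul, smul_eq_mul]
  have key (t : ℝ) : F (nb 0 + (-t) • nb j + (1 / 2 * t ^ 2) • nb 9) (nb j + (-t) • nb 9)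
      = F (nb 0) (nb j) := by
    obtain ⟨n, hn, hn0, hnj, hnM⟩ := exists_null_rotation hchir h0 h9 t
    have h1 : (fun i => vecAct n ((nb ∘ s) i)) = Function.update (Function.update (nb ∘ s) p
        (nb 0 + (-t) • nb j + (1 / 2 * t ^ 2) • nb 9)) q (nb j + (-t) • nb 9) := by
      funext i
      by_cases hi : i = q
      · subst hi
        rw [Function.update_self, Function.comp_apply, hq, hnj]; module
      by_cases hi' : i = p
      · subst hi'
        rw [Function.update_of_ne hi, Function.update_self, Function.comp_apply, hp, hn0]; module
      · rw [Function.update_of_ne hi, Function.update_of_ne hi']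
        exact hnM _ (fun h => hi' (hs (h.trans hp.symm))) (fun h => hi (hs (h.trans hq.symm)))
    have h2 := hf n hn (nb ∘ s)
    rw [h1] at h2
    refine h2.trans ?_
    simp only [F]
    rw [← hp, ← hq, show nb (s p) = (nb ∘ s) p from rfl, show nb (s q) = (nb ∘ s) q from rfl,
      Function.update_eq_self, Function.update_eq_self]
  have k1 := key 1
  have k2 := key (-1)
  simp only [hadd, hadd', hsmul, hsmul', hF0] at k1 k2
  have h3 : F (nb 0) (nb 9) = 0 := by linarith
  rw [Function.comp_update, ← h3]
  simp only [F]
  rw [← hp, show nb (s p) = (nb ∘ s) p from rfl, Function.update_eq_self]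

end Null

theorem injective_update {α β : Type*} [DecidableEq α] {s : α → β} (hs : Function.Injective s) {q : α}
    {b : β} (hb : ∀ i, i ≠ q → s i ≠ b) : Function.Injective (Function.update s q b) := by
  intro i j hij
  by_cases hi : i = q <;> by_cases hj : j = q
  · rw [hi, hj]
  · subst hi; rw [Function.update_self, Function.update_of_ne hj] at hij; exact absurd hij.symm (hb j hj)
  · subst hj; rw [Function.update_self, Function.update_of_ne hi] at hij; exact absurd hij (hb i hi)
  · rw [Function.update_of_ne hi, Function.update_of_ne hj] at hij; exact hs hij

section Null

variable {k : ℕ} {f : Mink [⋀^Fin k]→ₗ[ℝ] ℝ} {ψ : S8 → ℝ} (hchir : gammaP9 *ᵥ ψ = -ψ)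
  (hf : ∀ g ∈ expGroup (eps ψ), ∀ v, f (fun i => vecAct g (v i)) = f v)
include hchir hf

theorem vanish_of_zero_notMem {I : Finset (Fin 11)} (hI : 0 ∉ I) (hne : I ≠ ∅) : Vanish f I := by
  rintro s hs rfl
  have h0 (i : Fin k) : s i ≠ 0 := fun h => hI (h ▸ Finset.mem_image_of_mem _ (Finset.mem_univ i))
  by_cases hj : ∃ p, s p ≠ 9
  · obtain ⟨p, hp⟩ := hj
    have := (apply_update_of_notMem hchir hf (s := Function.update s p 0)
      (injective_update hs fun i _ => h0 i) (p := p) (Function.update_self _ _ _) (h0 p) hp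
      (fun i => by
        by_cases hi : i = p
        · subst hi; rw [Function.update_self]; exact (h0 i).symm
        · rw [Function.update_of_ne hi]; exact fun h => hi (hs h))).1
    rwa [Function.update_idem, Function.update_eq_self] at this
  · push Not at hj
    obtain ⟨_, hx⟩ := Finset.nonempty_iff_ne_empty.2 hne
    obtain ⟨p, -, -⟩ := Finset.mem_image.1 hx
    have := (apply_update_of_notMem hchir hf (s := Function.update s p 0)
      (injective_update hs fun i _ => h0 i) (p := p) (Function.update_self _ _ _) (j := 10)
      (by decide) (by decide)
      (fun i => by
        by_cases hi : i = p
        · subst hi; rw [Function.update_self]; decide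
        · rw [Function.update_of_ne hi, hj i]; decide)).2
    rwa [Function.update_idem, ← hj p, Function.update_eq_self] at this

theorem vanish_of_zero_nine_mem {I : Finset (Fin 11)} (h0 : 0 ∈ I) (h9 : 9 ∈ I)
    (hne : I ≠ Finset.univ) : Vanish f I := by
  rintro s hs rfl
  obtain ⟨p, -, hp⟩ := Finset.mem_image.1 h0
  obtain ⟨q, -, hq⟩ := Finset.mem_image.1 h9
  obtain ⟨j, hj⟩ : ∃ j, j ∉ Finset.univ.image s := by
    by_contra h; push Not at h; exact hne (Finset.eq_univ_iff_forall.2 h)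
  have hj' (i : Fin k) : s i ≠ j := fun h => hj (h ▸ Finset.mem_image_of_mem _ (Finset.mem_univ i))
  have hpq : p ≠ q := fun h => by rw [h, hq] at hp; exact absurd hp (by decide)
  have := apply_update_nine hchir hf (s := Function.update s q j)
    (injective_update hs fun i _ => hj' i) (p := p) (q := q) (j := j)
    (by rw [Function.update_of_ne hpq, hp]) (Function.update_self _ _ _)
    (fun h => hj' p (by rw [hp, h])) (fun h => hj' q (by rw [hq, h]))
  rwa [Function.update_idem, ← hq, Function.update_eq_self] at this

end Null

theorem vanish_of_signedPerm {k : ℕ} {f : Mink [⋀^Fin k]→ₗ[ℝ] ℝ} {g : Spin101}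
    (hf : ∀ v, f (fun i => vecAct g (v i)) = f v) {π : Equiv.Perm (Fin 11)} {ε : Fin 11 → ℝ}
    (hg : ∀ M, vecAct g (nb M) = ε M • nb (π M)) {I : Finset (Fin 11)}
    (h : Vanish f (I.image π)) : Vanish f I := by
  rintro s hs rfl
  have h1 := h (π ∘ s) (π.injective.comp hs) (by rw [Finset.image_image])
  rw [← hf]
  simp only [Function.comp_apply, hg]
  have := f.map_smul_univ (fun i => ε (s i)) (nb ∘ π ∘ s)
  simp only [Function.comp_apply] at this
  rw [this]
  exact (congrArg _ h1).trans (smul_zero _)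

theorem vanish_of_sign {k : ℕ} {f : Mink [⋀^Fin k]→ₗ[ℝ] ℝ} {g : Spin101}
    (hf : ∀ v, f (fun i => vecAct g (v i)) = f v) {ε : Fin 11 → ℝ}
    (hg : ∀ M, vecAct g (nb M) = ε M • nb M) {I : Finset (Fin 11)}
    (h : ∏ M ∈ I, ε M = -1) : Vanish f I := by
  rintro s hs rfl
  have h1 := hf (nb ∘ s)
  simp only [Function.comp_apply, hg] at h1
  have h2 := f.map_smul_univ (fun i => ε (s i)) (nb ∘ s)
  simp only [Function.comp_apply] at h2
  rw [Finset.prod_image (fun _ _ _ _ h => hs h)] at h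
  rw [h2, h] at h1
  change f (fun i => nb (s i)) = 0
  rw [neg_one_smul] at h1
  have h3 : -f (fun i => nb (s i)) = f (fun i => nb (s i)) := h1
  linarith

end ExoticSpinor
end

noncomputable section
namespace ExoticSpinor
open CliffordAlgebra

/-! ### Signed permutations in `Spin₇` -/

/-- The signed permutation matrix taking the `c`-th basis vector to `sg c` times the `π c`-th. -/
def signedPermMat (π : Equiv.Perm (Fin 8)) (sg : Fin 8 → ℤ) : Matrix (Fin 8) (Fin 8) ℤ :=
  Matrix.of fun r c => if r = π c then sg c else 0

theorem signedPermMat_mulVec_single (π : Equiv.Perm (Fin 8)) (sg : Fin 8 → ℤ) (c : Fin 8) :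
    (signedPermMat π sg).map (Int.castRingHom ℝ) *ᵥ Pi.single c 1 = (sg c : ℝ) • Pi.single (π c) 1 := by
  funext r
  by_cases h : r = π c <;> simp [signedPermMat, h]

theorem signedPermMat_orthogonal {π : Equiv.Perm (Fin 8)} {sg : Fin 8 → ℤ} (hsg : ∀ c, sg c * sg c = 1) :
    ((signedPermMat π sg).map (Int.castRingHom ℝ))ᵀ * (signedPermMat π sg).map (Int.castRingHom ℝ) = 1 := by
  have h : (signedPermMat π sg)ᵀ * signedPermMat π sg = 1 := by
    ext i j
    simp only [Matrix.mul_apply, signedPermMat, Matrix.transpose_apply, Matrix.of_apply, ite_mul,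
      zero_mul, Finset.sum_ite_eq', Finset.mem_univ, if_true, π.injective.eq_iff, Matrix.one_apply]
    by_cases hij : i = j
    · subst hij; simp [hsg]
    · simp [hij]
  have h2 := congrArg (Int.castRingHom ℝ).mapMatrix h
  rw [map_mul, map_one] at h2
  exact h2

/-- The signs of `conjEquiv` on the standard basis. -/
def conjSign (c : Fin 8) : ℤ := if c = 0 then 1 else -1

theorem conjEquiv_single (c : Fin 8) :
    conjEquiv (Pi.single c 1) = (conjSign c : ℝ) • Pi.single (c - 1) 1 := by
  funext i
  induction i using Fin.lastCases with
  | last =>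
    rw [conjEquiv_last]
    by_cases hc : c = 0
    · have : c - 1 = Fin.last 7 := by rw [hc]; decide
      rw [this, hc]; simp [conjSign]
    · have : Fin.last 7 ≠ c - 1 := by revert c; decide
      rw [Pi.smul_apply, Pi.single_eq_of_ne this, Pi.single_eq_of_ne (Ne.symm hc), smul_zero]
  | cast i =>
    rw [conjEquiv_castSucc]
    by_cases hc : i.succ = c
    · subst hc
      have : i.castSucc = i.succ - 1 := by revert i; decide
      simp [conjSign, this]
    · have : i.castSucc ≠ c - 1 := by revert i c; decide
      simp [Pi.single_apply, hc, this]

theorem conjSign_sq (c : Fin 8) : (conjSign c : ℝ) * conjSign c = 1 := by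
  by_cases h : c = 0 <;> simp [conjSign, h]

theorem conjEquiv_symm_single (i : Fin 8) :
    conjEquiv.symm (Pi.single i 1) = (conjSign (i + 1) : ℝ) • Pi.single (i + 1) 1 := by
  rw [LinearEquiv.symm_apply_eq, map_smul, conjEquiv_single, smul_smul, conjSign_sq, one_smul,
    add_sub_cancel_right]

/-- The permutation of the coordinates of `𝔼⁸` induced by a permutation of octonion coordinates. -/
def conjPerm (π : Equiv.Perm (Fin 8)) : Equiv.Perm (Fin 8) :=
  (Equiv.addRight 1).trans (π.trans (Equiv.addRight 1).symm)

theorem conjPerm_apply (π : Equiv.Perm (Fin 8)) (i : Fin 8) : conjPerm π i = π (i + 1) - 1 := by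
  simp [conjPerm, sub_eq_add_neg]

/-- The signs on `𝔼⁸` induced by a signed permutation of octonion coordinates. -/
def conjSigns (π : Equiv.Perm (Fin 8)) (sg : Fin 8 → ℤ) (i : Fin 8) : ℤ :=
  conjSign (i + 1) * sg (i + 1) * conjSign (π (i + 1))

theorem exists_signedPerm {π : Equiv.Perm (Fin 8)} {sg : Fin 8 → ℤ} (hsg : ∀ c, sg c * sg c = 1)
    {σ : Fin 7 → Fin 7} {τ : Fin 7 → ℤ}
    (hD : ∀ i, signedPermMat π sg * octLZ i = τ i • (octLZ (σ i) * signedPermMat π sg)) :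
    ∃ g ∈ expGroup (eps psi0), vecAct g (nb 0) = nb 0 ∧ vecAct g (nb 9) = nb 9 ∧
      vecAct g (nb 10) = nb 10 ∧
      ∀ i, vecAct g (nb (idx8 i)) = (conjSigns π sg i : ℝ) • nb (idx8 (conjPerm π i)) := by
  set D := (signedPermMat π sg).map (Int.castRingHom ℝ)
  have hD' (i : Fin 7) : D * octL i = octLin ((τ i : ℝ) • Pi.single (σ i) 1) * D := by
    have h := congrArg (Int.castRingHom ℝ).mapMatrix (hD i)
    rw [map_mul, map_zsmul, map_mul] at h
    refine h.trans ?_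
    rw [map_smul, smul_mul_assoc, ← Int.cast_smul_eq_zsmul ℝ]
    congr 2
    simp [octLin_apply, Pi.single_apply, octL]
  have hv (v : Fin 7 → ℝ) : ∃ v', D * octLin v = octLin v' * D := by
    refine ⟨∑ i, v i • (τ i : ℝ) • Pi.single (σ i) 1, ?_⟩
    rw [octLin_apply v, Finset.mul_sum, map_sum, Finset.sum_mul]
    refine Finset.sum_congr rfl fun i _ => ?_
    rw [mul_smul_comm, hD']
    simp only [map_smul, smul_mul_assoc]
  set g : Spin7 := ⟨rho7Sec D, rho7Sec_mem_spinGroup (signedPermMat_orthogonal hsg) hv⟩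
  have hp9 : proj8 (nb 9) = 0 := by rw [nb_nine, proj8_ePlus]
  refine ⟨spinLift g, ?_, ?_, ?_, ?_, fun i => ?_⟩
  · rw [expGroup_psi0]; exact spinLift_mem g
  · rw [nb_of_ne (by decide)]; exact vecAct_spinLift_timePart g proj8_e0
  · exact vecAct_spinLift_timePart g hp9
  · rw [nb_of_ne (by decide)]; exact vecAct_spinLift_timePart g proj8_e10
  · have ht : timePart (e (idx8 i)) = 0 := by
      simp [timePart, e_apply, Ne.symm (idx8_ne_zero i), Ne.symm (idx8_ne_nine i),
        Ne.symm (idx8_ne_ten i)]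
    have hg : rho7 (g : CliffordAlgebra Q7) = D := rho7_rho7Sec D
    have hs (j : Fin 8) : incl8 (Pi.single j 1) = e (idx8 j) := by simp [incl8_eq, Pi.single_apply]
    rw [nb_of_ne (idx8_ne_nine _), nb_of_ne (idx8_ne_nine _), vecAct_spinLift, ht, zero_add, proj8_e,
      hg, conjEquiv_symm_single, Matrix.mulVec_smul, signedPermMat_mulVec_single]
    simp only [map_smul, conjEquiv_single, hs, conjPerm_apply, smul_smul, conjSigns, Int.cast_mul]

/-- The index set `{0} ∪ idx8 J`, with `10` adjoined if `h`. -/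
def indexSet (J : Finset (Fin 8)) (h : Bool) : Finset (Fin 11) :=
  insert 0 (J.image idx8 ∪ if h then {10} else ∅)

theorem vanish_indexSet_of_image {k : ℕ} {f : Mink [⋀^Fin k]→ₗ[ℝ] ℝ} {g : Spin101}
    (hf : ∀ v, f (fun i => vecAct g (v i)) = f v) (h0 : vecAct g (nb 0) = nb 0)
    (h9 : vecAct g (nb 9) = nb 9) (h10 : vecAct g (nb 10) = nb 10) {π : Equiv.Perm (Fin 8)}
    {ε : Fin 8 → ℤ} (hg : ∀ i, vecAct g (nb (idx8 i)) = (ε i : ℝ) • nb (idx8 (π i)))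
    {J : Finset (Fin 8)} {h : Bool} (hJ : Vanish f (indexSet (J.image π) h)) :
    Vanish f (indexSet J h) := by
  set P : Equiv.Perm (Fin 11) := π.viaFintypeEmbedding ⟨idx8, idx8_injective⟩
  have hP (i : Fin 8) : P (idx8 i) = idx8 (π i) :=
    Equiv.Perm.viaFintypeEmbedding_apply_image π ⟨idx8, idx8_injective⟩ i
  have hP' {M : Fin 11} (hM : ∀ i, idx8 i ≠ M) : P M = M :=
    Equiv.Perm.viaFintypeEmbedding_apply_notMem_range π ⟨idx8, idx8_injective⟩
      (by rintro ⟨i, hi⟩; exact hM i hi)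
  have hP0 := hP' idx8_ne_zero
  have hP9 := hP' idx8_ne_nine
  have hP10 := hP' idx8_ne_ten
  have hex (M : Fin 11) : ∃ c : ℝ, vecAct g (nb M) = c • nb (P M) := by
    refine fin11_cases (p := fun M => ∃ c : ℝ, vecAct g (nb M) = c • nb (P M)) ⟨1, ?_⟩ ⟨1, ?_⟩ ⟨1, ?_⟩ (fun i => ⟨ε i, ?_⟩) M
    · rw [h0, hP0, one_smul]
    · rw [h9, hP9, one_smul]
    · rw [h10, hP10, one_smul]
    · rw [hg, hP]
  choose c hc using hex
  refine vanish_of_signedPerm hf hc ?_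
  have : (indexSet J h).image P = indexSet (J.image π) h := by
    rw [indexSet, indexSet, Finset.image_insert, hP0, Finset.image_union, Finset.image_image,
      Finset.image_image]
    congr 2
    · exact Finset.image_congr fun i _ => hP i
    · cases h <;> simp [hP10]
  rwa [this]

theorem vanish_indexSet_of_sign {k : ℕ} {f : Mink [⋀^Fin k]→ₗ[ℝ] ℝ} {g : Spin101}
    (hf : ∀ v, f (fun i => vecAct g (v i)) = f v) (h0 : vecAct g (nb 0) = nb 0)
    (h9 : vecAct g (nb 9) = nb 9) (h10 : vecAct g (nb 10) = nb 10)
    {ε : Fin 8 → ℤ} (hg : ∀ i, vecAct g (nb (idx8 i)) = (ε i : ℝ) • nb (idx8 i))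
    {J : Finset (Fin 8)} {h : Bool} (hJ : ∏ i ∈ J, ε i = -1) :
    Vanish f (indexSet J h) := by
  set c : Fin 11 → ℝ := Function.extend idx8 (fun i => (ε i : ℝ)) 1
  have hc (i : Fin 8) : c (idx8 i) = ε i := idx8_injective.extend_apply _ _ _
  have hc' {M : Fin 11} (hM : ∀ i, idx8 i ≠ M) : c M = 1 :=
    Function.extend_apply' _ _ _ (by rintro ⟨i, hi⟩; exact hM i hi)
  have h1 (M : Fin 11) : vecAct g (nb M) = c M • nb M := by
    refine fin11_cases (p := fun M => vecAct g (nb M) = c M • nb M) ?_ ?_ ?_ (fun i => ?_) M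
    · rw [h0, hc' idx8_ne_zero, one_smul]
    · rw [h9, hc' idx8_ne_nine, one_smul]
    · rw [h10, hc' idx8_ne_ten, one_smul]
    · rw [hg, hc]
  refine vanish_of_sign hf h1 ?_
  have hn0 : (0 : Fin 11) ∉ J.image idx8 ∪ if h then {10} else ∅ := by
    rw [Finset.mem_union, Finset.mem_image]
    rintro (⟨i, -, hi⟩ | hi)
    · exact idx8_ne_zero i hi
    · cases h <;> simp at hi
  have hd : Disjoint (J.image idx8) (if h then {10} else ∅) := by
    rw [Finset.disjoint_left]
    rintro M hM hM'
    obtain ⟨i, -, rfl⟩ := Finset.mem_image.1 hM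
    cases h
    · simp at hM'
    · exact idx8_ne_ten i (by simpa using hM')
  rw [indexSet, Finset.prod_insert hn0, hc' idx8_ne_zero, one_mul, Finset.prod_union hd,
    Finset.prod_image fun _ _ _ _ h => idx8_injective h]
  have h2 : ∏ M ∈ (if h then {10} else ∅ : Finset (Fin 11)), c M = 1 := by
    cases h
    · simp
    · simp [hc' idx8_ne_ten]
  rw [h2, mul_one]
  simp only [hc]
  rw [← Int.cast_prod, hJ]
  simp

/-- The signs of the diagonal elements used below. -/
def diagSigns : Fin 4 → Fin 8 → ℤ :=
  ![![1, -1, -1, -1, 1, 1, -1, 1], ![-1, -1, -1, 1, -1, 1, 1, 1], ![1, -1, -1, 1, 1, -1, 1, -1],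
    ![1, -1, 1, -1, -1, -1, 1, 1]]

/-- The cyclic automorphism of the octonions, as a permutation of coordinates. -/
def cyclePerm : Equiv.Perm (Fin 8) where
  toFun := ![0, 2, 3, 4, 5, 6, 7, 1]
  invFun := ![0, 7, 1, 2, 3, 4, 5, 6]
  left_inv := by decide
  right_inv := by decide

/-- The permutation of coordinates underlying left multiplication by the unit `o₀`. -/
def leftPerm : Equiv.Perm (Fin 8) where
  toFun := ![1, 0, 4, 7, 2, 6, 5, 3]
  invFun := ![1, 0, 4, 7, 2, 6, 5, 3]
  left_inv := by decide
  right_inv := by decide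

theorem finset8_cases : ∀ J : Finset (Fin 8), J = ∅ ∨ J = Finset.univ ∨
    (∃ a, ∏ i ∈ J, conjSigns 1 (diagSigns a) i = -1) ∨
    ∃ (n : Fin 7) (m : Fin 2), (Finset.image (conjPerm leftPerm))^[m]
      ((Finset.image (conjPerm cyclePerm))^[n] J) = {0, 1, 2, 5} := by
  decide +kernel

theorem exists_diag (a : Fin 4) : ∃ g ∈ expGroup (eps psi0), vecAct g (nb 0) = nb 0 ∧
    vecAct g (nb 9) = nb 9 ∧ vecAct g (nb 10) = nb 10 ∧
    ∀ i, vecAct g (nb (idx8 i)) = (conjSigns 1 (diagSigns a) i : ℝ) • nb (idx8 (conjPerm 1 i)) := by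
  have h1 : ∀ a c, diagSigns a c * diagSigns a c = 1 := by decide
  have h2 : ∀ a i, signedPermMat 1 (diagSigns a) * octLZ i
      = (diagSigns a 0 * diagSigns a i.succ) • (octLZ i * signedPermMat 1 (diagSigns a)) := by
    decide +kernel
  exact exists_signedPerm (h1 a) (σ := id) (h2 a)

theorem exists_cycle : ∃ g ∈ expGroup (eps psi0), vecAct g (nb 0) = nb 0 ∧
    vecAct g (nb 9) = nb 9 ∧ vecAct g (nb 10) = nb 10 ∧
    ∀ i, vecAct g (nb (idx8 i))
      = (conjSigns cyclePerm (fun _ => 1) i : ℝ) • nb (idx8 (conjPerm cyclePerm i)) := by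
  have h2 : ∀ i, signedPermMat cyclePerm (fun _ => 1) * octLZ i
      = (1 : ℤ) • (octLZ (i + 1) * signedPermMat cyclePerm (fun _ => 1)) := by
    decide +kernel
  exact exists_signedPerm (fun _ => rfl) (σ := fun i => i + 1) h2

/-- The signs of left multiplication by the unit `o₀`. -/
def leftSigns : Fin 8 → ℤ := ![1, -1, 1, 1, -1, 1, -1, -1]

theorem exists_left : ∃ g ∈ expGroup (eps psi0), vecAct g (nb 0) = nb 0 ∧
    vecAct g (nb 9) = nb 9 ∧ vecAct g (nb 10) = nb 10 ∧
    ∀ i, vecAct g (nb (idx8 i))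
      = (conjSigns leftPerm leftSigns i : ℝ) • nb (idx8 (conjPerm leftPerm i)) := by
  have h1 : ∀ c, leftSigns c * leftSigns c = 1 := by decide
  have h2 : ∀ i, signedPermMat leftPerm leftSigns * octLZ i
      = (if i = 0 then 1 else -1 : ℤ) • (octLZ i * signedPermMat leftPerm leftSigns) := by
    decide +kernel
  exact exists_signedPerm h1 (σ := id) h2

section

variable {k : ℕ} {f : Mink [⋀^Fin k]→ₗ[ℝ] ℝ}
  (hf : ∀ g ∈ expGroup (eps psi0), ∀ v, f (fun i => vecAct g (v i)) = f v)
include hf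

theorem vanish_indexSet {J : Finset (Fin 8)} {h : Bool} (h0 : Vanish f (indexSet ∅ h))
    (h1 : Vanish f (indexSet Finset.univ h)) (h2 : Vanish f (indexSet {0, 1, 2, 5} h)) :
    Vanish f (indexSet J h) := by
  rcases finset8_cases J with rfl | rfl | ⟨a, ha⟩ | ⟨n, m, hnm⟩
  · exact h0
  · exact h1
  · obtain ⟨g, hg, g0, g9, g10, gi⟩ := exists_diag a
    refine vanish_indexSet_of_sign (hf g hg) g0 g9 g10 (fun i => ?_) ha
    rw [gi, conjPerm_apply]; simp
  · obtain ⟨g, hg, g0, g9, g10, gi⟩ := exists_cycle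
    obtain ⟨g', hg', g0', g9', g10', gi'⟩ := exists_left
    have hc (n : ℕ) : ∀ J, Vanish f (indexSet ((Finset.image (conjPerm cyclePerm))^[n] J) h) →
        Vanish f (indexSet J h) := by
      induction n with
      | zero => exact fun J hJ => hJ
      | succ n ih => exact fun J hJ => vanish_indexSet_of_image (hf g hg) g0 g9 g10 gi (ih _ hJ)
    have hl (n : ℕ) : ∀ J, Vanish f (indexSet ((Finset.image (conjPerm leftPerm))^[n] J) h) →
        Vanish f (indexSet J h) := by
      induction n with
      | zero => exact fun J hJ => hJ
      | succ n ih =>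
        exact fun J hJ => vanish_indexSet_of_image (hf g' hg') g0' g9' g10' gi' (ih _ hJ)
    exact hc n J (hl m _ (hnm ▸ h2))

/-- The index set of the component of degree `k` which may be nonzero. -/
def mainSet : ℕ → Finset (Fin 11)
  | 1 => indexSet ∅ false
  | 2 => indexSet ∅ true
  | 5 => indexSet {0, 1, 2, 5} false
  | 6 => indexSet {0, 1, 2, 5} true
  | 9 => indexSet Finset.univ false
  | 10 => indexSet Finset.univ true
  | 11 => Finset.univ
  | _ => ∅

theorem eq_zero_of_vanish
    (h : ∀ k ∈ ({0, 1, 2, 5, 6, 9, 10, 11} : Finset ℕ), Vanish f (mainSet k)) : f = 0 := by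
  refine eq_zero_of_nb fun s hs => ?_
  suffices H : ∀ I, Vanish f I from H _ s hs rfl
  intro I
  by_cases he : I = ∅
  · rw [he]; exact h 0 (by simp)
  by_cases h0 : 0 ∈ I
  · by_cases h9 : 9 ∈ I
    · by_cases hu : I = Finset.univ
      · rw [hu]; exact h 11 (by simp)
      · exact vanish_of_zero_nine_mem psi0_chir hf h0 h9 hu
    · have : ∃ J h, I = indexSet J h := by
        refine ⟨Finset.univ.filter fun i => idx8 i ∈ I, decide (10 ∈ I), ?_⟩
        ext M
        refine fin11_cases (p := fun M => M ∈ I ↔ M ∈ indexSet _ _) ?_ ?_ ?_ (fun i => ?_) M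
        · simp [indexSet, h0]
        · simp only [h9, indexSet, Finset.mem_insert, Finset.mem_union, Finset.mem_image, false_iff]
          rintro (h | ⟨i, -, hi⟩ | h)
          · exact absurd h (by decide)
          · exact idx8_ne_nine i hi
          · by_cases h10 : 10 ∈ I <;> simp [h10] at h
        · by_cases h10 : 10 ∈ I <;> simp [indexSet, h10, idx8_ne_ten]
        · by_cases h10 : 10 ∈ I <;>
            simp [indexSet, h10, idx8_ne_ten, idx8_ne_zero, idx8_injective.eq_iff]
      obtain ⟨J, b, rfl⟩ := this
      cases b
      · exact vanish_indexSet hf (h 1 (by simp)) (h 9 (by simp)) (h 5 (by simp))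
      · exact vanish_indexSet hf (h 2 (by simp)) (h 10 (by simp)) (h 6 (by simp))
  · exact vanish_of_zero_notMem psi0_chir hf h0 he

end

theorem mainSet_card : ∀ k ∈ ({0, 1, 2, 5, 6, 9, 10, 11} : Finset ℕ), (mainSet k).card = k := by
  decide +kernel

theorem vanish_of_card {k : ℕ} (f : Mink [⋀^Fin k]→ₗ[ℝ] ℝ) {I : Finset (Fin 11)} (h : I.card ≠ k) :
    Vanish f I := by
  rintro s hs rfl
  rw [Finset.card_image_of_injective _ hs] at h
  simp at h

theorem invariantForms_psi0 (k : ℕ) :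
    invariantForms (expGroup (eps psi0)) k = Submodule.span ℝ {tableForm (cayley psi0) k} := by
  refine le_antisymm (fun ω hω => ?_) (Submodule.span_le.2 (Set.singleton_subset_iff.2
    (tableForm_mem_invariantForms psi0_ne psi0_chir k)))
  have hzero {ω : Forms} (hω : ω ∈ invariantForms (expGroup (eps psi0)) k)
      (h : ∀ k' ∈ ({0, 1, 2, 5, 6, 9, 10, 11} : Finset ℕ), Vanish (evalForm k ⟨ω, hω.1⟩) (mainSet k')) :
      ω = 0 :=
    congrArg Subtype.val (eq_zero_of_evalForm
      (eq_zero_of_vanish (fun g hg v => evalForm_invariant hω hg v) h))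
  by_cases hk : k ∈ ({0, 1, 2, 5, 6, 9, 10, 11} : Finset ℕ)
  · have hIk := mainSet_card k hk
    set I := mainSet k with hI
    have hzero' {ω : Forms} (hω : ω ∈ invariantForms (expGroup (eps psi0)) k)
        (h : evalForm k ⟨ω, hω.1⟩ (nb ∘ I.orderEmbOfFin hIk) = 0) : ω = 0 := by
      refine hzero hω fun k' hk' => ?_
      by_cases hc : k' = k
      · have := vanish_of_eq_zero h
        rw [Finset.image_orderEmbOfFin_univ] at this
        rwa [show mainSet k' = I from congrArg mainSet hc]
      · exact vanish_of_card _ (by rwa [mainSet_card k' hk'])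
    have hT := tableForm_mem_invariantForms psi0_ne psi0_chir k
    have hT0 : evalForm k ⟨_, hT.1⟩ (nb ∘ I.orderEmbOfFin hIk) ≠ 0 := fun h =>
      tableForm_psi0_ne_zero hk (hzero' hT h)
    set c := evalForm k ⟨ω, hω.1⟩ (nb ∘ I.orderEmbOfFin hIk)
      / evalForm k ⟨_, hT.1⟩ (nb ∘ I.orderEmbOfFin hIk) with hc
    have hd : ω - c • tableForm (cayley psi0) k ∈ invariantForms (expGroup (eps psi0)) k :=
      sub_mem hω (Submodule.smul_mem _ _ hT)
    have h0 : ω - c • tableForm (cayley psi0) k = 0 := by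
      refine hzero' hd ?_
      have h1 : (⟨_, hd.1⟩ : ⋀[ℝ]^k (Module.Dual ℝ Mink)) = ⟨ω, hω.1⟩ - c • ⟨_, hT.1⟩ := rfl
      rw [h1, evalForm_apply, map_sub, map_smul, LinearMap.sub_apply, LinearMap.smul_apply,
        ← evalForm_apply, ← evalForm_apply, hc, smul_eq_mul, div_mul_cancel₀ _ hT0, sub_self]
    exact Submodule.mem_span_singleton.2 ⟨c, (sub_eq_zero.1 h0).symm⟩
  · have : ω = 0 := hzero hω fun k' hk' => vanish_of_card _ fun h => hk (by
      rwa [← h, mainSet_card k' hk'])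
    rw [this]; exact zero_mem _

theorem mem_invariantForms_of_rotation {χ ψ : S8 → ℝ} {U : Spin101} {r : ℝ} (hr : r ≠ 0)
    (hU : rho U *ᵥ eps χ = r • eps ψ) {k : ℕ} {ω : Forms}
    (hω : ω ∈ invariantForms (expGroup (eps ψ)) k) : pull U ω ∈ invariantForms (expGroup (eps χ)) k := by
  refine ⟨pull_mem U hω.1, fun g hg => ?_⟩
  have h1 := hω.2 _ (conj_mem_expGroup hr hU hg)
  change pull g (pull U ω) = pull U ω
  change pull (U * g * U⁻¹) ω = ω at h1
  nth_rewrite 2 [← h1]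
  rw [pull_pull, pull_pull, inv_mul_cancel_right]

theorem exists_pull_tableForm {ψ : S8 → ℝ} (hψ : ψ ≠ 0) (hchir : gammaP9 *ᵥ ψ = -ψ) (k : ℕ) :
    ∃ (U : Spin101) (r c : ℝ), r ≠ 0 ∧ c ≠ 0 ∧ rho U *ᵥ eps psi0 = r • eps ψ ∧
      pull U (tableForm (cayley ψ) k) = c • tableForm (cayley psi0) k := by
  obtain ⟨U, r, hr, hU, h0, h9, h10⟩ := exists_rotation hψ hchir
  obtain ⟨c, hc, h⟩ := pull_tableForm (pull_cayley_of_rho hr hU h0 h9 h10) h0 h9 h10 k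
  refine ⟨U, r, c, hr, ?_, hU, h⟩
  rcases hc with rfl | rfl
  · exact one_ne_zero
  · intro h
    have := det_vecAct_sq U⁻¹
    rw [h, zero_mul] at this
    exact zero_ne_one this

theorem invariantForms_eq {ψ : S8 → ℝ} (hψ : ψ ≠ 0) (hchir : gammaP9 *ᵥ ψ = -ψ) (k : ℕ) :
    invariantForms (expGroup (eps ψ)) k = Submodule.span ℝ {tableForm (cayley ψ) k} := by
  refine le_antisymm (fun ω hω => ?_) (Submodule.span_le.2 (Set.singleton_subset_iff.2
    (tableForm_mem_invariantForms hψ hchir k)))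
  obtain ⟨U, r, c, hr, hc, hU, h⟩ := exists_pull_tableForm hψ hchir k
  have h1 := mem_invariantForms_of_rotation hr hU hω
  rw [invariantForms_psi0] at h1
  obtain ⟨a, ha⟩ := Submodule.mem_span_singleton.1 h1
  refine Submodule.mem_span_singleton.2 ⟨a * c⁻¹, ?_⟩
  rw [← pull_inv_pull U ω, ← ha, ← pull_inv_pull U (tableForm (cayley ψ) k), h, map_smul, map_smul,
    smul_smul, inv_mul_cancel_right₀ hc]

theorem tableForm_ne_zero {ψ : S8 → ℝ} (hψ : ψ ≠ 0) (hchir : gammaP9 *ᵥ ψ = -ψ) {k : ℕ}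
    (hk : k ∈ ({0, 1, 2, 5, 6, 9, 10, 11} : Finset ℕ)) : tableForm (cayley ψ) k ≠ 0 := by
  obtain ⟨U, r, c, hr, hc, hU, h⟩ := exists_pull_tableForm hψ hchir k
  intro h0
  rw [h0, map_zero] at h
  exact smul_ne_zero hc (tableForm_psi0_ne_zero hk) h.symm

end ExoticSpinor
end

open ExoticSpinor

theorem mainTheorem2 (ψ : S8 → ℝ) (hψ : ψ ≠ 0) (hchir : gammaP9 *ᵥ ψ = -ψ) :
    -- the general element of the isotropy subalgebra of `ε = (ψ, 0)`
    (∀ X : Cl, X ∈ isotropyAlgebra (eps ψ) ↔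
      ∃ (a : Matrix (Fin 8) (Fin 8) ℝ) (b : Fin 8 → ℝ) (c : ℝ), aᵀ = -a ∧
        ((1 / 2 : ℝ) • ∑ i, ∑ j, a i j • SigP i j) *ᵥ ψ = 0 ∧
        X = (1 / 2 : ℝ) • ∑ i, ∑ j, a i j • Sig (e (idx8 i)) (e (idx8 j)) + nullGen b c) ∧
    -- its structure
    Nonempty (isotropyAlgebra (eps ψ) ≃ₗ⁅ℝ⁆
      LieAlgebra.SemiDirectSum (Fin 8 → ℝ) (LieAlgebra.Orthogonal.so (Fin 7) ℝ) spinDer × ℝ) ∧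
    Module.finrank ℝ (isotropyAlgebra (eps ψ)) = 30 ∧
    ¬ LieAlgebra.HasCentralRadical ℝ (isotropyAlgebra (eps ψ)) ∧
    -- it is the Lie algebra of the closed subgroup of `Spin_{10,1}` which it generates,
    -- and that subgroup is the isotropy group of `ε`
    (∀ X : Cl, X ∈ isotropyAlgebra (eps ψ) ↔
      ∀ t : ℝ, ∃ g ∈ expGroup (eps ψ), (g : Cl) = NormedSpace.exp (t • X)) ∧
    IsClosed (expGroup (eps ψ) : Set Spin101) ∧
    expGroup (eps ψ) = isotropyGroup (eps ψ) ∧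
    SimplyConnectedSpace (expGroup (eps ψ)) ∧
    -- the structure of the group; `ℝ⁹` acts by null rotations, `Spin₇` by rotations of `𝔼⁸`
    (∃ (A : (Fin 8 → ℝ) ≃ₗ[ℝ] (Fin 8 → ℝ))
      (Φ : (Multiplicative ℝ × (Multiplicative (Fin 8 → ℝ) ⋊[spinAction] Spin7)) ≃ₜ*
        expGroup (eps ψ)),
      (∀ (b : Fin 8 → ℝ) (c : ℝ),
        ((Φ (Multiplicative.ofAdd c, SemidirectProduct.inl (Multiplicative.ofAdd b)) : Spin101) : Cl)
          = NormedSpace.exp (nullGen (A b) c)) ∧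
      (∀ (b : Fin 8 → ℝ) (c : ℝ), (b ≠ 0 ∨ c ≠ 0) →
        IsNullRotation ePlus (vecAct
          (Φ (Multiplicative.ofAdd c, SemidirectProduct.inl (Multiplicative.ofAdd b)) : Spin101))) ∧
      (∀ (σ : Spin7) (M : Fin 11), M = 0 ∨ M = 9 ∨ M = 10 →
        vecAct (Φ (1, SemidirectProduct.inr σ) : Spin101) (e M) = e M)) ∧
    -- the group acts reducibly yet indecomposably on Minkowski space
    (∃ U : Submodule ℝ Mink, U ≠ ⊥ ∧ U ≠ ⊤ ∧
      ∀ g ∈ expGroup (eps ψ), ∀ v ∈ U, vecAct g v ∈ U) ∧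
    (∀ U W : Submodule ℝ Mink, IsCompl U W →
      (∀ g ∈ expGroup (eps ψ), ∀ v ∈ U, vecAct g v ∈ U) →
      (∀ g ∈ expGroup (eps ψ), ∀ v ∈ W, vecAct g v ∈ W) → U = ⊥ ∨ W = ⊥) ∧
    -- the invariant spinors
    (∀ χ : S11 → ℝ, (∀ g ∈ expGroup (eps ψ), rho g *ᵥ χ = χ) ↔ χ ∈ Submodule.span ℝ {eps ψ}) ∧
    -- the invariant forms
    IsCayleyForm (cayley ψ) ∧
    (∀ k : ℕ, invariantForms (expGroup (eps ψ)) k = Submodule.span ℝ {tableForm (cayley ψ) k}) ∧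
    (∀ k ∈ ({0, 1, 2, 5, 6, 9, 10, 11} : Finset ℕ), tableForm (cayley ψ) k ≠ 0) := by
  obtain ⟨A, Φ, hΦ, hΦ'⟩ := exists_groupEquiv hψ hchir
  obtain ⟨F⟩ := nonempty_lieEquiv hψ hchir
  refine ⟨mem_isotropyAlgebra_iff hψ hchir, ⟨F⟩, ?_, not_hasCentralRadical F,
    mem_isotropyAlgebra_iff_exp hψ hchir, ?_, expGroup_eq_isotropyGroup hψ hchir, ?_,
    ⟨A, Φ, fun b c => ?_, fun b c h => ?_, hΦ'⟩, exists_invariant_subspace hψ hchir, ?_,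
    invariant_spinor_iff hψ hchir, isCayleyForm_cayley hψ hchir, invariantForms_eq hψ hchir,
    fun k hk => tableForm_ne_zero hψ hchir hk⟩
  · rw [F.toLinearEquiv.finrank_eq]; exact finrank_modelLie
  · rw [expGroup_eq_isotropyGroup hψ hchir]; exact isClosed_isotropyGroup _
  · exact simplyConnectedSpace_of_homeomorph Φ.symm.toHomeomorph simplyConnectedSpace_modelGroup
  · rw [hΦ]; rfl
  · rw [hΦ]
    refine isNullRotation_nullSpin (h.imp_left fun hb => ?_)
    exact fun h0 => hb (A.map_eq_zero_iff.1 h0)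
  · intro U W hUW hU hW
    exact indecomposable hchir U W hUW hU hW
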